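/- **Setting.** Let $W_*=(W_\alpha)_{\alpha\in A}$ be a simplicial system of Stein compact sets: $A$ is a simplicial scheme of finite dimension (a set of nonempty finite subsets of a set $I$, closed under nonempty subsets, of bounded cardinality), each $W_\alpha$ is a compact subset of a complex space having a fundamental system of Stein open neighbourhoods, with structure sheaf $\mathcal O_{W_\alpha}$ the topological restriction of the structure sheaf of the complex space, and for $\alpha\subseteq\beta$ there are compatible morphisms of ringed spaces $p_{\alpha\beta}:W_\beta\to W_\alpha$. A sheaf on $W_*$ is a family of sheaves on the $W_\alpha$ with compatible maps $p_{\alpha\beta}^{-1}M_\alpha\to M_\beta$; quasi-isomorphisms are tested on stalks. DG algebras are $\mathbb Z$-graded, graded commutative, over $\mathbb C$, with differential $\partial$ of degree $1$. A graded free module on $W_*$ is a direct sum of modules $p_\gamma^*(F_\gamma)$ with $F_\gamma$ graded free on $W_\gamma$, where $p_\gamma^*(F_\gamma)$ is on $W_\alpha$ the pullback $p_{\gamma\alpha}^*F_\gamma$ if $\gamma\subseteq\alpha$ and $0$ otherwise. Let $R=R_*$ be a sheaf of DG algebras on $W_*$ in degrees $\le 0$ with $R^0=\mathcal O_{W_*}$.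 Let $S=S_*$ be an augmented DG $R$-algebra, with homomorphisms of DG algebras $R\to S\xrightarrow{\mu}R$ of composition $\mathrm{id}_R$, and assume that $S$ is free analytic over $R$. This means that as a graded $R$-algebra $S$ is the analytic symmetric algebra of a graded free $R$-module $F$ with generators in degrees $\le 0$, finitely many in degree $0$ on each $W_\alpha$: if $t_1,\dots,t_n$ are the generators of degree $0$ on $W_\alpha$, then $S^0_\alpha$ is the topological restriction to the zero section $W_\alpha=W_\alpha\times 0$ of the structure sheaf of $W_\alpha\times\mathbb C^n$ (so its elements are locally the convergent power series in the $t_i$ over $\mathcal O_{W_\alpha}$), the transition maps being given by substitution, and $S$ is the free graded commutative algebra over $R\otimes_{R^0}S^0$ on the generators of negative degree. Let $d:S\to\Omega^1_{S/R}$ be the universal $R$-derivation into the module of analytic differentials (it satisfies the chain rule for convergent power series), and let $\Omega_*=\mathbb S(\Omega^1_{S/R}[1])$ be the graded symmetric algebra over $S$, a DG $S$-algebra. Let $B$ be a free resolution of $R$ over $S$: a DG $S$-algebra which, as a graded $S$-algebra, is the free graded commutative algebra $\mathbb S_S(E)$ on a graded free module $E$ with generators in degrees $<0$, together with a quasi-isomorphism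 $\nu:B\to R$ of DG $S$-algebras. **Theorem 2.1.** There is an $R$-linear connection $\nabla:B\to B\otimes_S\Omega^1_{S/R}$ that is a derivation extending $d$. For every such $\nabla$ the following holds. 1. The Atiyah class $\mathrm{At}_B=[\partial,\nabla]:B\to B\otimes_S\Omega^1_{S/R}[1]$ extends uniquely to an $\Omega_*$-linear derivation $\widetilde{\mathrm{At}}$ of the algebra $B\otimes_S\Omega_*$, and $\widetilde{\mathrm{At}}$ is locally nilpotent. 2. There is a unique homomorphism of DG $R$-algebras $\Phi_B:B\otimes_SR\to R\otimes_S\Omega_*$ with $$\Phi_B(b\otimes 1)=(\nu\otimes\mathrm{id})\Big(\sum_{n\ge 0}\frac{(-1)^n}{n!}\,\widetilde{\mathrm{At}}{}^{\,n}(b\otimes 1)\Big)\qquad(b\in B),$$ where $R$ acts on $B\otimes_SR$ through the right factor and on $R\otimes_S\Omega_*$ through the left factor. 3. $\Phi_B$ is a quasi-isomorphism. Hence, with $R\otimes_S^{\mathbf L}R$ represented by $B\otimes_SR$, the morphism represented by $\Phi_B$ (the one induced by the universal Atiyah–Chern character) is an isomorphism $$R\otimes_S^{\mathbf L}R\;\cong\;R\otimes_S\mathbb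 S(\Omega^1_{S/R}[1])$$ in the derived category $D(R)$ of DG $R$-modules on $W_*$. -/

import Mathlib

open Filter Topology CategoryTheory

universe u

noncomputable section

/-! ## Complex spaces and simplicial systems of Stein compact sets -/

/-- The ring of (functions representing) germs at `a` of holomorphic functions on `E`. -/
def Hol (E : Type*) [NormedAddCommGroup E] [NormedSpace ℂ E] (a : E) : Subalgebra ℂ (E → ℂ) where
  carrier := {g | AnalyticAt ℂ g a}
  mul_mem' := fun hf hg => AnalyticAt.mul hf hg
  add_mem' := fun hf hg => AnalyticAt.add hf hg
  algebraMap_mem' := fun _ => analyticAt_const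

/-- A sheaf on `X` given through its stalks `F x`: `IsSec s x` says that the family of germs `s`
is a section of the sheaf in some neighbourhood of `x`.  The axioms are those of the sheaf of
sections of an étale space over `X` (each germ extends to a section, and two sections with the same
germ at a point agree near that point). -/
structure SheafStr (X : Type u) [TopologicalSpace X] (F : X → Type u) where
  IsSec : (∀ x, F x) → X → Prop
  eventually : ∀ {s x}, IsSec s x → ∀ᶠ y in 𝓝 x, IsSec s y
  congr : ∀ {s t x}, IsSec s x → (∀ᶠ y in 𝓝 x, s y = t y) → IsSec t x
  exists_sec : ∀ x (a : F x), ∃ s, IsSec s x ∧ s x = a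
  eq_near : ∀ {s t x}, IsSec s x → IsSec t x → s x = t x → ∀ᶠ y in 𝓝 x, s y = t y

/-- A local model on the open set `U`: the sheaf of algebras `A0` (a subsheaf of the sheaf `sh`)
is, along `z : U → E`, the topological restriction of `𝒪_E / (f₁, …, f_k)`: the maps `θ x` send
germs of holomorphic functions at `z x` onto `A0 x` with kernel generated by the `f_j`, and the
sections of `A0` are those locally induced by a holomorphic function. -/
structure IsLocalModel {X : Type u} [TopologicalSpace X] {A : X → Type u} [∀ x, Ring (A x)]
    [∀ x, Algebra ℂ (A x)] (sh : SheafStr X A) (A0 : ∀ x, Subalgebra ℂ (A x))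
    {E : Type} [NormedAddCommGroup E] [NormedSpace ℂ E] {k : ℕ} (U : Set X) (z : X → E)
    (f : Fin k → E → ℂ) (θ : ∀ x, Hol E (z x) →ₐ[ℂ] A x) : Prop where
  isOpen : IsOpen U
  cont : ContinuousOn z U
  analytic : ∀ x ∈ U, ∀ j, AnalyticAt ℂ (f j) (z x)
  zero : ∀ x ∈ U, ∀ j, f j (z x) = 0
  range : ∀ x ∈ U, (θ x).range = A0 x
  ker : ∀ x ∈ U, ∀ g : Hol E (z x), θ x g = 0 ↔ ∃ a : Fin k → E → ℂ,
    (∀ j, AnalyticAt ℂ (a j) (z x)) ∧ ∀ᶠ e in 𝓝 (z x), g.1 e = ∑ j, a j e * f j e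
  sec : ∀ x ∈ U, ∀ s : ∀ y, A y, (∀ᶠ y in 𝓝 x, s y ∈ A0 y) → (sh.IsSec s x ↔
    ∃ g : E → ℂ, ∀ᶠ y in 𝓝 x, ∃ h : AnalyticAt ℂ g (z y), s y = θ y ⟨g, h⟩)

/-- (Hausdorff) complex spaces: `ℂ`-ringed spaces that are locally isomorphic to the zero locus of
finitely many holomorphic functions `f_j` on an open set `D ⊆ ℂ^N`, with structure sheaf
`𝒪_D / (f₁, …, f_k)`. -/
structure ComplexSpace where
  carrier : Type u
  [top : TopologicalSpace carrier]
  [t2 : T2Space carrier]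
  stalk : carrier → Type u
  [ring : ∀ x, CommRing (stalk x)]
  [algebra : ∀ x, Algebra ℂ (stalk x)]
  sheaf : SheafStr carrier stalk
  charts : ∀ x, ∃ (N k : ℕ) (U : Set carrier) (D : Set (Fin N → ℂ)) (z : carrier → Fin N → ℂ)
    (f : Fin k → (Fin N → ℂ) → ℂ) (θ : ∀ y, Hol (Fin N → ℂ) (z y) →ₐ[ℂ] stalk y),
    x ∈ U ∧ IsLocalModel sheaf (fun _ => ⊤) U z f θ ∧
    IsOpen D ∧ (∀ a ∈ D, ∀ j, AnalyticAt ℂ (f j) a) ∧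
    z '' U = {a ∈ D | ∀ j, f j a = 0} ∧ IsEmbedding (fun y : U => z y)

attribute [instance] ComplexSpace.top ComplexSpace.t2 ComplexSpace.ring ComplexSpace.algebra

/-- Holomorphic functions on the open subset `V`. -/
def ComplexSpace.IsFun (X : ComplexSpace.{u}) (V : Set X.carrier) (s : ∀ x, X.stalk x) : Prop :=
  ∀ x ∈ V, X.sheaf.IsSec s x

/-- The open subspace `V` is Stein: holomorphically separable and holomorphically convex.  The value
at `x` of a germ `a` in the local algebra `𝒪_{X,x}` is the only element of `spectrum ℂ a`. -/
structure ComplexSpace.IsStein (X : ComplexSpace.{u}) (V : Set X.carrier) : Prop where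
  isOpen : IsOpen V
  separable : ∀ x ∈ V, ∀ y ∈ V, x ≠ y → ∃ s, X.IsFun V s ∧ spectrum ℂ (s x) ≠ spectrum ℂ (s y)
  convex : ∀ C ⊆ V, IsCompact C → IsCompact {x ∈ V | ∀ s, X.IsFun V s → ∀ M : ℝ,
    (∀ y ∈ C, ∀ c ∈ spectrum ℂ (s y), ‖c‖ ≤ M) → ∀ c ∈ spectrum ℂ (s x), ‖c‖ ≤ M}

/-- A Stein compact set: a compact subset `K` of a complex space `X` with a fundamental system of
Stein open neighbourhoods.  It carries the topological restriction of `𝒪_X`. -/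
structure SteinCompact where
  X : ComplexSpace.{u}
  K : Set X.carrier
  compact : IsCompact K
  stein : ∀ V, IsOpen V → K ⊆ V → ∃ V', X.IsStein V' ∧ K ⊆ V' ∧ V' ⊆ V

/-- A simplicial scheme of finite dimension over the set `I` (a set of nonempty finite subsets of
`I`, closed under nonempty subsets), a Stein compact set `W α` for each simplex `α`, and compatible
continuous maps `p : W β → W α` for `α ⊆ β`. -/
structure SimplicialSpace where
  I : Type u
  faces : Set (Finset I)
  nonempty : ∀ α ∈ faces, α.Nonempty
  down_closed : ∀ α ∈ faces, ∀ β ⊆ α, β.Nonempty → β ∈ faces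
  finite_dim : ∃ n : ℕ, ∀ α ∈ faces, α.card ≤ n
  W : faces → SteinCompact.{u}
  p : ∀ {α β : faces}, α ≤ β → (W β).K → (W α).K
  p_cont : ∀ {α β : faces} (h : α ≤ β), Continuous (p h)
  p_refl : ∀ {α : faces} (h : α ≤ α) w, p h w = w
  p_trans : ∀ {α β γ : faces} (h : α ≤ β) (h' : β ≤ γ) w, p h (p h' w) = p (h.trans h') w

namespace SimplicialSpace

variable (W : SimplicialSpace.{u})

/-- The underlying compact space of the simplex `α`. -/
abbrev K (α : W.faces) : Type u := (W.W α).K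

/-- Points of the simplicial system: pairs of a simplex `α` and a point of `W α`. -/
structure Pt where
  face : W.faces
  pt : W.K face

/-- `P ≤ Q` if `P` is the image of `Q` under a structure map `p`. -/
instance : Preorder W.Pt where
  le P Q := ∃ h : P.face ≤ Q.face, W.p h Q.pt = P.pt
  le_refl P := ⟨le_rfl, W.p_refl _ _⟩
  le_trans := by
    rintro ⟨a, x⟩ ⟨b, y⟩ ⟨c, z⟩ ⟨h, h1⟩ ⟨h', h2⟩
    refine ⟨h.trans h', ?_⟩
    simp only at h1 h2 ⊢
    rw [← h1, ← h2, W.p_trans]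

theorem le_face {α β : W.faces} (h : α ≤ β) (w : W.K β) : (⟨α, W.p h w⟩ : W.Pt) ≤ ⟨β, w⟩ :=
  ⟨h, rfl⟩

/-- The stalks of the structure sheaf. -/
abbrev O (P : W.Pt) : Type u := (W.W P.face).X.stalk P.pt.1

/-- Sections of the structure sheaf `𝒪_X | K` of a simplex. -/
def IsSecO (α : W.faces) (s : ∀ w : W.K α, W.O ⟨α, w⟩) (w : W.K α) : Prop :=
  ∃ t : ∀ x, (W.W α).X.stalk x, (W.W α).X.sheaf.IsSec t w.1 ∧ ∀ᶠ y in 𝓝 w, s y = t y.1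

end SimplicialSpace

/-- A simplicial system `W_*` of Stein compact sets: the maps `p : W β → W α` are morphisms of
`ℂ`-ringed spaces. -/
structure SimplicialSystem extends SimplicialSpace.{u} where
  pull : ∀ {P Q : toSimplicialSpace.Pt}, P ≤ Q →
    toSimplicialSpace.O P →ₐ[ℂ] toSimplicialSpace.O Q
  pull_refl : ∀ {P} (h : P ≤ P) a, pull h a = a
  pull_trans : ∀ {P Q T} (h : P ≤ Q) (h' : Q ≤ T) a, pull h' (pull h a) = pull (h.trans h') a
  pull_sec : ∀ {α β : faces} (h : α ≤ β) (w) (s), toSimplicialSpace.IsSecO α s (p h w) →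
    toSimplicialSpace.IsSecO β (fun y => pull (toSimplicialSpace.le_face h y) (s (p h y))) w

/-! ## Graded commutative differential graded algebras -/

/-- The sign `(-1)^i`. -/
def sgn (i : ℤ) : ℂ := ((i.negOnePow : ℤ) : ℂ)

/-- The equational part of the structure of a `ℤ`-graded, graded commutative DG algebra over `ℂ`,
with differential of degree `1`.  The grading is encoded by the projections `pr i` onto the part of
degree `i`; thus `a` is homogeneous of degree `i` if and only if `pr i a = a`. -/
class DGRing (A : Type u) extends Ring A, Algebra ℂ A where
  pr : ℤ → A →ₗ[ℂ] A
  d : A →ₗ[ℂ] A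
  pr_self : ∀ i a, pr i (pr i a) = pr i a
  pr_ne : ∀ i j a, i ≠ j → pr i (pr j a) = 0
  pr_one : pr 0 1 = 1
  pr_mul : ∀ i j a b, pr (i + j) (pr i a * pr j b) = pr i a * pr j b
  comm : ∀ i j a b, pr i a * pr j b = sgn (i * j) • (pr j b * pr i a)
  d_pr : ∀ i a, d (pr i a) = pr (i + 1) (d a)
  d_d : ∀ a, d (d a) = 0
  leibniz : ∀ i a b, d (pr i a * b) = d (pr i a) * b + sgn i • (pr i a * d b)

/-- Graded commutative DG algebras over `ℂ`: each element is the sum of finitely many homogeneous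
components. -/
class CDGA (A : Type u) extends DGRing A where
  exists_sum : ∀ a : A, ∃ s : Finset ℤ, ∑ i ∈ s, DGRing.pr i a = a

open DGRing

/-- Homomorphisms of graded `ℂ`-algebras. -/
structure IsGrHom {A B : Type u} [DGRing A] [DGRing B] (f : A → B) : Prop where
  map_add : ∀ a b, f (a + b) = f a + f b
  map_mul : ∀ a b, f (a * b) = f a * f b
  map_scal : ∀ c : ℂ, f (algebraMap ℂ A c) = algebraMap ℂ B c
  map_pr : ∀ i a, f (pr i a) = pr i (f a)

/-- Homomorphisms of DG algebras. -/
structure IsDGHom {A B : Type u} [DGRing A] [DGRing B] (f : A → B) : Prop extends IsGrHom f where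
  map_d : ∀ a, f (d a) = d (f a)

theorem IsDGHom.comp {A B C : Type u} [DGRing A] [DGRing B] [DGRing C] {g : B → C} {f : A → B}
    (hg : IsDGHom g) (hf : IsDGHom f) : IsDGHom (fun a => g (f a)) where
  map_add a b := by simp [hf.map_add, hg.map_add]
  map_mul a b := by simp [hf.map_mul, hg.map_mul]
  map_scal c := by simp [hf.map_scal, hg.map_scal]
  map_pr i a := by simp [hf.map_pr, hg.map_pr]
  map_d a := by simp [hf.map_d, hg.map_d]

theorem IsDGHom.id {A : Type u} [DGRing A] : IsDGHom (fun a : A => a) := by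
  constructor <;> first | constructor | skip
  all_goals intros; rfl

theorem IsGrHom.map_zero {A B : Type u} [DGRing A] [DGRing B] {f : A → B} (h : IsGrHom f) :
    f 0 = 0 := by
  simpa using h.map_scal 0

theorem IsGrHom.map_smul {A B : Type u} [DGRing A] [DGRing B] {f : A → B} (h : IsGrHom f)
    (c : ℂ) (a : A) : f (c • a) = c • f a := by
  rw [Algebra.smul_def, h.map_mul, h.map_scal, ← Algebra.smul_def]

/-- The subalgebra of elements of degree zero. -/
def deg0 (A : Type u) [DGRing A] : Subalgebra ℂ A where
  carrier := {a | pr 0 a = a}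
  mul_mem' := by
    intro a b ha hb
    have := pr_mul 0 0 a b
    simp only [Set.mem_ofPred_eq] at *
    rwa [ha, hb, add_zero] at this
  add_mem' := by
    intro a b ha hb
    simp only [Set.mem_ofPred_eq] at *
    rw [map_add, ha, hb]
  algebraMap_mem' := by
    intro c
    simp only [Set.mem_ofPred_eq, Algebra.algebraMap_eq_smul_one, map_smul, pr_one]

/-! ## Presented DG algebras -/

/-- Formal DG algebra expressions in two sets of symbols `A`, `B`. -/
inductive DGTerm (A B : Type u) : Type u
  | left (a : A)
  | right (b : B)
  | scal (c : ℂ)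
  | add (x y : DGTerm A B)
  | mul (x y : DGTerm A B)
  | diff (x : DGTerm A B)
  | proj (i : ℤ) (x : DGTerm A B)

/-- The value of an expression under an assignment of the symbols. -/
def DGTerm.eval {A B Z : Type u} [DGRing Z] (f : A → Z) (g : B → Z) : DGTerm A B → Z
  | left a => f a
  | right b => g b
  | scal c => algebraMap ℂ Z c
  | add x y => x.eval f g + y.eval f g
  | mul x y => x.eval f g * y.eval f g
  | diff x => d (x.eval f g)
  | proj i x => pr i (x.eval f g)

/-- A system of relations on symbols from `A`, `B`: it says which assignments of the symbols in DG
algebras are admissible. -/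
abbrev Relations (A B : Type u) := ∀ (Z : Type u) [DGRing Z], (A → Z) → (B → Z) → Prop

/-- Two expressions are identified if all admissible assignments give them the same value. -/
def presSetoid {A B : Type u} (Q : Relations A B) : Setoid (DGTerm A B) where
  r x y := ∀ (Z : Type u) [DGRing Z] (f : A → Z) (g : B → Z), Q Z f g → x.eval f g = y.eval f g
  iseqv := ⟨fun _ _ _ _ _ _ => rfl, fun h Z _ f g q => (h Z f g q).symm,
    fun h h' Z _ f g q => (h Z f g q).trans (h' Z f g q)⟩

/-- The DG algebra with generators `A`, `B` and relations `Q`, that is, the universal one. -/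
def Pres {A B : Type u} (Q : Relations A B) : Type u := Quotient (presSetoid Q)

namespace Pres

variable {A B : Type u} {Q : Relations A B}

def mk (x : DGTerm A B) : Pres Q := Quotient.mk (presSetoid Q) x

theorem sound {x y : DGTerm A B} (h : ∀ (Z : Type u) [DGRing Z] (f : A → Z) (g : B → Z),
    Q Z f g → x.eval f g = y.eval f g) : (mk x : Pres Q) = mk y := Quotient.sound h

theorem ind {p : Pres Q → Prop} (h : ∀ x, p (mk x)) (x : Pres Q) : p x := Quotient.ind h x

instance : Add (Pres Q) := ⟨Quotient.map₂ DGTerm.add (fun _ _ h _ _ h' Z _ f g q => by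
  simp only [DGTerm.eval, h Z f g q, h' Z f g q])⟩

instance : Mul (Pres Q) := ⟨Quotient.map₂ DGTerm.mul (fun _ _ h _ _ h' Z _ f g q => by
  simp only [DGTerm.eval, h Z f g q, h' Z f g q])⟩

instance : Zero (Pres Q) := ⟨mk (.scal 0)⟩

instance : One (Pres Q) := ⟨mk (.scal 1)⟩

instance : Neg (Pres Q) := ⟨Quotient.map (fun x => DGTerm.mul (.scal (-1)) x)
  (fun _ _ h Z _ f g q => by simp only [DGTerm.eval, h Z f g q])⟩

instance : Ring (Pres Q) where
  nsmul := nsmulRec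
  zsmul := zsmulRec
  add_assoc := by
    refine ind fun x => ind fun y => ind fun z => sound ?_
    intros; simp only [DGTerm.eval, add_assoc]
  zero_add := by
    refine ind fun x => sound ?_
    intros; simp only [DGTerm.eval, map_zero, zero_add]
  add_zero := by
    refine ind fun x => sound ?_
    intros; simp only [DGTerm.eval, map_zero, add_zero]
  add_comm := by
    refine ind fun x => ind fun y => sound ?_
    intros; simp only [DGTerm.eval, add_comm]
  mul_assoc := by
    refine ind fun x => ind fun y => ind fun z => sound ?_
    intros; simp only [DGTerm.eval, mul_assoc]
  zero_mul := by
    refine ind fun x => sound ?_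
    intros; simp only [DGTerm.eval, map_zero, zero_mul]
  mul_zero := by
    refine ind fun x => sound ?_
    intros; simp only [DGTerm.eval, map_zero, mul_zero]
  one_mul := by
    refine ind fun x => sound ?_
    intros; simp only [DGTerm.eval, map_one, one_mul]
  mul_one := by
    refine ind fun x => sound ?_
    intros; simp only [DGTerm.eval, map_one, mul_one]
  left_distrib := by
    refine ind fun x => ind fun y => ind fun z => sound ?_
    intros; simp only [DGTerm.eval, mul_add]
  right_distrib := by
    refine ind fun x => ind fun y => ind fun z => sound ?_
    intros; simp only [DGTerm.eval, add_mul]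
  neg_add_cancel := by
    refine ind fun x => sound ?_
    intros; simp only [DGTerm.eval, map_neg, map_one, map_zero, neg_mul, one_mul, neg_add_cancel]

instance : Algebra ℂ (Pres Q) where
  smul c := Quotient.map (fun x => DGTerm.mul (.scal c) x) (fun _ _ h Z _ f g q => by
    simp only [DGTerm.eval, h Z f g q])
  algebraMap :=
    { toFun := fun c => mk (.scal c)
      map_one' := rfl
      map_zero' := rfl
      map_add' := fun a b => sound (by intros; simp only [DGTerm.eval, map_add])
      map_mul' := fun a b => sound (by intros; simp only [DGTerm.eval, map_mul]) }
  commutes' := by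
    intro c
    refine ind fun x => sound ?_
    intros; simp only [DGTerm.eval, Algebra.commutes]
  smul_def' := by
    intro c
    refine ind fun x => sound ?_
    intros; rfl

instance : DGRing (Pres Q) where
  pr i :=
    { toFun := Quotient.map (DGTerm.proj i) (fun _ _ h Z _ f g q => by
        simp only [DGTerm.eval, h Z f g q])
      map_add' := by
        refine ind fun x => ind fun y => sound ?_
        intros; simp only [DGTerm.eval, map_add]
      map_smul' := by
        intro c
        refine ind fun x => sound ?_
        intros; simp only [DGTerm.eval, ← Algebra.smul_def, map_smul, RingHom.id_apply] }
  d :=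
    { toFun := Quotient.map DGTerm.diff (fun _ _ h Z _ f g q => by
        simp only [DGTerm.eval, h Z f g q])
      map_add' := by
        refine ind fun x => ind fun y => sound ?_
        intros; simp only [DGTerm.eval, map_add]
      map_smul' := by
        intro c
        refine ind fun x => sound ?_
        intros; simp only [DGTerm.eval, ← Algebra.smul_def, map_smul, RingHom.id_apply] }
  pr_self i := by
    refine ind fun x => sound ?_
    intros; simp only [DGTerm.eval, pr_self]
  pr_ne i j := by
    refine ind fun x hij => sound ?_
    intros; simp only [DGTerm.eval, pr_ne i j _ hij, map_zero]
  pr_one := sound (by intros; simp only [DGTerm.eval, map_one, DGRing.pr_one])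
  pr_mul i j := by
    refine ind fun x => ind fun y => sound ?_
    intros; simp only [DGTerm.eval, DGRing.pr_mul]
  comm i j := by
    refine ind fun x => ind fun y => sound ?_
    intros; simp only [DGTerm.eval, ← Algebra.smul_def]; exact DGRing.comm _ _ _ _
  d_pr i := by
    refine ind fun x => sound ?_
    intros; simp only [DGTerm.eval, DGRing.d_pr]
  d_d := by
    refine ind fun x => sound ?_
    intros; simp only [DGTerm.eval, DGRing.d_d, map_zero]
  leibniz i := by
    refine ind fun x => ind fun y => sound ?_
    intros; simp only [DGTerm.eval, ← Algebra.smul_def]; exact DGRing.leibniz _ _ _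

/-- The generators. -/
def left (a : A) : Pres Q := mk (.left a)
def right (b : B) : Pres Q := mk (.right b)

/-- The homomorphism out of a presented algebra given by an admissible assignment. -/
def lift {Z : Type u} [DGRing Z] {f : A → Z} {g : B → Z} (q : Q Z f g) : Pres Q → Z :=
  Quotient.lift (fun x => x.eval f g) (fun _ _ h => h Z f g q)

theorem lift_hom {Z : Type u} [DGRing Z] {f : A → Z} {g : B → Z} (q : Q Z f g) :
    IsDGHom (lift q) where
  map_add := by refine ind fun x => ind fun y => rfl
  map_mul := by refine ind fun x => ind fun y => rfl
  map_scal _ := rfl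
  map_pr i := by refine ind fun x => rfl
  map_d := by refine ind fun x => rfl

@[elab_as_elim]
theorem induction {p : Pres Q → Prop} (hl : ∀ a, p (left a)) (hr : ∀ b, p (right b))
    (hs : ∀ c, p (algebraMap ℂ _ c)) (ha : ∀ x y, p x → p y → p (x + y))
    (hm : ∀ x y, p x → p y → p (x * y)) (hd : ∀ x, p x → p (d x))
    (hp : ∀ i x, p x → p (pr i x)) (x : Pres Q) : p x := by
  refine ind (fun t => ?_) x
  induction t with
  | left a => exact hl a
  | right b => exact hr b
  | scal c => exact hs c
  | add x y hx hy => exact ha _ _ hx hy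
  | mul x y hx hy => exact hm _ _ hx hy
  | diff x hx => exact hd _ hx
  | proj i x hx => exact hp i _ hx

end Pres

/-- Elements that are finite sums of homogeneous elements. -/
def IsFinSum {A : Type u} [DGRing A] (a : A) : Prop := ∃ s : Finset ℤ, ∑ i ∈ s, pr i a = a

namespace IsFinSum

variable {A : Type u} [DGRing A]

theorem of_hom (i : ℤ) (a : A) (h : pr i a = a) : IsFinSum a := ⟨{i}, by simpa⟩

theorem pr_eq_zero {a : A} {s : Finset ℤ} (h : ∑ i ∈ s, pr i a = a) {j : ℤ} (hj : j ∉ s) :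
    pr j a = 0 := by
  rw [← h, map_sum]
  exact Finset.sum_eq_zero fun i hi => pr_ne _ _ _ (by rintro rfl; exact hj hi)

theorem add {a b : A} (ha : IsFinSum a) (hb : IsFinSum b) : IsFinSum (a + b) := by
  obtain ⟨s, hs⟩ := ha
  obtain ⟨t, ht⟩ := hb
  refine ⟨s ∪ t, ?_⟩
  simp only [map_add, Finset.sum_add_distrib]
  rw [← Finset.sum_subset Finset.subset_union_left (fun x _ hx => pr_eq_zero hs hx),
    ← Finset.sum_subset Finset.subset_union_right (fun x _ hx => pr_eq_zero ht hx), hs, ht]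

theorem sum {ι : Type*} (s : Finset ι) (f : ι → A) (h : ∀ i ∈ s, IsFinSum (f i)) :
    IsFinSum (∑ i ∈ s, f i) :=
  Finset.sum_induction _ _ (fun _ _ => add) ⟨∅, by simp⟩ h

theorem mul {a b : A} (ha : IsFinSum a) (hb : IsFinSum b) : IsFinSum (a * b) := by
  obtain ⟨s, hs⟩ := ha
  obtain ⟨t, ht⟩ := hb
  rw [← hs, ← ht, Finset.sum_mul_sum]
  exact sum _ _ fun i _ => sum _ _ fun j _ => of_hom (i + j) _ (pr_mul _ _ _ _)

theorem diff {a : A} (ha : IsFinSum a) : IsFinSum (d a) := by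
  obtain ⟨s, hs⟩ := ha
  rw [← hs, map_sum]
  exact sum _ _ fun i _ => of_hom (i + 1) _ (by rw [d_pr, pr_self])

end IsFinSum

/-- Germs at `x` of arbitrary families of elements of the DG algebras `A y`. -/
def germCon {X : Type u} [TopologicalSpace X] (A : X → Type u) [∀ x, DGRing (A x)] (x : X) :
    RingCon (∀ y, A y) where
  r s t := ∀ᶠ y in 𝓝 x, s y = t y
  iseqv := ⟨fun _ => Eventually.of_forall fun _ => rfl, fun h => h.mono fun _ h => h.symm,
    fun h h' => (h.and h').mono fun _ h => h.1.trans h.2⟩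
  add' h h' := (h.and h').mono fun y h => by simp [h.1, h.2]
  mul' h h' := (h.and h').mono fun y h => by simp [h.1, h.2]

/-- The algebra of germs of families. -/
abbrev Germs {X : Type u} [TopologicalSpace X] (A : X → Type u) [∀ x, DGRing (A x)] (x : X) :
    Type u := (germCon A x).Quotient

namespace Germs

variable {X : Type u} [TopologicalSpace X] {A : X → Type u} [∀ x, DGRing (A x)] {x : X}

def mk (x : X) (s : ∀ y, A y) : Germs A x := (s : (germCon A x).Quotient)

theorem ind {p : Germs A x → Prop} (h : ∀ s, p (mk x s)) (a : Germs A x) : p a :=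
  Quotient.inductionOn' a h

theorem sound {s t : ∀ y, A y} (h : ∀ᶠ y in 𝓝 x, s y = t y) : mk x s = mk x t :=
  Quotient.sound' h

theorem exact {s t : ∀ y, A y} (h : mk x s = mk x t) : ∀ᶠ y in 𝓝 x, s y = t y :=
  (germCon A x).eq.1 h

theorem mk_congr {s t : ∀ y, A y} (h : ∀ y, s y = t y) : mk x s = mk x t := by
  rw [funext h]

instance : DGRing (Germs A x) where
  pr i :=
    { toFun := Quotient.map' (fun s y => pr i (s y)) (fun _ _ h => h.mono fun y h => by
        simp only [h])
      map_add' := by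
        refine ind fun s => ind fun t => mk_congr fun y => ?_
        exact map_add _ _ _
      map_smul' := by
        intro c
        refine ind fun s => mk_congr fun y => ?_
        exact map_smul _ _ _ }
  d :=
    { toFun := Quotient.map' (fun s y => d (s y)) (fun _ _ h => h.mono fun y h => by
        simp only [h])
      map_add' := by
        refine ind fun s => ind fun t => mk_congr fun y => ?_
        exact map_add _ _ _
      map_smul' := by
        intro c
        refine ind fun s => mk_congr fun y => ?_
        exact map_smul _ _ _ }
  pr_self i := ind fun s => mk_congr fun y => pr_self _ _
  pr_ne i j := ind fun s h => mk_congr fun y => pr_ne _ _ _ h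
  pr_one := mk_congr fun y => pr_one
  pr_mul i j := ind fun s => ind fun t => mk_congr fun y => pr_mul _ _ _ _
  comm i j := ind fun s => ind fun t => mk_congr fun y => comm _ _ _ _
  d_pr i := ind fun s => mk_congr fun y => d_pr _ _
  d_d := ind fun s => mk_congr fun y => d_d _
  leibniz i := ind fun s => ind fun t => mk_congr fun y => leibniz _ _ _

end Germs

/-! ## Sheaves of DG algebras on a simplicial system -/

/-- Sheaves of graded commutative DG algebras on a simplicial space `W_*`: a sheaf on each `W α`,
and compatible maps `p⁻¹ A_α → A_β` for `α ⊆ β`, here given on stalks by `res`. -/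
structure DGSheaf (W : SimplicialSpace.{u}) where
  stalk : W.Pt → Type u
  [cdga : ∀ P, CDGA (stalk P)]
  res : ∀ {P Q : W.Pt}, P ≤ Q → stalk P → stalk Q
  res_hom : ∀ {P Q : W.Pt} (h : P ≤ Q), IsDGHom (res h)
  res_refl : ∀ {P : W.Pt} (h : P ≤ P) a, res h a = a
  res_trans : ∀ {P Q T : W.Pt} (h : P ≤ Q) (h' : Q ≤ T) a, res h' (res h a) = res (h.trans h') a
  sheaf : ∀ α, SheafStr (W.K α) (fun w => stalk ⟨α, w⟩)
  sec_scal : ∀ {α w} (c : ℂ), (sheaf α).IsSec (fun _ => algebraMap ℂ _ c) w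
  sec_add : ∀ {α w s t}, (sheaf α).IsSec s w → (sheaf α).IsSec t w →
    (sheaf α).IsSec (fun y => s y + t y) w
  sec_mul : ∀ {α w s t}, (sheaf α).IsSec s w → (sheaf α).IsSec t w →
    (sheaf α).IsSec (fun y => s y * t y) w
  sec_d : ∀ {α w s}, (sheaf α).IsSec s w → (sheaf α).IsSec (fun y => d (s y)) w
  sec_pr : ∀ {α w s} (i : ℤ), (sheaf α).IsSec s w → (sheaf α).IsSec (fun y => pr i (s y)) w
  sec_res : ∀ {α β : W.faces} (h : α ≤ β) (w : W.K β) (s), (sheaf α).IsSec s (W.p h w) →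
    (sheaf β).IsSec (fun y => res (W.le_face h y) (s (W.p h y))) w

attribute [instance] DGSheaf.cdga

/-- Morphisms of sheaves of DG algebras. -/
structure DGSheaf.Hom {W : SimplicialSpace.{u}} (A B : DGSheaf W) where
  app : ∀ P, A.stalk P → B.stalk P
  hom : ∀ P, IsDGHom (app P)
  res : ∀ {P Q : W.Pt} (h : P ≤ Q) a, app Q (A.res h a) = B.res h (app P a)
  sec : ∀ {α w s}, (A.sheaf α).IsSec s w → (B.sheaf α).IsSec (fun y => app ⟨α, y⟩ (s y)) w

namespace SheafStr

variable {X : Type u} [TopologicalSpace X] {F : X → Type u} (S : SheafStr X F)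

/-- A section extending a given germ. -/
def ext (x : X) (a : F x) : ∀ y, F y := (S.exists_sec x a).choose

theorem ext_sec (x : X) (a : F x) : S.IsSec (S.ext x a) x := (S.exists_sec x a).choose_spec.1

theorem ext_self (x : X) (a : F x) : S.ext x a x = a := (S.exists_sec x a).choose_spec.2

theorem ext_eq {x : X} {a : F x} {s : ∀ y, F y} (h : S.IsSec s x) (h' : s x = a) :
    ∀ᶠ y in 𝓝 x, S.ext x a y = s y :=
  S.eq_near (S.ext_sec x a) h ((S.ext_self x a).trans h'.symm)

end SheafStr

section germs

variable {W : SimplicialSpace.{u}} (C : DGSheaf W) {α : W.faces} (w : W.K α)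
  {A : W.K α → Type u} [∀ y, DGRing (A y)]

/-- Extension of stalkwise maps to germs. -/
def toGerms (f : ∀ y, C.stalk ⟨α, y⟩ → A y) (c : C.stalk ⟨α, w⟩) : Germs A w :=
  Germs.mk w (fun y => f y ((C.sheaf α).ext w c y))

theorem toGerms_eq (f : ∀ y, C.stalk ⟨α, y⟩ → A y) {c : C.stalk ⟨α, w⟩}
    {s : ∀ y, C.stalk ⟨α, y⟩} (h : (C.sheaf α).IsSec s w) (h' : s w = c) :
    toGerms C w f c = Germs.mk w (fun y => f y (s y)) :=
  Germs.sound (((C.sheaf α).ext_eq h h').mono fun y hy => by rw [hy])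

theorem toGerms_add (f : ∀ y, C.stalk ⟨α, y⟩ → A y) (h : ∀ y a b, f y (a + b) = f y a + f y b)
    (a b) : toGerms C w f (a + b) = toGerms C w f a + toGerms C w f b := by
  rw [toGerms_eq C w f (C.sec_add ((C.sheaf α).ext_sec w a) ((C.sheaf α).ext_sec w b))
    (by simp only [SheafStr.ext_self])]
  exact Germs.mk_congr fun y => h _ _ _

theorem toGerms_hom (f : ∀ y, C.stalk ⟨α, y⟩ → A y) (h : ∀ y, IsDGHom (f y)) :
    IsDGHom (toGerms C w f) where
  map_add := toGerms_add C w f fun y => (h y).map_add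
  map_mul a b := by
    rw [toGerms_eq C w f (C.sec_mul ((C.sheaf α).ext_sec w a) ((C.sheaf α).ext_sec w b))
      (by simp only [SheafStr.ext_self])]
    exact Germs.mk_congr fun y => (h y).map_mul _ _
  map_scal c := by
    rw [toGerms_eq C w f (C.sec_scal c) rfl]
    exact Germs.mk_congr fun y => (h y).map_scal _
  map_pr i a := by
    rw [toGerms_eq C w f (C.sec_pr i ((C.sheaf α).ext_sec w a))
      (by simp only [SheafStr.ext_self])]
    exact Germs.mk_congr fun y => (h y).map_pr _ _
  map_d a := by
    rw [toGerms_eq C w f (C.sec_d ((C.sheaf α).ext_sec w a))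
      (by simp only [SheafStr.ext_self])]
    exact Germs.mk_congr fun y => (h y).map_d _

end germs

/-- A sheaf of DG algebras presented by two sheaves of generators `C`, `C'` and relations `Q`, which
are required to be compatible with restriction and with passing to germs. -/
structure SheafPres (W : SimplicialSpace.{u}) where
  C : DGSheaf W
  C' : DGSheaf W
  Q : ∀ P, Relations (C.stalk P) (C'.stalk P)
  self : ∀ P, Q P (Pres (Q P)) Pres.left Pres.right
  fin_left : ∀ P a, IsFinSum (Pres.left a : Pres (Q P))
  fin_right : ∀ P a, IsFinSum (Pres.right a : Pres (Q P))
  pull : ∀ {P P' : W.Pt} (h : P ≤ P') (Z : Type u) [DGRing Z] (f g), Q P' Z f g →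
    Q P Z (fun a => f (C.res h a)) (fun a => g (C'.res h a))
  germ : ∀ α w (A : W.K α → Type u) [∀ y, DGRing (A y)] (f g), (∀ y, Q ⟨α, y⟩ (A y) (f y) (g y)) →
    Q ⟨α, w⟩ (Germs A w) (toGerms C w f) (toGerms C' w g)

namespace SheafPres

variable {W : SimplicialSpace.{u}} (D : SheafPres W)

abbrev Stalk (P : W.Pt) : Type u := Pres (D.Q P)

instance (P : W.Pt) : CDGA (D.Stalk P) where
  exists_sum a := by
    change IsFinSum a
    induction a using Pres.induction with
    | hl a => exact D.fin_left P a
    | hr a => exact D.fin_right P a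
    | hs c => exact .of_hom 0 _ (by rw [Algebra.algebraMap_eq_smul_one, map_smul, pr_one])
    | ha x y hx hy => exact hx.add hy
    | hm x y hx hy => exact hx.mul hy
    | hd x hx => exact hx.diff
    | hp i x hx => exact .of_hom i _ (pr_self _ _)

/-- Restriction. -/
def res {P P' : W.Pt} (h : P ≤ P') : D.Stalk P → D.Stalk P' :=
  Pres.lift (D.pull h _ _ _ (D.self P'))

theorem res_hom {P P' : W.Pt} (h : P ≤ P') : IsDGHom (D.res h) := Pres.lift_hom _

/-- Sections are the families that are locally given by a fixed expression in sections of the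
sheaves of generators. -/
inductive Sec (α : W.faces) (w : W.K α) : (∀ y : W.K α, D.Stalk ⟨α, y⟩) → Prop
  | left (c) : (D.C.sheaf α).IsSec c w → Sec α w (fun y => Pres.left (c y))
  | right (c) : (D.C'.sheaf α).IsSec c w → Sec α w (fun y => Pres.right (c y))
  | scal (c : ℂ) : Sec α w (fun _ => algebraMap ℂ _ c)
  | add (s t) : Sec α w s → Sec α w t → Sec α w (fun y => s y + t y)
  | mul (s t) : Sec α w s → Sec α w t → Sec α w (fun y => s y * t y)
  | diff (s) : Sec α w s → Sec α w (fun y => d (s y))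
  | proj (i : ℤ) (s) : Sec α w s → Sec α w (fun y => pr i (s y))
  | congr (s t) : (∀ᶠ y in 𝓝 w, s y = t y) → Sec α w s → Sec α w t

theorem Sec.eventually {α w s} (h : D.Sec α w s) : ∀ᶠ y in 𝓝 w, D.Sec α y s := by
  induction h with
  | left c h => exact ((D.C.sheaf α).eventually h).mono fun y h => .left c h
  | right c h => exact ((D.C'.sheaf α).eventually h).mono fun y h => .right c h
  | scal c => exact Eventually.of_forall fun _ => .scal c
  | add s t _ _ hs ht => exact (hs.and ht).mono fun y h => .add s t h.1 h.2
  | mul s t _ _ hs ht => exact (hs.and ht).mono fun y h => .mul s t h.1 h.2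
  | diff s _ hs => exact hs.mono fun y h => .diff s h
  | proj i s _ hs => exact hs.mono fun y h => .proj i s h
  | congr s t e _ hs => 
    exact (hs.and (eventually_eventually_nhds.2 e)).mono fun y h => .congr s t h.2 h.1

theorem Sec.exists (α w) (a : D.Stalk ⟨α, w⟩) : ∃ s, D.Sec α w s ∧ s w = a := by
  induction a using Pres.induction with
  | hl a =>
    obtain ⟨s, hs, rfl⟩ := (D.C.sheaf α).exists_sec w a
    exact ⟨_, .left s hs, rfl⟩
  | hr a =>
    obtain ⟨s, hs, rfl⟩ := (D.C'.sheaf α).exists_sec w a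
    exact ⟨_, .right s hs, rfl⟩
  | hs c => exact ⟨_, .scal c, rfl⟩
  | ha x y hx hy =>
    obtain ⟨s, hs, rfl⟩ := hx
    obtain ⟨t, ht, rfl⟩ := hy
    exact ⟨_, .add s t hs ht, rfl⟩
  | hm x y hx hy =>
    obtain ⟨s, hs, rfl⟩ := hx
    obtain ⟨t, ht, rfl⟩ := hy
    exact ⟨_, .mul s t hs ht, rfl⟩
  | hd x hx =>
    obtain ⟨s, hs, rfl⟩ := hx
    exact ⟨_, .diff s hs, rfl⟩
  | hp i x hx =>
    obtain ⟨s, hs, rfl⟩ := hx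
    exact ⟨_, .proj i s hs, rfl⟩

/-- The germ of a presented section at `w` is determined by its value at `w`. -/
def germ' (α) (w : W.K α) : D.Stalk ⟨α, w⟩ → Germs (fun y => D.Stalk ⟨α, y⟩) w :=
  Pres.lift (D.germ α w (fun y => D.Stalk ⟨α, y⟩) _ _ fun y => D.self ⟨α, y⟩)

theorem Sec.germ_eq {α w s} (h : D.Sec α w s) : D.germ' α w (s w) = Germs.mk w s := by
  have H : IsDGHom (D.germ' α w) := Pres.lift_hom _
  induction h with
  | left c h => exact toGerms_eq _ _ _ h rfl
  | right c h => exact toGerms_eq _ _ _ h rfl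
  | scal c => exact H.map_scal c
  | add s t _ _ hs ht => rw [H.map_add, hs, ht]; rfl
  | mul s t _ _ hs ht => rw [H.map_mul, hs, ht]; rfl
  | diff s _ hs => rw [H.map_d, hs]; rfl
  | proj i s _ hs => rw [H.map_pr, hs]; rfl
  | congr s t e _ hs => rw [← e.self_of_nhds, hs]; exact Germs.sound e

theorem Sec.res {α β : W.faces} (h : α ≤ β) (w : W.K β) (s) (hs : D.Sec α (W.p h w) s) :
    D.Sec β w (fun y => D.res (W.le_face h y) (s (W.p h y))) := by
  have key : ∀ v s, D.Sec α v s → v = W.p h w →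
      D.Sec β w (fun y => D.res (W.le_face h y) (s (W.p h y))) := by
    intro v s hs
    induction hs with
    | left c hc => rintro rfl; exact .left _ (D.C.sec_res h w c hc)
    | right c hc => rintro rfl; exact .right _ (D.C'.sec_res h w c hc)
    | scal c => rintro rfl; simp only [(D.res_hom _).map_scal]; exact .scal c
    | add s t _ _ hs ht =>
      intro e; simp only [(D.res_hom _).map_add]; exact .add _ _ (hs e) (ht e)
    | mul s t _ _ hs ht =>
      intro e; simp only [(D.res_hom _).map_mul]; exact .mul _ _ (hs e) (ht e)
    | diff s _ hs => intro e; simp only [(D.res_hom _).map_d]; exact .diff _ (hs e)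
    | proj i s _ hs => intro e; simp only [(D.res_hom _).map_pr]; exact .proj i _ (hs e)
    | congr s t ev _ hs =>
      rintro rfl
      exact .congr _ _ (((W.p_cont h).continuousAt.eventually ev).mono fun y hy => by
        simp only [hy]) (hs rfl)
  exact key _ s hs rfl

/-- Two DG homomorphisms out of a presented algebra agree if they agree on generators. -/
theorem hom_ext {P : W.Pt} {Z : Type u} [DGRing Z] {f g : D.Stalk P → Z} (hf : IsDGHom f)
    (hg : IsDGHom g) (hl : ∀ a, f (Pres.left a) = g (Pres.left a))
    (hr : ∀ a, f (Pres.right a) = g (Pres.right a)) (x) : f x = g x := by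
  induction x using Pres.induction with
  | hl a => exact hl a
  | hr a => exact hr a
  | hs c => rw [hf.map_scal, hg.map_scal]
  | ha x y hx hy => rw [hf.map_add, hg.map_add, hx, hy]
  | hm x y hx hy => rw [hf.map_mul, hg.map_mul, hx, hy]
  | hd x hx => rw [hf.map_d, hg.map_d, hx]
  | hp i x hx => rw [hf.map_pr, hg.map_pr, hx]

/-- The presented sheaf of DG algebras. -/
def toSheaf : DGSheaf W where
  stalk := D.Stalk
  res := D.res
  res_hom := D.res_hom
  res_refl h := D.hom_ext (D.res_hom h) IsDGHom.id
    (fun a => congrArg Pres.left (D.C.res_refl h a))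
    (fun a => congrArg Pres.right (D.C'.res_refl h a))
  res_trans h h' := D.hom_ext ((D.res_hom h').comp (D.res_hom h)) (D.res_hom _)
    (fun a => congrArg Pres.left (D.C.res_trans h h' a))
    (fun a => congrArg Pres.right (D.C'.res_trans h h' a))
  sheaf α :=
    { IsSec := fun s w => D.Sec α w s
      eventually := fun h => h.eventually
      congr := fun h e => .congr _ _ e h
      exists_sec := fun w a => Sec.exists D α w a
      eq_near := fun hs ht e => Germs.exact (by rw [← hs.germ_eq, ← ht.germ_eq, e]) }
  sec_scal c := .scal c
  sec_add hs ht := .add _ _ hs ht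
  sec_mul hs ht := .mul _ _ hs ht
  sec_d hs := .diff _ hs
  sec_pr i hs := .proj i _ hs
  sec_res h w s hs := Sec.res D h w s hs

end SheafPres

/-! ## Tensor products -/

section tensor

variable {W : SimplicialSpace.{u}} {S C C' : DGSheaf W}

/-- The relations of the tensor product: `c ↦ f c = c ⊗ 1` and `c' ↦ g c' = 1 ⊗ c'` are DG algebra
homomorphisms that agree on `S`. -/
structure TensorRel (φ : S.Hom C) (ψ : S.Hom C') (P : W.Pt) (Z : Type u) [DGRing Z]
    (f : C.stalk P → Z) (g : C'.stalk P → Z) : Prop where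
  left : IsDGHom f
  right : IsDGHom g
  eq : ∀ s, f (φ.app P s) = g (ψ.app P s)

theorem IsFinSum.of_map {A B : Type u} [CDGA A] [DGRing B] {f : A → B} (hf : IsDGHom f) (a : A) :
    IsFinSum (f a) := by
  obtain ⟨s, hs⟩ := CDGA.exists_sum a
  refine ⟨s, ?_⟩
  let F : A →+ B := ⟨⟨f, hf.map_zero⟩, hf.map_add⟩
  have : F (∑ i ∈ s, pr i a) = F a := by rw [hs]
  rw [map_sum] at this
  simpa only [F, AddMonoidHom.coe_mk, ZeroHom.coe_mk, hf.map_pr] using this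

/-- Presentation of the tensor product over `S`. -/
def tensorPres (φ : S.Hom C) (ψ : S.Hom C') : SheafPres W :=
  have self : ∀ P, TensorRel φ ψ P (Pres fun Z _ => TensorRel φ ψ P Z) Pres.left Pres.right :=
    fun P =>
    { left := by
        constructor <;> first | constructor | skip
        · exact fun a b => Pres.sound fun Z _ f g q => q.left.map_add a b
        · exact fun a b => Pres.sound fun Z _ f g q => q.left.map_mul a b
        · exact fun a => Pres.sound fun Z _ f g q => q.left.map_scal a
        · exact fun i a => Pres.sound fun Z _ f g q => q.left.map_pr i a
        · exact fun a => Pres.sound fun Z _ f g q => q.left.map_d a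
      right := by
        constructor <;> first | constructor | skip
        · exact fun a b => Pres.sound fun Z _ f g q => q.right.map_add a b
        · exact fun a b => Pres.sound fun Z _ f g q => q.right.map_mul a b
        · exact fun a => Pres.sound fun Z _ f g q => q.right.map_scal a
        · exact fun i a => Pres.sound fun Z _ f g q => q.right.map_pr i a
        · exact fun a => Pres.sound fun Z _ f g q => q.right.map_d a
      eq := fun s => Pres.sound fun Z _ f g q => q.eq s }
  { C := C
    C' := C'
    Q := fun P Z _ => TensorRel φ ψ P Z
    self := self
    fin_left := fun P a => IsFinSum.of_map (self P).left a
    fin_right := fun P a => IsFinSum.of_map (self P).right a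
    pull := fun h Z _ f g q =>
      ⟨q.left.comp (C.res_hom h), q.right.comp (C'.res_hom h), fun s => by
        rw [← φ.res, ← ψ.res, q.eq]⟩
    germ := fun α w A _ f g q =>
      ⟨toGerms_hom C w f fun y => (q y).left, toGerms_hom C' w g fun y => (q y).right, fun s => by
        have hs := (S.sheaf α).ext_sec w s
        rw [toGerms_eq C w f (φ.sec hs) (by rw [SheafStr.ext_self]),
          toGerms_eq C' w g (ψ.sec hs) (by rw [SheafStr.ext_self])]
        exact Germs.mk_congr fun y => (q y).eq _⟩ }

/-- The tensor product `C ⊗_S C'` of sheaves of DG algebras. -/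
def tensor (φ : S.Hom C) (ψ : S.Hom C') : DGSheaf W := (tensorPres φ ψ).toSheaf

variable (φ : S.Hom C) (ψ : S.Hom C')

/-- `c ↦ c ⊗ 1`. -/
def tensorLeft : C.Hom (tensor φ ψ) where
  app P := (Pres.left : _ → (tensorPres φ ψ).Stalk P)
  hom P := ((tensorPres φ ψ).self P).left
  res _ _ := rfl
  sec h := .left _ h

/-- `c' ↦ 1 ⊗ c'`. -/
def tensorRight : C'.Hom (tensor φ ψ) where
  app P := (Pres.right : _ → (tensorPres φ ψ).Stalk P)
  hom P := ((tensorPres φ ψ).self P).right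
  res _ _ := rfl
  sec h := .right _ h

/-- The map `f ⊗ id : C ⊗_S C' → D ⊗_S C'` for a homomorphism `f : C → D` of `S`-algebras. -/
def tensorMap {D : DGSheaf W} (χ : S.Hom D) (f : C.Hom D)
    (hf : ∀ P s, f.app P (φ.app P s) = χ.app P s) (P : W.Pt) :
    (tensor φ ψ).stalk P → (tensor χ ψ).stalk P :=
  Pres.lift (Q := fun Z _ => TensorRel φ ψ P Z)
    (f := fun c => (tensorLeft χ ψ).app P (f.app P c)) (g := (tensorRight χ ψ).app P)
    ⟨((tensorLeft χ ψ).hom P).comp (f.hom P), (tensorRight χ ψ).hom P, fun s => by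
      rw [hf]; exact ((tensorPres χ ψ).self P).eq s⟩

end tensor
/-! ## Free algebras -/

/-- A graded set of generators in a sheaf of DG algebras `A` on a simplicial system: for each
simplex `α` and degree `i` a set `X α i` of sections of degree `i` of `A` over `W α`. -/
structure Gens {W : SimplicialSpace.{u}} (A : DGSheaf W) where
  X : W.faces → ℤ → Type u
  e : ∀ {α i}, X α i → ∀ w : W.K α, A.stalk ⟨α, w⟩
  deg : ∀ {α i} (x : X α i) w, pr i (e x w) = e x w
  sec : ∀ {α i} (x : X α i) w, (A.sheaf α).IsSec (e x) w

namespace Gens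

variable {W : SimplicialSpace.{u}} {A : DGSheaf W} (F : Gens A)

/-- The index set of the degree `i` generators on `W α`, namely those of all faces of `α`: a graded
free module on a simplicial system is a direct sum of modules `p_γ^*(F_γ)` with `F_γ` free on
`W γ`, where `p_γ^*(F_γ)` is on `W α` the inverse image of `F_γ` if `γ ⊆ α` and zero otherwise. -/
def Idx (α : W.faces) (i : ℤ) : Type u := Σ γ : {γ : W.faces // γ ≤ α}, F.X γ.1 i

def incl {α β : W.faces} (h : α ≤ β) {i : ℤ} (x : F.Idx α i) : F.Idx β i :=
  ⟨⟨x.1.1, x.1.2.trans h⟩, x.2⟩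

/-- The germs of the generators at a point. -/
def val (P : W.Pt) {i : ℤ} (x : F.Idx P.face i) : A.stalk P :=
  A.res (W.le_face x.1.2 P.pt) (F.e x.2 (W.p x.1.2 P.pt))

theorem val_sec {α : W.faces} {i : ℤ} (x : F.Idx α i) (w : W.K α) :
    (A.sheaf α).IsSec (fun y => F.val ⟨α, y⟩ x) w :=
  A.sec_res x.1.2 w _ (F.sec x.2 _)

theorem res_val {P P' : W.Pt} (h : P ≤ P') {i : ℤ} (x : F.Idx P.face i) :
    A.res h (F.val P x) = F.val P' (F.incl h.1 x) := by
  obtain ⟨α, w⟩ := P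
  obtain ⟨β, v⟩ := P'
  obtain ⟨h1, h2⟩ := h
  simp only at h1 h2
  subst h2
  simp only [val, incl]
  rw [A.res_trans]
  have key : ∀ (u u' : W.K x.1.1) (e : u = u') (l : (⟨_, u⟩ : W.Pt) ≤ ⟨β, v⟩)
      (l' : (⟨_, u'⟩ : W.Pt) ≤ ⟨β, v⟩), A.res l (F.e x.2 u) = A.res l' (F.e x.2 u') := by
    rintro u _ rfl _ _; rfl
  exact key _ _ (W.p_trans _ _ _) _ _

/-- `B` is the free graded commutative algebra `𝕊_S(E)` over a graded free `S`-module `E` with the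
given generators, all of degree `< 0`: on the stalks, `B` has the universal property of a free
graded commutative algebra over `S`. -/
structure IsFree {S B : DGSheaf W} (φ : S.Hom B) (E : Gens B) : Prop where
  neg : ∀ α i, 0 ≤ i → IsEmpty (E.X α i)
  universal : ∀ (P : W.Pt) (Z : Type u) [CDGA Z] (ψ : S.stalk P → Z), IsGrHom ψ →
    ∀ c : ∀ i, E.Idx P.face i → Z, (∀ i x, pr i (c i x) = c i x) →
    ∃! h : B.stalk P → Z, IsGrHom h ∧ (∀ s, h (φ.app P s) = ψ s) ∧
      ∀ i x, h (E.val P x) = c i x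

end Gens

/-! ## Augmented analytic algebras -/

/-- A DG algebra `R_*` over `𝒪_{W_*}`, concentrated in degrees `≤ 0` and with `R^0 = 𝒪_{W_*}`. -/
structure IsStructureAlgebra (W : SimplicialSystem.{u}) (R : DGSheaf W.toSimplicialSpace)
    (ι : ∀ P, W.O P →ₐ[ℂ] R.stalk P) : Prop where
  nonpos : ∀ P i (a : R.stalk P), 0 < i → pr i a = 0
  injective : ∀ P, Function.Injective (ι P)
  range : ∀ P, (ι P).range = deg0 (R.stalk P)
  res : ∀ {P Q} (h : P ≤ Q) a, R.res h (ι P a) = ι Q (W.pull h a)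
  sec : ∀ α (s : ∀ w, W.O ⟨α, w⟩) w, W.IsSecO α s w ↔ (R.sheaf α).IsSec (fun y => ι ⟨α, y⟩ (s y)) w

section hol

variable {N n : ℕ}

theorem Hol.fst_mem {a : Fin N → ℂ} (g : Hol (Fin N → ℂ) a) :
    (fun b : (Fin N → ℂ) × (Fin n → ℂ) => g.1 b.1) ∈ Hol _ (a, (0 : Fin n → ℂ)) :=
  AnalyticAt.fun_comp (g := g.1) (f := Prod.fst) (x := (a, (0 : Fin n → ℂ))) g.2 analyticAt_fst

theorem Hol.coord_mem (a : Fin N → ℂ) (i : Fin n) :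
    (fun b : (Fin N → ℂ) × (Fin n → ℂ) => b.2 i) ∈ Hol _ (a, (0 : Fin n → ℂ)) :=
  (ContinuousLinearMap.analyticAt
    ((ContinuousLinearMap.proj (R := ℂ) (φ := fun _ : Fin n => ℂ) i).comp
      (ContinuousLinearMap.snd ℂ (Fin N → ℂ) (Fin n → ℂ))) _ :)

/-- The partial derivative `∂g/∂t_i` of a function `g(z, t)`. -/
def dt (i : Fin n) (g : (Fin N → ℂ) × (Fin n → ℂ) → ℂ) : (Fin N → ℂ) × (Fin n → ℂ) → ℂ :=
  fun b => fderiv ℂ g b (0, Pi.single i 1)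

theorem Hol.dt_mem {a : (Fin N → ℂ) × (Fin n → ℂ)} (i : Fin n)
    {g : (Fin N → ℂ) × (Fin n → ℂ) → ℂ} (hg : AnalyticAt ℂ g a) : dt i g ∈ Hol _ a :=
  ((ContinuousLinearMap.apply ℂ ℂ ((0, Pi.single i 1) :
    (Fin N → ℂ) × (Fin n → ℂ))).analyticAt _).fun_comp hg.fderiv

end hol

/-- A presentation of the `R`-algebra `S` as a free analytic algebra, that is, as the analytic
symmetric algebra `S̃_R(F) = 𝕊(F) ⊗ 𝒪_{𝕍(F^0)}|W` over a graded free `R`-module `F` in degrees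
`≤ 0`, of finite rank in degree zero.

Let `t_1, …, t_n` be the generators of degree zero on `W α`.  In local models with coordinates
`z : W α → ℂ^N` and equations `f_j(z) = 0` for `W α`, the sheaf `S^0` is the topological
restriction to the zero section `t = 0` of the structure sheaf of the complex space `f_j(z) = 0`
in `ℂ^N × ℂ^n`; thus its sections are locally given by convergent power series in
`t_1, …, t_n`.  The restriction maps `S^0_α → S^0_β` are given by substitution of holomorphic
functions for `z`.  Finally `S` is the free graded commutative algebra on the generators of
negative degree over `R ⊗_{R^0} S^0`. -/
structure FreeAnalytic {W : SimplicialSpace.{u}} {R S : DGSheaf W} (j : R.Hom S) where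
  gens : Gens S
  nonpos : ∀ α i, 0 < i → IsEmpty (gens.X α i)
  Chart : W.faces → Type u
  N : ∀ {α}, Chart α → ℕ
  n : ∀ {α}, Chart α → ℕ
  k : ∀ {α}, Chart α → ℕ
  U : ∀ {α}, Chart α → Set (W.K α)
  z : ∀ {α} (c : Chart α), W.K α → Fin (N c) → ℂ
  f : ∀ {α} (c : Chart α), Fin (k c) → (Fin (N c) → ℂ) → ℂ
  coord : ∀ {α} (c : Chart α), Fin (n c) ≃ gens.Idx α 0
  θ : ∀ {α} (c : Chart α) (w : W.K α), Hol (Fin (N c) → ℂ) (z c w) →ₐ[ℂ] R.stalk ⟨α, w⟩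
  θS : ∀ {α} (c : Chart α) (w : W.K α),
    Hol ((Fin (N c) → ℂ) × (Fin (n c) → ℂ)) (z c w, 0) →ₐ[ℂ] S.stalk ⟨α, w⟩
  cover : ∀ {α} (w : W.K α), ∃ c, w ∈ U c
  modelR : ∀ {α} (c : Chart α),
    IsLocalModel (R.sheaf α) (fun w => deg0 (R.stalk ⟨α, w⟩)) (U c) (z c) (f c) (θ c)
  modelS : ∀ {α} (c : Chart α), IsLocalModel (S.sheaf α) (fun w => deg0 (S.stalk ⟨α, w⟩)) (U c)
    (fun w => (z c w, (0 : Fin (n c) → ℂ))) (fun i b => f c i b.1) (θS c)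
  θS_fst : ∀ {α} (c : Chart α), ∀ w ∈ U c, ∀ g,
    θS c w ⟨fun b => g.1 b.1, Hol.fst_mem g⟩ = j.app ⟨α, w⟩ (θ c w g)
  θS_coord : ∀ {α} (c : Chart α), ∀ w ∈ U c, ∀ i,
    θS c w ⟨fun b => b.2 i, Hol.coord_mem _ i⟩ = gens.val ⟨α, w⟩ (coord c i)
  compat : ∀ {α β} (h : α ≤ β) (c : Chart α) (c' : Chart β) (w : W.K β), W.p h w ∈ U c → w ∈ U c' →
    ∃ ζ : (Fin (N c') → ℂ) → Fin (N c) → ℂ, AnalyticAt ℂ ζ (z c' w) ∧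
      ζ (z c' w) = z c (W.p h w) ∧ ∀ g hg,
      S.res (W.le_face h w) (θS c (W.p h w) g) = θS c' w
        ⟨fun b => g.1 (ζ b.1, fun i => b.2 ((coord c').symm (gens.incl h (coord c i)))), hg⟩
  universal : ∀ (P : W.Pt) (Z : Type u) [CDGA Z] (ψ : R.stalk P → Z), IsGrHom ψ →
    ∀ ψ0 : deg0 (S.stalk P) →ₐ[ℂ] Z, (∀ s, pr 0 (ψ0 s) = ψ0 s) →
    (∀ r, pr 0 r = r → ∀ h, ψ0 ⟨j.app P r, h⟩ = ψ r) →
    ∀ c : ∀ i, gens.Idx P.face i → Z, (∀ i x, pr i (c i x) = c i x) →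
    ∃! h : S.stalk P → Z, IsGrHom h ∧ (∀ r, h (j.app P r) = ψ r) ∧ (∀ s, h s.1 = ψ0 s) ∧
      ∀ i x, i < 0 → h (gens.val P x) = c i x

/-! ## Differential forms -/

section omega

variable {W : SimplicialSpace.{u}} {R S : DGSheaf W} {j : R.Hom S}

/-- The relations of `Ω_* = 𝕊_S(Ω^1_{S/R}[1])`.  It is generated by `S`, through a DG homomorphism
`f`, and by symbols `T s`, where `T s` stands for the differential `ds ∈ Ω^1_{S/R}` considered as an
element of `Ω^1_{S/R}[1]`; hence `T` lowers degrees by one and anticommutes with the differentials.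
The relations say that `d` is an `R`-linear derivation, and that it satisfies the chain rule for
holomorphic functions, whence `Ω^1` is the module of analytic (finite) differential forms; for
convenience the chain rule is also stated for elements restricted from faces. -/
structure OmegaRel (F : FreeAnalytic j) (P : W.Pt) (Z : Type u) [DGRing Z]
    (f T : S.stalk P → Z) : Prop where
  hom : IsDGHom f
  add : ∀ s s', T (s + s') = T s + T s'
  base : ∀ r, T (j.app P r) = 0
  leibniz : ∀ i s s', T (pr i s * s') = T (pr i s) * f s' + sgn i • (f (pr i s) * T s')
  diff : ∀ s, T (d s) = - d (T s)
  proj : ∀ i s, T (pr (i + 1) s) = pr i (T s)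
  chain : ∀ {Q : W.Pt} (hQ : Q ≤ P) (c : F.Chart Q.face), Q.pt ∈ F.U c → ∀ g,
    T (S.res hQ (F.θS c Q.pt g)) = ∑ i, f (S.res hQ (F.θS c Q.pt ⟨dt i g.1, Hol.dt_mem i g.2⟩)) *
      T (F.gens.val P (F.gens.incl hQ.1 (F.coord c i)))

theorem Pres.sum_sound {A B : Type u} {Q : Relations A B} {m : ℕ} (x : DGTerm A B)
    (y y' : Fin m → DGTerm A B) (h : ∀ (Z : Type u) [DGRing Z] (f : A → Z) (g : B → Z), Q Z f g →
      x.eval f g = ∑ i, (y i).eval f g * (y' i).eval f g) :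
    (Pres.mk x : Pres Q) = ∑ i, Pres.mk (y i) * Pres.mk (y' i) := by
  have : ∃ t : DGTerm A B, (Pres.mk t : Pres Q) = ∑ i, Pres.mk (y i) * Pres.mk (y' i) :=
    ⟨_, Quotient.out_eq _⟩
  obtain ⟨t, ht⟩ := this
  rw [← ht]
  refine Pres.sound fun Z _ f g q => ?_
  rw [h Z f g q]
  have H := Pres.lift_hom q
  have e : Pres.lift q (Pres.mk t) = Pres.lift q (∑ i, Pres.mk (y i) * Pres.mk (y' i)) := by rw [ht]
  let L : Pres Q →+ Z := ⟨⟨Pres.lift q, H.map_zero⟩, H.map_add⟩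
  have e' : L (Pres.mk t) = L (∑ i, Pres.mk (y i) * Pres.mk (y' i)) := e
  rw [map_sum] at e'
  refine Eq.trans ?_ e'.symm
  exact Finset.sum_congr rfl fun i _ => (H.map_mul (Pres.mk (y i)) (Pres.mk (y' i))).symm

theorem OmegaRel.self (F : FreeAnalytic j) (P : W.Pt) :
    OmegaRel F P (Pres fun Z _ => OmegaRel F P Z) Pres.left Pres.right where
  hom := by
    constructor <;> first | constructor | skip
    · exact fun a b => Pres.sound fun Z _ f g q => q.hom.map_add a b
    · exact fun a b => Pres.sound fun Z _ f g q => q.hom.map_mul a b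
    · exact fun a => Pres.sound fun Z _ f g q => q.hom.map_scal a
    · exact fun i a => Pres.sound fun Z _ f g q => q.hom.map_pr i a
    · exact fun a => Pres.sound fun Z _ f g q => q.hom.map_d a
  add a b := Pres.sound fun Z _ f g q => q.add a b
  base r := Pres.sound fun Z _ f g q => (q.base r).trans (map_zero _).symm
  leibniz i s s' := Pres.sound (x := .right (pr i s * s'))
    (y := .add (.mul (.right (pr i s)) (.left s'))
      (.mul (.scal (sgn i)) (.mul (.left (pr i s)) (.right s')))) fun Z _ f g q => by
      simp only [DGTerm.eval, ← Algebra.smul_def]; exact q.leibniz i s s'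
  diff s := Pres.sound (x := .right (d s)) (y := .mul (.scal (-1)) (.diff (.right s)))
    fun Z _ f g q => by
      simp only [DGTerm.eval, map_neg, map_one, neg_mul, one_mul]; exact q.diff s
  proj i s := Pres.sound fun Z _ f g q => q.proj i s
  chain hQ c hc g := Pres.sum_sound (.right _) (fun i => .left _) (fun i => .right _)
    fun Z _ f g' q => q.chain hQ c hc g

theorem OmegaRel.germ (F : FreeAnalytic j) (α : W.faces) (w : W.K α) (A : W.K α → Type u)
    [∀ y, DGRing (A y)] (f T : ∀ y, S.stalk ⟨α, y⟩ → A y)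
    (q : ∀ y, OmegaRel F ⟨α, y⟩ (A y) (f y) (T y)) :
    OmegaRel F ⟨α, w⟩ (Germs A w) (toGerms S w f) (toGerms S w T) where
  hom := toGerms_hom S w f fun y => (q y).hom
  add := toGerms_add S w T fun y => (q y).add
  base r := by
    rw [toGerms_eq S w T (j.sec ((R.sheaf α).ext_sec w r)) (by rw [SheafStr.ext_self])]
    exact Germs.mk_congr fun y => (q y).base _
  leibniz i s s' := by
    have h1 := S.sec_pr i ((S.sheaf α).ext_sec w s)
    rw [toGerms_eq S w T (S.sec_mul h1 ((S.sheaf α).ext_sec w s'))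
      (by simp only [SheafStr.ext_self]), toGerms_eq S w T (c := pr i s) h1 (by simp only [SheafStr.ext_self]),
      toGerms_eq S w f (c := pr i s) h1 (by simp only [SheafStr.ext_self])]
    exact Germs.mk_congr fun y => (q y).leibniz _ _ _
  diff s := by
    rw [toGerms_eq S w T (S.sec_d ((S.sheaf α).ext_sec w s)) (by simp only [SheafStr.ext_self])]
    exact Germs.mk_congr fun y => (q y).diff _
  proj i s := by
    rw [toGerms_eq S w T (S.sec_pr (i + 1) ((S.sheaf α).ext_sec w s))
      (by simp only [SheafStr.ext_self])]
    exact Germs.mk_congr fun y => (q y).proj _ _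
  chain := by
    rintro ⟨γ, v⟩ ⟨hγ, hv⟩ c hc g
    simp only at hγ hv hc g
    subst hv
    classical
    have key : ∀ g : Hol ((Fin (F.N c) → ℂ) × (Fin (F.n c) → ℂ)) (F.z c (W.p hγ w), 0),
        ∃ s : ∀ y : W.K α, S.stalk ⟨α, y⟩, (S.sheaf α).IsSec s w ∧ ∀ᶠ y in 𝓝 w,
          W.p hγ y ∈ F.U c ∧ ∃ h : AnalyticAt ℂ g.1 (F.z c (W.p hγ y), 0),
          s y = S.res (W.le_face hγ y) (F.θS c (W.p hγ y) ⟨g.1, h⟩) := by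
      intro g
      have hU : ∀ᶠ y in 𝓝 (W.p hγ w), y ∈ F.U c := (F.modelS c).isOpen.mem_nhds hc
      have hcont : ContinuousAt (fun y => (F.z c y, (0 : Fin (F.n c) → ℂ))) (W.p hγ w) :=
        (F.modelS c).cont.continuousAt hU
      have han : ∀ᶠ y in 𝓝 (W.p hγ w), AnalyticAt ℂ g.1 (F.z c y, 0) :=
        hcont.eventually (AnalyticAt.eventually_analyticAt g.2)
      let s0 : ∀ y : W.K γ, S.stalk ⟨γ, y⟩ := fun y =>
        if h : AnalyticAt ℂ g.1 (F.z c y, 0) then F.θS c y ⟨g.1, h⟩ else 0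
      have hs0 : (S.sheaf γ).IsSec s0 (W.p hγ w) := by
        refine ((F.modelS c).sec _ hc s0 ?_).2 ⟨g.1, ?_⟩
        · filter_upwards [hU, han] with y hy hy'
          simp only [s0, dif_pos hy']
          rw [← (F.modelS c).range y hy]
          exact ⟨_, rfl⟩
        · filter_upwards [han] with y hy
          exact ⟨hy, dif_pos hy⟩
      refine ⟨_, S.sec_res hγ w s0 hs0, ?_⟩
      filter_upwards [(W.p_cont hγ).continuousAt.eventually (hU.and han)] with y hy
      exact ⟨hy.1, hy.2, by simp only [s0, dif_pos hy.2]⟩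
    obtain ⟨s, hs, hs'⟩ := key g
    choose t ht ht' using fun i => key ⟨dt i g.1, Hol.dt_mem i g.2⟩
    rw [toGerms_eq S w T hs hs'.self_of_nhds.2.2]
    have e : ∀ i, toGerms S w f (S.res (W.le_face hγ w)
        (F.θS c (W.p hγ w) ⟨dt i g.1, Hol.dt_mem i g.2⟩)) *
        toGerms S w T (F.gens.val ⟨α, w⟩ (F.gens.incl hγ (F.coord c i))) =
        (germCon A w).mk' (fun y => f y (t i y) *
          T y (F.gens.val ⟨α, y⟩ (F.gens.incl hγ (F.coord c i)))) := by
      intro i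
      rw [toGerms_eq S w f (ht i) (ht' i).self_of_nhds.2.2,
        toGerms_eq S w T (F.gens.val_sec _ w) rfl]
      rfl
    refine Eq.trans ?_ (Finset.sum_congr rfl fun i _ => (e i).symm)
    rw [← map_sum]
    refine Germs.sound ?_
    filter_upwards [hs', eventually_all.2 ht'] with y hy hy'
    obtain ⟨hyU, hga, hsy⟩ := hy
    rw [hsy, Finset.sum_apply]
    refine ((q y).chain (W.le_face hγ y) c hyU ⟨g.1, hga⟩).trans ?_
    refine Finset.sum_congr rfl fun i _ => ?_
    obtain ⟨_, _, hti⟩ := hy' i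
    rw [hti]

/-- Presentation of `Ω_*`. -/
def omegaPres (F : FreeAnalytic j) : SheafPres W where
  C := S
  C' := S
  Q P Z _ := OmegaRel F P Z
  self P := OmegaRel.self F P
  fin_left P a := IsFinSum.of_map (OmegaRel.self F P).hom a
  fin_right P a := by
    have q := OmegaRel.self F P
    obtain ⟨s, hs⟩ := CDGA.exists_sum a
    let L : S.stalk P →+ Pres (fun Z _ => OmegaRel F P Z) :=
      AddMonoidHom.mk' Pres.right q.add
    have : (Pres.right a : Pres (fun Z _ => OmegaRel F P Z)) = ∑ i ∈ s, L (pr i a) := by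
      rw [← map_sum, hs]; rfl
    rw [this]
    refine IsFinSum.sum _ _ fun i _ => .of_hom (i - 1) _ ?_
    have := q.proj (i - 1) (pr i a)
    rw [sub_add_cancel, pr_self] at this
    exact this.symm
  pull {P P'} h Z _ f T q :=
    { hom := q.hom.comp (S.res_hom h)
      add := fun s s' => by rw [(S.res_hom h).map_add, q.add]
      base := fun r => by rw [← j.res, q.base]
      leibniz := fun i s s' => by
        rw [(S.res_hom h).map_mul, (S.res_hom h).map_pr, q.leibniz]
      diff := fun s => by rw [(S.res_hom h).map_d, q.diff]
      proj := fun i s => by rw [(S.res_hom h).map_pr, q.proj]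
      chain := fun hQ c hc g => by
        simp only [S.res_trans, F.gens.res_val]
        exact q.chain (hQ.trans h) c hc g }
  germ α w A _ f T q := OmegaRel.germ F α w A f T q

/-- The sheaf of DG algebras `Ω_* = 𝕊_S(Ω^1_{S/R}[1])`. -/
def Omega (F : FreeAnalytic j) : DGSheaf W := (omegaPres F).toSheaf

/-- The structure map `S → Ω_*`. -/
def omegaIncl (F : FreeAnalytic j) : S.Hom (Omega F) where
  app P := (Pres.left : _ → (omegaPres F).Stalk P)
  hom P := (OmegaRel.self F P).hom
  res _ _ := rfl
  sec h := .left _ h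

/-- The universal derivation `s ↦ ds ∈ Ω^1_{S/R}[1] ⊆ Ω_*`. -/
def omegaD (F : FreeAnalytic j) (P : W.Pt) (s : S.stalk P) : (Omega F).stalk P :=
  (Pres.right s : (omegaPres F).Stalk P)

end omega

/-! ## Derived categories of DG modules -/

/-- Sheaves of (left) DG modules over `R`. -/
structure DGMod {W : SimplicialSpace.{u}} (R : DGSheaf W) where
  stalk : W.Pt → Type u
  [grp : ∀ P, AddCommGroup (stalk P)]
  [mod : ∀ P, Module (R.stalk P) (stalk P)]
  pr : ∀ P, ℤ → stalk P →+ stalk P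
  d : ∀ P, stalk P →+ stalk P
  pr_self : ∀ P i m, pr P i (pr P i m) = pr P i m
  pr_ne : ∀ P i k m, i ≠ k → pr P i (pr P k m) = 0
  exists_sum : ∀ P m, ∃ s : Finset ℤ, ∑ i ∈ s, pr P i m = m
  pr_smul : ∀ P i k (a : R.stalk P) m,
    pr P (i + k) (DGRing.pr i a • pr P k m) = DGRing.pr i a • pr P k m
  d_pr : ∀ P i m, d P (pr P i m) = pr P (i + 1) (d P m)
  d_d : ∀ P m, d P (d P m) = 0
  leibniz : ∀ P i (a : R.stalk P) m, d P (DGRing.pr i a • m) =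
    DGRing.d (DGRing.pr i a) • m + (i.negOnePow : ℤ) • (DGRing.pr i a • d P m)
  res : ∀ {P Q : W.Pt}, P ≤ Q → stalk P →+ stalk Q
  res_smul : ∀ {P Q : W.Pt} (h : P ≤ Q) (a : R.stalk P) m, res h (a • m) = R.res h a • res h m
  res_pr : ∀ {P Q : W.Pt} (h : P ≤ Q) i m, res h (pr P i m) = pr Q i (res h m)
  res_d : ∀ {P Q : W.Pt} (h : P ≤ Q) m, res h (d P m) = d Q (res h m)
  res_refl : ∀ {P : W.Pt} (h : P ≤ P) m, res h m = m
  res_trans : ∀ {P Q T : W.Pt} (h : P ≤ Q) (h' : Q ≤ T) m, res h' (res h m) = res (h.trans h') m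
  sheaf : ∀ α, SheafStr (W.K α) (fun w => stalk ⟨α, w⟩)
  sec_add : ∀ {α w s t}, (sheaf α).IsSec s w → (sheaf α).IsSec t w →
    (sheaf α).IsSec (fun y => s y + t y) w
  sec_smul : ∀ {α w a s}, (R.sheaf α).IsSec a w → (sheaf α).IsSec s w →
    (sheaf α).IsSec (fun y => a y • s y) w
  sec_d : ∀ {α w s}, (sheaf α).IsSec s w → (sheaf α).IsSec (fun y => d ⟨α, y⟩ (s y)) w
  sec_pr : ∀ {α w s} (i : ℤ), (sheaf α).IsSec s w → (sheaf α).IsSec (fun y => pr ⟨α, y⟩ i (s y)) w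
  sec_res : ∀ {α β : W.faces} (h : α ≤ β) (w : W.K β) (s), (sheaf α).IsSec s (W.p h w) →
    (sheaf β).IsSec (fun y => res (W.le_face h y) (s (W.p h y))) w

attribute [instance] DGMod.grp DGMod.mod

/-- A map of complexes (with gradings given by projections) induces bijections on cohomology. -/
structure IsCohomologyIso {M N : Type u} [AddCommGroup M] [AddCommGroup N] (prM : ℤ → M → M)
    (dM : M → M) (prN : ℤ → N → N) (dN : N → N) (f : M → N) : Prop where
  injective : ∀ n m, prM n m = m → dM m = 0 → (∃ b, prN (n - 1) b = b ∧ dN b = f m) →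
    ∃ a, prM (n - 1) a = a ∧ dM a = m
  surjective : ∀ n b, prN n b = b → dN b = 0 →
    ∃ m, prM n m = m ∧ dM m = 0 ∧ ∃ c, prN (n - 1) c = c ∧ f m = b + dN c

/-- Quasi-isomorphisms of sheaves of DG algebras (tested on stalks). -/
def DGSheaf.Hom.IsQuasiIso {W : SimplicialSpace.{u}} {A B : DGSheaf W} (f : A.Hom B) : Prop :=
  ∀ P, IsCohomologyIso (fun i (a : A.stalk P) => pr i a) (fun a => d a)
    (fun i (b : B.stalk P) => pr i b) (fun b => d b) (f.app P)

namespace DGMod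

variable {W : SimplicialSpace.{u}} {R : DGSheaf W}

/-- Morphisms of sheaves of DG modules. -/
@[ext]
structure Hom (M N : DGMod R) where
  app : ∀ P, M.stalk P →+ N.stalk P
  smul : ∀ P (a : R.stalk P) m, app P (a • m) = a • app P m
  pr : ∀ P i m, app P (M.pr P i m) = N.pr P i (app P m)
  d : ∀ P m, app P (M.d P m) = N.d P (app P m)
  res : ∀ {P Q : W.Pt} (h : P ≤ Q) m, app Q (M.res h m) = N.res h (app P m)
  sec : ∀ {α w s}, (M.sheaf α).IsSec s w → (N.sheaf α).IsSec (fun y => app ⟨α, y⟩ (s y)) w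

instance : Category (DGMod R) where
  Hom := Hom
  id M :=
    { app := fun P => AddMonoidHom.id _
      smul := fun _ _ _ => rfl
      pr := fun _ _ _ => rfl
      d := fun _ _ => rfl
      res := fun _ _ => rfl
      sec := fun h => h }
  comp f g :=
    { app := fun P => (g.app P).comp (f.app P)
      smul := fun P a m => by simp [f.smul, g.smul]
      pr := fun P i m => by simp [f.pr, g.pr]
      d := fun P m => by simp [f.d, g.d]
      res := fun h m => by simp [f.res, g.res]
      sec := fun h => g.sec (f.sec h) }

/-- Quasi-isomorphisms of sheaves of DG modules (tested on stalks). -/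
def qis (R : DGSheaf W) : MorphismProperty (DGMod R) := fun M N f =>
  ∀ P, IsCohomologyIso (fun i m => M.pr P i m) (fun m => M.d P m) (fun i m => N.pr P i m)
    (fun m => N.d P m) (fun m => Hom.app f P m)

end DGMod

/-- The derived category `D(R_*)` of DG modules over `R_*`. -/
abbrev DerivedCat {W : SimplicialSpace.{u}} (R : DGSheaf W) := (DGMod.qis R).Localization

theorem sgn_smul {M : Type*} [AddCommGroup M] [Module ℂ M] (i : ℤ) (m : M) :
    sgn i • m = (i.negOnePow : ℤ) • m := by
  rw [sgn, Int.cast_smul_eq_zsmul]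

section toMod

variable {W : SimplicialSpace.{u}} {R : DGSheaf W}

/-- The ring homomorphism underlying a homomorphism of graded algebras. -/
def IsGrHom.toRingHom {A B : Type u} [DGRing A] [DGRing B] {f : A → B} (h : IsGrHom f) :
    A →+* B where
  toFun := f
  map_one' := by simpa using h.map_scal 1
  map_mul' := h.map_mul
  map_zero' := h.map_zero
  map_add' := h.map_add

/-- An `R`-algebra, considered as a DG `R`-module. -/
def DGSheaf.Hom.toMod {A : DGSheaf W} (i : R.Hom A) : DGMod R :=
  letI (P : W.Pt) : Module (R.stalk P) (A.stalk P) :=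
    Module.compHom (A.stalk P) (i.hom P).toIsGrHom.toRingHom
  have smul_def : ∀ P (a : R.stalk P) (m : A.stalk P), a • m = i.app P a * m := fun _ _ _ => rfl
  { stalk := A.stalk
    pr := fun P k => (DGRing.pr k : A.stalk P →ₗ[ℂ] A.stalk P).toAddMonoidHom
    d := fun P => (DGRing.d : A.stalk P →ₗ[ℂ] A.stalk P).toAddMonoidHom
    pr_self := fun P i m => DGRing.pr_self i m
    pr_ne := fun P i k m h => DGRing.pr_ne i k m h
    exists_sum := fun P m => CDGA.exists_sum m
    pr_smul := fun P k l a m => by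
      simp only [smul_def, LinearMap.toAddMonoidHom_coe, (i.hom P).map_pr, DGRing.pr_mul]
    d_pr := fun P i m => DGRing.d_pr i m
    d_d := fun P m => DGRing.d_d m
    leibniz := fun P k a m => by
      simp only [smul_def, LinearMap.toAddMonoidHom_coe, (i.hom P).map_pr, (i.hom P).map_d,
        DGRing.leibniz, sgn_smul]
    res := fun {P Q} h => AddMonoidHom.mk' (A.res h) (A.res_hom h).map_add
    res_smul := fun h a m => by
      simp only [smul_def, AddMonoidHom.mk'_apply, (A.res_hom h).map_mul, i.res]
    res_pr := fun h k m => (A.res_hom h).map_pr k m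
    res_d := fun h m => (A.res_hom h).map_d m
    res_refl := A.res_refl
    res_trans := A.res_trans
    sheaf := A.sheaf
    sec_add := A.sec_add
    sec_smul := fun ha hs => A.sec_mul (i.sec ha) hs
    sec_d := A.sec_d
    sec_pr := A.sec_pr
    sec_res := A.sec_res }

/-- A homomorphism of `R`-algebras, considered as a morphism of DG `R`-modules. -/
def DGSheaf.Hom.toModHom {A A' : DGSheaf W} (i : R.Hom A) (i' : R.Hom A') (f : A.Hom A')
    (h : ∀ P r, f.app P (i.app P r) = i'.app P r) : i.toMod ⟶ i'.toMod :=
  DGMod.Hom.mk (M := i.toMod) (N := i'.toMod)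
    (fun P => AddMonoidHom.mk' (f.app P) (f.hom P).map_add)
    (fun P a (m : A.stalk P) => by
      change f.app P (i.app P a * m) = i'.app P a * f.app P m
      rw [(f.hom P).map_mul, h])
    (fun P k m => (f.hom P).map_pr k m)
    (fun P m => (f.hom P).map_d m)
    (fun h m => f.res h m)
    (fun h => f.sec h)

end toMod

/-! ## The Atiyah class and the Atiyah–Chern character -/

section atiyah

variable {W : SimplicialSpace.{u}} {R S B : DGSheaf W} {j : R.Hom S}

/-- `B ⊗_S Ω_*`. -/
abbrev BOmega (F : FreeAnalytic j) (φ : S.Hom B) : DGSheaf W := tensor φ (omegaIncl F)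

/-- `b ↦ b ⊗ 1`. -/
abbrev inB (F : FreeAnalytic j) (φ : S.Hom B) (P : W.Pt) (b : B.stalk P) : (BOmega F φ).stalk P :=
  (tensorLeft φ (omegaIncl F)).app P b

/-- `ω ↦ 1 ⊗ ω`. -/
abbrev inOmega (F : FreeAnalytic j) (φ : S.Hom B) (P : W.Pt) (a : (Omega F).stalk P) :
    (BOmega F φ).stalk P :=
  (tensorRight φ (omegaIncl F)).app P a

/-- An `R`-linear connection on `B` that is a derivation `∇ : B → B ⊗_S Ω^1_{S/R}` extending the
differential `d : S → Ω^1_{S/R}`.  It is given by its composition with the shift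
`B ⊗_S Ω^1 → B ⊗_S Ω^1[1]`, the part of `B ⊗_S Ω_*` spanned by the elements `b ⊗ ds`; hence it lowers
degrees by one and is a derivation in the graded sense. -/
structure Connection (F : FreeAnalytic j) (φ : S.Hom B) where
  app : ∀ P, B.stalk P → (BOmega F φ).stalk P
  map_add : ∀ P b b', app P (b + b') = app P b + app P b'
  leibniz : ∀ P i b b', app P (pr i b * b') =
    app P (pr i b) * inB F φ P b' + sgn i • (inB F φ P (pr i b) * app P b')
  extends_d : ∀ P s, app P (φ.app P s) = inOmega F φ P (omegaD F P s)
  mem_span : ∀ P b, app P b ∈ Submodule.span ℂ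
    {x | ∃ b' s, x = inB F φ P b' * inOmega F φ P (omegaD F P s)}
  proj : ∀ P i b, app P (pr (i + 1) b) = pr i (app P b)
  res : ∀ {P Q : W.Pt} (h : P ≤ Q) b, app Q (B.res h b) = (BOmega F φ).res h (app P b)
  sec : ∀ {α w s}, (B.sheaf α).IsSec s w →
    ((BOmega F φ).sheaf α).IsSec (fun y => app ⟨α, y⟩ (s y)) w

/-- The Atiyah class `At_B = [∂, ∇] : B → B ⊗_S Ω^1[1]`.  In terms of `∇' = T ∘ ∇` with the shift
`T`, which anticommutes with `∂`, it is `T ∘ [∂, ∇] = -(∂ ∇' + ∇' ∂)`. -/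
def Connection.atiyah {F : FreeAnalytic j} {φ : S.Hom B} (c : Connection F φ) (P : W.Pt)
    (b : B.stalk P) : (BOmega F φ).stalk P :=
  -(d (c.app P b) + c.app P (d b))

/-- `D` is the extension of the Atiyah class to an `Ω_*`-linear derivation of `B ⊗_S Ω_*`. -/
structure IsAtiyahExtension {F : FreeAnalytic j} {φ : S.Hom B} (c : Connection F φ)
    (D : ∀ P, (BOmega F φ).stalk P → (BOmega F φ).stalk P) : Prop where
  map_add : ∀ P x y, D P (x + y) = D P x + D P y
  leibniz : ∀ P x y, D P (x * y) = D P x * y + x * D P y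
  omega : ∀ P a, D P (inOmega F φ P a) = 0
  atiyah : ∀ P b, D P (inB F φ P b) = c.atiyah P b

/-- The partial sum `∑_{n < N} (-1)^n / n! D^n (b ⊗ 1)` of the exponential series of `-D`.  If
`D^N (b ⊗ 1) = 0`, this is the value `AC_B(b) = exp(-D)(b ⊗ 1)` of the Atiyah–Chern character. -/
def expSum {F : FreeAnalytic j} {φ : S.Hom B}
    (D : ∀ P, (BOmega F φ).stalk P → (BOmega F φ).stalk P) (N : ℕ) (P : W.Pt) (b : B.stalk P) :
    (BOmega F φ).stalk P :=
  ∑ n ∈ Finset.range N, ((-1) ^ n / (n.factorial : ℂ)) • (D P)^[n] (inB F φ P b)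

/-- `B ⊗_S R`. -/
abbrev BR (φ : S.Hom B) (μ : S.Hom R) : DGSheaf W := tensor φ μ

/-- `R ⊗_S Ω_*`. -/
abbrev ROmega (F : FreeAnalytic j) (μ : S.Hom R) : DGSheaf W := tensor μ (omegaIncl F)

/-- `Φ : B ⊗_S R → R ⊗_S Ω_*` is the homomorphism of `R`-algebras with
`Φ(b ⊗ 1) = (ν ⊗ id)(AC_B(b))`. -/
structure IsPhi {F : FreeAnalytic j} {φ : S.Hom B} {μ : S.Hom R} (ν : B.Hom R)
    (hν : ∀ P s, ν.app P (φ.app P s) = μ.app P s)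
    (D : ∀ P, (BOmega F φ).stalk P → (BOmega F φ).stalk P) (Φ : (BR φ μ).Hom (ROmega F μ)) :
    Prop where
  linear : ∀ P r, Φ.app P ((tensorRight φ μ).app P r) = (tensorLeft μ (omegaIncl F)).app P r
  character : ∀ P b N, (D P)^[N] (inB F φ P b) = 0 →
    Φ.app P ((tensorLeft φ μ).app P b) =
      tensorMap φ (omegaIncl F) μ ν hν P (expSum D N P b)

/-- `R ⊗^L_S R` as an object of `D(R_*)`, represented by `B ⊗_S R` for the free resolution `B` of
`R` over `S`, with `R_*` acting on the right factor. -/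
def derivedTensor (φ : S.Hom B) (μ : S.Hom R) : DerivedCat R :=
  (DGMod.qis R).Q.obj (tensorRight φ μ).toMod

/-- The morphism `R ⊗^L_S R → R ⊗_S Ω_*` of `D(R_*)` represented by `Φ_B`. -/
def IsPhi.derived {F : FreeAnalytic j} {φ : S.Hom B} {μ : S.Hom R} {ν : B.Hom R}
    {hν : ∀ P s, ν.app P (φ.app P s) = μ.app P s}
    {D : ∀ P, (BOmega F φ).stalk P → (BOmega F φ).stalk P} {Φ : (BR φ μ).Hom (ROmega F μ)}
    (h : IsPhi ν hν D Φ) :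
    derivedTensor φ μ ⟶ (DGMod.qis R).Q.obj (tensorLeft μ (omegaIncl F)).toMod :=
  (DGMod.qis R).Q.map (DGSheaf.Hom.toModHom _ _ Φ h.linear)

end atiyah

end

noncomputable section

open DGRing

/-! ## Signs and the parity involution -/

/-! Existence and uniqueness. Since `B` is free over `S`, a derivation extending `d` may be
prescribed on the generators of `B`, and the value zero gives a connection. The Atiyah class is a
derivation of degree zero that commutes with the differentials and vanishes on `S`. Adding a
multiple of a variable of square zero turns it into an algebra homomorphism, so the universal
property of `B ⊗ Ω` extends it. It is locally nilpotent for reasons of degree: it replaces an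
element of `B` by forms `b · ds`, where `ds` has degree at most `-1` in `Ω^1[1]`, so the degree of
the `B`-factor rises, while `B` lives in degrees at most zero. The exponential of minus a locally
nilpotent derivation commuting with `d` is a DG homomorphism. It is the identity on `S`, and so `Φ`
descends to `B ⊗_S R`.

Quasi-isomorphism. This is tested on stalks (`FreeStalk`), by comparison with one explicit
resolution. Over `M = R ⊗ S⁰` the elements `t_i - α_i`, with `α_i` representing `μ(t_i)`, have an
acyclic augmented Koszul algebra; this rests on Hadamard division of holomorphic functions. Free
contractible pairs `η_x`, `ξ_x = dη_x` are adjoined for the generators `e_x` of negative degree. A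
map `χ` from `S` to the result `PC` is found with `χ(e_x) = μ(e_x) + ξ_x + q_x`, where `q_x`
involves only generators of larger degree. Replacing `ξ_x` by `χ(e_x)` is a unipotent change of
variables (`twist_bijective`), hence `PC` is a free resolution of `R` over `S` with generators `y_x`
(`χ_free`). There is one `y_x` for each generator `g_x` of `S`, in degree one lower, exactly as for
the generators `dg_x` of `R ⊗ Ω` over `R` (`FreeAnalytic.formAlg`).

The forms carry a weight, the number of differentials. Only weights zero and one of the character
matter: weight zero is the augmentation, and weight one is the bracket of the differential with the
connection (`IsAtiyahExtension.linear_part`). Transported to `PC`, the connection can be moved along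
an affine path to the one that vanishes on all `y_x`, and the character can be deformed with it
(`exists_deformation`). For that connection the linear part sends `y_x` to `dg_x` plus combinations
of `dg_x'` with `g_x'` of larger degree (`κ_dy`). An endomorphism of `R ⊗ Ω` over `R` with such a
linear part is bijective, whatever its terms of higher weight are (`bijective_of_unipotent`). So the
deformed map identifies `PC ⊗_S R` with `R ⊗ Ω`. Free resolutions of `R` over `S` are homotopy
equivalent, and `FormAlg.isCohomologyIso` carries the conclusion back to `B`.

Homotopies are maps into the path object of polynomial forms, odd derivations are maps into odd dual
numbers, and graded maps are DG maps into cofree algebras. In this way every construction reduces to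
universal properties of algebras. -/

theorem sgn_add (i k : ℤ) : sgn (i + k) = sgn i * sgn k := by
  simp [sgn, Int.negOnePow_add]

theorem sgn_mul_self (i : ℤ) : sgn i * sgn i = 1 := by
  rw [← sgn_add, sgn, Int.negOnePow_even _ ⟨i, rfl⟩]; simp

theorem sgn_even {i : ℤ} (h : Even i) : sgn i = 1 := by
  simp [sgn, Int.negOnePow_even _ h]

theorem sgn_odd {i : ℤ} (h : Odd i) : sgn i = -1 := by
  simp [sgn, Int.negOnePow_odd _ h]

theorem sgn_zero : sgn 0 = 1 := sgn_even (by decide)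

theorem sgn_one : sgn 1 = -1 := sgn_odd (by decide)

theorem sgn_neg (i : ℤ) : sgn (-i) = sgn i := by simp [sgn, Int.negOnePow_neg]

theorem sgn_sub_odd {i k : ℤ} (h : Odd k) : sgn (i - k) = -sgn i := by
  rw [sub_eq_add_neg, sgn_add, sgn_neg, sgn_odd h]; ring

theorem sgn_mul_odd {i k : ℤ} (h : Odd k) : sgn (i * k) = sgn i := by
  rcases Int.even_or_odd i with hi | hi
  · rw [sgn_even hi, sgn_even (hi.mul_right k)]
  · rw [sgn_odd hi, sgn_odd (hi.mul h)]

theorem sgn_mul_even {i k : ℤ} (h : Even k) : sgn (i * k) = 1 := sgn_even (h.mul_left i)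

namespace CDGA

variable {A : Type u} [CDGA A]

theorem pr_finite (a : A) : {i | pr i a ≠ 0}.Finite := by
  obtain ⟨s, hs⟩ := exists_sum a
  refine s.finite_toSet.subset fun i hi => ?_
  by_contra h
  exact hi (IsFinSum.pr_eq_zero hs h)

/-- The set of degrees of the homogeneous components. -/
def supp (a : A) : Finset ℤ := (pr_finite a).toFinset

theorem mem_supp {a : A} {i : ℤ} : i ∈ supp a ↔ pr i a ≠ 0 := by
  simp [supp]

theorem sum_pr_subset (a : A) {t : Finset ℤ} (h : supp a ⊆ t) : ∑ i ∈ t, pr i a = a := by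
  obtain ⟨s, hs⟩ := exists_sum a
  have hst : supp a ⊆ s := fun i hi => by
    by_contra h
    exact mem_supp.1 hi (IsFinSum.pr_eq_zero hs h)
  rw [← Finset.sum_subset h fun i _ hi => not_not.1 fun h' => hi (mem_supp.2 h')]
  conv_rhs => rw [← hs]
  exact Finset.sum_subset hst fun i _ hi => not_not.1 fun h' => hi (mem_supp.2 h')

theorem sum_pr (a : A) : ∑ i ∈ supp a, pr i a = a := sum_pr_subset a subset_rfl

theorem hom_induction {p : A → Prop} (add : ∀ a b, p a → p b → p (a + b))
    (hom : ∀ i a, pr i a = a → p a) (a : A) : p a := by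
  rw [← sum_pr a]
  exact Finset.sum_induction _ _ add (hom 0 0 (map_zero _)) fun i _ => hom i _ (pr_self _ _)

/-- Additive maps that agree on homogeneous elements agree. -/
theorem addHom_ext {M : Type*} [AddCommGroup M] {f g : A → M} (hf : ∀ a b, f (a + b) = f a + f b)
    (hg : ∀ a b, g (a + b) = g a + g b) (h : ∀ i a, f (pr i a) = g (pr i a)) (a : A) : f a = g a := by
  induction a using hom_induction with
  | add a b ha hb => rw [hf, hg, ha, hb]
  | hom i a ha => rw [← ha, h]

/-- The parity involution `a ↦ (-1)^|a| a`. -/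
def inv : A →ₗ[ℂ] A where
  toFun a := ∑ᶠ i, sgn i • pr i a
  map_add' a b := by
    simp only [map_add, smul_add]
    refine finsum_add_distrib ((pr_finite a).subset ?_) ((pr_finite b).subset ?_) <;>
    · intro i hi h
      exact hi (by simp [h])
  map_smul' c a := by
    simp only [map_smul, RingHom.id_apply]
    rw [smul_finsum' c ((pr_finite a).subset fun i hi h => hi (by simp [h]))]
    exact finsum_congr fun i => smul_comm _ _ _

theorem inv_pr (i : ℤ) (a : A) : inv (pr i a) = sgn i • pr i a := by
  change ∑ᶠ k, sgn k • pr k (pr i a) = _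
  rw [finsum_eq_single _ i fun k hk => by rw [pr_ne _ _ _ hk, smul_zero], pr_self]

theorem inv_hom {i : ℤ} {a : A} (h : pr i a = a) : inv a = sgn i • a := by
  rw [← h, inv_pr]

protected theorem inv_inv (a : A) : inv (inv a) = a := by
  refine addHom_ext (f := fun a => inv (inv a)) (g := id) (by simp) (by simp) (fun i a => ?_) a
  simp [inv_pr, smul_smul, sgn_mul_self]

protected theorem inv_one : inv (1 : A) = 1 := by
  rw [inv_hom pr_one, sgn_zero, one_smul]

protected theorem inv_mul (a b : A) : inv (a * b) = inv a * inv b := by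
  refine addHom_ext (f := fun a => inv (a * b)) (g := fun a => inv a * inv b) (by simp [add_mul])
    (by simp [add_mul]) (fun i a => ?_) a
  refine addHom_ext (f := fun b => inv (pr i a * b)) (g := fun b => inv (pr i a) * inv b)
    (by simp [mul_add]) (by simp [mul_add]) (fun k b => ?_) b
  rw [← pr_mul, inv_pr, inv_pr, inv_pr, pr_mul, sgn_add, smul_mul_smul_comm]

theorem d_inv (a : A) : d (inv a) = -inv (d a) := by
  refine addHom_ext (f := fun a => d (inv a)) (g := fun a => -inv (d a)) (by simp) 
    (fun a b => by simp only [map_add, neg_add]) (fun k a => ?_) a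
  rw [inv_pr, map_smul, d_pr, inv_pr, sgn_add, sgn_one]
  simp

/-- The shape of the Leibniz rule for maps of odd degree that involves the parity involution. -/
theorem leibniz_inv {M : Type u} [Ring M] [Algebra ℂ M] {f D : A → M}
    (hf : ∀ a b, f (a + b) = f a + f b) (hs : ∀ (c : ℂ) a, f (c • a) = c • f a)
    (hD : ∀ a b, D (a + b) = D a + D b)
    (h : ∀ i a b, D (pr i a * b) = D (pr i a) * f b + sgn i • (f (pr i a) * D b)) (a b : A) :
    D (a * b) = D a * f b + f (inv a) * D b := by
  refine addHom_ext (f := fun a => D (a * b)) (g := fun a => D a * f b + f (inv a) * D b)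
    (fun a a' => by simp only [add_mul, hD]) (fun a a' => by simp only [map_add, hf, hD, add_mul]; abel)
    (fun i a => ?_) a
  simp only [h, inv_pr, hs, smul_mul_assoc]

theorem d_mul (a b : A) : d (a * b) = d a * b + inv a * d b :=
  leibniz_inv (f := id) (D := d) (by simp) (by simp) (by simp) (fun i a b => leibniz i a b) a b

theorem odd_comm {k : ℤ} (hk : Odd k) {e : A} (he : pr k e = e) (b : A) : b * e = e * inv b := by
  refine addHom_ext (f := fun b => b * e) (g := fun b => e * inv b) (by simp [add_mul])
    (by simp [mul_add]) (fun i b => ?_) b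
  have := comm i k b e
  rw [he, sgn_mul_odd hk] at this
  simp only [this, inv_pr, mul_smul_comm]

theorem even_comm {k : ℤ} (hk : Even k) {e : A} (he : pr k e = e) (b : A) : b * e = e * b := by
  refine addHom_ext (f := fun b => b * e) (g := fun b => e * b) (by simp [add_mul])
    (by simp [mul_add]) (fun i b => ?_) b
  have := comm i k b e
  rw [he, sgn_mul_even hk, one_smul] at this
  exact this

theorem odd_sq {k : ℤ} (hk : Odd k) {e : A} (he : pr k e = e) : e * e = 0 := by
  have h := odd_comm hk he e
  rw [inv_hom he, sgn_odd hk, neg_one_smul, mul_neg] at h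
  have h2 : (2 : ℂ) • (e * e) = 0 := by rw [two_smul]; exact add_eq_zero_iff_eq_neg.2 h
  exact (smul_eq_zero.1 h2).resolve_left two_ne_zero

theorem pr_mul_left (k i : ℤ) (a b : A) : pr k (pr i a * b) = pr i a * pr (k - i) b := by
  refine addHom_ext (f := fun b => pr k (pr i a * b)) (g := fun b => pr i a * pr (k - i) b)
    (by simp [mul_add]) (by simp [mul_add]) (fun l b => ?_) b
  rcases eq_or_ne l (k - i) with rfl | h
  · have := pr_mul i (k - i) a b
    rw [add_sub_cancel] at this
    rw [this, pr_self]
  · rw [pr_ne _ _ _ h.symm, mul_zero, ← pr_mul, pr_ne _ _ _ (by omega)]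

theorem pr_mul_eq_sum (k : ℤ) (a b : A) :
    pr k (a * b) = ∑ i ∈ supp a, pr i a * pr (k - i) b := by
  conv_lhs => rw [← sum_pr a]
  rw [Finset.sum_mul, map_sum]
  exact Finset.sum_congr rfl fun i _ => pr_mul_left _ _ _ _

/-- A graded property that is stable under sums and products holds for the components of a product
if it holds for those of the factors. -/
theorem graded_mul {p : ℤ → A → Prop} (zero : ∀ i, p i 0)
    (add : ∀ i a b, p i a → p i b → p i (a + b))
    (mul : ∀ i k a b, pr i a = a → pr k b = b → p i a → p k b → p (i + k) (a * b)) {a b : A}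
    (ha : ∀ i, p i (pr i a)) (hb : ∀ i, p i (pr i b)) (k : ℤ) : p k (pr k (a * b)) := by
  rw [pr_mul_eq_sum]
  refine Finset.sum_induction _ _ (add k) (zero k) fun i _ => ?_
  have := mul i (k - i) _ _ (pr_self _ _) (pr_self _ _) (ha i) (hb (k - i))
  rwa [add_sub_cancel] at this

/-- The even bracket of the differentials with an odd derivation is a derivation. -/
theorem bracket_mul {M : Type u} [CDGA M] {f K : A → M} (hf : IsDGHom f)
    (hinv : ∀ a, f (inv a) = inv (f a)) (hK : ∀ a b, K (a + b) = K a + K b)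
    (hKi : ∀ a, K (inv a) = -inv (K a))
    (h : ∀ a b, K (a * b) = K a * f b + f (inv a) * K b) (a b : A) :
    d (K (a * b)) + K (d (a * b)) = (d (K a) + K (d a)) * f b + f a * (d (K b) + K (d b)) := by
  have h0 : K 0 = 0 := by simpa using hK 0 0
  have h1 : inv (inv (f a)) = f a := CDGA.inv_inv _
  -- The mixed terms `inv (K a) * d (f b)` and `d (f (inv a)) * K b` occur twice with opposite
  -- signs, because `K` and `d` both anticommute with the parity involution.
  rw [h, d_mul, hK, h, h, map_add, d_mul, d_mul, hKi, hinv, hinv, hinv, h1, d_inv,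
    hf.map_d, hf.map_d]
  have h2 : inv (d (f a)) = -d (inv (f a)) := by rw [d_inv, neg_neg]
  rw [h2]
  simp only [hinv, h1]
  noncomm_ring

end CDGA

open CDGA

namespace IsGrHom

variable {A B C : Type u}

theorem comp [DGRing A] [DGRing B] [DGRing C] {g : B → C} {f : A → B} (hg : IsGrHom g)
    (hf : IsGrHom f) : IsGrHom (fun a => g (f a)) where
  map_add a b := by simp [hf.map_add, hg.map_add]
  map_mul a b := by simp [hf.map_mul, hg.map_mul]
  map_scal c := by simp [hf.map_scal, hg.map_scal]
  map_pr i a := by simp [hf.map_pr, hg.map_pr]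

theorem refl [DGRing A] : IsGrHom (fun a : A => a) := IsDGHom.id.toIsGrHom

theorem map_one [DGRing A] [DGRing B] {f : A → B} (h : IsGrHom f) : f 1 = 1 := by
  simpa using h.map_scal 1

theorem map_neg [DGRing A] [DGRing B] {f : A → B} (h : IsGrHom f) (a : A) : f (-a) = -f a :=
  h.toRingHom.map_neg a

theorem map_sub [DGRing A] [DGRing B] {f : A → B} (h : IsGrHom f) (a b : A) :
    f (a - b) = f a - f b := h.toRingHom.map_sub a b

theorem map_sum [DGRing A] [DGRing B] {f : A → B} (h : IsGrHom f) {ι : Type*} (s : Finset ι)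
    (g : ι → A) : f (∑ i ∈ s, g i) = ∑ i ∈ s, f (g i) := _root_.map_sum h.toRingHom g s

theorem map_inv [CDGA A] [CDGA B] {f : A → B} (h : IsGrHom f) (a : A) : f (inv a) = inv (f a) := by
  refine addHom_ext (f := fun a => f (inv a)) (g := fun a => inv (f a))
    (fun a b => by simp [h.map_add]) (fun a b => by simp [h.map_add]) (fun k a => ?_) a
  simp only [inv_pr, h.map_smul, h.map_pr]

theorem hom [DGRing A] [DGRing B] {f : A → B} (h : IsGrHom f) {i : ℤ} {a : A} (ha : pr i a = a) :
    pr i (f a) = f a := by rw [← h.map_pr, ha]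

/-- A graded homomorphism is a DG homomorphism if it commutes with the differentials. -/
theorem toDG [DGRing A] [DGRing B] {f : A → B} (h : IsGrHom f) (hd : ∀ a, f (d a) = d (f a)) :
    IsDGHom f := { h with map_d := hd }

end IsGrHom

theorem DGRing.d_one {A : Type u} [DGRing A] : d (1 : A) = 0 := by
  have := leibniz (A := A) 0 1 1
  rw [pr_one, sgn_zero, one_smul, one_mul, mul_one, one_mul] at this
  simpa using this

theorem DGRing.d_algebraMap {A : Type u} [DGRing A] (c : ℂ) : d (algebraMap ℂ A c) = 0 := by
  rw [Algebra.algebraMap_eq_smul_one, map_smul, d_one, smul_zero]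

theorem DGRing.pr_algebraMap {A : Type u} [DGRing A] (c : ℂ) :
    pr 0 (algebraMap ℂ A c) = algebraMap ℂ A c := by
  rw [Algebra.algebraMap_eq_smul_one, map_smul, pr_one]

theorem DGRing.d_hom {A : Type u} [DGRing A] {i : ℤ} {a : A} (h : pr i a = a) :
    pr (i + 1) (d a) = d a := by rw [← d_pr, h]

theorem DGRing.mul_hom {A : Type u} [DGRing A] {i k : ℤ} {a b : A} (h : pr i a = a)
    (h' : pr k b = b) : pr (i + k) (a * b) = a * b := by
  have := pr_mul i k a b
  rwa [h, h'] at this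

/-! ## Adjoining an odd variable of square zero -/

/-- Data for a differential on `A ⊕ ε A`, where `ε` is an odd variable of degree `k`:
`d ε = t` and `d a = d_A a + ε δ(a)`. -/
structure DNData (A : Type u) [CDGA A] where
  k : ℤ
  odd : Odd k
  t : A
  δ : A →ₗ[ℂ] A
  t_deg : pr (k + 1) t = t
  d_t : d t = 0
  δ_mul : ∀ a b, δ (a * b) = δ a * b + a * δ b
  δ_pr : ∀ i a, δ (pr i a) = pr (i + 1 - k) (δ a)
  δ_d : ∀ a, δ (d a) = d (δ a)
  t_δ : ∀ a, t * δ a = 0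
  δ_t : ∀ a, δ (t * a) = 0

/-- The algebra `A ⊕ ε A`. -/
@[ext] structure DN {A : Type u} [CDGA A] (D : DNData A) where
  fst : A
  snd : A

namespace DN

variable {A : Type u} [CDGA A] {D : DNData A}

theorem even (D : DNData A) : Even (D.k + 1) := D.odd.add_one

theorem inv_t (D : DNData A) : inv D.t = D.t := by
  rw [inv_hom D.t_deg, sgn_even (even D), one_smul]

theorem t_comm (D : DNData A) (a : A) : a * D.t = D.t * a := even_comm (even D) D.t_deg a

instance : Add (DN D) := ⟨fun x y => ⟨x.1 + y.1, x.2 + y.2⟩⟩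
instance : Zero (DN D) := ⟨⟨0, 0⟩⟩
instance : Neg (DN D) := ⟨fun x => ⟨-x.1, -x.2⟩⟩
instance : SMul ℂ (DN D) := ⟨fun c x => ⟨c • x.1, c • x.2⟩⟩
-- A pair stands for `fst + ε snd`. Moving `ε` to the left past `x.1` produces the parity
-- involution, and `ε² = 0`.
instance : Mul (DN D) := ⟨fun x y => ⟨x.1 * y.1, x.2 * y.1 + inv x.1 * y.2⟩⟩
instance : One (DN D) := ⟨⟨1, 0⟩⟩

@[simp] theorem add_fst (x y : DN D) : (x + y).1 = x.1 + y.1 := rfl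
@[simp] theorem add_snd (x y : DN D) : (x + y).2 = x.2 + y.2 := rfl
@[simp] theorem zero_fst : (0 : DN D).1 = 0 := rfl
@[simp] theorem zero_snd : (0 : DN D).2 = 0 := rfl
@[simp] theorem one_fst : (1 : DN D).1 = 1 := rfl
@[simp] theorem one_snd : (1 : DN D).2 = 0 := rfl
@[simp] theorem mul_fst (x y : DN D) : (x * y).1 = x.1 * y.1 := rfl
@[simp] theorem mul_snd (x y : DN D) : (x * y).2 = x.2 * y.1 + inv x.1 * y.2 := rfl
@[simp] theorem smul_fst (c : ℂ) (x : DN D) : (c • x).1 = c • x.1 := rfl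
@[simp] theorem smul_snd (c : ℂ) (x : DN D) : (c • x).2 = c • x.2 := rfl

@[simp] theorem neg_fst (x : DN D) : (-x).1 = -x.1 := rfl
@[simp] theorem neg_snd (x : DN D) : (-x).2 = -x.2 := rfl

instance : Ring (DN D) where
  nsmul := nsmulRec
  zsmul := zsmulRec
  add_assoc x y z := by ext <;> simp [add_assoc]
  zero_add x := by ext <;> simp
  add_zero x := by ext <;> simp
  add_comm x y := by ext <;> simp [add_comm]
  neg_add_cancel x := by ext <;> simp
  left_distrib x y z := by ext <;> simp [mul_add]; abel
  right_distrib x y z := by ext <;> simp [add_mul]; abel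
  zero_mul x := by ext <;> simp
  mul_zero x := by ext <;> simp
  mul_assoc x y z := by ext <;> simp [mul_assoc, add_mul, mul_add, CDGA.inv_mul, add_assoc]
  one_mul x := by ext <;> simp [CDGA.inv_one]
  mul_one x := by ext <;> simp

instance : Module ℂ (DN D) where
  one_smul x := by ext <;> simp
  mul_smul c c' x := by ext <;> simp [mul_smul]
  smul_zero c := by ext <;> simp
  smul_add c x y := by ext <;> simp
  add_smul c c' x := by ext <;> simp [add_smul]
  zero_smul x := by ext <;> simp

instance : Algebra ℂ (DN D) := Algebra.ofModule (fun c x y => by ext <;> simp [smul_add])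
  (fun c x y => by ext <;> simp [smul_add])

theorem algebraMap_eq (c : ℂ) : algebraMap ℂ (DN D) c = mk (algebraMap ℂ A c) 0 := by
  rw [Algebra.algebraMap_eq_smul_one]
  ext <;> simp [Algebra.algebraMap_eq_smul_one]

def prL (D : DNData A) (i : ℤ) : DN D →ₗ[ℂ] DN D where
  toFun x := mk (pr i x.1) (pr (i - D.k) x.2)
  map_add' x y := by ext <;> simp
  map_smul' c x := by ext <;> simp

def dL (D : DNData A) : DN D →ₗ[ℂ] DN D where
  toFun x := mk (d x.1 + D.t * x.2) (D.δ x.1 - d x.2)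
  map_add' x y := by ext <;> simp [mul_add] <;> abel
  map_smul' c x := by ext <;> simp [smul_add, smul_sub]

theorem inv_eq (i : ℤ) (a : A) (x : A) : inv (pr i a) * x = sgn i • (pr i a * x) := by
  rw [inv_pr, smul_mul_assoc]

/-- The differential of `ε b` is `t b - ε d b`. The conditions `t_δ`, `δ_t`, `δ_d` and `d_t` are
what makes it square to zero. Oddness of `k` supplies the relative sign of the two components in
graded commutativity and in the Leibniz rule. -/
instance : CDGA (DN D) where
  pr := prL D
  d := dL D
  pr_self i x := by ext <;> simp [prL, pr_self]
  pr_ne i l x h := by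
    ext
    · simp [prL, pr_ne _ _ _ h]
    · simp [prL, pr_ne (i - D.k) (l - D.k) x.2 (by omega)]
  pr_one := by ext <;> simp [prL, pr_one]
  pr_mul i l x y := by
    ext
    · simp [prL, pr_mul]
    · have h1 := pr_mul (i - D.k) l x.2 y.1
      have h2 := pr_mul i (l - D.k) x.1 y.2
      rw [show i - D.k + l = i + l - D.k by ring] at h1
      rw [show i + (l - D.k) = i + l - D.k by ring] at h2
      simp [prL, inv_pr, h1, h2]
  comm i l x y := by
    ext
    · simp [prL, comm i l x.1 y.1]
    · have h1 := comm (i - D.k) l x.2 y.1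
      have h2 := comm i (l - D.k) x.1 y.2
      rw [sub_mul, sub_eq_add_neg (i * l), sgn_add, sgn_neg, mul_comm D.k, sgn_mul_odd D.odd] at h1
      rw [mul_sub, sub_eq_add_neg (i * l), sgn_add, sgn_neg, sgn_mul_odd D.odd] at h2
      simp only [prL, LinearMap.coe_mk, AddHom.coe_mk, mul_snd, smul_snd, h1,
        inv_pr, smul_mul_assoc, h2, smul_smul, smul_add]
      rw [add_comm]
      congr 2
      rw [mul_comm (sgn i), mul_assoc, sgn_mul_self, mul_one]
  d_pr i x := by
    have h1 := pr_mul_left (i + 1) (D.k + 1) D.t x.2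
    rw [D.t_deg, show i + 1 - (D.k + 1) = i - D.k by ring] at h1
    ext
    · simp [prL, dL, d_pr, h1]
    · simp [prL, dL, D.δ_pr, d_pr, show i - D.k + 1 = i + 1 - D.k by ring]
  d_d x := by
    have h1 : d (D.t * x.2) = D.t * d x.2 := by rw [d_mul, D.d_t, inv_t]; simp
    ext
    · simp [dL, d_d, h1, mul_sub, D.t_δ]
    · simp [dL, d_d, D.δ_t, D.δ_d]
  leibniz i x y := by
    ext
    · simp only [prL, dL, LinearMap.coe_mk, AddHom.coe_mk, mul_fst, mul_snd,
        add_fst, smul_fst, d_mul, mul_add, add_mul]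
      have h1 : D.t * (inv (pr i x.1) * y.2) = inv (pr i x.1) * (D.t * y.2) := by
        rw [← mul_assoc, ← mul_assoc, t_comm]
      rw [h1, mul_assoc]
      simp only [inv_eq, smul_add]
      abel
    · have h0 : sgn i • (pr (i - D.k) x.2 * (d y.1 + D.t * y.2)) =
          - (inv (pr (i - D.k) x.2) * (d y.1 + D.t * y.2)) := by
        rw [inv_pr, sgn_sub_odd D.odd]; simp
      have h1 : sgn i • (inv (pr i x.1) * (D.δ y.1 - d y.2)) = pr i x.1 * (D.δ y.1 - d y.2) := by
        rw [inv_pr, smul_mul_assoc, smul_smul, sgn_mul_self, one_smul]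
      have h2 : inv (D.t * pr (i - D.k) x.2) = inv (pr (i - D.k) x.2) * D.t := by
        rw [CDGA.inv_mul, inv_t, t_comm]
      simp only [prL, dL, LinearMap.coe_mk, AddHom.coe_mk, mul_fst, mul_snd,
        add_snd, smul_snd, smul_add, h0, h1, map_add, D.δ_mul, d_mul, CDGA.inv_inv, h2, d_inv]
      noncomm_ring
  exists_sum x := by
    refine ⟨supp x.1 ∪ (supp x.2).image (· + D.k), ?_⟩
    change ∑ i ∈ _, prL D i x = x
    have h1 : ∀ s : Finset ℤ, (∑ i ∈ s, prL D i x).1 = ∑ i ∈ s, pr i x.1 := fun s => by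
      induction s using Finset.induction_on with
      | empty => simp
      | insert a s h ih => rw [Finset.sum_insert h, Finset.sum_insert h, add_fst, ih]; rfl
    have h2 : ∀ s : Finset ℤ, (∑ i ∈ s, prL D i x).2 = ∑ i ∈ s, pr (i - D.k) x.2 := fun s => by
      induction s using Finset.induction_on with
      | empty => simp
      | insert a s h ih => rw [Finset.sum_insert h, Finset.sum_insert h, add_snd, ih]; rfl
    ext
    · rw [h1, sum_pr_subset _ Finset.subset_union_left]
    · rw [h2]
      have h3 : ∀ s : Finset ℤ, ∑ i ∈ s, pr (i - D.k) x.2 =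
          ∑ i ∈ s.image (· - D.k), pr i x.2 := fun s => by
        rw [Finset.sum_image fun a _ b _ h => sub_left_injective h]
      rw [h3, sum_pr_subset]
      intro i hi
      simp only [Finset.mem_image, Finset.mem_union]
      exact ⟨i + D.k, .inr ⟨i, hi, rfl⟩, by ring⟩

@[simp] theorem pr_fst (i : ℤ) (x : DN D) : (pr i x).1 = pr i x.1 := rfl
@[simp] theorem pr_snd (i : ℤ) (x : DN D) : (pr i x).2 = pr (i - D.k) x.2 := rfl
@[simp] theorem d_fst (x : DN D) : (d x).1 = d x.1 + D.t * x.2 := rfl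
@[simp] theorem d_snd (x : DN D) : (d x).2 = D.δ x.1 - d x.2 := rfl
@[simp] theorem algebraMap_fst (c : ℂ) : (algebraMap ℂ (DN D) c).1 = algebraMap ℂ A c := by
  rw [algebraMap_eq]
@[simp] theorem algebraMap_snd (c : ℂ) : (algebraMap ℂ (DN D) c).2 = 0 := by
  rw [algebraMap_eq]

theorem sum_fst {ι : Type*} (s : Finset ι) (f : ι → DN D) :
    (∑ i ∈ s, f i).1 = ∑ i ∈ s, (f i).1 :=
  map_sum (⟨⟨fun x : DN D => x.1, rfl⟩, fun _ _ => rfl⟩ : DN D →+ A) f s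

theorem sum_snd {ι : Type*} (s : Finset ι) (f : ι → DN D) :
    (∑ i ∈ s, f i).2 = ∑ i ∈ s, (f i).2 :=
  map_sum (⟨⟨fun x : DN D => x.2, rfl⟩, fun _ _ => rfl⟩ : DN D →+ A) f s

theorem fst_hom (D : DNData A) : IsGrHom (fun x : DN D => x.1) :=
  ⟨fun _ _ => rfl, fun _ _ => rfl, algebraMap_fst, fun _ _ => rfl⟩

theorem inl_hom (D : DNData A) : IsGrHom (fun a : A => (mk a 0 : DN D)) where
  map_add a b := by ext <;> simp
  map_mul a b := by ext <;> simp
  map_scal c := by ext <;> simp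
  map_pr i a := by ext <;> simp

/-- A homomorphism into `A ⊕ ε A` consists of a homomorphism into `A` and an odd derivation. -/
theorem mk_hom {X : Type u} [CDGA X] {f K : X → A} (hf : IsGrHom f)
    (hadd : ∀ x y, K (x + y) = K x + K y) (hmul : ∀ x y, K (x * y) = K x * f y + f (inv x) * K y)
    (hscal : ∀ c, K (algebraMap ℂ X c) = 0) (hpr : ∀ i x, K (pr i x) = pr (i - D.k) (K x)) :
    IsGrHom (fun x => (mk (f x) (K x) : DN D)) where
  map_add a b := by ext <;> simp [hf.map_add, hadd]
  map_mul a b := by ext <;> simp [hf.map_mul, hmul, hf.map_inv]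
  map_scal c := by ext <;> simp [hf.map_scal, hscal]
  map_pr i a := by ext <;> simp [hf.map_pr, hpr]

theorem snd_mul {X : Type u} [CDGA X] {h : X → DN D} (hh : IsGrHom h) (x y : X) :
    (h (x * y)).2 = (h x).2 * (h y).1 + (h (inv x)).1 * (h y).2 := by
  rw [hh.map_mul, mul_snd, ((fst_hom D).comp hh).map_inv]

end DN

/-- The odd dual numbers with a variable of degree `1`. -/
def derData (A : Type u) [CDGA A] : DNData A where
  k := 1
  odd := odd_one
  t := 0
  δ := 0
  t_deg := map_zero _
  d_t := map_zero _
  δ_mul := by simp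
  δ_pr := by simp
  δ_d := by simp
  t_δ := by simp
  δ_t := by simp

/-- The extension of `A` by a variable of degree `-1` with differential `t`. -/
def koszulData {A : Type u} [CDGA A] (t : A) (h : pr 0 t = t) (h' : d t = 0) : DNData A where
  k := -1
  odd := by decide
  t := t
  δ := 0
  t_deg := by simpa using h
  d_t := h'
  δ_mul := by simp
  δ_pr := by simp
  δ_d := by simp
  t_δ := by simp
  δ_t := by simp

/-- The graded algebra `A` with zero differential. -/
def ZeroD (A : Type u) : Type u := A

instance {A : Type u} [CDGA A] : Ring (ZeroD A) := inferInstanceAs (Ring A)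

instance {A : Type u} [CDGA A] : Algebra ℂ (ZeroD A) := inferInstanceAs (Algebra ℂ A)

instance {A : Type u} [CDGA A] : CDGA (ZeroD A) where
  pr := (DGRing.pr : ℤ → A →ₗ[ℂ] A)
  d := 0
  pr_self := fun i (a : A) => DGRing.pr_self i a
  pr_ne := fun i k (a : A) h => DGRing.pr_ne i k a h
  pr_one := DGRing.pr_one (A := A)
  pr_mul := fun i k (a b : A) => DGRing.pr_mul i k a b
  comm := fun i k (a b : A) => DGRing.comm i k a b
  d_pr := fun _ _ => (map_zero _).symm
  d_d := fun _ => rfl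
  leibniz := by simp
  exists_sum := fun a => CDGA.exists_sum (A := A) a

namespace ZeroD

variable {A : Type u} [CDGA A]

def of (a : A) : ZeroD A := a

def un (a : ZeroD A) : A := a

theorem un_hom : IsGrHom (un : ZeroD A → A) :=
  ⟨fun _ _ => rfl, fun _ _ => rfl, fun _ => rfl, fun _ _ => rfl⟩

end ZeroD

/-- The cofree DG algebra on the graded algebra `A`. -/
def cofData (A : Type u) [CDGA A] : DNData (ZeroD A) := koszulData 1 pr_one rfl

/-- Graded homomorphisms into `A` correspond to DG homomorphisms into `Cof A`. A presented algebra
is known only through its DG homomorphisms, and this is how its freeness as a graded algebra is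
extracted. The second component records the value on `d x`, which explains the variable of degree
`-1` with differential `1`. -/
abbrev Cof (A : Type u) [CDGA A] : Type u := DN (cofData A)

namespace Cof

variable {A X : Type u} [CDGA A] [CDGA X]

/-- The map to the cofree algebra induced by a graded homomorphism. -/
def lift (f : X → A) (x : X) : Cof A := DN.mk (ZeroD.of (f x)) (ZeroD.of (f (d x)))

theorem lift_hom {f : X → A} (hf : IsGrHom f) : IsDGHom (lift f) where
  map_add a b := by
    ext
    · exact hf.map_add a b
    · change f (d (a + b)) = f (d a) + f (d b)
      rw [map_add, hf.map_add]
  map_mul a b := by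
    ext
    · exact hf.map_mul a b
    · change f (d (a * b)) = f (d a) * f b + inv (A := A) (f a) * f (d b)
      rw [d_mul, hf.map_add, hf.map_mul, hf.map_mul, hf.map_inv]
  map_scal c := by
    ext
    · rw [DN.algebraMap_fst]; exact hf.map_scal c
    · rw [DN.algebraMap_snd]
      change f (d (algebraMap ℂ X c)) = 0
      rw [d_algebraMap, hf.map_zero]
  map_pr i a := by
    ext
    · exact hf.map_pr i a
    · change f (d (pr i a)) = pr (i - -1) (f (d a))
      rw [d_pr, hf.map_pr, sub_neg_eq_add]
  map_d a := by
    ext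
    · change f (d a) = 0 + 1 * f (d a)
      rw [one_mul, zero_add]
    · change f (d (d a)) = 0 - 0
      rw [d_d, hf.map_zero, sub_zero]

/-- The projection of the cofree algebra. -/
def proj (x : Cof A) : A := ZeroD.un x.1

theorem proj_hom : IsGrHom (proj : Cof A → A) := ZeroD.un_hom.comp (DN.fst_hom _)

end Cof

section

open scoped Polynomial

/-! ## Polynomials over a DG algebra and the path object -/

namespace DGPoly

variable {A B : Type u} [CDGA A] [CDGA B]

/-- A linear map applied to the coefficients. -/
def lmap (L : A →ₗ[ℂ] B) : A[X] →ₗ[ℂ] B[X] :=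
  Polynomial.lsum fun n => ((Polynomial.monomial n).restrictScalars ℂ).comp L

@[simp] theorem lmap_monomial (L : A →ₗ[ℂ] B) (n : ℕ) (a : A) :
    lmap L (Polynomial.monomial n a) = Polynomial.monomial n (L a) := by
  simp [lmap, Polynomial.lsum_apply]

@[simp] theorem coeff_lmap (L : A →ₗ[ℂ] B) (p : A[X]) (n : ℕ) :
    (lmap L p).coeff n = L (p.coeff n) := by
  induction p using Polynomial.induction_on' with
  | add p q hp hq => simp [hp, hq]
  | monomial m a =>
    rw [lmap_monomial, Polynomial.coeff_monomial, Polynomial.coeff_monomial]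
    split_ifs <;> simp

theorem smul_monomial (c : ℂ) (n : ℕ) (a : A) :
    c • Polynomial.monomial n a = Polynomial.monomial n (c • a) := Polynomial.smul_monomial _ _ _

instance : CDGA A[X] where
  pr i := lmap (pr i)
  d := lmap d
  pr_self i p := by ext n; simp [pr_self]
  pr_ne i k p h := by ext n; simp [pr_ne _ _ _ h]
  pr_one := by
    rw [← Polynomial.C_1, ← Polynomial.monomial_zero_left, lmap_monomial, pr_one]
  pr_mul i k p q := by
    induction p using Polynomial.induction_on' with
    | add p p' hp hp' => simp only [map_add, add_mul, hp, hp']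
    | monomial m a =>
      induction q using Polynomial.induction_on' with
      | add p p' hp hp' => simp only [map_add, mul_add, hp, hp']
      | monomial n b => simp only [lmap_monomial, Polynomial.monomial_mul_monomial, pr_mul]
  comm i k p q := by
    induction p using Polynomial.induction_on' with
    | add p p' hp hp' => simp only [map_add, add_mul, mul_add, hp, hp', smul_add]
    | monomial m a =>
      induction q using Polynomial.induction_on' with
      | add p p' hp hp' => simp only [map_add, add_mul, mul_add, hp, hp', smul_add]
      | monomial n b =>
        simp only [lmap_monomial, Polynomial.monomial_mul_monomial, comm i k a b, smul_monomial,
          add_comm m n]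
  d_pr i p := by ext n; simp [d_pr]
  d_d p := by ext n; simp [d_d]
  leibniz i p q := by
    induction p using Polynomial.induction_on' with
    | add p p' hp hp' => simp only [map_add, add_mul, hp, hp', smul_add]; abel
    | monomial m a =>
      induction q using Polynomial.induction_on' with
      | add p p' hp hp' => simp only [map_add, mul_add, hp, hp', smul_add]; abel
      | monomial n b =>
        simp only [lmap_monomial, Polynomial.monomial_mul_monomial, leibniz, smul_monomial, map_add]
  exists_sum p := by
    change ∃ s : Finset ℤ, ∑ i ∈ s, lmap (pr i) p = p
    refine ⟨p.support.biUnion fun n => supp (p.coeff n), ?_⟩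
    ext n
    rw [Polynomial.finsetSum_coeff]
    simp only [coeff_lmap]
    by_cases hn : n ∈ p.support
    · exact sum_pr_subset _ (Finset.subset_biUnion_of_mem (fun n => supp (p.coeff n)) hn)
    · rw [Polynomial.notMem_support_iff.1 hn]
      simp

theorem pr_eq (i : ℤ) (p : A[X]) : pr i p = lmap (pr i) p := rfl
@[simp] theorem coeff_pr (i : ℤ) (p : A[X]) (n : ℕ) : (pr i p).coeff n = pr i (p.coeff n) :=
  coeff_lmap _ _ _

@[simp] theorem coeff_d (p : A[X]) (n : ℕ) : (d p).coeff n = d (p.coeff n) := coeff_lmap _ _ _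

theorem C_hom : IsDGHom (fun a : A => (Polynomial.C a : A[X])) where
  map_add a b := Polynomial.C_add
  map_mul a b := Polynomial.C_mul
  map_scal c := rfl
  map_pr i a := by rw [← Polynomial.monomial_zero_left, ← Polynomial.monomial_zero_left]; exact
    (lmap_monomial _ _ _).symm
  map_d a := by rw [← Polynomial.monomial_zero_left, ← Polynomial.monomial_zero_left]; exact
    (lmap_monomial _ _ _).symm

/-- Evaluation at a complex number. -/
def ev (c : ℂ) : A[X] →+* A :=
  Polynomial.eval₂RingHom' (RingHom.id A) (algebraMap ℂ A c) fun a =>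
    (Algebra.commutes c a).symm

theorem ev_monomial (c : ℂ) (n : ℕ) (a : A) : ev c (Polynomial.monomial n a) = c ^ n • a := by
  change Polynomial.eval₂ _ _ _ = _
  rw [Polynomial.eval₂_monomial, ← map_pow, ← Algebra.commutes, ← Algebra.smul_def, RingHom.id_apply]

theorem ev_C (c : ℂ) (a : A) : ev c (Polynomial.C a) = a := by
  rw [← Polynomial.monomial_zero_left, ev_monomial, pow_zero, one_smul]

theorem ev_lmap (c : ℂ) (L : A →ₗ[ℂ] B) (p : A[X]) : ev c (lmap L p) = L (ev c p) := by
  induction p using Polynomial.induction_on' with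
  | add p q hp hq => simp [hp, hq]
  | monomial m a => simp [ev_monomial]

theorem ev_hom (c : ℂ) : IsDGHom (ev c : A[X] → A) where
  map_add a b := map_add _ _ _
  map_mul a b := map_mul _ _ _
  map_scal x := ev_C _ _
  map_pr i p := ev_lmap _ _ _
  map_d p := ev_lmap _ _ _

/-- The primitive without constant term. -/
def prim : A[X] →ₗ[ℂ] A[X] :=
  Polynomial.lsum fun n => ((Polynomial.monomial (n + 1)).restrictScalars ℂ).comp
    (((n + 1 : ℂ)⁻¹) • LinearMap.id)

theorem prim_monomial (n : ℕ) (a : A) :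
    prim (Polynomial.monomial n a) = Polynomial.monomial (n + 1) (((n + 1 : ℂ)⁻¹) • a) := by
  simp [prim, Polynomial.lsum_apply]

theorem derivative_monomial (n : ℕ) (a : A) :
    Polynomial.derivative (Polynomial.monomial n a) =
      Polynomial.monomial (n - 1) ((n : ℂ) • a) := by
  rw [Polynomial.derivative_monomial]
  congr 1
  rw [Nat.cast_smul_eq_nsmul, nsmul_eq_mul, (Nat.cast_commute n a).eq]

theorem derivative_prim (p : A[X]) : Polynomial.derivative (prim p) = p := by
  induction p using Polynomial.induction_on' with
  | add p q hp hq => simp [hp, hq]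
  | monomial m a =>
    rw [prim_monomial, derivative_monomial, smul_smul, Nat.add_sub_cancel, Nat.cast_add,
      Nat.cast_one, mul_inv_cancel₀ (Nat.cast_add_one_ne_zero m), one_smul]

theorem prim_derivative (p : A[X]) :
    prim (Polynomial.derivative p) = p - Polynomial.C (ev 0 p) := by
  induction p using Polynomial.induction_on' with
  | add p q hp hq => simp only [map_add, hp, hq]; abel
  | monomial m a =>
    rw [derivative_monomial, ev_monomial]
    rcases m with _ | m
    · simp
    · rw [prim_monomial, Nat.add_sub_cancel, smul_smul, Nat.cast_add, Nat.cast_one,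
        inv_mul_cancel₀ (Nat.cast_add_one_ne_zero m), one_smul]
      simp

theorem prim_lmap (L : A →ₗ[ℂ] B) (p : A[X]) : prim (lmap L p) = lmap L (prim p) := by
  induction p using Polynomial.induction_on' with
  | add p q hp hq => simp [hp, hq]
  | monomial m a => simp [prim_monomial]

theorem ev_zero_prim (p : A[X]) : ev 0 (prim p) = 0 := by
  induction p using Polynomial.induction_on' with
  | add p q hp hq => simp [hp, hq]
  | monomial m a => rw [prim_monomial, ev_monomial]; simp

theorem derivative_lmap (L : A →ₗ[ℂ] B) (p : A[X]) :
    Polynomial.derivative (lmap L p) = lmap L (Polynomial.derivative p) := by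
  induction p using Polynomial.induction_on' with
  | add p q hp hq => simp [hp, hq]
  | monomial m a => rw [lmap_monomial, derivative_monomial, derivative_monomial, lmap_monomial,
      LinearMap.map_smul]

end DGPoly

open DGPoly

/-- The data of the path object: polynomial forms in one variable. -/
def pathData (A : Type u) [CDGA A] : DNData A[X] where
  k := 1
  odd := odd_one
  t := 0
  δ := Polynomial.derivative.restrictScalars ℂ
  t_deg := map_zero _
  d_t := map_zero _
  δ_mul p q := Polynomial.derivative_mul
  δ_pr i p := by
    rw [add_sub_cancel_right]
    exact derivative_lmap _ _
  δ_d p := derivative_lmap _ _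
  t_δ p := zero_mul _
  δ_t p := by rw [zero_mul, map_zero]

/-- The path object `A[τ, dτ]`. -/
abbrev PathAlg (A : Type u) [CDGA A] : Type u := DN (pathData A)

namespace PathAlg

variable {A B X : Type u} [CDGA A] [CDGA B] [CDGA X]

theorem pr_fst (i : ℤ) (x : PathAlg A) : (pr i x).1 = pr i x.1 := rfl
theorem pr_snd (i : ℤ) (x : PathAlg A) : (pr i x).2 = pr (i - 1) x.2 := rfl

theorem d_fst (x : PathAlg A) : (d x).1 = d x.1 := by
  rw [DN.d_fst]
  change _ + 0 * x.2 = _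
  rw [zero_mul, add_zero]

theorem d_snd (x : PathAlg A) : (d x).2 = Polynomial.derivative x.1 - d x.2 := rfl

/-- The constant path. -/
def const (a : A) : PathAlg A := DN.mk (Polynomial.C a) 0

theorem const_hom : IsDGHom (const : A → PathAlg A) where
  __ := (DN.inl_hom (pathData A)).comp C_hom.toIsGrHom
  map_d a := by
    ext1
    · rw [d_fst]; exact C_hom.map_d a
    · rw [d_snd]; simp [const]

/-- Evaluation of a path. -/
def ev (c : ℂ) (x : PathAlg A) : A := DGPoly.ev c x.1

theorem ev_hom (c : ℂ) : IsDGHom (ev c : PathAlg A → A) where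
  __ := (DGPoly.ev_hom c).toIsGrHom.comp (DN.fst_hom (pathData A))
  map_d x := by
    simp only [ev, d_fst]
    exact (DGPoly.ev_hom c).map_d _

theorem ev_const (c : ℂ) (a : A) : ev c (const a) = a := ev_C c a

/-- Integration of the form part from `0`. -/
def int (x : PathAlg A) : PathAlg A := DN.mk (prim x.2) 0

/-- The Poincaré lemma in one variable: integration from `0` contracts the path object onto the
constant paths. The function part uses `prim_derivative`, the form part `derivative_prim`. -/
theorem d_int (x : PathAlg A) : d (int x) + int (d x) = x - const (ev 0 x) := by
  have h1 : ∀ y : A[X], d (prim y) = prim (d y) := fun y => (prim_lmap _ _).symm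
  rw [sub_eq_add_neg]
  ext1
  · rw [DN.add_fst, d_fst]
    simp only [int, h1, d_snd, map_sub, prim_derivative, DN.add_fst, DN.neg_fst, ev, const]
    abel
  · rw [DN.add_snd, d_snd]
    simp [int, derivative_prim, const]

theorem int_hom {i : ℤ} {x : PathAlg A} (h : pr i x = x) : pr (i - 1) (int x) = int x := by
  have h1 : pr (i - 1) x.2 = x.2 := by rw [← pr_snd, h]
  ext1
  · rw [pr_fst]
    change lmap _ _ = _
    simp only [int]
    rw [← prim_lmap]
    exact congrArg _ h1
  · rw [pr_snd]; simp [int]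

theorem ev_zero_int (x : PathAlg A) : ev 0 (int x) = 0 := ev_zero_prim _

/-- Homotopic homomorphisms of DG algebras differ by a boundary on cocycles. -/
theorem ev_one_sub {h : X → PathAlg A} (hh : IsDGHom h) {a : X} (ha : d a = 0) :
    ev 1 (h a) - ev 0 (h a) = d (ev 1 (int (h a))) := by
  have h1 := d_int (h a)
  rw [← hh.map_d, ha, hh.map_zero, show int (0 : PathAlg A) = 0 by ext1 <;> simp [int], add_zero] at h1
  rw [← (ev_hom 1).map_d, h1, (ev_hom 1).map_sub, ev_const]

/-- A linear map applied to the coefficients of paths. -/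
def lmap (L : A →ₗ[ℂ] B) (x : PathAlg A) : PathAlg B := DN.mk (DGPoly.lmap L x.1) (DGPoly.lmap L x.2)

theorem lmap_add (L : A →ₗ[ℂ] B) (x y : PathAlg A) : lmap L (x + y) = lmap L x + lmap L y := by
  ext1 <;> simp [lmap]

theorem lmap_sub (L : A →ₗ[ℂ] B) (x y : PathAlg A) : lmap L (x - y) = lmap L x - lmap L y := by
  rw [eq_sub_iff_add_eq, ← lmap_add, sub_add_cancel]

theorem lmap_d (L : A →ₗ[ℂ] B) (h : ∀ a, L (d a) = d (L a)) (x : PathAlg A) :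
    lmap L (d x) = d (lmap L x) := by
  have h1 : ∀ p : A[X], DGPoly.lmap L (d p) = d (DGPoly.lmap L p) := fun p => by
    ext n; simp [h]
  ext1
  · rw [d_fst]
    change DGPoly.lmap L (d x).1 = _
    rw [d_fst, h1]
    rfl
  · rw [d_snd]
    change DGPoly.lmap L (d x).2 = _
    rw [d_snd, map_sub, h1, ← derivative_lmap]
    rfl

theorem lmap_pr (L : A →ₗ[ℂ] B) (h : ∀ i a, L (pr i a) = pr i (L a)) (i : ℤ) (x : PathAlg A) :
    lmap L (pr i x) = pr i (lmap L x) := by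
  have h1 : ∀ i (p : A[X]), DGPoly.lmap L (pr i p) = pr i (DGPoly.lmap L p) := fun i p => by
    ext n; simp [h]
  ext1
  · simp [lmap, h1]
  · exact h1 _ _

theorem lmap_const (L : A →ₗ[ℂ] B) (a : A) : lmap L (const a) = const (L a) := by
  ext1
  · simp [lmap, const, ← Polynomial.monomial_zero_left]
  · simp [lmap, const]

theorem ev_lmap (c : ℂ) (L : A →ₗ[ℂ] B) (x : PathAlg A) : ev c (lmap L x) = L (ev c x) :=
  DGPoly.ev_lmap _ _ _

theorem lmap_int (L : A →ₗ[ℂ] B) (x : PathAlg A) : lmap L (int x) = int (lmap L x) := by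
  ext1
  · simp [lmap, int, prim_lmap]
  · simp [lmap, int]

/-- Bilinear extension of a product rule to paths. -/
theorem lmap_mul {L L₁ L₂ L₃ L₄ : A →ₗ[ℂ] B} (hinv : ∀ a, L₁ (inv a) = inv (L₁ a))
    (hinv' : ∀ a, L₃ (inv a) = inv (L₃ a))
    (h : ∀ a b, L (a * b) = L₁ a * L₂ b + L₃ a * L₄ b) (x y : PathAlg A) :
    lmap L (x * y) = lmap L₁ x * lmap L₂ y + lmap L₃ x * lmap L₄ y := by
  have h1 : ∀ p q : A[X], DGPoly.lmap L (p * q) = DGPoly.lmap L₁ p * DGPoly.lmap L₂ q +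
      DGPoly.lmap L₃ p * DGPoly.lmap L₄ q := fun p q => by
    induction p using Polynomial.induction_on' with
    | add p p' hp hp' => simp only [map_add, add_mul, hp, hp']; abel
    | monomial m a =>
      induction q using Polynomial.induction_on' with
      | add p p' hp hp' => simp only [map_add, mul_add, hp, hp']; abel
      | monomial n b =>
        simp only [lmap_monomial, Polynomial.monomial_mul_monomial, h, map_add]
  have h2 : ∀ {C : Type u} [CDGA C] (n : ℕ) (a : C),
      inv (Polynomial.monomial n a) = Polynomial.monomial n (inv a) := fun {C} _ n a => by
    refine addHom_ext (f := fun a : C => inv (Polynomial.monomial n a))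
      (g := fun a : C => Polynomial.monomial n (inv a)) (by simp) (by simp) (fun i a => ?_) a
    have : pr i (Polynomial.monomial n (pr i a)) = Polynomial.monomial n (pr i a) := by
      rw [pr_eq, lmap_monomial, pr_self]
    rw [inv_hom this, inv_pr, smul_monomial]
  have h3 : ∀ (M : A →ₗ[ℂ] B) (_ : ∀ a, M (inv a) = inv (M a)) (p : A[X]),
      DGPoly.lmap M (inv p) = inv (DGPoly.lmap M p) := fun M hM p => by
    induction p using Polynomial.induction_on' with
    | add p p' hp hp' => simp only [map_add, hp, hp']
    | monomial m a => rw [h2, lmap_monomial, lmap_monomial, h2, hM]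
  ext1
  · simp [lmap, h1]
  · simp only [lmap, DN.mul_snd, DN.add_snd, map_add, h1, h3 _ hinv, h3 _ hinv']
    abel

end PathAlg

end

/-! ## Odd derivations -/

/-- Derivations of degree `-1` along a homomorphism `f`. -/
structure IsOddDer {X Z : Type u} [CDGA X] [CDGA Z] (f K : X → Z) : Prop where
  add : ∀ x y, K (x + y) = K x + K y
  mul : ∀ x y, K (x * y) = K x * f y + f (inv x) * K y
  scal : ∀ c, K (algebraMap ℂ X c) = 0
  pr : ∀ i x, K (pr i x) = pr (i - 1) (K x)

namespace IsOddDer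

variable {X Y Z : Type u} [CDGA X] [CDGA Y] [CDGA Z] {f K K' : X → Z}

theorem toHom (h : IsOddDer f K) (hf : IsGrHom f) :
    IsGrHom (fun x => (⟨f x, K x⟩ : DN (derData Z))) :=
  DN.mk_hom hf h.add h.mul h.scal h.pr

theorem of_hom {h : X → DN (derData Z)} (hh : IsGrHom h) :
    IsOddDer (fun x => (h x).1) (fun x => (h x).2) where
  add x y := by rw [hh.map_add]; rfl
  mul x y := DN.snd_mul hh x y
  scal c := by rw [hh.map_scal, DN.algebraMap_snd]
  pr i x := by rw [hh.map_pr]; rfl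

theorem zero (h : IsOddDer f K) : K 0 = 0 := by simpa using h.add 0 0

theorem neg (h : IsOddDer f K) (x : X) : K (-x) = -K x := by
  rw [eq_neg_iff_add_eq_zero, ← h.add, neg_add_cancel, h.zero]

theorem sub (h : IsOddDer f K) (x y : X) : K (x - y) = K x - K y := by
  rw [sub_eq_add_neg, h.add, h.neg, sub_eq_add_neg]

theorem smul (h : IsOddDer f K) (hf : IsGrHom f) (c : ℂ) (x : X) : K (c • x) = c • K x := by
  rw [Algebra.smul_def, h.mul, h.scal, zero_mul, zero_add,
    inv_hom (pr_algebraMap (A := X) c), sgn_zero, one_smul, hf.map_scal, Algebra.smul_def]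

theorem map_inv (h : IsOddDer f K) (hf : IsGrHom f) (x : X) : K (inv x) = -inv (K x) := by
  refine addHom_ext (f := fun x => K (inv x)) (g := fun x => -inv (K x))
    (fun a b => by simp only [map_add, h.add]) (fun a b => by simp only [h.add, map_add, neg_add])
    (fun i x => ?_) x
  rw [inv_pr, h.smul hf, h.pr, inv_pr, sgn_sub_odd odd_one, neg_smul, neg_neg]

theorem comp (h : IsOddDer f K) {g : Y → X} (hg : IsGrHom g) :
    IsOddDer (fun y => f (g y)) (fun y => K (g y)) where
  add x y := by rw [hg.map_add, h.add]
  mul x y := by rw [hg.map_mul, h.mul, hg.map_inv]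
  scal c := by rw [hg.map_scal, h.scal]
  pr i x := by rw [hg.map_pr, h.pr]

theorem postcomp (h : IsOddDer f K) {g : Z → Y} (hg : IsGrHom g) :
    IsOddDer (fun y => g (f y)) (fun y => g (K y)) where
  add x y := by rw [h.add, hg.map_add]
  mul x y := by rw [h.mul, hg.map_add, hg.map_mul, hg.map_mul]
  scal c := by rw [h.scal, hg.map_zero]
  pr i x := by rw [h.pr, hg.map_pr]

theorem hom (h : IsOddDer f K) {i : ℤ} {x : X} (hx : DGRing.pr i x = x) :
    DGRing.pr (i - 1) (K x) = K x := by rw [← h.pr, hx]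

/-- The bracket with the differentials. -/
theorem bracket (h : IsOddDer f K) (hf : IsDGHom f) (x y : X) :
    d (K (x * y)) + K (d (x * y)) = (d (K x) + K (d x)) * f y + f x * (d (K y) + K (d y)) :=
  bracket_mul hf hf.map_inv h.add (h.map_inv hf.toIsGrHom) h.mul x y

end IsOddDer

/-! ## Free graded commutative extensions -/

/-- Algebras concentrated in degrees `≤ 0`. -/
def NonPos (A : Type u) [CDGA A] : Prop := ∀ i (a : A), 0 < i → pr i a = 0

theorem NonPos.eq_zero {A : Type u} [CDGA A] (h : NonPos A) {i : ℤ} (hi : 0 < i) {a : A}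
    (ha : pr i a = a) : a = 0 := by rw [← ha, h i a hi]

/-- `Y` is the free graded commutative `X`-algebra on generators `e x` of degrees `deg x`. -/
structure FreeOn {X Y : Type u} [CDGA X] [CDGA Y] {ι : Type*} (a : X → Y) (deg : ι → ℤ)
    (e : ι → Y) : Prop where
  hom : IsGrHom a
  deg_e : ∀ x, pr (deg x) (e x) = e x
  gen : ∀ p : Y → Prop, (∀ s, p (a s)) → (∀ x, p (e x)) → (∀ y z, p y → p z → p (y + z)) →
    (∀ y z, p y → p z → p (y * z)) → ∀ y, p y
  universal : ∀ (Z : Type u) [CDGA Z] (ψ : X → Z), IsGrHom ψ → ∀ c : ι → Z,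
    (∀ x, pr (deg x) (c x) = c x) →
    ∃ h : Y → Z, IsGrHom h ∧ (∀ s, h (a s) = ψ s) ∧ ∀ x, h (e x) = c x

section subalgebra

variable {Y : Type u} [CDGA Y] (G : Subalgebra ℂ Y) (hG : ∀ i, ∀ y ∈ G, pr i y ∈ G)

/-- A graded subalgebra, with zero differential. -/
@[reducible] def gradedSub : CDGA G where
  pr i :=
    { toFun := fun y => ⟨pr i y.1, hG i _ y.2⟩
      map_add' := fun x y => Subtype.ext (map_add _ _ _)
      map_smul' := fun c x => Subtype.ext (map_smul _ _ _) }
  d := 0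
  pr_self i a := Subtype.ext (pr_self i a.1)
  pr_ne i k a h := Subtype.ext (pr_ne i k a.1 h)
  pr_one := Subtype.ext pr_one
  pr_mul i k a b := Subtype.ext (pr_mul i k a.1 b.1)
  comm i k a b := Subtype.ext (comm i k a.1 b.1)
  d_pr _ _ := (map_zero _).symm
  d_d _ := rfl
  leibniz _ _ _ := by simp
  exists_sum a := by
    refine ⟨supp a.1, Subtype.ext ?_⟩
    exact (map_sum G.val (fun i => (⟨pr i a.1, hG i _ a.2⟩ : G)) _).trans (sum_pr a.1)

theorem gradedSub_val : @IsGrHom G Y (gradedSub G hG).toDGRing _ (fun y => y.1) :=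
  letI := gradedSub G hG
  ⟨fun _ _ => rfl, fun _ _ => rfl, fun _ => rfl, fun _ _ => rfl⟩

end subalgebra

theorem adjoin_graded {Y : Type u} [CDGA Y] {s : Set Y} (hs : ∀ y ∈ s, ∀ i, pr i y ∈ s ∨ pr i y = 0)
    (i : ℤ) (y : Y) (hy : y ∈ Algebra.adjoin ℂ s) : pr i y ∈ Algebra.adjoin ℂ s := by
  induction hy using Algebra.adjoin_induction generalizing i with
  | mem y hy =>
    rcases hs y hy i with h | h
    · exact Algebra.subset_adjoin h
    · rw [h]; exact zero_mem _
  | algebraMap c =>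
    rcases eq_or_ne i 0 with rfl | h
    · rw [pr_algebraMap]; exact Subalgebra.algebraMap_mem _ _
    · rw [← pr_algebraMap, pr_ne _ _ _ h]; exact zero_mem _
  | add x y _ _ hx hy => rw [map_add]; exact add_mem (hx i) (hy i)
  | mul x y _ _ hx hy =>
    exact graded_mul (p := fun _ y => y ∈ Algebra.adjoin ℂ s) (fun _ => zero_mem _)
      (fun _ _ _ => add_mem) (fun _ _ _ _ _ _ => mul_mem) hx hy i

namespace FreeOn

variable {X Y Z : Type u} [CDGA X] [CDGA Y] [CDGA Z] {ι κ : Type*} {a : X → Y} {deg : ι → ℤ}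
  {e : ι → Y}

/-- Generation follows from the uniqueness part of the universal property. -/
theorem mk' (hom : IsGrHom a) (deg_e : ∀ x, pr (deg x) (e x) = e x)
    (universal : ∀ (Z : Type u) [CDGA Z] (ψ : X → Z), IsGrHom ψ → ∀ c : ι → Z,
      (∀ x, pr (deg x) (c x) = c x) →
      ∃! h : Y → Z, IsGrHom h ∧ (∀ s, h (a s) = ψ s) ∧ ∀ x, h (e x) = c x) :
    FreeOn a deg e where
  hom := hom
  deg_e := deg_e
  universal Z _ ψ hψ c hc := (universal Z ψ hψ c hc).exists
  gen p ha he hadd hmul := by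
    let s : Set Y := Set.range a ∪ Set.range e
    have hs : ∀ y ∈ s, ∀ i, pr i y ∈ s ∨ pr i y = 0 := by
      rintro _ (⟨x, rfl⟩ | ⟨x, rfl⟩) i
      · exact .inl (.inl ⟨pr i x, hom.map_pr i x⟩)
      · rcases eq_or_ne i (deg x) with rfl | h
        · exact .inl (.inr ⟨x, (deg_e x).symm⟩)
        · rw [← deg_e x, pr_ne _ _ _ h]; exact .inr rfl
    have hG := adjoin_graded hs
    let G := Algebra.adjoin ℂ s
    -- The subalgebra need not be stable under `d`. The universal property concerns graded
    -- homomorphisms only, so the zero differential will do.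
    let : CDGA G := gradedSub G hG
    have hval : IsGrHom (fun y : G => y.1) := gradedSub_val G hG
    have hs' : s ⊆ G := Algebra.subset_adjoin
    obtain ⟨h, ⟨hh, hha, hhe⟩, -⟩ := universal G (fun x => ⟨a x, hs' (.inl ⟨x, rfl⟩)⟩)
      ⟨fun _ _ => Subtype.ext (hom.map_add _ _), fun _ _ => Subtype.ext (hom.map_mul _ _),
        fun _ => Subtype.ext (hom.map_scal _), fun _ _ => Subtype.ext (hom.map_pr _ _)⟩
      (fun x => ⟨e x, hs' (.inr ⟨x, rfl⟩)⟩) (fun x => Subtype.ext (deg_e x))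
    -- The map to the generated subalgebra followed by the inclusion fixes the generators, so
    -- uniqueness makes it the identity and the subalgebra is everything.
    have key : (fun y => (h y).1) = id := (universal Y a hom e deg_e).unique
      ⟨hval.comp hh, fun s => by rw [hha], fun x => by rw [hhe]⟩ ⟨IsGrHom.refl, by simp, by simp⟩
    intro y
    have hy : y ∈ G := by rw [← show (h y).1 = y from congrFun key y]; exact (h y).2
    induction hy using Algebra.adjoin_induction with
    | mem y hy =>
      rcases hy with ⟨x, rfl⟩ | ⟨x, rfl⟩
      · exact ha x
      · exact he x
    | algebraMap c => rw [← hom.map_scal]; exact ha _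
    | add x y _ _ hx hy => exact hadd _ _ hx hy
    | mul x y _ _ hx hy => exact hmul _ _ hx hy

variable (H : FreeOn a deg e)
include H

theorem hom_ext {h h' : Y → Z} (hh : IsGrHom h) (hh' : IsGrHom h') (h1 : ∀ s, h (a s) = h' (a s))
    (h2 : ∀ x, h (e x) = h' (e x)) (y : Y) : h y = h' y :=
  H.gen (fun y => h y = h' y) h1 h2 (fun y z hy hz => by rw [hh.map_add, hh'.map_add, hy, hz])
    (fun y z hy hz => by rw [hh.map_mul, hh'.map_mul, hy, hz]) y

theorem graded_induction {p : ℤ → Y → Prop} (add : ∀ i y z, p i y → p i z → p i (y + z))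
    (mul : ∀ i k y z, pr i y = y → pr k z = z → p i y → p k z → p (i + k) (y * z))
    (base : ∀ i s, pr i s = s → p i (a s)) (gens : ∀ x, p (deg x) (e x)) (i : ℤ) (y : Y) :
    p i (pr i y) := by
  have zero : ∀ i, p i 0 := fun i => by
    rw [← H.hom.map_zero]; exact base i 0 (map_zero _)
  refine H.gen (fun y => ∀ i, p i (pr i y)) (fun s i => ?_) (fun x i => ?_)
    (fun y z hy hz i => by rw [map_add]; exact add _ _ _ (hy i) (hz i))
    (fun y z hy hz i => graded_mul zero add mul hy hz i) y i
  · rw [← H.hom.map_pr]; exact base _ _ (pr_self _ _)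
  · rcases eq_or_ne i (deg x) with rfl | h
    · rw [H.deg_e]; exact gens x
    · rw [← H.deg_e x, pr_ne _ _ _ h]; exact zero _

theorem nonPos (hX : NonPos X) (hdeg : ∀ x, deg x ≤ 0) : NonPos Y := fun i y hi =>
  H.graded_induction (p := fun i y => 0 < i → y = 0)
    (fun i y z hy hz h => by rw [hy h, hz h, add_zero])
    (fun i k y z _ _ hy hz h => by
      rcases lt_or_ge 0 i with h' | h'
      · rw [hy h', zero_mul]
      · rw [hz (by omega), mul_zero])
    (fun i s hs h => by rw [hX.eq_zero h hs, H.hom.map_zero])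
    (fun x h => absurd h (not_lt.2 (hdeg x))) i y hi

/-- Elements of degree `> n` are expressed through generators of degree `> n`. -/
theorem induction_gt (hY : NonPos Y) (n : ℤ) {p : ℤ → Y → Prop}
    (add : ∀ i y z, p i y → p i z → p i (y + z))
    (mul : ∀ i k y z, pr i y = y → pr k z = z → p i y → p k z → p (i + k) (y * z))
    (base : ∀ i s, pr i s = s → p i (a s)) (gens : ∀ x, n < deg x → p (deg x) (e x))
    {k : ℤ} (hk : n < k) {y : Y} (hy : pr k y = y) : p k y := by
  have zero : ∀ i, p i 0 := fun i => by
    rw [← H.hom.map_zero]; exact base i 0 (map_zero _)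
  rw [← hy]
  refine H.graded_induction (p := fun k y => n < k → p k y)
    (fun i y z hy hz h => add i y z (hy h) (hz h)) (fun i k y z hy' hz' hy hz h => ?_)
    (fun i s hs _ => base i s hs) gens k y hk
  -- Unless the product vanishes, both factors have degree at most zero, and then each of them
  -- inherits the bound `> n` from the product.
  rcases lt_or_ge 0 i with h1 | h1
  · rw [hY.eq_zero h1 hy', zero_mul]; exact zero _
  rcases lt_or_ge 0 k with h2 | h2
  · rw [hY.eq_zero h2 hz', mul_zero]; exact zero _
  exact mul i k y z hy' hz' (hy (by omega)) (hz (by omega))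

/-- This is what makes recursion on the degree possible: for a generator `x` the element `d (e x)`
has degree above `deg x`, so maps that agree on generators of larger degree agree on it. -/
theorem eq_of_gt (hY : NonPos Y) (n : ℤ) {h h' : Y → Z} (hh : IsGrHom h) (hh' : IsGrHom h')
    (h1 : ∀ s, h (a s) = h' (a s)) (h2 : ∀ x, n < deg x → h (e x) = h' (e x))
    {k : ℤ} (hk : n < k) {y : Y} (hy : pr k y = y) : h y = h' y :=
  H.induction_gt hY n (p := fun _ y => h y = h' y)
    (fun _ y z hy hz => by rw [hh.map_add, hh'.map_add, hy, hz])
    (fun _ _ y z _ _ hy hz => by rw [hh.map_mul, hh'.map_mul, hy, hz]) (fun _ s _ => h1 s) h2 hk hy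

theorem map_d_of_gt (hY : NonPos Y) (n : ℤ) {h : Y → Z} (hh : IsGrHom h) (ha : IsDGHom a)
    (h1 : IsDGHom (fun s => h (a s))) (h2 : ∀ x, n < deg x → h (d (e x)) = d (h (e x)))
    {k : ℤ} (hk : n < k) {y : Y} (hy : pr k y = y) : h (d y) = d (h y) :=
  H.induction_gt hY n (p := fun _ y => h (d y) = d (h y))
    (fun _ y z hy hz => by rw [map_add, hh.map_add, hh.map_add, map_add, hy, hz])
    (fun _ _ y z _ _ hy hz => by
      rw [d_mul, hh.map_add, hh.map_mul, hh.map_mul, hh.map_mul, d_mul, hy, hz, hh.map_inv])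
    (fun _ s _ => by rw [← ha.map_d]; exact h1.map_d s) h2 hk hy

theorem dg_of_gens {h : Y → Z} (hh : IsGrHom h) (ha : IsDGHom a)
    (h1 : IsDGHom (fun s => h (a s))) (h2 : ∀ x, h (d (e x)) = d (h (e x))) : IsDGHom h :=
  hh.toDG fun y => H.gen (fun y => h (d y) = d (h y))
    (fun s => by rw [← ha.map_d]; exact h1.map_d s) h2
    (fun y z hy hz => by rw [map_add, hh.map_add, hh.map_add, map_add, hy, hz])
    (fun y z hy hz => by
      rw [d_mul, hh.map_add, hh.map_mul, hh.map_mul, hh.map_mul, d_mul, hy, hz, hh.map_inv]) y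

/-- An odd derivation along `f` is a graded homomorphism into the odd dual numbers with first
component `f`, so freeness provides it. -/
theorem exists_oddDer {f : Y → Z} (hf : IsGrHom f) {K0 : X → Z}
    (hK : IsOddDer (fun s => f (a s)) K0) (c : ι → Z) (hc : ∀ x, pr (deg x - 1) (c x) = c x) :
    ∃ K : Y → Z, IsOddDer f K ∧ (∀ s, K (a s) = K0 s) ∧ ∀ x, K (e x) = c x := by
  obtain ⟨h, hh, h1, h2⟩ := H.universal (DN (derData Z)) _ (hK.toHom (hf.comp H.hom))
    (fun x => ⟨f (e x), c x⟩) (fun x => by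
      ext1
      · exact hf.hom (H.deg_e x)
      · exact hc x)
  have e1 : ∀ y, (h y).1 = f y := H.hom_ext ((DN.fst_hom _).comp hh) hf (fun s => by rw [h1])
    (fun x => by rw [h2])
  refine ⟨fun y => (h y).2, ?_, fun s => by simp only [h1], fun x => by simp only [h2]⟩
  have := IsOddDer.of_hom hh
  rwa [funext e1] at this

theorem oddDer_ext {f K K' : Y → Z} (hK : IsOddDer f K) (hK' : IsOddDer f K')
    (h1 : ∀ s, K (a s) = K' (a s)) (h2 : ∀ x, K (e x) = K' (e x)) (y : Y) : K y = K' y :=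
  H.gen (fun y => K y = K' y) h1 h2 (fun y z hy hz => by rw [hK.add, hK'.add, hy, hz])
    (fun y z hy hz => by rw [hK.mul, hK'.mul, hy, hz]) y

theorem trans {b : Y → Z} {deg' : κ → ℤ} {e' : κ → Z} (H' : FreeOn b deg' e') :
    FreeOn (fun x => b (a x)) (Sum.elim deg deg') (Sum.elim (fun x => b (e x)) e') where
  hom := H'.hom.comp H.hom
  deg_e := by
    rintro (x | x)
    · exact H'.hom.hom (H.deg_e x)
    · exact H'.deg_e x
  gen p h1 h2 h3 h4 := H'.gen p (H.gen (fun y => p (b y)) h1 (fun x => h2 (.inl x))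
    (fun y z hy hz => by rw [H'.hom.map_add]; exact h3 _ _ hy hz)
    (fun y z hy hz => by rw [H'.hom.map_mul]; exact h4 _ _ hy hz)) (fun x => h2 (.inr x)) h3 h4
  universal Z _ ψ hψ c hc := by
    obtain ⟨h, hh, h1, h2⟩ := H.universal Z ψ hψ (fun x => c (.inl x)) fun x => hc (.inl x)
    obtain ⟨h', hh', h1', h2'⟩ := H'.universal Z h hh (fun x => c (.inr x)) fun x => hc (.inr x)
    refine ⟨h', hh', fun s => by rw [h1', h1], ?_⟩
    rintro (x | x)
    · exact (h1' _).trans (h2 x)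
    · exact h2' x

theorem reindex (σ : κ ≃ ι) : FreeOn a (fun x => deg (σ x)) (fun x => e (σ x)) where
  hom := H.hom
  deg_e x := H.deg_e _
  gen p h1 h2 h3 h4 := H.gen p h1 (fun x => by rw [← σ.apply_symm_apply x]; exact h2 _) h3 h4
  universal Z _ ψ hψ c hc := by
    obtain ⟨h, hh, h1, h2⟩ := H.universal Z ψ hψ (fun x => c (σ.symm x)) fun x => by
      have := hc (σ.symm x)
      rwa [σ.apply_symm_apply] at this
    exact ⟨h, hh, h1, fun x => by rw [h2, σ.symm_apply_apply]⟩

/-- Extension of a DG homomorphism to a free extension by recursion on the degree. -/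
theorem exists_dgHom (hY : NonPos Y) (hdeg : ∀ x, deg x < 0) (ha : IsDGHom a) {f0 : X → Z}
    (hf0 : IsDGHom f0) (Good : ι → Z → Prop)
    (step : ∀ x (f : Y → Z), IsGrHom f → (∀ s, f (a s) = f0 s) →
      (∀ x', deg x < deg x' → Good x' (f (e x'))) →
      (∀ y k, deg x < k → pr k y = y → f (d y) = d (f y)) →
      ∃ z, pr (deg x) z = z ∧ d z = f (d (e x)) ∧ Good x z) :
    ∃ f : Y → Z, IsDGHom f ∧ (∀ s, f (a s) = f0 s) ∧ ∀ x, Good x (f (e x)) := by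
  classical
  let S : ℕ → (Y → Z) → Prop := fun n f => IsGrHom f ∧ (∀ s, f (a s) = f0 s) ∧
    ∀ x, -(n : ℤ) ≤ deg x → f (d (e x)) = d (f (e x)) ∧ Good x (f (e x))
  have next : ∀ n (f : {f // S n f}), ∃ f' : {f // S (n + 1) f},
      ∀ x, -(n : ℤ) ≤ deg x → f'.1 (e x) = f.1 (e x) := by
    rintro n ⟨f, hf, hfa, hfe⟩
    -- Only the generators of degree exactly `-n - 1` receive new values here. Those of lower degree
    -- keep provisional ones until their turn comes.
    have hex : ∀ x, ∃ z, pr (deg x) z = z ∧ (-(n : ℤ) ≤ deg x → z = f (e x)) ∧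
        (deg x = -(n : ℤ) - 1 → d z = f (d (e x)) ∧ Good x z) := fun x => by
      by_cases hx : deg x = -(n : ℤ) - 1
      · obtain ⟨z, h1, h2⟩ := step x f hf hfa (fun x' h => (hfe x' (by omega)).2)
          (fun y k hk hy => H.map_d_of_gt hY (deg x) hf ha (by rwa [funext hfa])
            (fun x' h => (hfe x' (by omega)).1) hk hy)
        exact ⟨z, h1, fun h => by omega, fun _ => h2⟩
      · exact ⟨f (e x), hf.hom (H.deg_e x), fun _ => rfl, fun h => absurd h hx⟩
    choose c hc1 hc2 hc3 using hex
    obtain ⟨f', hf', hfa', hfe'⟩ := H.universal Z f0 hf0.toIsGrHom c hc1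
    -- The differential of a generator treated so far lies in degrees `> -n - 1`, where the old and
    -- the new map coincide. Hence earlier achievements survive.
    have agree : ∀ k, -(n : ℤ) - 1 < k → ∀ y, pr k y = y → f' y = f y := fun k hk y hy =>
      H.eq_of_gt hY (-(n : ℤ) - 1) hf' hf (fun s => by rw [hfa, hfa'])
        (fun x hx => by rw [hfe', hc2 x (by omega)]) hk hy
    refine ⟨⟨f', hf', hfa', fun x hx => ?_⟩, fun x hx => (hfe' x).trans (hc2 x hx)⟩
    push_cast at hx
    have e1 := agree (deg x + 1) (by omega) _ (d_hom (H.deg_e x))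
    rcases eq_or_ne (deg x) (-(n : ℤ) - 1) with h | h
    · rw [e1, hfe', ← (hc3 x h).1]; exact ⟨rfl, (hc3 x h).2⟩
    · rw [e1, hfe', hc2 x (by omega)]; exact hfe x (by omega)
  -- Stage zero imposes nothing, since all generators have negative degree; any values, here zero,
  -- may serve.
  obtain ⟨g, hg, hga, -⟩ := H.universal Z f0 hf0.toIsGrHom 0 fun x => map_zero _
  have S0 : S 0 g := ⟨hg, hga, fun x hx => by have := hdeg x; push_cast at hx; omega⟩
  choose nx hnx using next
  let F : ∀ n : ℕ, {f // S n f} := fun n => Nat.rec ⟨g, S0⟩ (fun n f => nx n f) n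
  have hF : ∀ (n : ℕ) x, -(n : ℤ) ≤ deg x → (F (n + 1)).1 (e x) = (F n).1 (e x) := fun n x hx =>
    hnx n (F n) x hx
  have hF' : ∀ x (n m : ℕ), n ≤ m → -(n : ℤ) ≤ deg x → (F m).1 (e x) = (F n).1 (e x) := by
    intro x n m hnm hx
    induction m, hnm using Nat.le_induction with
    | base => rfl
    | succ m hm ih => rw [hF m x (by omega), ih]
  -- The value on `x` is stationary from stage `-deg x` on, and these final values define the limit.
  let N : ι → ℕ := fun x => (-deg x).toNat
  have hN : ∀ x, (N x : ℤ) = -deg x := fun x => Int.toNat_of_nonneg (by have := hdeg x; omega)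
  obtain ⟨f, hf, hfa, hfe⟩ := H.universal Z f0 hf0.toIsGrHom (fun x => (F (N x)).1 (e x))
    fun x => (F (N x)).2.1.hom (H.deg_e x)
  have agree : ∀ n : ℕ, ∀ k, -(n : ℤ) - 1 < k → ∀ y, pr k y = y → f y = (F n).1 y :=
    fun n k hk y hy => H.eq_of_gt hY (-(n : ℤ) - 1) hf (F n).2.1
      (fun s => by rw [hfa, (F n).2.2.1]) (fun x hx => by
        rw [hfe, hF' x (N x) n (by have := hN x; omega) (by have := hN x; omega)]) hk hy
  refine ⟨f, H.dg_of_gens hf ha (by rwa [funext hfa]) fun x => ?_, hfa, fun x => ?_⟩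
  · rw [agree (N x) (deg x + 1) (by have := hN x; omega) _ (d_hom (H.deg_e x)),
      ((F (N x)).2.2.2 x (by have := hN x; omega)).1, hfe]
  · rw [hfe]
    exact ((F (N x)).2.2.2 x (by have := hN x; omega)).2

end FreeOn

/-- The extension by one odd variable is free. -/
theorem DN.freeOn {A : Type u} [CDGA A] (D : DNData A) :
    FreeOn (fun a : A => (⟨a, 0⟩ : DN D)) (fun _ : Unit => D.k) (fun _ => ⟨0, 1⟩) where
  hom := DN.inl_hom D
  deg_e _ := by ext1 <;> simp [pr_one]
  gen p h1 h2 h3 h4 y := by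
    have : y = ⟨y.1, 0⟩ + ⟨0, 1⟩ * ⟨y.2, 0⟩ := by ext1 <;> simp
    rw [this]
    exact h3 _ _ (h1 _) (h4 _ _ (h2 ()) (h1 _))
  universal Z _ ψ hψ c hc := by
    refine ⟨fun y => ψ y.1 + c () * ψ y.2, ?_, fun s => by simp [hψ.map_zero], fun x => by
      simp [hψ.map_zero, hψ.map_one]⟩
    -- The relations of `ε` hold for the chosen value as well: an odd element squares to zero in
    -- characteristic zero and commutes up to the parity involution.
    have hsq := odd_sq D.odd (hc ())
    have hcomm := odd_comm D.odd (hc ())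
    constructor
    · intro a b
      simp only [DN.add_fst, DN.add_snd, hψ.map_add, mul_add]
      abel
    · intro a b
      simp only [DN.mul_fst, DN.mul_snd, hψ.map_add, hψ.map_mul, hψ.map_inv, mul_add, add_mul]
      have e1 : c () * ψ a.2 * (c () * ψ b.2) = 0 := by
        rw [mul_assoc, ← mul_assoc (ψ a.2), hcomm, ← mul_assoc, ← mul_assoc, hsq]; simp
      have e2 : ψ a.1 * (c () * ψ b.2) = c () * (inv (ψ a.1) * ψ b.2) := by
        rw [← mul_assoc, hcomm, mul_assoc]
      rw [e1, e2, mul_assoc]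
      abel
    · intro c
      simp [hψ.map_scal, hψ.map_zero]
    · intro i a
      have := pr_mul_left i D.k (c ()) (ψ a.2)
      rw [hc] at this
      simp [hψ.map_pr, this]

/-! ## Unipotent endomorphisms -/

section unipotent

variable {C : Type u} [Ring C] (ω : C →+* C)

theorem unipotent_iterate_add (n : ℕ) (x y : C) : (fun c => ω c - c)^[n] (x + y) =
    (fun c => ω c - c)^[n] x + (fun c => ω c - c)^[n] y := by
  induction n generalizing x y with
  | zero => rfl
  | succ n ih =>
    simp only [Function.iterate_succ_apply]
    rw [← ih]; congr 1; simp only [map_add]; abel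

/-- With `δ = ω - 1` one has `δ(ab) = δ(a) ω(b) + a δ(b)`, and `ω` commutes with `δ`. Thus every
application of `δ` lowers one of the two nilpotency orders. -/
theorem unipotent_mul (N M : ℕ) (a b : C) (ha : (fun c => ω c - c)^[N] a = 0)
    (hb : (fun c => ω c - c)^[M] b = 0) : (fun c => ω c - c)^[N + M] (a * b) = 0 := by
  have hz : ∀ n, (fun c => ω c - c)^[n] 0 = 0 := fun n =>
    Function.iterate_fixed (by simp) n
  have hω : ∀ n x, (fun c => ω c - c)^[n] (ω x) = ω ((fun c => ω c - c)^[n] x) := fun n x =>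
    (Function.Commute.iterate_left (f := fun c => ω c - c) (g := ω) (fun x => by simp) n) x
  induction N generalizing M a b with
  | zero => simp only [Function.iterate_zero, id] at ha; rw [ha, zero_mul, hz]
  | succ N ihN =>
    induction M generalizing a b with
    | zero => simp only [Function.iterate_zero, id] at hb; rw [hb, mul_zero, hz]
    | succ M ihM =>
      rw [show N + 1 + (M + 1) = N + M + 1 + 1 by ring, Function.iterate_succ_apply]
      have e1 : ω (a * b) - a * b = (ω a - a) * ω b + a * (ω b - b) := by
        rw [map_mul]; noncomm_ring
      rw [e1, unipotent_iterate_add, show N + M + 1 = N + (M + 1) by ring,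
        ihN (M + 1) (ω a - a) (ω b) ha
        (by rw [hω, hb, map_zero]), show N + (M + 1) = N + 1 + M by ring, ihM a (ω b - b) ha hb,
        add_zero]

theorem unipotent_add (N M : ℕ) (a b : C) (ha : (fun c => ω c - c)^[N] a = 0)
    (hb : (fun c => ω c - c)^[M] b = 0) : (fun c => ω c - c)^[N + M] (a + b) = 0 := by
  have hz : ∀ n, (fun c => ω c - c)^[n] 0 = 0 := fun n =>
    Function.iterate_fixed (by simp) n
  rw [unipotent_iterate_add, Function.iterate_add_apply _ _ _ b, hb, hz, add_zero, Nat.add_comm,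
    Function.iterate_add_apply, ha, hz]

/-- A ring endomorphism `ω` such that `ω - 1` is locally nilpotent is bijective. -/
theorem unipotent_bijective (h : ∀ c, ∃ N, (fun c => ω c - c)^[N] c = 0) :
    Function.Bijective ω := by
  constructor
  · refine (injective_iff_map_eq_zero ω).2 fun c hc => ?_
    obtain ⟨N, hN⟩ := h c
    -- On the kernel of `ω` the operator `ω - 1` is `-1`, which is nilpotent only on zero.
    have : ∀ n, (fun c => ω c - c)^[n] c = (-1) ^ n * c := fun n => by
      induction n with
      | zero => simp
      | succ n ih =>
        rw [Function.iterate_succ_apply', ih]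
        simp [hc, pow_succ]
    rw [this] at hN
    rcases neg_one_pow_eq_or C N with h | h <;> simpa [h] using hN
  · intro c
    obtain ⟨N, hN⟩ := h c
    induction N generalizing c with
    | zero => exact ⟨0, by simpa using hN.symm⟩
    | succ N ih =>
      obtain ⟨x, hx⟩ := ih (ω c - c) (by simpa using hN)
      exact ⟨c - x, by rw [map_sub, hx]; abel⟩

end unipotent

/-! ## Division of holomorphic functions -/

section division

variable {V : Type*} [NormedAddCommGroup V] [NormedSpace ℂ V]

/-- The power series of the quotient `(F y - F (π y)) / l y`, where `y = π y + l y • e`. -/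
def divSeries (P : FormalMultilinearSeries ℂ V ℂ) (π : V →L[ℂ] V) (e : V) :
    FormalMultilinearSeries ℂ V ℂ := fun n => ∑ k : Fin (n + 1),
  ((P (n + 1)).curryMid k e).compContinuousLinearMap
    (fun i => if i.castSucc < k then ContinuousLinearMap.id ℂ V else π)

/-- Telescoping: the arguments `y` are exchanged for `π y` one slot at a time. By multilinearity
each exchange contributes `y - π y = l y • e` in its slot, which produces the factor `l y`. -/
theorem divSeries_apply (P : FormalMultilinearSeries ℂ V ℂ) (π : V →L[ℂ] V) (l : V →L[ℂ] ℂ) (e : V)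
    (h : ∀ y, y = π y + l y • e) (n : ℕ) (y : V) :
    l y * divSeries P π e n (fun _ => y) = P (n + 1) (fun _ => y) - P (n + 1) (fun _ => π y) := by
  let a : ℕ → ℂ := fun k => P (n + 1) (fun i => if i.1 < k then y else π y)
  have h1 : ∀ k : Fin (n + 1), l y * ((P (n + 1)).curryMid k e).compContinuousLinearMap
      (fun i => if i.castSucc < k then ContinuousLinearMap.id ℂ V else π) (fun _ => y) =
      a (k + 1) - a k := by
    intro k
    let m : Fin (n + 1) → V := fun i => if i.1 < k.1 then y else π y
    have e1 : ∀ x : V, k.insertNth x (fun i : Fin n =>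
        (if i.castSucc < k then ContinuousLinearMap.id ℂ V else π) y) = Function.update m k x := by
      intro x
      rw [Fin.insertNth_eq_iff]
      refine ⟨by simp, funext fun i => ?_⟩
      simp only [Fin.removeNth, m]
      rw [Function.update_of_ne (Fin.succAbove_ne _ _)]
      rcases lt_or_ge i.castSucc k with hi | hi
      · rw [Fin.succAbove_of_castSucc_lt _ _ hi, if_pos hi, if_pos (Fin.lt_def.1 hi)]; rfl
      · have : ¬ i.succ.1 < k.1 := by
          rw [Fin.le_def] at hi; simp only [Fin.val_castSucc, Fin.val_succ] at *; omega
        rw [Fin.succAbove_of_le_castSucc _ _ hi, if_neg (not_lt.2 hi), if_neg this]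
    rw [ContinuousMultilinearMap.compContinuousLinearMap_apply,
      ContinuousMultilinearMap.curryMid_apply]
    rw [e1, ← smul_eq_mul, ← ContinuousMultilinearMap.map_update_smul,
      show l y • e = y - π y by rw [eq_sub_iff_add_eq, add_comm]; exact (h y).symm,
      ContinuousMultilinearMap.map_update_sub]
    congr 2
    · funext i
      rcases eq_or_ne i k with rfl | hi
      · simp
      · rw [Function.update_of_ne hi]
        simp only [m]
        have : i.1 ≠ k.1 := fun h => hi (Fin.ext h)
        congr 1
        simp only [eq_iff_iff]; omega
    · funext i
      rcases eq_or_ne i k with rfl | hi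
      · simp
      · rw [Function.update_of_ne hi]
  rw [divSeries, sum_apply, Finset.mul_sum, Finset.sum_congr rfl fun k _ => h1 k,
    Fin.sum_univ_eq_sum_range (fun k => a (k + 1) - a k), Finset.sum_range_sub]
  have e1 : (fun i : Fin (n + 1) => if i.1 < n + 1 then y else π y) = fun _ => y :=
    funext fun i => if_pos i.2
  simp only [a, e1, Nat.not_lt_zero, if_false]

/-- The `n + 1` summands are each bounded by a constant times `(r M)^n`, and `n + 1 ≤ 2^n` keeps the
total geometric, with ratio `2 r M`. -/
theorem divSeries_radius (P : FormalMultilinearSeries ℂ V ℂ) (π : V →L[ℂ] V) (e : V)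
    (hP : 0 < P.radius) : 0 < (divSeries P π e).radius := by
  obtain ⟨C, r, hC, hr, hb⟩ := P.le_mul_pow_of_radius_pos hP
  let M : ℝ := max 1 ‖π‖
  have hM : 1 ≤ M := le_max_left _ _
  have hn : ∀ n, ‖divSeries P π e n‖ ≤ (C * r * ‖e‖) * ((2 * r * M) ^ n) := by
    intro n
    have h1 : ∀ k : Fin (n + 1), ‖((P (n + 1)).curryMid k e).compContinuousLinearMap
        (fun i => if i.castSucc < k then ContinuousLinearMap.id ℂ V else π)‖ ≤
        C * r ^ (n + 1) * ‖e‖ * M ^ n := by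
      intro k
      refine (ContinuousMultilinearMap.norm_compContinuousLinearMap_le _ _).trans ?_
      refine mul_le_mul ?_ ?_ (Finset.prod_nonneg fun _ _ => norm_nonneg _) (by positivity)
      · refine (ContinuousLinearMap.le_opNorm _ _).trans ?_
        rw [ContinuousMultilinearMap.norm_curryMid]
        exact mul_le_mul_of_nonneg_right (hb _) (norm_nonneg _)
      · refine (Finset.prod_le_prod (fun _ _ => norm_nonneg _) (g := fun _ => M)
          fun i _ => ?_).trans (by simp)
        split_ifs
        · exact ContinuousLinearMap.norm_id_le.trans hM
        · exact le_max_right _ _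
    refine (norm_sum_le _ _).trans ((Finset.sum_le_sum fun k _ => h1 k).trans ?_)
    rw [Finset.sum_const, Finset.card_univ, Fintype.card_fin, nsmul_eq_mul]
    have h2 : ((n + 1 : ℕ) : ℝ) ≤ 2 ^ n := by exact_mod_cast Nat.lt_two_pow_self
    calc ((n + 1 : ℕ) : ℝ) * (C * r ^ (n + 1) * ‖e‖ * M ^ n)
        ≤ 2 ^ n * (C * r ^ (n + 1) * ‖e‖ * M ^ n) :=
          mul_le_mul_of_nonneg_right h2 (by positivity)
      _ = _ := by rw [mul_pow, mul_pow]; ring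
  have hpos : 0 < 2 * r * M := by positivity
  let ρ : NNReal := ⟨(2 * r * M)⁻¹, by positivity⟩
  have : (ρ : ENNReal) ≤ (divSeries P π e).radius := by
    refine FormalMultilinearSeries.le_radius_of_bound _ (C * r * ‖e‖) fun n => ?_
    refine (mul_le_mul_of_nonneg_right (hn n) (by positivity)).trans ?_
    rw [show ((ρ : NNReal) : ℝ) = (2 * r * M)⁻¹ from rfl, mul_assoc, ← mul_pow,
      mul_inv_cancel₀ hpos.ne', one_pow, mul_one]
  refine lt_of_lt_of_le ?_ this
  rw [ENNReal.coe_pos, ← NNReal.coe_pos]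
  exact inv_pos.2 hpos

theorem AnalyticAt.exists_linear_div {F : V → ℂ} (hF : AnalyticAt ℂ F 0) (π : V →L[ℂ] V)
    (l : V →L[ℂ] ℂ) (e : V) (h : ∀ y, y = π y + l y • e) :
    ∃ q : V → ℂ, AnalyticAt ℂ q 0 ∧ ∀ᶠ y in 𝓝 0, F y = F (π y) + l y * q y := by
  obtain ⟨P, r, hr⟩ := hF
  have hq := (divSeries P π e).hasFPowerSeriesOnBall
    (divSeries_radius P π e (hr.r_pos.trans_le hr.r_le))
  refine ⟨_, hq.analyticAt, ?_⟩
  have hπ : Tendsto π (𝓝 0) (𝓝 0) := by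
    have := π.continuous.tendsto 0
    rwa [map_zero] at this
  filter_upwards [hr.eventually_hasSum, hπ.eventually hr.eventually_hasSum,
    hq.eventually_hasSum] with y h1 h2 h3
  simp only [zero_add] at h1 h2 h3
  -- The terms of index zero of the two series are the same constant and cancel, so the difference
  -- starts at index one and matches `l y` times the shifted quotient series.
  have h4 := (hasSum_nat_add_iff' 1).2 (h1.sub h2)
  have h5 := h3.mul_left (l y)
  simp only [divSeries_apply P π l e h] at h5
  have := h5.unique h4
  simp only [Finset.range_one, Finset.sum_singleton] at this
  rw [this, show (fun _ : Fin 0 => y) = fun _ => π y from Subsingleton.elim _ _]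
  ring

/-- Hadamard's lemma. -/
theorem AnalyticAt.exists_slope {G : V → ℂ} {p : V} (hG : AnalyticAt ℂ G p) (v : V) :
    ∃ q : V × ℂ → ℂ, AnalyticAt ℂ q (p, 0) ∧
      ∀ᶠ x in 𝓝 (p, (0 : ℂ)), G (x.1 + x.2 • v) = G x.1 + x.2 * q x := by
  let F : V × ℂ → ℂ := fun x => G (p + x.1 + x.2 • v)
  have hF : AnalyticAt ℂ F 0 := by
    have : AnalyticAt ℂ (fun x : V × ℂ => p + x.1 + x.2 • v) 0 :=
      (analyticAt_const.add analyticAt_fst).add (analyticAt_snd.smul analyticAt_const)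
    exact AnalyticAt.fun_comp (g := G) (by simpa using hG) this
  obtain ⟨q, hq, hq'⟩ := hF.exists_linear_div
    ((ContinuousLinearMap.inl ℂ V ℂ).comp (ContinuousLinearMap.fst ℂ V ℂ))
    (ContinuousLinearMap.snd ℂ V ℂ) (0, 1) (fun y => by ext <;> simp)
  have ht : Tendsto (fun x : V × ℂ => x - (p, 0)) (𝓝 (p, 0)) (𝓝 0) := by
    have : Continuous (fun x : V × ℂ => x - (p, 0)) := by fun_prop
    simpa using this.tendsto (p, 0)
  refine ⟨fun x => q (x - (p, 0)), ?_, ?_⟩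
  · refine AnalyticAt.fun_comp (g := q) (by simpa using hq) (analyticAt_id.sub analyticAt_const)
  · filter_upwards [ht.eventually hq'] with x hx
    simpa [F] using hx

/-- Cancellation of a factor with nowhere dense zero set. -/
theorem AnalyticAt.eventuallyEq_of_mul {f g l : V → ℂ} {p : V} (hf : AnalyticAt ℂ f p)
    (hg : AnalyticAt ℂ g p) (h : ∀ᶠ x in 𝓝 p, l x * f x = l x * g x)
    (hl : ∀ x, x ∈ closure {y | l y ≠ 0}) : ∀ᶠ x in 𝓝 p, f x = g x := by
  have hc := (hf.eventually_analyticAt.and hg.eventually_analyticAt).and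
    (eventually_eventually_nhds.2 h)
  filter_upwards [hc] with x ⟨⟨hfx, hgx⟩, hx⟩
  by_contra hne
  have : ∀ᶠ y in 𝓝 x, f y ≠ g y := 
    ((hfx.continuousAt.sub hgx.continuousAt).eventually_ne (sub_ne_zero.2 hne)).mono
      fun y h => sub_ne_zero.1 h
  obtain ⟨y, hy, hy'⟩ := mem_closure_iff_nhds.1 (hl x) _ (this.and hx)
  exact hy.1 (mul_left_cancel₀ hy' hy.2)

end division


/-! ## Substitutions in the parameters -/

namespace Hol

/-- Composition with an analytic map. -/
def comp {E E' : Type*} [NormedAddCommGroup E] [NormedSpace ℂ E] [NormedAddCommGroup E']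
    [NormedSpace ℂ E'] {a : E} {b : E'} (σ : E → E') (hσ : AnalyticAt ℂ σ a) (h : σ a = b) :
    Hol E' b →ₐ[ℂ] Hol E a where
  toFun g := ⟨fun x => g.1 (σ x), AnalyticAt.fun_comp (g := g.1) (by rw [h]; exact g.2) hσ⟩
  map_one' := rfl
  map_mul' _ _ := rfl
  map_zero' := rfl
  map_add' _ _ := rfl
  commutes' _ := rfl

variable {N n : ℕ} {z : Fin N → ℂ}

/-- Functions on the base as functions on the total space. -/
def fst (n : ℕ) : Hol (Fin N → ℂ) z →ₐ[ℂ] Hol ((Fin N → ℂ) × (Fin n → ℂ)) (z, 0) :=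
  comp Prod.fst analyticAt_fst rfl

/-- The coordinates. -/
def coord (z : Fin N → ℂ) (i : Fin n) : Hol ((Fin N → ℂ) × (Fin n → ℂ)) (z, 0) :=
  ⟨fun b => b.2 i, coord_mem z i⟩

/-- Replace the coordinates `t_i` with `i < m` by the functions `α_i(z)`. -/
def substMap (α : Fin n → (Fin N → ℂ) → ℂ) (m : ℕ) (x : (Fin N → ℂ) × (Fin n → ℂ)) :
    (Fin N → ℂ) × (Fin n → ℂ) := (x.1, fun i => if i.1 < m then α i x.1 else x.2 i)

variable {α : Fin n → (Fin N → ℂ) → ℂ}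

theorem substMap_analytic (hα : ∀ i, AnalyticAt ℂ (α i) z) (m : ℕ) :
    AnalyticAt ℂ (substMap α m) (z, 0) := by
  refine analyticAt_fst.prod (AnalyticAt.pi fun i => ?_)
  by_cases h : i.1 < m
  · simp only [h, if_true]
    exact AnalyticAt.fun_comp (g := α i) (hα i) analyticAt_fst
  · simp only [h, if_false]
    exact coord_mem z i

theorem substMap_self (hα0 : ∀ i, α i z = 0) (m : ℕ) : substMap α m (z, 0) = (z, 0) := by
  ext i <;> simp [substMap, hα0]

/-- Substitution of `α_i(z)` for the coordinates `t_i` with `i < m`. -/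
def subst (hα : ∀ i, AnalyticAt ℂ (α i) z) (hα0 : ∀ i, α i z = 0) (m : ℕ) :
    Hol ((Fin N → ℂ) × (Fin n → ℂ)) (z, 0) →ₐ[ℂ] Hol ((Fin N → ℂ) × (Fin n → ℂ)) (z, 0) :=
  comp (substMap α m) (substMap_analytic hα m) (substMap_self hα0 m)

variable (hα : ∀ i, AnalyticAt ℂ (α i) z) (hα0 : ∀ i, α i z = 0)

/-- The functions `t_i - α_i(z)`. -/
def dif (i : Fin n) : Hol ((Fin N → ℂ) × (Fin n → ℂ)) (z, 0) :=
  coord z i - fst n ⟨α i, hα i⟩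

theorem subst_fst (m : ℕ) (g : Hol (Fin N → ℂ) z) : subst hα hα0 m (fst n g) = fst n g := rfl

theorem subst_zero (g : Hol ((Fin N → ℂ) × (Fin n → ℂ)) (z, 0)) : subst hα hα0 0 g = g := by
  ext x; simp [subst, comp, substMap]

theorem subst_subst {l m : ℕ} (h : l ≤ m) (g : Hol ((Fin N → ℂ) × (Fin n → ℂ)) (z, 0)) :
    subst hα hα0 m (subst hα hα0 l g) = subst hα hα0 m g := by
  ext x
  refine congrArg g.1 (a₁ := substMap α l (substMap α m x)) (a₂ := substMap α m x) ?_
  ext i <;> simp only [substMap]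
  split_ifs <;> first | rfl | omega

theorem subst_dif_lt (m : ℕ) (i : Fin n) (h : i.1 < m) : subst hα hα0 m (dif hα i) = 0 := by
  ext x
  change (substMap α m x).2 i - α i (substMap α m x).1 = 0
  simp [substMap, h]

theorem subst_dif_ge (m : ℕ) (i : Fin n) (h : m ≤ i.1) :
    subst hα hα0 m (dif hα i) = dif hα i := by
  ext x
  change (substMap α m x).2 i - α i (substMap α m x).1 = x.2 i - α i x.1
  simp [substMap, not_lt.2 h]

theorem exists_div (m : Fin n) (g : Hol ((Fin N → ℂ) × (Fin n → ℂ)) (z, 0)) :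
    ∃ q : Hol ((Fin N → ℂ) × (Fin n → ℂ)) (z, 0), ∀ᶠ x in 𝓝 (z, (0 : Fin n → ℂ)),
      (subst hα hα0 m g).1 x = (subst hα hα0 (m + 1) g).1 x + (dif hα m).1 x * q.1 x := by
  let v : (Fin N → ℂ) × (Fin n → ℂ) := (0, Pi.single m 1)
  obtain ⟨q, hq, hq'⟩ := (subst hα hα0 m g).2.exists_slope v
  -- The point with `t_m` moved to `α_m(z)`, together with the increment `t_m - α_m(z)` that leads
  -- back. Hadamard's lemma in the direction of `t_m` is evaluated there.
  let σ : (Fin N → ℂ) × (Fin n → ℂ) → ((Fin N → ℂ) × (Fin n → ℂ)) × ℂ := fun x =>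
    (x - (dif hα m).1 x • v, (dif hα m).1 x)
  have hσ : AnalyticAt ℂ σ (z, 0) :=
    (analyticAt_id.sub ((dif hα m).2.smul analyticAt_const)).prod (dif hα m).2
  have h0 : (dif hα m).1 (z, 0) = 0 := by
    change (0 : Fin n → ℂ) m - α m z = 0
    simp [hα0]
  have hσ0 : σ (z, 0) = ((z, 0), 0) := by simp [σ, h0]
  refine ⟨⟨fun x => q (σ x), AnalyticAt.fun_comp (g := q) (by rwa [hσ0]) hσ⟩, ?_⟩
  have ht : Tendsto σ (𝓝 (z, 0)) (𝓝 ((z, 0), 0)) := by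
    have := hσ.continuousAt.tendsto
    rwa [hσ0] at this
  filter_upwards [ht.eventually hq'] with x hx
  simp only [σ, sub_add_cancel] at hx
  rw [hx]
  congr 1
  refine congrArg g.1 (a₁ := substMap α m _) (a₂ := substMap α (m + 1) x) ?_
  have hm : (dif hα m).1 x = x.2 m - α m x.1 := rfl
  ext i
  · simp [substMap, v]
  · simp only [substMap, v, hm, Prod.fst_sub, Prod.snd_sub, Prod.smul_mk, smul_zero, sub_zero]
    rcases lt_trichotomy i.1 m.1 with h | h | h
    · rw [if_pos h, if_pos (by omega)]
    · have : i = m := Fin.ext h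
      subst this
      simp
    · have : i ≠ m := fun h' => by simp [h'] at h
      rw [if_neg (by omega), if_neg (by omega)]
      simp [this]

/-- The quotient `(g_m - g_{m+1}) / (t_m - α_m)`, where `g_m = subst m g`. -/
def quo (m : Fin n) (g : Hol ((Fin N → ℂ) × (Fin n → ℂ)) (z, 0)) :
    Hol ((Fin N → ℂ) × (Fin n → ℂ)) (z, 0) := (exists_div hα hα0 m g).choose

theorem quo_spec (m : Fin n) (g : Hol ((Fin N → ℂ) × (Fin n → ℂ)) (z, 0)) :
    ∀ᶠ x in 𝓝 (z, (0 : Fin n → ℂ)), (subst hα hα0 m g).1 x =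
      (subst hα hα0 (m + 1) g).1 x + (dif hα m).1 x * (quo hα hα0 m g).1 x :=
  (exists_div hα hα0 m g).choose_spec

/-- On each line in the direction of `t_m` the factor `t_m - α_m` vanishes at one point only, so it
can be cancelled. This uniqueness yields all the algebraic rules for the quotient. -/
theorem quo_unique (m : Fin n) {g q : Hol ((Fin N → ℂ) × (Fin n → ℂ)) (z, 0)}
    (h : ∀ᶠ x in 𝓝 (z, (0 : Fin n → ℂ)), (subst hα hα0 m g).1 x =
      (subst hα hα0 (m + 1) g).1 x + (dif hα m).1 x * q.1 x) :
    ∀ᶠ x in 𝓝 (z, (0 : Fin n → ℂ)), (quo hα hα0 m g).1 x = q.1 x := by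
  refine AnalyticAt.eventuallyEq_of_mul (l := (dif hα m).1) (quo hα hα0 m g).2 q.2 ?_ ?_
  · filter_upwards [h, quo_spec hα hα0 m g] with x h1 h2
    exact add_left_cancel (h2.symm.trans h1)
  · intro x
    have hc : Tendsto (fun s : ℂ => (x.1, Function.update x.2 m s)) (𝓝[≠] (x.2 m)) (𝓝 x) := by
      have : Continuous (fun s : ℂ => (x.1, Function.update x.2 m s)) := by fun_prop
      have := this.tendsto (x.2 m)
      simp only [Function.update_eq_self] at this
      exact this.mono_left nhdsWithin_le_nhds
    refine mem_closure_of_tendsto hc ?_ 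
    have : ∀ᶠ s in 𝓝[≠] (x.2 m), s ≠ α m x.1 := by
      rcases eq_or_ne (x.2 m) (α m x.1) with h | h
      · rw [← h]; exact self_mem_nhdsWithin
      · exact nhdsWithin_le_nhds (isOpen_ne.mem_nhds h)
    filter_upwards [this] with s hs
    change Function.update x.2 m s m - α m x.1 ≠ 0
    rw [Function.update_self]
    exact sub_ne_zero.2 hs

end Hol

/-! ## Splitting extensions -/

/-- Cocycles of degree zero. -/
def Cocycle0 (A : Type u) [CDGA A] : Type u := {t : A // pr 0 t = t ∧ d t = 0}

/-- The algebra `A[x] / (x² - t x)`. -/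
@[ext] structure SplitExt {A : Type u} [CDGA A] (t : Cocycle0 A) where
  fst : A
  snd : A

namespace SplitExt

variable {A : Type u} [CDGA A] {t : Cocycle0 A}

theorem t_comm (t : Cocycle0 A) (a : A) : a * t.1 = t.1 * a :=
  even_comm (by decide : Even (0 : ℤ)) t.2.1 a

instance : Add (SplitExt t) := ⟨fun x y => ⟨x.1 + y.1, x.2 + y.2⟩⟩
instance : Zero (SplitExt t) := ⟨⟨0, 0⟩⟩
instance : Neg (SplitExt t) := ⟨fun x => ⟨-x.1, -x.2⟩⟩
instance : SMul ℂ (SplitExt t) := ⟨fun c x => ⟨c • x.1, c • x.2⟩⟩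
instance : Mul (SplitExt t) := ⟨fun x y => ⟨x.1 * y.1, x.2 * y.1 + x.1 * y.2 + t.1 * x.2 * y.2⟩⟩
instance : One (SplitExt t) := ⟨⟨1, 0⟩⟩

@[simp] theorem add_fst (x y : SplitExt t) : (x + y).1 = x.1 + y.1 := rfl
@[simp] theorem add_snd (x y : SplitExt t) : (x + y).2 = x.2 + y.2 := rfl
@[simp] theorem zero_fst : (0 : SplitExt t).1 = 0 := rfl
@[simp] theorem zero_snd : (0 : SplitExt t).2 = 0 := rfl
@[simp] theorem one_fst : (1 : SplitExt t).1 = 1 := rfl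
@[simp] theorem one_snd : (1 : SplitExt t).2 = 0 := rfl
@[simp] theorem mul_fst (x y : SplitExt t) : (x * y).1 = x.1 * y.1 := rfl
@[simp] theorem mul_snd (x y : SplitExt t) :
    (x * y).2 = x.2 * y.1 + x.1 * y.2 + t.1 * x.2 * y.2 := rfl
@[simp] theorem smul_fst (c : ℂ) (x : SplitExt t) : (c • x).1 = c • x.1 := rfl
@[simp] theorem smul_snd (c : ℂ) (x : SplitExt t) : (c • x).2 = c • x.2 := rfl
@[simp] theorem neg_fst (x : SplitExt t) : (-x).1 = -x.1 := rfl
@[simp] theorem neg_snd (x : SplitExt t) : (-x).2 = -x.2 := rfl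

instance : Ring (SplitExt t) where
  nsmul := nsmulRec
  zsmul := zsmulRec
  add_assoc x y z := by ext <;> simp [add_assoc]
  zero_add x := by ext <;> simp
  add_zero x := by ext <;> simp
  add_comm x y := by ext <;> simp [add_comm]
  neg_add_cancel x := by ext <;> simp
  left_distrib x y z := by ext <;> simp [mul_add]; abel
  right_distrib x y z := by ext <;> simp [add_mul, mul_add]; abel
  zero_mul x := by ext <;> simp
  mul_zero x := by ext <;> simp
  mul_assoc x y z := by
    have h : ∀ a b : A, a * (t.1 * b) = t.1 * (a * b) := fun a b => by
      rw [← mul_assoc, t_comm, mul_assoc]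
    ext
    · simp [mul_assoc]
    · simp only [mul_fst, mul_snd, mul_add, add_mul, mul_assoc, h]
      abel
  one_mul x := by ext <;> simp
  mul_one x := by ext <;> simp

instance : Module ℂ (SplitExt t) where
  one_smul x := by ext <;> simp
  mul_smul c c' x := by ext <;> simp [mul_smul]
  smul_zero c := by ext <;> simp
  smul_add c x y := by ext <;> simp
  add_smul c c' x := by ext <;> simp [add_smul]
  zero_smul x := by ext <;> simp

instance : Algebra ℂ (SplitExt t) := Algebra.ofModule (fun c x y => by ext <;> simp [smul_add])
  (fun c x y => by ext <;> simp [smul_add])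

theorem algebraMap_eq (c : ℂ) : algebraMap ℂ (SplitExt t) c = mk (algebraMap ℂ A c) 0 := by
  rw [Algebra.algebraMap_eq_smul_one]
  ext <;> simp [Algebra.algebraMap_eq_smul_one]

/-- Linear maps act componentwise. -/
def lmap (t : Cocycle0 A) (L : A →ₗ[ℂ] A) : SplitExt t →ₗ[ℂ] SplitExt t where
  toFun x := mk (L x.1) (L x.2)
  map_add' x y := by ext <;> simp
  map_smul' c x := by ext <;> simp

/-- The variable has degree zero and differential zero. This is compatible with `x² = t x` because
`t` is a cocycle of degree zero, so everything acts componentwise. -/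
instance : CDGA (SplitExt t) where
  pr i := lmap t (pr i)
  d := lmap t d
  pr_self i x := by ext <;> simp [lmap, pr_self]
  pr_ne i l x h := by ext <;> simp [lmap, pr_ne _ _ _ h]
  pr_one := by ext <;> simp [lmap, pr_one]
  pr_mul i l x y := by
    have h := mul_hom t.2.1 (pr_self i x.2)
    rw [zero_add] at h
    have := mul_hom h (pr_self l y.2)
    ext <;> simp [lmap, pr_mul, this]
  comm i l x y := by
    ext
    · simp [lmap, comm i l x.1 y.1]
    · have h := mul_hom t.2.1 (pr_self i x.2)
      rw [zero_add] at h
      have h3 := comm i l (t.1 * pr i x.2) y.2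
      rw [h] at h3
      simp only [lmap, LinearMap.coe_mk, AddHom.coe_mk, mul_snd, smul_snd, comm i l x.2 y.1,
        comm i l x.1 y.2, h3, smul_add]
      rw [← mul_assoc (pr l y.2), t_comm]
      abel
  d_pr i x := by ext <;> simp [lmap, d_pr]
  d_d x := by ext <;> simp [lmap, d_d]
  leibniz i x y := by
    have h1 : inv t.1 = t.1 := by rw [inv_hom t.2.1, sgn_zero, one_smul]
    ext
    · simp [lmap, leibniz]
    · simp only [lmap, LinearMap.coe_mk, AddHom.coe_mk, mul_snd, smul_snd, add_snd, map_add, d_mul,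
        CDGA.inv_mul, inv_pr, h1, t.2.2, smul_add, zero_mul, zero_add, smul_mul_assoc, mul_smul_comm]
      abel
  exists_sum x := by
    refine ⟨supp x.1 ∪ supp x.2, ?_⟩
    change ∑ i ∈ _, lmap t (pr i) x = x
    let p1 : SplitExt t →+ A := ⟨⟨fun x => x.1, rfl⟩, fun _ _ => rfl⟩
    let p2 : SplitExt t →+ A := ⟨⟨fun x => x.2, rfl⟩, fun _ _ => rfl⟩
    ext
    · change p1 _ = _
      rw [map_sum]
      exact sum_pr_subset _ Finset.subset_union_left
    · change p2 _ = _
      rw [map_sum]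
      exact sum_pr_subset _ Finset.subset_union_right

@[simp] theorem pr_fst (i : ℤ) (x : SplitExt t) : (pr i x).1 = pr i x.1 := rfl
@[simp] theorem pr_snd (i : ℤ) (x : SplitExt t) : (pr i x).2 = pr i x.2 := rfl
@[simp] theorem d_fst (x : SplitExt t) : (d x).1 = d x.1 := rfl
@[simp] theorem d_snd (x : SplitExt t) : (d x).2 = d x.2 := rfl

theorem fst_hom : IsDGHom (fun x : SplitExt t => x.1) :=
  ⟨⟨fun _ _ => rfl, fun _ _ => rfl, fun c => by rw [algebraMap_eq], fun _ _ => rfl⟩, fun _ => rfl⟩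

theorem inl_hom : IsDGHom (fun a : A => (⟨a, 0⟩ : SplitExt t)) where
  map_add _ _ := by ext <;> simp
  map_mul _ _ := by ext <;> simp
  map_scal c := (algebraMap_eq c).symm
  map_pr _ _ := by ext <;> simp
  map_d _ := by ext <;> simp

/-- Evaluation at `x = t`. -/
theorem ev_hom : IsDGHom (fun x : SplitExt t => x.1 + t.1 * x.2) where
  map_add _ _ := by simp only [add_fst, add_snd, mul_add]; abel
  map_mul x y := by
    have h : ∀ a b : A, a * (t.1 * b) = t.1 * (a * b) := fun a b => by
      rw [← mul_assoc, t_comm, mul_assoc]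
    simp only [mul_fst, mul_snd, mul_add, add_mul, mul_assoc, h]
    abel
  map_scal c := by simp [algebraMap_eq]
  map_pr i x := by
    have := pr_mul_left i 0 t.1 x.2
    rw [t.2.1, sub_zero] at this
    simp [this]
  map_d x := by
    have h1 : inv t.1 = t.1 := by rw [inv_hom t.2.1, sgn_zero, one_smul]
    simp [d_mul, t.2.2, h1]

end SplitExt

/-! ## Stalks of free analytic algebras -/

/-- A stalk of a free analytic augmented algebra `S` over `R`. -/
structure FreeStalk (R S : Type u) [CDGA R] [CDGA S] where
  j : R → S
  μ : S → R
  j_hom : IsDGHom j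
  μ_hom : IsDGHom μ
  μ_j : ∀ r, μ (j r) = r
  nonpos : NonPos R
  N : ℕ
  n : ℕ
  k : ℕ
  z : Fin N → ℂ
  f : Fin k → (Fin N → ℂ) → ℂ
  f_analytic : ∀ i, AnalyticAt ℂ (f i) z
  f_zero : ∀ i, f i z = 0
  θ : Hol (Fin N → ℂ) z →ₐ[ℂ] R
  θS : Hol ((Fin N → ℂ) × (Fin n → ℂ)) (z, 0) →ₐ[ℂ] S
  θ_surj : ∀ r, pr 0 r = r → ∃ g, θ g = r
  θS_deg : ∀ g, pr 0 (θS g) = θS g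
  θS_fst : ∀ g, θS (Hol.fst n g) = j (θ g)
  ker : ∀ g, θS g = 0 ↔ ∃ a : Fin k → Hol ((Fin N → ℂ) × (Fin n → ℂ)) (z, 0),
    ∀ᶠ b in 𝓝 (z, (0 : Fin n → ℂ)), g.1 b = ∑ i, (a i).1 b * f i b.1
  ι : Type u
  deg : ι → ℤ
  e : ι → S
  deg_neg : ∀ x, deg x < 0
  deg_e : ∀ x, pr (deg x) (e x) = e x
  universal : ∀ (Z : Type u) [CDGA Z] (ψ : R → Z), IsGrHom ψ →
    ∀ χ : Hol ((Fin N → ℂ) × (Fin n → ℂ)) (z, 0) →ₐ[ℂ] Z, (∀ g, pr 0 (χ g) = χ g) →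
    (∀ g, χ (Hol.fst n g) = ψ (θ g)) → (∀ g, θS g = 0 → χ g = 0) →
    ∀ c : ι → Z, (∀ x, pr (deg x) (c x) = c x) →
    ∃! h : S → Z, IsGrHom h ∧ (∀ r, h (j r) = ψ r) ∧ (∀ g, h (θS g) = χ g) ∧ ∀ x, h (e x) = c x

namespace FreeStalk

variable {R S : Type u} [CDGA R] [CDGA S] (F : FreeStalk R S)

/-- Functions on the total space. -/
abbrev H : Type := Hol ((Fin F.N → ℂ) × (Fin F.n → ℂ)) (F.z, 0)

theorem ker_of_eventually {g g' : F.H} (h : ∀ᶠ b in 𝓝 (F.z, (0 : Fin F.n → ℂ)), g.1 b = g'.1 b) :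
    F.θS g = F.θS g' := by
  rw [← sub_eq_zero, ← map_sub, F.ker]
  refine ⟨0, h.mono fun b hb => ?_⟩
  change g.1 b - g'.1 b = ∑ i, 0 * F.f i b.1
  simp [hb]

/-- Generation comes from the uniqueness clause of the universal property, by the argument of
`FreeOn.mk'`. -/
theorem gen (F : FreeStalk R S) {p : S → Prop} (hj : ∀ r, p (F.j r)) (hθ : ∀ g, p (F.θS g)) (he : ∀ x, p (F.e x))
    (hadd : ∀ y z, p y → p z → p (y + z)) (hmul : ∀ y z, p y → p z → p (y * z)) (y : S) : p y := by
  let s : Set S := Set.range F.j ∪ Set.range F.θS ∪ Set.range F.e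
  have hs : ∀ y ∈ s, ∀ i, pr i y ∈ s ∨ pr i y = 0 := by
    rintro _ ((⟨x, rfl⟩ | ⟨x, rfl⟩) | ⟨x, rfl⟩) i
    · exact .inl (.inl (.inl ⟨pr i x, F.j_hom.map_pr i x⟩))
    · rcases eq_or_ne i 0 with rfl | h
      · exact .inl (.inl (.inr ⟨x, (F.θS_deg x).symm⟩))
      · rw [← F.θS_deg x, pr_ne _ _ _ h]; exact .inr rfl
    · rcases eq_or_ne i (F.deg x) with rfl | h
      · exact .inl (.inr ⟨x, (F.deg_e x).symm⟩)
      · rw [← F.deg_e x, pr_ne _ _ _ h]; exact .inr rfl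
  have hG := adjoin_graded hs
  let G := Algebra.adjoin ℂ s
  let : CDGA G := gradedSub G hG
  have hval : IsGrHom (fun y : G => y.1) := gradedSub_val G hG
  have hs' : s ⊆ G := Algebra.subset_adjoin
  obtain ⟨h, ⟨hh, hh1, hh2, hh3⟩, -⟩ := F.universal G (fun x => ⟨F.j x, hs' (.inl (.inl ⟨x, rfl⟩))⟩)
    ⟨fun _ _ => Subtype.ext (F.j_hom.map_add _ _), fun _ _ => Subtype.ext (F.j_hom.map_mul _ _),
      fun _ => Subtype.ext (F.j_hom.map_scal _), fun _ _ => Subtype.ext (F.j_hom.map_pr _ _)⟩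
    (F.θS.codRestrict G fun g => hs' (.inl (.inr ⟨g, rfl⟩))) (fun g => Subtype.ext (F.θS_deg g))
    (fun g => Subtype.ext (F.θS_fst g)) (fun g hg => Subtype.ext hg)
    (fun x => ⟨F.e x, hs' (.inr ⟨x, rfl⟩)⟩) (fun x => Subtype.ext (F.deg_e x))
  have key : (fun y => (h y).1) = fun y => y :=
    (F.universal S F.j F.j_hom.toIsGrHom F.θS F.θS_deg F.θS_fst (fun _ h => h) F.e F.deg_e).unique
      ⟨hval.comp hh, fun s => by rw [hh1], fun s => by rw [hh2]; rfl, fun x => by rw [hh3]⟩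
      ⟨IsGrHom.refl, by simp, by simp, by simp⟩
  have hy : y ∈ G := by rw [← show (h y).1 = y from congrFun key y]; exact (h y).2
  induction hy using Algebra.adjoin_induction with
  | mem y hy =>
    rcases hy with (⟨x, rfl⟩ | ⟨x, rfl⟩) | ⟨x, rfl⟩
    · exact hj x
    · exact hθ x
    · exact he x
  | algebraMap c => rw [← F.j_hom.map_scal]; exact hj _
  | add x y _ _ hx hy => exact hadd _ _ hx hy
  | mul x y _ _ hx hy => exact hmul _ _ hx hy

theorem hom_ext {Z : Type u} [CDGA Z] {h h' : S → Z} (hh : IsGrHom h) (hh' : IsGrHom h')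
    (h1 : ∀ r, h (F.j r) = h' (F.j r)) (h2 : ∀ g, h (F.θS g) = h' (F.θS g))
    (h3 : ∀ x, h (F.e x) = h' (F.e x)) (y : S) : h y = h' y :=
  F.gen (p := fun y => h y = h' y) h1 h2 h3
    (fun y z hy hz => by rw [hh.map_add, hh'.map_add, hy, hz])
    (fun y z hy hz => by rw [hh.map_mul, hh'.map_mul, hy, hz]) y

theorem nonpos_S (F : FreeStalk R S) : NonPos S := fun i y hi => by
  have zero : ∀ i : ℤ, 0 < i → (0 : S) = 0 := fun _ _ => rfl
  refine F.gen (p := fun y => ∀ i, 0 < i → pr i y = 0) (fun r i hi => ?_) (fun g i hi => ?_)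
    (fun x i hi => ?_) (fun y z hy hz i hi => by rw [map_add, hy i hi, hz i hi, add_zero])
    (fun y z hy hz i => graded_mul (p := fun i y => 0 < i → y = 0) zero
      (fun i a b ha hb hi => by rw [ha hi, hb hi, add_zero])
      (fun i k a b _ _ ha hb h => by
        rcases lt_or_ge 0 i with h' | h'
        · rw [ha h', zero_mul]
        · rw [hb (by omega), mul_zero]) hy hz i) y i hi
  · rw [← F.j_hom.map_pr, F.nonpos i r hi, F.j_hom.map_zero]
  · rw [← F.θS_deg, pr_ne _ _ _ (by omega)]
  · rw [← F.deg_e, pr_ne _ _ _ (by have := F.deg_neg x; omega)]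

theorem d_θS (g : F.H) : d (F.θS g) = 0 :=
  F.nonpos_S.eq_zero one_pos (by simpa using d_hom (F.θS_deg g))

/-! ### The subalgebra generated by `R` and the elements of degree zero -/

/-- The subalgebra `R ⊗ S⁰`. -/
def sub : Subalgebra ℂ S := Algebra.adjoin ℂ (Set.range F.j ∪ Set.range F.θS)

theorem sub_pr (i : ℤ) (y : S) (hy : y ∈ F.sub) : pr i y ∈ F.sub := by
  refine adjoin_graded ?_ i y hy
  rintro _ (⟨x, rfl⟩ | ⟨x, rfl⟩) i
  · exact .inl (.inl ⟨pr i x, F.j_hom.map_pr i x⟩)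
  · rcases eq_or_ne i 0 with rfl | h
    · exact .inl (.inr ⟨x, (F.θS_deg x).symm⟩)
    · rw [← F.θS_deg x, pr_ne _ _ _ h]; exact .inr rfl

theorem sub_induction {p : S → Prop} (hj : ∀ r, p (F.j r)) (hθ : ∀ g, p (F.θS g))
    (hadd : ∀ y z, p y → p z → p (y + z)) (hmul : ∀ y z, p y → p z → y ∈ F.sub → p (y * z))
    {y : S} (hy : y ∈ F.sub) : p y := by
  induction hy using Algebra.adjoin_induction with
  | mem y hy =>
    rcases hy with ⟨x, rfl⟩ | ⟨x, rfl⟩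
    · exact hj x
    · exact hθ x
  | algebraMap c => rw [← F.j_hom.map_scal]; exact hj _
  | add x y _ _ hx hy => exact hadd _ _ hx hy
  | mul x y hx' _ hx hy => exact hmul _ _ hx hy hx'

theorem j_mem (r : R) : F.j r ∈ F.sub := Algebra.subset_adjoin (.inl ⟨r, rfl⟩)

theorem θS_mem (g : F.H) : F.θS g ∈ F.sub := Algebra.subset_adjoin (.inr ⟨g, rfl⟩)

theorem sub_inv {y : S} (hy : y ∈ F.sub) : inv y ∈ F.sub := by
  rw [← sum_pr y, map_sum]
  refine sum_mem fun i _ => ?_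
  rw [inv_pr]
  exact F.sub.smul_mem (F.sub_pr i y hy) _

theorem sub_d (y : S) (hy : y ∈ F.sub) : d y ∈ F.sub := by
  refine (F.sub_induction (p := fun y => y ∈ F.sub ∧ d y ∈ F.sub) (fun r => ⟨F.j_mem r, ?_⟩)
    (fun g => ⟨F.θS_mem g, ?_⟩) (fun y z hy hz => ⟨add_mem hy.1 hz.1, ?_⟩)
    (fun y z hy hz _ => ⟨mul_mem hy.1 hz.1, ?_⟩) hy).2
  · rw [← F.j_hom.map_d]; exact F.j_mem _
  · rw [F.d_θS]; exact zero_mem _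
  · rw [map_add]; exact add_mem hy.2 hz.2
  · rw [d_mul]; exact add_mem (mul_mem hy.2 hz.1) (mul_mem (F.sub_inv hy.1) hz.2)

/-- The DG algebra `R ⊗ S⁰`. -/
def M : Type u := F.sub

instance : Ring F.M := inferInstanceAs (Ring F.sub)

instance : Algebra ℂ F.M := inferInstanceAs (Algebra ℂ F.sub)

instance : CDGA F.M where
  pr i :=
    { toFun := fun y => ⟨pr i y.1, F.sub_pr i _ y.2⟩
      map_add' := fun x y => Subtype.ext (map_add _ _ _)
      map_smul' := fun c x => Subtype.ext (map_smul _ _ _) }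
  d :=
    { toFun := fun y => ⟨d y.1, F.sub_d _ y.2⟩
      map_add' := fun x y => Subtype.ext (map_add _ _ _)
      map_smul' := fun c x => Subtype.ext (map_smul _ _ _) }
  pr_self i a := Subtype.ext (pr_self i a.1)
  pr_ne i k a h := Subtype.ext (pr_ne i k a.1 h)
  pr_one := Subtype.ext pr_one
  pr_mul i k a b := Subtype.ext (pr_mul i k a.1 b.1)
  comm i k a b := Subtype.ext (comm i k a.1 b.1)
  d_pr i a := Subtype.ext (d_pr i a.1)
  d_d a := Subtype.ext (d_d a.1)
  leibniz i a b := Subtype.ext (leibniz i a.1 b.1)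
  exists_sum a := ⟨supp a.1, Subtype.ext <|
    (map_sum F.sub.val (fun i => (⟨pr i a.1, F.sub_pr i _ a.2⟩ : F.sub)) _).trans (sum_pr a.1)⟩

/-- The inclusion of `R ⊗ S⁰`. -/
def val (y : F.M) : S := y.1

theorem val_hom : IsDGHom F.val := ⟨⟨fun _ _ => rfl, fun _ _ => rfl, fun _ => rfl, fun _ _ => rfl⟩,
  fun _ => rfl⟩

/-- The inclusion of `R`. -/
def jM (r : R) : F.M := ⟨F.j r, F.j_mem r⟩

theorem jM_hom : IsDGHom F.jM where
  map_add _ _ := Subtype.ext (F.j_hom.map_add _ _)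
  map_mul _ _ := Subtype.ext (F.j_hom.map_mul _ _)
  map_scal _ := Subtype.ext (F.j_hom.map_scal _)
  map_pr _ _ := Subtype.ext (F.j_hom.map_pr _ _)
  map_d _ := Subtype.ext (F.j_hom.map_d _)

/-- Functions as elements of `R ⊗ S⁰`. -/
def θM : F.H →ₐ[ℂ] F.M := F.θS.codRestrict F.sub F.θS_mem

theorem val_θM (g : F.H) : F.val (F.θM g) = F.θS g := rfl

theorem θM_deg (g : F.H) : pr 0 (F.θM g) = F.θM g := Subtype.ext (F.θS_deg g)

theorem θM_fst (g) : F.θM (Hol.fst F.n g) = F.jM (F.θ g) := Subtype.ext (F.θS_fst g)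

theorem θM_ker {g : F.H} : F.θM g = 0 ↔ F.θS g = 0 :=
  ⟨fun h => congrArg F.val h, fun h => Subtype.ext h⟩

theorem d_θM (g : F.H) : d (F.θM g) = 0 := Subtype.ext (F.d_θS g)

theorem M_induction {p : F.M → Prop} (hj : ∀ r, p (F.jM r)) (hθ : ∀ g, p (F.θM g))
    (hadd : ∀ y z, p y → p z → p (y + z)) (hmul : ∀ y z, p y → p z → p (y * z)) (y : F.M) : p y := by
  obtain ⟨y, hy⟩ := y
  suffices h : ∃ h : y ∈ F.sub, p ⟨y, h⟩ from h.choose_spec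
  refine F.sub_induction (p := fun y => ∃ h : y ∈ F.sub, p ⟨y, h⟩) (fun r => ⟨F.j_mem r, hj r⟩)
    (fun g => ⟨F.θS_mem g, hθ g⟩) ?_ ?_ hy
  · rintro y z ⟨hy, hy'⟩ ⟨hz, hz'⟩; exact ⟨add_mem hy hz, hadd _ _ hy' hz'⟩
  · rintro y z ⟨hy, hy'⟩ ⟨hz, hz'⟩ _; exact ⟨mul_mem hy hz, hmul _ _ hy' hz'⟩

theorem M_hom_ext {Z : Type u} [CDGA Z] {h h' : F.M → Z} (hh : IsGrHom h) (hh' : IsGrHom h')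
    (h1 : ∀ r, h (F.jM r) = h' (F.jM r)) (h2 : ∀ g, h (F.θM g) = h' (F.θM g)) (y : F.M) :
    h y = h' y :=
  F.M_induction (p := fun y => h y = h' y) h1 h2
    (fun y z hy hz => by rw [hh.map_add, hh'.map_add, hy, hz])
    (fun y z hy hz => by rw [hh.map_mul, hh'.map_mul, hy, hz]) y

theorem M_dg {Z : Type u} [CDGA Z] {h : F.M → Z} (hh : IsGrHom h)
    (h1 : IsDGHom (fun r => h (F.jM r))) (h2 : ∀ g, d (h (F.θM g)) = 0) : IsDGHom h :=
  hh.toDG fun y => F.M_induction (p := fun y => h (d y) = d (h y))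
    (fun r => by rw [← F.jM_hom.map_d]; exact h1.map_d r)
    (fun g => by rw [F.d_θM, hh.map_zero, h2])
    (fun y z hy hz => by rw [map_add, hh.map_add, hh.map_add, map_add, hy, hz])
    (fun y z hy hz => by
      rw [d_mul, hh.map_add, hh.map_mul, hh.map_mul, hh.map_mul, d_mul, hy, hz, hh.map_inv]) y

/-- A homomorphism on `M` restricts to one on `R` and one on functions, and the latter respects the
relations. The universal property of `S` over `R` therefore reads as freeness over `M`. -/
theorem freeOn_M : FreeOn F.val F.deg F.e := by
  refine FreeOn.mk' F.val_hom.toIsGrHom F.deg_e fun Z _ ψ hψ c hc => ?_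
  obtain ⟨h, ⟨hh, h1, h2, h3⟩, -⟩ := F.universal Z (fun r => ψ (F.jM r)) (hψ.comp F.jM_hom.toIsGrHom)
    ({ toFun := fun g => ψ (F.θM g)
       map_one' := by rw [map_one, hψ.map_one]
       map_mul' := fun _ _ => by rw [map_mul, hψ.map_mul]
       map_zero' := by rw [map_zero, hψ.map_zero]
       map_add' := fun _ _ => by rw [map_add, hψ.map_add]
       commutes' := fun c => by rw [AlgHom.commutes, hψ.map_scal] } : F.H →ₐ[ℂ] Z)
    (fun g => hψ.hom (F.θM_deg g)) (fun g => congrArg ψ (F.θM_fst g))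
    (fun g hg => by
      change ψ (F.θM g) = 0
      rw [F.θM_ker.2 hg, hψ.map_zero]) c hc
  have hext : ∀ s, h (F.val s) = ψ s :=
    F.M_hom_ext (hh.comp F.val_hom.toIsGrHom) hψ h1 h2
  refine ⟨h, ⟨hh, hext, h3⟩, ?_⟩
  rintro h' ⟨hh', h1', h3'⟩
  exact funext (F.hom_ext hh' hh (fun r => (h1' (F.jM r)).trans (h1 r).symm)
    (fun g => (h1' (F.θM g)).trans (h2 g).symm) fun x => (h3' x).trans (h3 x).symm)

/-- Obtained by sending the generators of negative degree to zero and restricting to `M`. -/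
theorem M_lift {Z : Type u} [CDGA Z] {ψ : R → Z} (hψ : IsGrHom ψ) (χ : F.H →ₐ[ℂ] Z)
    (h0 : ∀ g, pr 0 (χ g) = χ g) (h1 : ∀ g, χ (Hol.fst F.n g) = ψ (F.θ g))
    (h2 : ∀ g, F.θS g = 0 → χ g = 0) :
    ∃ h : F.M → Z, IsGrHom h ∧ (∀ r, h (F.jM r) = ψ r) ∧ ∀ g, h (F.θM g) = χ g := by
  obtain ⟨h, ⟨hh, h1, h2, -⟩, -⟩ := F.universal Z ψ hψ χ h0 h1 h2 0 fun x => map_zero _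
  exact ⟨fun y => h (F.val y), hh.comp F.val_hom.toIsGrHom, h1, h2⟩

end FreeStalk

/-! ## The Koszul resolution -/

namespace FreeStalk

variable {R S : Type u} [CDGA R] [CDGA S] (F : FreeStalk R S)

theorem exists_root (i : Fin F.n) : ∃ g : Hol (Fin F.N → ℂ) F.z, F.θ g = F.μ (F.θS (Hol.coord F.z i)) :=
  F.θ_surj _ (F.μ_hom.hom (F.θS_deg _))

/-- Functions on the base that represent the values of the augmentation on the coordinates. -/
def α (i : Fin F.n) : (Fin F.N → ℂ) → ℂ := (F.exists_root i).choose.1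

theorem α_analytic (i : Fin F.n) : AnalyticAt ℂ (F.α i) F.z := (F.exists_root i).choose.2

theorem θ_α (i : Fin F.n) : F.θ ⟨F.α i, F.α_analytic i⟩ = F.μ (F.θS (Hol.coord F.z i)) :=
  (F.exists_root i).choose_spec

/-- The functions `t_i - α_i`. -/
def dif (i : Fin F.n) : F.H := Hol.dif F.α_analytic i

theorem μ_dif (i : Fin F.n) : F.μ (F.θS (F.dif i)) = 0 := by
  rw [dif, Hol.dif, map_sub, F.μ_hom.map_sub, ← F.θ_α, F.θS_fst, F.μ_j, sub_self]

/-- If `α_i` did not vanish at the base point, `t_i - α_i` would be a unit near it. The augmentation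
kills this element, so `1 = 0` in `R` and hence in `S`, which is impossible because all equations
`f_i` vanish at the base point. -/
theorem α_zero (i : Fin F.n) : F.α i F.z = 0 := by
  by_contra h
  have h0 : (F.dif i).1 (F.z, 0) ≠ 0 := by
    change (0 : Fin F.n → ℂ) i - F.α i F.z ≠ 0
    simpa using h
  let g : F.H := ⟨fun x => ((F.dif i).1 x)⁻¹, (F.dif i).2.inv h0⟩
  have h1 : F.θS (F.dif i * g) = F.θS 1 := by
    refine F.ker_of_eventually ?_
    filter_upwards [(F.dif i).2.continuousAt.eventually_ne h0] with x hx
    exact mul_inv_cancel₀ hx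
  have h2 : (1 : R) = 0 := by
    rw [← F.μ_hom.map_one, ← map_one F.θS, ← h1, map_mul, F.μ_hom.map_mul, F.μ_dif, zero_mul]
  have h3 : F.θS 1 = 0 := by rw [map_one, ← F.j_hom.map_one, h2, F.j_hom.map_zero]
  obtain ⟨a, ha⟩ := (F.ker _).1 h3
  have := ha.self_of_nhds
  simp [F.f_zero] at this

/-- Substitution of `α_i` for the first `m` coordinates. -/
def subst (m : ℕ) : F.H →ₐ[ℂ] F.H := Hol.subst F.α_analytic F.α_zero m

/-- The relations `f_i` depend on `z` alone, and the substitution leaves `z` fixed. -/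
theorem subst_ker (m : ℕ) {g : F.H} (hg : F.θS g = 0) : F.θS (F.subst m g) = 0 := by
  obtain ⟨a, ha⟩ := (F.ker _).1 hg
  refine (F.ker _).2 ⟨fun i => F.subst m (a i), ?_⟩
  have ht : Tendsto (Hol.substMap F.α m) (𝓝 (F.z, 0)) (𝓝 (F.z, 0)) := by
    have := (Hol.substMap_analytic F.α_analytic m).continuousAt.tendsto
    rwa [Hol.substMap_self F.α_zero] at this
  exact ht.eventually ha

theorem exists_em (m : ℕ) : ∃ h : F.M → F.M, IsDGHom h ∧ (∀ r, h (F.jM r) = F.jM r) ∧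
    ∀ g, h (F.θM g) = F.θM (F.subst m g) := by
  obtain ⟨h, hh, h1, h2⟩ := F.M_lift F.jM_hom.toIsGrHom (F.θM.comp (F.subst m))
    (fun g => F.θM_deg _) (fun g => F.θM_fst g) (fun g hg => F.θM_ker.2 (F.subst_ker m hg))
  exact ⟨h, F.M_dg hh (by rw [funext h1]; exact F.jM_hom) (fun g => by
    rw [h2]; exact F.d_θM _), h1, h2⟩

/-- Substitution of `α_i` for the first `m` coordinates. -/
def em (m : ℕ) : F.M → F.M := (F.exists_em m).choose

theorem em_hom (m : ℕ) : IsDGHom (F.em m) := (F.exists_em m).choose_spec.1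

theorem em_j (m : ℕ) (r : R) : F.em m (F.jM r) = F.jM r := (F.exists_em m).choose_spec.2.1 r

theorem em_θ (m : ℕ) (g : F.H) : F.em m (F.θM g) = F.θM (F.subst m g) :=
  (F.exists_em m).choose_spec.2.2 g

theorem em_zero (y : F.M) : F.em 0 y = y :=
  F.M_hom_ext (F.em_hom 0).toIsGrHom IsGrHom.refl (F.em_j 0) (fun g => by
    rw [F.em_θ, subst, Hol.subst_zero]) y

theorem em_em {l m : ℕ} (h : l ≤ m) (y : F.M) : F.em m (F.em l y) = F.em m y :=
  F.M_hom_ext ((F.em_hom m).comp (F.em_hom l)).toIsGrHom (F.em_hom m).toIsGrHom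
    (fun r => by rw [F.em_j, F.em_j]) (fun g => by
      rw [F.em_θ, F.em_θ, F.em_θ, subst, subst, Hol.subst_subst _ _ h]) y

/-- The elements `t_i - α_i`. -/
def tbar (i : Fin F.n) : F.M := F.θM (F.dif i)

theorem em_tbar_lt (m : ℕ) (i : Fin F.n) (h : i.1 < m) : F.em m (F.tbar i) = 0 := by
  rw [tbar, F.em_θ, subst, dif, Hol.subst_dif_lt _ _ _ _ h, map_zero]

theorem em_tbar_ge (m : ℕ) (i : Fin F.n) (h : m ≤ i.1) : F.em m (F.tbar i) = F.tbar i := by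
  rw [tbar, F.em_θ, subst, dif, Hol.subst_dif_ge _ _ _ _ h]

/-- The elements `t_i - α_i` as cocycles. -/
def cocycle (i : Fin F.n) : Cocycle0 F.M := ⟨F.tbar i, F.θM_deg _, F.d_θM _⟩

/-- The quotients `(g_m - g_{m+1}) / (t_m - α_m)`. -/
def quo (m : Fin F.n) (g : F.H) : F.H := Hol.quo F.α_analytic F.α_zero m g

theorem quo_spec (m : Fin F.n) (g : F.H) : ∀ᶠ x in 𝓝 (F.z, (0 : Fin F.n → ℂ)),
    (F.subst m g).1 x = (F.subst (m + 1) g).1 x + (F.dif m).1 x * (F.quo m g).1 x :=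
  Hol.quo_spec _ _ m g

theorem quo_unique (m : Fin F.n) {g q : F.H} (h : ∀ᶠ x in 𝓝 (F.z, (0 : Fin F.n → ℂ)),
    (F.subst m g).1 x = (F.subst (m + 1) g).1 x + (F.dif m).1 x * q.1 x) :
    F.θM (F.quo m g) = F.θM q :=
  Subtype.ext (F.ker_of_eventually (Hol.quo_unique _ _ m h))

/-- Division by `t_m - α_m` is linear over functions of `z`. If `g` is a combination of the `f_i`,
then by `quo_unique` its quotient is the combination with divided coefficients. -/
theorem quo_ker (m : Fin F.n) {g : F.H} (hg : F.θS g = 0) : F.θM (F.quo m g) = 0 := by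
  obtain ⟨a, ha⟩ := (F.ker _).1 hg
  let q : F.H := ∑ i, F.quo m (a i) * Hol.fst F.n ⟨F.f i, F.f_analytic i⟩
  have hq : ∀ x, q.1 x = ∑ i, (F.quo m (a i)).1 x * F.f i x.1 := fun x => by
    simp only [q, AddSubmonoidClass.coe_finsetSum, Finset.sum_apply]
    rfl
  rw [F.quo_unique m (q := q), F.θM_ker]
  · exact (F.ker _).2 ⟨fun i => F.quo m (a i), Eventually.of_forall hq⟩
  · have ht : ∀ m, Tendsto (Hol.substMap F.α m) (𝓝 (F.z, 0)) (𝓝 (F.z, 0)) := fun m => by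
      have := (Hol.substMap_analytic F.α_analytic m).continuousAt.tendsto
      rwa [Hol.substMap_self F.α_zero] at this
    have h1 : ∀ m, ∀ᶠ x in 𝓝 (F.z, (0 : Fin F.n → ℂ)), (F.subst m g).1 x =
        ∑ i, (F.subst m (a i)).1 x * F.f i x.1 := fun m => (ht m).eventually ha
    filter_upwards [h1 m, h1 (m + 1), eventually_all.2 fun i => F.quo_spec m (a i)] with x e1 e2 e3
    rw [e1, e2, hq, Finset.mul_sum, ← Finset.sum_add_distrib]
    refine Finset.sum_congr rfl fun i _ => ?_
    rw [e3]; ring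

/-- The homomorphism `g ↦ g_{m+1} + x (g_m - g_{m+1}) / (t_m - α_m)`. -/
def splitAlg (m : Fin F.n) : F.H →ₐ[ℂ] SplitExt (F.cocycle m) where
  toFun g := ⟨F.θM (F.subst (m + 1) g), F.θM (F.quo m g)⟩
  map_one' := by
    rw [F.quo_unique m (q := 0) (Eventually.of_forall fun x => ?_)]
    · ext <;> simp
    · simp
  map_zero' := by
    rw [F.quo_unique m (q := 0) (Eventually.of_forall fun x => ?_)]
    · ext <;> simp
    · simp
  map_add' g g' := by
    rw [F.quo_unique m (q := F.quo m g + F.quo m g')]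
    · ext <;> simp
    · filter_upwards [F.quo_spec m g, F.quo_spec m g'] with x h1 h2
      simp only [map_add, Subalgebra.coe_add, Pi.add_apply, h1, h2]
      ring
  map_mul' g g' := by
    rw [F.quo_unique m (q := F.quo m g * F.subst (m + 1) g' + F.subst (m + 1) g * F.quo m g' +
      F.dif m * F.quo m g * F.quo m g')]
    · refine SplitExt.ext ?_ ?_
      · change F.θM (F.subst (m + 1) g * F.subst (m + 1) g') = _
        rw [map_mul]; rfl
      · change F.θM (F.quo m g * F.subst (m + 1) g' + F.subst (m + 1) g * F.quo m g' +
          F.dif m * F.quo m g * F.quo m g') = _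
        rw [map_add, map_add, map_mul, map_mul, map_mul, map_mul]; rfl
    · filter_upwards [F.quo_spec m g, F.quo_spec m g'] with x h1 h2
      simp only [map_mul, Subalgebra.coe_mul, Subalgebra.coe_add, Pi.mul_apply, Pi.add_apply, h1, h2]
      ring
  commutes' c := by
    rw [F.quo_unique m (q := 0) (Eventually.of_forall fun x => ?_)]
    · ext <;> simp [SplitExt.algebraMap_eq]
    · simp

theorem exists_split (m : Fin F.n) : ∃ h : F.M → SplitExt (F.cocycle m), IsDGHom h ∧
    (∀ r, h (F.jM r) = ⟨F.jM r, 0⟩) ∧ ∀ g, h (F.θM g) = F.splitAlg m g := by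
  obtain ⟨h, hh, h1, h2⟩ := F.M_lift (SplitExt.inl_hom.comp F.jM_hom).toIsGrHom (F.splitAlg m)
    (fun g => by ext <;> exact F.θM_deg _)
    (fun g => by
      change SplitExt.mk _ _ = _
      rw [F.quo_unique m (q := 0)]
      · ext
        · exact F.θM_fst g
        · simp
      · exact Eventually.of_forall fun x => by simp [subst, Hol.subst_fst])
    (fun g hg => by
      change SplitExt.mk _ _ = _
      rw [F.quo_ker m hg, F.θM_ker.2 (F.subst_ker _ hg)]; rfl)
  refine ⟨h, F.M_dg hh (by rw [funext h1]; exact SplitExt.inl_hom.comp F.jM_hom) (fun g => ?_), h1, h2⟩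
  rw [h2]
  ext <;> exact F.d_θM _

/-- The division operator `(e_m - e_{m+1}) / (t_m - α_m)`. -/
def Qm (m : Fin F.n) (y : F.M) : F.M := ((F.exists_split m).choose y).2

theorem split_eq (m : Fin F.n) (y : F.M) : (F.exists_split m).choose y = ⟨F.em (m + 1) y, F.Qm m y⟩ := by
  have h := (F.exists_split m).choose_spec
  ext
  · exact F.M_hom_ext ((SplitExt.fst_hom.comp h.1).toIsGrHom) (F.em_hom _).toIsGrHom
      (fun r => by rw [h.2.1, F.em_j]) (fun g => by rw [h.2.2, F.em_θ]; rfl) y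
  · rfl

/-- Evaluating the splitting homomorphism at `x = t_m - α_m` gives a homomorphism that agrees with
`em m` on `R` and on functions. Thus the division formula for functions spreads to all of `M`. -/
theorem em_eq (m : Fin F.n) (y : F.M) : F.em m y = F.em (m + 1) y + F.tbar m * F.Qm m y := by
  have h := (F.exists_split m).choose_spec
  have := F.M_hom_ext (F.em_hom m).toIsGrHom ((SplitExt.ev_hom.comp h.1).toIsGrHom)
    (fun r => by rw [h.2.1, F.em_j]; simp) (fun g => by
      rw [h.2.2, F.em_θ]
      change _ = F.θM (F.subst (m + 1) g) + F.θM (F.dif m) * F.θM (F.quo m g)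
      rw [← map_mul, ← map_add]
      exact Subtype.ext (F.ker_of_eventually (F.quo_spec m g))) y
  rw [this, F.split_eq]
  rfl

theorem Qm_d (m : Fin F.n) (y : F.M) : F.Qm m (d y) = d (F.Qm m y) :=
  congrArg SplitExt.snd ((F.exists_split m).choose_spec.1.map_d y)

theorem Qm_neg (m : Fin F.n) (y : F.M) : F.Qm m (-y) = -F.Qm m y :=
  congrArg SplitExt.snd ((F.exists_split m).choose_spec.1.map_neg y)

theorem Qm_zero (m : Fin F.n) : F.Qm m 0 = 0 :=
  congrArg SplitExt.snd ((F.exists_split m).choose_spec.1.map_zero)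

/-- The multiplicativity of the splitting homomorphism is a twisted Leibniz rule for `Qm`; here `Qm`
of the first factor is `1` and `em (m + 1)` of it is `0`. On elements fixed by `em m` this inverts
multiplication by `t_m - α_m`, which is the regularity behind the Koszul resolution. -/
theorem Qm_tbar_mul (m : Fin F.n) (y : F.M) : F.Qm m (F.tbar m * y) = F.em m y := by
  have h := (F.exists_split m).choose_spec.1.map_mul (F.tbar m) y
  rw [F.split_eq, F.split_eq, F.split_eq, F.em_tbar_lt _ _ (Nat.lt_succ_self _)] at h
  have h1 : F.Qm m (F.tbar m) = 1 := by
    have := congrArg SplitExt.snd ((F.exists_split m).choose_spec.2.2 (F.dif m))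
    refine Eq.trans this (Eq.trans (F.quo_unique m (q := 1) ?_) (map_one _))
    refine Eventually.of_forall fun x => ?_
    rw [subst, subst, dif, Hol.subst_dif_ge _ _ _ _ le_rfl, Hol.subst_dif_lt _ _ _ _ (Nat.lt_succ_self _)]
    simp
  have := congrArg SplitExt.snd h
  simp only [SplitExt.mul_snd, h1] at this
  rw [this, F.em_eq m y]
  simp [cocycle]

/-- After all coordinates are replaced by functions of `z`, an element of `M` comes from `R`. Each
substitution changes it by a multiple of some `t_m - α_m`, which the augmentation kills, so its
value is the augmentation. -/
theorem em_n (y : F.M) : F.em F.n y = F.jM (F.μ (F.val y)) := by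
  have hμ : IsGrHom (fun y => F.μ (F.val y)) := (F.μ_hom.comp F.val_hom).toIsGrHom
  have hm : ∀ m ≤ F.n, ∀ y, F.μ (F.val (F.em m y)) = F.μ (F.val y) := by
    intro m
    induction m with
    | zero => intro _ y; rw [F.em_zero]
    | succ m ih =>
      intro hm y
      have h1 : F.em m y = _ := F.em_eq ⟨m, hm⟩ y
      rw [← ih (by omega) y, h1, hμ.map_add, hμ.map_mul,
        show F.μ (F.val (F.tbar ⟨m, hm⟩)) = 0 from F.μ_dif _, zero_mul, add_zero]
  refine F.M_hom_ext (F.em_hom _).toIsGrHom (F.jM_hom.toIsGrHom.comp hμ)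
    (fun r => by rw [F.em_j]; exact congrArg F.jM (F.μ_j r).symm) (fun g => ?_) y
  rw [← hm F.n le_rfl, F.em_θ]
  have : F.subst F.n g = Hol.fst F.n (Hol.comp (fun z => (z, fun i => F.α i z))
      (analyticAt_id.prod (AnalyticAt.pi fun i => F.α_analytic i)) (by
        ext i <;> simp [F.α_zero]) g) := by
    ext x
    refine congrArg g.1 (a₁ := Hol.substMap F.α F.n x) (a₂ := (x.1, fun i => F.α i x.1)) ?_
    ext i <;> simp [Hol.substMap]
  rw [this, F.val_θM, F.θS_fst, F.μ_j, F.θM_fst]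

/-- A Koszul algebra for the first `m` of the elements `t_i - α_i`. -/
structure Koszul (m : ℕ) (hm : m ≤ F.n) where
  K : Type u
  [cdga : CDGA K]
  a : F.M → K
  a_hom : IsDGHom a
  u : Fin m → K
  free : FreeOn a (fun _ => (-1 : ℤ)) u
  d_u : ∀ i, d (u i) = a (F.tbar (i.castLE hm))
  ρ : K → F.M
  ρ_hom : IsDGHom ρ
  ρ_a : ∀ y, ρ (a y) = F.em m y
  ρ_u : ∀ i, ρ (u i) = 0
  acyclic : ∀ z : K, d z = 0 → ∃ f w, F.em m f = f ∧ z = a f + d w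

attribute [instance] Koszul.cdga

theorem koszul_zero : Nonempty (F.Koszul 0 (Nat.zero_le _)) := ⟨
  { K := F.M
    a := fun y => y
    a_hom := IsDGHom.id
    u := Fin.elim0
    free :=
      { hom := IsGrHom.refl
        deg_e := fun x => x.elim0
        gen := fun p h _ _ _ y => h y
        universal := fun Z _ ψ hψ c hc => ⟨ψ, hψ, fun _ => rfl, fun x => x.elim0⟩ }
    d_u := fun x => x.elim0
    ρ := fun y => y
    ρ_hom := IsDGHom.id
    ρ_a := fun y => (F.em_zero y).symm
    ρ_u := fun x => x.elim0
    acyclic := fun z _ => ⟨z, 0, F.em_zero z, by simp⟩ }⟩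

/-- One variable `ε` with `dε = t_m - α_m` is adjoined. A cocycle `z0 + ε z1` has `z1` a cocycle of
the previous stage, hence an element `f1` of `M` up to a boundary. Division by `t_m - α_m` shows
that `f1` is a boundary too, and what remains of `z0` is divided once more. -/
theorem koszul_succ (m : ℕ) (hm : m + 1 ≤ F.n) (X : F.Koszul m (by omega)) :
    Nonempty (F.Koszul (m + 1) hm) := by
  let i : Fin F.n := ⟨m, hm⟩
  let D := koszulData (X.a (F.tbar i)) (X.a_hom.hom (F.θM_deg _)) (by
    rw [← X.a_hom.map_d, show d (F.tbar i) = 0 from F.d_θM _, X.a_hom.map_zero])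
  let K := DN D
  let inl : X.K → K := fun x => ⟨x, 0⟩
  let ε : K := ⟨0, 1⟩
  have hinl : IsDGHom inl := (DN.inl_hom D).toDG fun x => by
    ext
    · simp [inl]
    · simp only [DN.d_snd, inl, map_zero, sub_zero]; rfl
  have dmk : ∀ x y : X.K, d (⟨x, y⟩ : K) = ⟨d x + X.a (F.tbar i) * y, -d y⟩ := fun x y => by
    ext
    · rfl
    · exact zero_sub _
  have hρ : IsDGHom (fun x : K => F.em (m + 1) (X.ρ x.1)) :=
    ((F.em_hom (m + 1)).toIsGrHom.comp (X.ρ_hom.toIsGrHom.comp (DN.fst_hom D))).toDG fun x => by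
      have := F.em_tbar_lt (m + 1) i (Nat.lt_succ_self _)
      have h2 := F.em_tbar_ge m i le_rfl
      rw [DN.d_fst, X.ρ_hom.map_add, X.ρ_hom.map_mul, X.ρ_hom.map_d,
        show X.ρ D.t = F.em m (F.tbar i) from X.ρ_a _, (F.em_hom _).map_add, (F.em_hom _).map_mul,
        h2, this, zero_mul, add_zero, (F.em_hom _).map_d]
  let σ : Fin (m + 1) ≃ Fin m ⊕ Fin 1 := finSumFinEquiv.symm
  let u : Fin (m + 1) → K := fun k => Sum.elim (fun x => inl (X.u x)) (fun _ => ε) (σ k)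
  have hσ1 : ∀ x : Fin m, (σ.symm (.inl x)).castLE hm = x.castLE (by omega) := fun x =>
    Fin.ext (by simp [σ])
  have hσ2 : ∀ x : Fin 1, (σ.symm (.inr x)).castLE hm = i := fun x =>
    Fin.ext (by simp [σ, i])
  have hu1 : ∀ x, u (σ.symm (.inl x)) = inl (X.u x) := fun x => by simp [u]
  have hu2 : ∀ x, u (σ.symm (.inr x)) = ε := fun x => by simp [u]
  refine ⟨{
    K := K
    a := fun y => inl (X.a y)
    a_hom := hinl.comp X.a_hom
    u := u
    free := ?_
    d_u := ?_
    ρ := _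
    ρ_hom := hρ
    ρ_a := ?_
    ρ_u := ?_
    acyclic := ?_ }⟩
  · have := (X.free.trans ((DN.freeOn D).reindex (Equiv.ofUnique (Fin 1) Unit))).reindex σ
    have e1 : (fun x => Sum.elim (fun _ : Fin m => (-1 : ℤ)) (fun _ => D.k) (σ x)) = fun _ => -1 :=
      funext fun x => by rcases σ x with x | x <;> rfl
    rwa [e1] at this
  · intro k
    obtain ⟨s, rfl⟩ := σ.symm.surjective k
    rcases s with x | x
    · rw [hu1, hσ1, ← hinl.map_d, X.d_u]
    · rw [hu2, hσ2, dmk]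
      simp [inl, d_one]
  · intro y
    simp only [inl, X.ρ_a, F.em_em (Nat.le_succ m)]
  · intro k
    obtain ⟨s, rfl⟩ := σ.symm.surjective k
    rcases s with x | x
    · rw [hu1]; simp only [inl, X.ρ_u, (F.em_hom _).map_zero]
    · rw [hu2]; simp only [ε, X.ρ_hom.map_zero, (F.em_hom _).map_zero]
  · rintro ⟨z0, z1⟩ hz
    rw [dmk] at hz
    have hz0 : d z0 + X.a (F.tbar i) * z1 = 0 := congrArg DN.fst hz
    have hz1 : d z1 = 0 := neg_eq_zero.1 (congrArg DN.snd hz)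
    obtain ⟨f1, w1, hf1, rfl⟩ := X.acyclic z1 hz1
    have tcl : d (F.tbar i) = 0 := F.d_θM _
    have tinv : ∀ y : F.M, d (F.tbar i * y) = F.tbar i * d y := fun y => by
      rw [d_mul, tcl, inv_hom (show pr 0 (F.tbar i) = F.tbar i from F.θM_deg _), sgn_zero, one_smul]; simp
    have tcl' : d (X.a (F.tbar i)) = 0 := by rw [← X.a_hom.map_d, tcl, X.a_hom.map_zero]
    have tinv' : ∀ y : X.K, d (X.a (F.tbar i) * y) = X.a (F.tbar i) * d y := fun y => by
      rw [d_mul, tcl', inv_hom (X.a_hom.hom (show pr 0 (F.tbar i) = F.tbar i from F.θM_deg _)), sgn_zero,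
        one_smul]; simp
    -- The exact part `d w1` of `z1` is removed by subtracting a boundary; only `f1` is left
    -- opposite to `z0'`.
    let z0' := z0 + X.a (F.tbar i) * w1
    have hz0' : d z0' = -X.a (F.tbar i * f1) := by
      rw [map_add, tinv', X.a_hom.map_mul, eq_neg_iff_add_eq_zero, ← hz0, mul_add]; abel
    -- The retraction `ρ` carries the equation `d z0' = -(t_m - α_m) f1` to `M`. Dividing it there
    -- exhibits `f1` as `-d g`.
    let g := F.Qm i (X.ρ z0')
    have hg : f1 = -d g := by
      have h1 := congrArg X.ρ hz0'
      rw [X.ρ_hom.map_d, X.ρ_hom.map_neg, X.ρ_a, (F.em_hom m).map_mul, hf1,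
        F.em_tbar_ge m i le_rfl] at h1
      have h2 := congrArg (F.Qm i) h1
      rw [F.Qm_d, F.Qm_neg, F.Qm_tbar_mul, show F.em i f1 = f1 from hf1] at h2
      rw [h2, neg_neg]
    -- With `f1 = -d g` absorbed, this is a cocycle of the previous stage.
    let z0'' := z0' - X.a (F.tbar i * g)
    have hz0'' : d z0'' = 0 := by
      rw [map_sub, hz0', ← X.a_hom.map_d, tinv, hg, mul_neg, X.a_hom.map_neg]; abel
    obtain ⟨f, w, hf, hw⟩ := X.acyclic z0'' hz0''
    have hdf : d f = 0 := by
      have h1 : X.a (d f) = 0 := by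
        rw [X.a_hom.map_d]
        rw [hw, map_add, d_d, add_zero] at hz0''
        exact hz0''
      have h2 := congrArg X.ρ h1
      rw [X.ρ_a, X.ρ_hom.map_zero, (F.em_hom m).map_d, hf] at h2
      exact h2
    have hdQ : d (F.Qm i f) = 0 := by rw [← F.Qm_d, hdf, F.Qm_zero]
    -- The multiple of `t_m - α_m` in `f` is the differential of `ε` times a cocycle, so modulo
    -- boundaries only the part fixed by `em (m + 1)` survives.
    have hf2 : f = F.em (m + 1) f + F.tbar i * F.Qm i f := by
      rw [← F.em_eq i f]; exact hf.symm
    refine ⟨F.em (m + 1) f, ⟨w, X.a (F.Qm i f) + X.a g - w1⟩, F.em_em le_rfl f, ?_⟩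
    have e1 : z0 = X.a f + d w - X.a (F.tbar i) * w1 + X.a (F.tbar i * g) := by
      rw [← hw]; simp only [z0'', z0']; abel
    rw [dmk]
    ext
    · change z0 = X.a (F.em (m + 1) f) + _
      rw [e1]
      conv_lhs => rw [hf2]
      rw [X.a_hom.map_add, X.a_hom.map_mul, X.a_hom.map_mul]
      noncomm_ring
    · change X.a f1 + d w1 = 0 + _
      rw [map_sub, map_add, ← X.a_hom.map_d, hdQ, ← X.a_hom.map_d, hg, X.a_hom.map_zero,
        X.a_hom.map_neg]
      abel

theorem exists_koszul (m : ℕ) (hm : m ≤ F.n) : Nonempty (F.Koszul m hm) := by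
  induction m with
  | zero => exact F.koszul_zero
  | succ m ih => exact F.koszul_succ m hm (ih (by omega)).some

/-- The Koszul algebra of the elements `t_i - α_i`. -/
def koszul : F.Koszul F.n le_rfl := (F.exists_koszul F.n le_rfl).some

/-- The augmentation of the Koszul algebra. -/
def koszulAug (z : F.koszul.K) : R := F.μ (F.val (F.koszul.ρ z))

theorem koszulAug_hom : IsDGHom F.koszulAug := F.μ_hom.comp (F.val_hom.comp F.koszul.ρ_hom)

theorem koszulAug_a (y : F.M) : F.koszulAug (F.koszul.a y) = F.μ (F.val y) := by
  rw [koszulAug, F.koszul.ρ_a, F.em_n]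
  exact F.μ_j _

/-- Modulo boundaries a cocycle is an element of `M` fixed by `em n`, hence by `em_n` an element of
`R`, namely its own augmentation up to a boundary in `R`. -/
theorem koszul_acyclic {z : F.koszul.K} (hz : d z = 0) (hz' : F.koszulAug z = 0) :
    ∃ w, d w = z := by
  obtain ⟨f, w, hf, rfl⟩ := F.koszul.acyclic z hz
  rw [F.koszulAug_hom.map_add, F.koszulAug_a, F.koszulAug_hom.map_d] at hz'
  have : F.koszul.a f = -d (F.koszul.a (F.jM (F.koszulAug w))) := by
    rw [← F.koszul.a_hom.map_d, ← F.jM_hom.map_d, ← neg_eq_of_add_eq_zero_right hz',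
      F.jM_hom.map_neg, F.koszul.a_hom.map_neg, neg_neg, ← F.em_n, hf]
  exact ⟨w - F.koszul.a (F.jM (F.koszulAug w)), by rw [map_sub, this]; abel⟩

end FreeStalk

namespace PathAlg

variable {A B : Type u} [CDGA A] [CDGA B]

/-- The path `τ k`. -/
def line (k : A) : PathAlg A := DN.mk (Polynomial.monomial 1 k) 0

theorem line_add (k l : A) : line (k + l) = line k + line l := by
  ext1 <;> simp [line]

theorem line_zero : line (0 : A) = 0 := by ext1 <;> simp [line]

theorem ev_line (c : ℂ) (k : A) : ev c (line k) = c • k := by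
  simp [ev, line, DGPoly.ev_monomial]

theorem line_pr (i : ℤ) (k : A) : line (pr i k) = pr i (line k) := by
  ext1
  · rw [pr_fst, line, line, DGPoly.pr_eq, DGPoly.lmap_monomial]
  · rw [pr_snd]; simp [line]

theorem lmap_line (L : A →ₗ[ℂ] B) (k : A) : lmap L (line k) = line (L k) := by
  ext1 <;> simp [lmap, line]

theorem const_mul_line (a k : A) : const a * line k = line (a * k) := by
  ext1
  · simp [const, line, Polynomial.C_mul_monomial]
  · simp [const, line]

theorem line_mul_const (a k : A) : line k * const a = line (k * a) := by
  ext1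
  · simp [const, line, Polynomial.monomial_mul_C]
  · simp [const, line]

/-- The map of path objects induced by a homomorphism. -/
theorem map_hom {L : A → B} (hL : IsDGHom L) : ∃ f : PathAlg A → PathAlg B, IsDGHom f ∧
    (∀ a, f (const a) = const (L a)) ∧ ∀ c x, ev c (f x) = L (ev c x) := by
  let L' : A →ₗ[ℂ] B := { toFun := L, map_add' := hL.map_add, map_smul' := hL.map_smul }
  refine ⟨lmap L', IsGrHom.toDG ⟨lmap_add L', fun x y => ?_, fun c => ?_, lmap_pr L' hL.map_pr⟩
    (lmap_d L' hL.map_d), lmap_const L', fun c x => ev_lmap c L' x⟩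
  · have := lmap_mul (L := L') (L₁ := L') (L₂ := L') (L₃ := 0) (L₄ := 0) hL.map_inv (by simp)
      (fun a b => by
        rw [LinearMap.zero_apply, zero_mul, add_zero]; exact hL.map_mul a b) x y
    rw [this]
    have h0 : ∀ x : PathAlg A, lmap (0 : A →ₗ[ℂ] B) x = 0 := fun x => by
      have h1 : ∀ p : Polynomial A, DGPoly.lmap (0 : A →ₗ[ℂ] B) p = 0 := fun p => by ext n; simp
      ext1 <;> simp [lmap, h1]
    rw [h0, h0]
    simp
  · rw [← const_hom.map_scal, lmap_const, ← const_hom.map_scal]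
    exact congrArg const (hL.map_scal c)

end PathAlg

/-! ## Contractible extensions -/

section contr

variable (K : Type u) [CDGA K] {ι : Type u} (dg : ι → ℤ)

/-- The relations of the extension of `K` by free contractible variables. -/
structure ContrRel (Z : Type u) [DGRing Z] (f : K → Z) (g : ι → Z) : Prop where
  hom : IsDGHom f
  deg : ∀ x, pr (dg x - 1) (g x) = g x

/-- The extension `K[η_x, dη_x]` of `K`. -/
abbrev Contr : Type u := Pres (fun Z _ => ContrRel K dg Z)

namespace Contr

variable {K dg}

/-- The inclusion of `K`. -/
def base (k : K) : Contr K dg := Pres.left k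

/-- The generators of degree `dg x - 1`. -/
def η (x : ι) : Contr K dg := Pres.right x

theorem self : ContrRel K dg (Contr K dg) base η where
  hom :=
    { map_add := fun a b => Pres.sound fun Z _ f g q => q.hom.map_add a b
      map_mul := fun a b => Pres.sound fun Z _ f g q => q.hom.map_mul a b
      map_scal := fun a => Pres.sound fun Z _ f g q => q.hom.map_scal a
      map_pr := fun i a => Pres.sound fun Z _ f g q => q.hom.map_pr i a
      map_d := fun a => Pres.sound fun Z _ f g q => q.hom.map_d a }
  deg x := Pres.sound (x := .proj _ (.right x)) (y := .right x) fun Z _ f g q => q.deg x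

instance : CDGA (Contr K dg) where
  exists_sum a := by
    change IsFinSum a
    induction a using Pres.induction with
    | hl a => exact IsFinSum.of_map self.hom a
    | hr a => exact .of_hom _ _ (self.deg a)
    | hs c => exact .of_hom 0 _ (by rw [Algebra.algebraMap_eq_smul_one, map_smul, pr_one])
    | ha x y hx hy => exact hx.add hy
    | hm x y hx hy => exact hx.mul hy
    | hd x hx => exact hx.diff
    | hp i x hx => exact .of_hom i _ (pr_self _ _)

theorem base_hom : IsDGHom (base : K → Contr K dg) := self.hom

theorem η_deg (x : ι) : pr (dg x - 1) (η x : Contr K dg) = η x := self.deg x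

theorem dη_deg (x : ι) : pr (dg x) (d (η x : Contr K dg)) = d (η x) := by
  simpa using d_hom (η_deg (K := K) (dg := dg) x)

variable {Z : Type u} [CDGA Z]

theorem dg_ext {f g : Contr K dg → Z} (hf : IsDGHom f) (hg : IsDGHom g)
    (h1 : ∀ k, f (base k) = g (base k)) (h2 : ∀ x, f (η x) = g (η x)) (y) : f y = g y := by
  induction y using Pres.induction with
  | hl a => exact h1 a
  | hr a => exact h2 a
  | hs c => rw [hf.map_scal, hg.map_scal]
  | ha x y hx hy => rw [hf.map_add, hg.map_add, hx, hy]
  | hm x y hx hy => rw [hf.map_mul, hg.map_mul, hx, hy]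
  | hd x hx => rw [hf.map_d, hg.map_d, hx]
  | hp i x hx => rw [hf.map_pr, hg.map_pr, hx]

theorem exists_dg {ψ : K → Z} (hψ : IsDGHom ψ) (c : ι → Z) (hc : ∀ x, pr (dg x - 1) (c x) = c x) :
    ∃ h : Contr K dg → Z, IsDGHom h ∧ (∀ k, h (base k) = ψ k) ∧ ∀ x, h (η x) = c x :=
  ⟨Pres.lift (Q := fun Z _ => ContrRel K dg Z) ⟨hψ, hc⟩, Pres.lift_hom _, fun _ => rfl, fun _ => rfl⟩

/-- As a graded algebra, the extension is free on the variables `η_x` and `dη_x`. -/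
theorem freeOn : FreeOn (base : K → Contr K dg) (Sum.elim dg fun x => dg x - 1)
    (Sum.elim (fun x => d (η x)) η) := by
  refine FreeOn.mk' base_hom.toIsGrHom ?_ fun Z _ ψ hψ c hc => ?_
  · rintro (x | x)
    · exact dη_deg x
    · exact η_deg x
  -- The values wanted on `η_x` and `dη_x` form the two components of a single element of `Cof Z`,
  -- the image of `η_x` under a DG homomorphism.
  · obtain ⟨h, hh, h1, h2⟩ := exists_dg (dg := dg) (Cof.lift_hom hψ)
      (fun x => ⟨ZeroD.of (c (.inr x)), ZeroD.of (c (.inl x))⟩) (fun x => by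
        ext
        · exact hc (.inr x)
        · refine Eq.trans ?_ (hc (.inl x))
          change pr (dg x - 1 - -1) (c (.inl x)) = _
          rw [sub_neg_eq_add, sub_add_cancel]; rfl)
    refine ⟨fun y => Cof.proj (h y), ⟨Cof.proj_hom.comp hh.toIsGrHom, fun s => by simp only [h1]; rfl, ?_⟩, ?_⟩
    · rintro (x | x)
      · change Cof.proj (h (d (η x))) = _
        rw [hh.map_d, h2]
        change 0 + 1 * c (.inl x) = c (.inl x)
        rw [one_mul, zero_add]
      · change Cof.proj (h (η x)) = _
        rw [h2]; rfl
    · rintro h' ⟨hh', h1', h2'⟩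
      funext y
      have e := dg_ext (Cof.lift_hom hh') hh (fun k => by
        rw [h1]
        ext
        · exact h1' k
        · refine Eq.trans ?_ (h1' (d k))
          change h' (d (base k)) = _
          rw [base_hom.map_d]) (fun x => by
        rw [h2]
        ext
        · exact h2' (.inr x)
        · exact h2' (.inl x)) y
      exact congrArg Cof.proj e

/-- If the kernel of `ε : K → Z` is acyclic, so is that of its extension by zero. -/
theorem acyclic {ε' : Contr K dg → Z} (hε' : IsDGHom ε') (hη : ∀ x, ε' (η x) = 0)
    (hac : ∀ z : K, d z = 0 → ε' (base z) = 0 → ∃ w, d w = z) {z : Contr K dg} (hz : d z = 0)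
    (hz' : ε' z = 0) : ∃ w, d w = z := by
  obtain ⟨π, hπ, h1, h2⟩ := exists_dg (dg := dg) (IsDGHom.id (A := K)) 0 (fun x => map_zero _)
  -- The homotopy `η_x ↦ τ η_x` contracts the extension onto `K`: at `τ = 0` it is the retraction
  -- `base ∘ π`, at `τ = 1` the identity.
  obtain ⟨h, hh, h3, h4⟩ := exists_dg (dg := dg)
    (PathAlg.const_hom.comp (base_hom (K := K) (dg := dg)))
    (fun x => PathAlg.line (η x)) (fun x => by rw [← PathAlg.line_pr, η_deg])
  have e1 : ∀ y, PathAlg.ev 1 (h y) = y := dg_ext ((PathAlg.ev_hom 1).comp hh) IsDGHom.id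
    (fun k => by rw [h3, PathAlg.ev_const]) (fun x => by rw [h4, PathAlg.ev_line, one_smul])
  have e0 : ∀ y, PathAlg.ev 0 (h y) = base (π y) :=
    dg_ext ((PathAlg.ev_hom 0).comp hh) (base_hom.comp hπ)
      (fun k => by rw [h3, PathAlg.ev_const, h1]) (fun x => by
        rw [h4, PathAlg.ev_line, zero_smul, h2]; exact base_hom.map_zero.symm)
  have e2 : ∀ y, ε' (base (π y)) = ε' y := dg_ext (hε'.comp (base_hom.comp hπ)) hε'
    (fun k => by rw [h1]) (fun x => by
      rw [h2, hη]; exact (hε'.comp base_hom).map_zero)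
  obtain ⟨w, hw⟩ := hac (π z) (by rw [← hπ.map_d, hz, hπ.map_zero]) (by rw [e2, hz'])
  have := PathAlg.ev_one_sub hh hz
  rw [e1, e0, ← hw, base_hom.map_d] at this
  exact ⟨base w + PathAlg.ev 1 (PathAlg.int (h z)), by rw [map_add, ← this]; abel⟩

end Contr

end contr

/-! ## Augmented algebras with acyclic kernel -/

/-- A split augmentation with acyclic kernel. -/
structure AcyclicAug {A R : Type u} [CDGA A] [CDGA R] (s : R → A) (ε : A → R) : Prop where
  s_hom : IsDGHom s
  ε_hom : IsDGHom ε
  ε_s : ∀ r, ε (s r) = r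
  acyclic : ∀ i z, pr i z = z → d z = 0 → ε z = 0 → ∃ w, d w = z

namespace AcyclicAug

variable {A R : Type u} [CDGA A] [CDGA R] {s : R → A} {ε : A → R} (h : AcyclicAug s ε)
include h

theorem exists_hom {i : ℤ} {z : A} (hz : pr (i + 1) z = z) (hd : d z = 0) (hε : ε z = 0) :
    ∃ w, pr i w = w ∧ d w = z ∧ ε w = 0 := by
  obtain ⟨w, rfl⟩ := h.acyclic _ z hz hd hε
  -- Subtracting `s (ε w)` moves the primitive into the kernel of `ε`. Its differential is unchanged
  -- because `ε w` is a cocycle, and the component of degree `i` suffices.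
  refine ⟨pr i (w - s (ε w)), pr_self _ _, ?_, ?_⟩
  · rw [d_pr, map_sub, ← h.s_hom.map_d, ← h.ε_hom.map_d, hε, h.s_hom.map_zero, sub_zero, hz]
  · rw [h.ε_hom.map_pr, h.ε_hom.map_sub, h.ε_s, sub_self, map_zero]

/-- The single step of all liftings: `s b` has the right augmentation, and the error `c - s (ε c)`
in its differential is a cocycle of the acyclic kernel. -/
theorem fill {i : ℤ} {c : A} (hc : pr (i + 1) c = c) (hd : d c = 0) {b : R} (hb : pr i b = b)
    (hbc : d b = ε c) : ∃ z, pr i z = z ∧ d z = c ∧ ε z = b := by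
  obtain ⟨w, h1, h2, h3⟩ := h.exists_hom (i := i) (z := c - s (ε c))
    (by rw [map_sub, hc, ← h.s_hom.map_pr, ← h.ε_hom.map_pr, hc])
    (by rw [map_sub, hd, ← h.s_hom.map_d, ← h.ε_hom.map_d, hd, h.ε_hom.map_zero, h.s_hom.map_zero,
      sub_zero]) (by rw [h.ε_hom.map_sub, h.ε_s, sub_self])
  refine ⟨s b + w, ?_, ?_, ?_⟩
  · rw [map_add, h1, h.s_hom.hom hb]
  · rw [map_add, h2, ← h.s_hom.map_d, hbc]; abel
  · rw [h.ε_hom.map_add, h.ε_s, h3, add_zero]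

end AcyclicAug

theorem IsGrHom.inverse {A B : Type u} [CDGA A] [CDGA B] {f : A → B} (hf : IsGrHom f) {g : B → A}
    (h1 : ∀ b, f (g b) = b) (h2 : ∀ a, g (f a) = a) : IsGrHom g where
  map_add a b := by rw [← h2 (g a + g b), hf.map_add, h1, h1]
  map_mul a b := by rw [← h2 (g a * g b), hf.map_mul, h1, h1]
  map_scal c := by rw [← hf.map_scal, h2]
  map_pr i a := by rw [← h2 (pr i (g a)), hf.map_pr, h1]

/-! ## A resolution of the augmentation -/

namespace FreeStalk

variable {R S : Type u} [CDGA R] [CDGA S] (F : FreeStalk R S)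

/-- The index set of all generators. -/
abbrev J : Type u := Fin F.n ⊕ F.ι

/-- The generators. -/
def g : F.J → S := Sum.elim (fun i => F.θS (Hol.coord F.z i)) F.e

/-- The degrees of the generators. -/
def dgJ : F.J → ℤ := Sum.elim (fun _ => 0) F.deg

/-- The algebra `K[ξ, η]`. -/
abbrev PC : Type u := Contr F.koszul.K F.deg

/-- The structure map of `K[ξ, η]` over `R ⊗ S⁰`. -/
def pcM (y : F.M) : F.PC := Contr.base (F.koszul.a y)

theorem pcM_hom : IsDGHom F.pcM := Contr.base_hom.comp F.koszul.a_hom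

theorem exists_pcε : ∃ h : F.PC → R, IsDGHom h ∧ (∀ k, h (Contr.base k) = F.koszulAug k) ∧
    ∀ x, h (Contr.η x) = 0 :=
  Contr.exists_dg F.koszulAug_hom 0 fun x => map_zero _

/-- The augmentation of `K[ξ, η]`. -/
def pcε : F.PC → R := F.exists_pcε.choose

theorem pcε_hom : IsDGHom F.pcε := F.exists_pcε.choose_spec.1

theorem pcε_base (k) : F.pcε (Contr.base k) = F.koszulAug k := F.exists_pcε.choose_spec.2.1 k

theorem pcε_η (x) : F.pcε (Contr.η x) = 0 := F.exists_pcε.choose_spec.2.2 x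

theorem pcε_M (y : F.M) : F.pcε (F.pcM y) = F.μ (F.val y) := by
  rw [pcM, F.pcε_base, F.koszulAug_a]

/-- The inclusion of `R` into `K[ξ, η]`. -/
def pcR (r : R) : F.PC := F.pcM (F.jM r)

theorem pc_acyclic : AcyclicAug F.pcR F.pcε where
  s_hom := F.pcM_hom.comp F.jM_hom
  ε_hom := F.pcε_hom
  ε_s r := by rw [pcR, F.pcε_M]; exact F.μ_j r
  acyclic _ z _ hz hz' := Contr.acyclic F.pcε_hom F.pcε_η
    (fun z hz hz' => F.koszul_acyclic hz (by rwa [F.pcε_base] at hz')) hz hz'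

open Classical in
theorem exists_trunc (i : ℤ) : ∃ h : F.PC → F.PC, IsDGHom h ∧
    (∀ k, h (Contr.base k) = Contr.base k) ∧
    ∀ x, h (Contr.η x) = if i < F.deg x then Contr.η x else 0 :=
  Contr.exists_dg Contr.base_hom _ fun x => by
    split_ifs
    · exact Contr.η_deg x
    · exact map_zero _

/-- The endomorphism of `K[ξ, η]` that kills `ξ_x`, `η_x` for the generators `x` of degree at
most `i`. -/
def trunc (i : ℤ) : F.PC → F.PC := (F.exists_trunc i).choose

theorem trunc_hom (i : ℤ) : IsDGHom (F.trunc i) := (F.exists_trunc i).choose_spec.1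

theorem trunc_base (i : ℤ) (k) : F.trunc i (Contr.base k) = Contr.base k :=
  (F.exists_trunc i).choose_spec.2.1 k

theorem trunc_η_lt {i : ℤ} {x : F.ι} (h : i < F.deg x) : F.trunc i (Contr.η x) = Contr.η x := by
  rw [trunc, (F.exists_trunc i).choose_spec.2.2 x, if_pos h]

theorem trunc_η_ge {i : ℤ} {x : F.ι} (h : F.deg x ≤ i) : F.trunc i (Contr.η x) = 0 := by
  rw [trunc, (F.exists_trunc i).choose_spec.2.2 x, if_neg (not_lt.2 h)]

theorem trunc_trunc {i k : ℤ} (h : i ≤ k) (y : F.PC) : F.trunc i (F.trunc k y) = F.trunc k y :=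
  Contr.dg_ext ((F.trunc_hom i).comp (F.trunc_hom k)) (F.trunc_hom k)
    (fun k => by simp only [F.trunc_base]) (fun x => by
      rcases lt_or_ge k (F.deg x) with h' | h'
      · rw [F.trunc_η_lt h', F.trunc_η_lt (h.trans_lt h')]
      · rw [F.trunc_η_ge h', (F.trunc_hom i).map_zero]) y

/-- The condition on the image of a generator `x` under the comparison `S → K[ξ, η]`. -/
def Good (x : F.ι) (z : F.PC) : Prop := ∃ q, z = F.pcR (F.μ (F.e x)) + d (Contr.η x) + q ∧
  F.trunc (F.deg x) q = q ∧ F.pcε q = 0 ∧ pr (F.deg x) q = q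

theorem Good.ε {F : FreeStalk R S} {x : F.ι} {z : F.PC} (h : F.Good x z) :
    F.pcε z = F.μ (F.e x) := by
  obtain ⟨q, rfl, -, h2, -⟩ := h
  rw [F.pcε_hom.map_add, F.pcε_hom.map_add, h2, F.pcε_hom.map_d, F.pcε_η, map_zero, add_zero,
    add_zero]
  exact F.pc_acyclic.ε_s _

theorem Good.trunc {F : FreeStalk R S} {x : F.ι} {z : F.PC} (h : F.Good x z) {i : ℤ}
    (hi : i < F.deg x) : F.trunc i z = z := by
  obtain ⟨q, rfl, h1, h2, -⟩ := h
  rw [(F.trunc_hom i).map_add, (F.trunc_hom i).map_add, (F.trunc_hom i).map_d, F.trunc_η_lt hi,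
    pcR, pcM, F.trunc_base, ← h1, F.trunc_trunc hi.le]

/-- Recursion on the degree of the generator. A primitive of `f (d (e x))` exists because the
augmentation of `PC` has acyclic kernel. It is normalized so that the new variable `ξ_x` occurs with
coefficient one and the remaining correction involves only variables belonging to generators of
larger degree. -/
theorem exists_χ : ∃ χ : S → F.PC, IsDGHom χ ∧ (∀ y, χ (F.val y) = F.pcM y) ∧
    ∀ x, F.Good x (χ (F.e x)) := by
  refine F.freeOn_M.exists_dgHom F.nonpos_S F.deg_neg F.val_hom F.pcM_hom F.Good ?_
  intro x f hf hfM hgood hfd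
  have hc : pr (F.deg x + 1) (f (d (F.e x))) = f (d (F.e x)) := hf.hom (d_hom (F.deg_e x))
  have hdc : d (f (d (F.e x))) = 0 := by
    rw [← hfd _ (F.deg x + 1) (by omega) (d_hom (F.deg_e x)), d_d, hf.map_zero]
  have hεc : F.pcε (f (d (F.e x))) = F.μ (d (F.e x)) :=
    F.freeOn_M.eq_of_gt F.nonpos_S (F.deg x) (h := fun y => F.pcε (f y)) (h' := F.μ)
      (F.pcε_hom.toIsGrHom.comp hf) F.μ_hom.toIsGrHom (fun y => by rw [hfM, F.pcε_M])
      (fun x' h => (hgood x' h).ε) (by omega) (d_hom (F.deg_e x))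
  have htc : F.trunc (F.deg x) (f (d (F.e x))) = f (d (F.e x)) :=
    F.freeOn_M.eq_of_gt F.nonpos_S (F.deg x) (h := fun y => F.trunc (F.deg x) (f y)) (h' := f)
      ((F.trunc_hom _).toIsGrHom.comp hf) hf (fun y => by rw [hfM, pcM, F.trunc_base])
      (fun x' h => (hgood x' h).trunc h) (by omega) (d_hom (F.deg_e x))
  have hp : IsDGHom F.pcR := F.pc_acyclic.s_hom
  have ht : ∀ r, F.trunc (F.deg x) (F.pcR r) = F.pcR r := fun r => F.trunc_base _ _
  obtain ⟨q, h1, h2, h3⟩ := F.pc_acyclic.exists_hom (i := F.deg x)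
    (z := f (d (F.e x)) - d (F.pcR (F.μ (F.e x))))
    (by rw [map_sub, hc, ← d_pr, ← hp.map_pr, ← F.μ_hom.map_pr, F.deg_e])
    (by rw [map_sub, hdc, d_d, sub_zero])
    (by rw [F.pcε_hom.map_sub, hεc, F.pcε_hom.map_d, F.pc_acyclic.ε_s, F.μ_hom.map_d, sub_self])
  -- Truncation removes the variables of generators of degree at most `deg x` and keeps the
  -- differential, as the target contains none of them. The second term restores augmentation zero.
  let q' := F.trunc (F.deg x) q - F.pcR (F.pcε (F.trunc (F.deg x) q))
  have hdq : d (F.trunc (F.deg x) q) = f (d (F.e x)) - d (F.pcR (F.μ (F.e x))) := by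
    rw [← (F.trunc_hom _).map_d, h2, (F.trunc_hom _).map_sub, htc, (F.trunc_hom _).map_d, ht]
  have hq' : d q' = f (d (F.e x)) - d (F.pcR (F.μ (F.e x))) := by
    rw [map_sub, ← hp.map_d, ← F.pcε_hom.map_d, hdq, F.pcε_hom.map_sub, hεc, F.pcε_hom.map_d,
      F.pc_acyclic.ε_s, F.μ_hom.map_d, sub_self, hp.map_zero, sub_zero]
  have hqd : pr (F.deg x) q' = q' := by
    rw [map_sub, ← hp.map_pr, ← F.pcε_hom.map_pr, ← (F.trunc_hom _).map_pr, h1]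
  -- The summand `dη_x` is a cocycle of augmentation zero, so it may be added freely. It is what
  -- later makes `χ (e x)` a substitute for the variable `ξ_x`.
  refine ⟨F.pcR (F.μ (F.e x)) + d (Contr.η x) + q', ?_, ?_, q', rfl, ?_, ?_, hqd⟩
  · rw [map_add, map_add, hqd, Contr.dη_deg, ← hp.map_pr, ← F.μ_hom.map_pr, F.deg_e]
  · rw [map_add, map_add, hq', d_d]; abel
  · rw [(F.trunc_hom _).map_sub, F.trunc_trunc le_rfl, ht]
  · rw [F.pcε_hom.map_sub, F.pc_acyclic.ε_s, sub_self]

/-- The comparison `S → K[ξ, η]`. -/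
def χ : S → F.PC := F.exists_χ.choose

theorem χ_hom : IsDGHom F.χ := F.exists_χ.choose_spec.1

theorem χ_val (y) : F.χ (F.val y) = F.pcM y := F.exists_χ.choose_spec.2.1 y

theorem χ_good (x) : F.Good x (F.χ (F.e x)) := F.exists_χ.choose_spec.2.2 x

/-- The correction terms in the comparison. -/
def q (x : F.ι) : F.PC := (F.χ_good x).choose

theorem χ_e (x : F.ι) : F.χ (F.e x) = F.pcR (F.μ (F.e x)) + d (Contr.η x) + F.q x :=
  (F.χ_good x).choose_spec.1

theorem trunc_q (x : F.ι) : F.trunc (F.deg x) (F.q x) = F.q x := (F.χ_good x).choose_spec.2.1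

theorem pcε_χ (s : S) : F.pcε (F.χ s) = F.μ s :=
  F.freeOn_M.hom_ext (F.pcε_hom.comp F.χ_hom).toIsGrHom F.μ_hom.toIsGrHom
    (fun y => by rw [F.χ_val, F.pcε_M]) (fun x => (F.χ_good x).ε) s

/-- The resolution is graded free over `K` on `ξ`, `η`. -/
theorem pc_free : FreeOn (Contr.base : F.koszul.K → F.PC) (Sum.elim F.deg fun x => F.deg x - 1)
    (Sum.elim (fun x => d (Contr.η x)) Contr.η) := Contr.freeOn

theorem trunc_induction (i : ℤ) {p : F.PC → Prop} (base : ∀ k, p (Contr.base k))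
    (add : ∀ y z, p y → p z → p (y + z))
    (mul : ∀ y z, p (F.trunc i y) → p (F.trunc i z) → p (F.trunc i y * F.trunc i z))
    (ξ : ∀ x, i < F.deg x → p (d (Contr.η x))) (η : ∀ x, i < F.deg x → p (Contr.η x)) (y : F.PC) :
    p (F.trunc i y) := by
  have zero : p 0 := by rw [← (Contr.base_hom (K := F.koszul.K) (dg := F.deg)).map_zero]; exact base 0
  refine F.pc_free.gen (fun y => p (F.trunc i y)) (fun k => by rw [F.trunc_base]; exact base k)
    ?_ (fun y z hy hz => by rw [(F.trunc_hom i).map_add]; exact add _ _ hy hz)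
    (fun y z hy hz => by rw [(F.trunc_hom i).map_mul]; exact mul _ _ hy hz) y
  rintro (x | x)
  · simp only [Sum.elim_inl, (F.trunc_hom i).map_d]
    rcases lt_or_ge i (F.deg x) with h | h
    · rw [F.trunc_η_lt h]; exact ξ x h
    · rw [F.trunc_η_ge h, map_zero]; exact zero
  · simp only [Sum.elim_inr]
    rcases lt_or_ge i (F.deg x) with h | h
    · rw [F.trunc_η_lt h]; exact η x h
    · rw [F.trunc_η_ge h]; exact zero

theorem deg_strong_induction {p : F.ι → Prop} (h : ∀ x, (∀ x', F.deg x < F.deg x' → p x') → p x)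
    (x : F.ι) : p x := by
  have key : ∀ n : ℕ, ∀ x, F.deg x = -(n : ℤ) → p x := fun n => by
    induction n using Nat.strong_induction_on with
    | _ n ih =>
      intro x hx
      refine h x fun x' hx' => ?_
      have := F.deg_neg x'
      exact ih (-F.deg x').toNat (by omega) x' (by omega)
  have := F.deg_neg x
  exact key (-F.deg x).toNat x (by omega)

theorem exists_twist : ∃ ω : F.PC → F.PC, IsGrHom ω ∧ (∀ k, ω (Contr.base k) = Contr.base k) ∧
    (∀ x, ω (d (Contr.η x)) = F.χ (F.e x)) ∧ ∀ x, ω (Contr.η x) = Contr.η x := by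
  obtain ⟨ω, h1, h2, h3⟩ := F.pc_free.universal F.PC _ Contr.base_hom.toIsGrHom
    (Sum.elim (fun x => F.χ (F.e x)) Contr.η) (by
      rintro (x | x)
      · exact F.χ_hom.hom (F.deg_e x)
      · exact Contr.η_deg x)
  exact ⟨ω, h1, h2, fun x => h3 (.inl x), fun x => h3 (.inr x)⟩

/-- The automorphism `ξ_x ↦ χ(x)`. -/
def twist : F.PC → F.PC := F.exists_twist.choose

theorem twist_hom : IsGrHom F.twist := F.exists_twist.choose_spec.1

theorem twist_base (k) : F.twist (Contr.base k) = Contr.base k := F.exists_twist.choose_spec.2.1 k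

theorem twist_ξ (x) : F.twist (d (Contr.η x)) = F.χ (F.e x) := F.exists_twist.choose_spec.2.2.1 x

theorem twist_η (x) : F.twist (Contr.η x) = Contr.η x := F.exists_twist.choose_spec.2.2.2 x

/-- The map moves `ξ_x` by an element of `R` and by `q x`, which contains `ξ_x'` only for generators
of larger degree. Since degrees are negative, induction shows that `twist - 1` is locally nilpotent.
-/
theorem twist_bijective : Function.Bijective F.twist := by
  let ω := F.twist_hom.toRingHom
  let P : F.PC → Prop := fun c => ∃ N, (fun c => ω c - c)^[N] c = 0
  have hfix : ∀ c, F.twist c = c → P c := fun c hc => ⟨1, sub_eq_zero.2 hc⟩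
  have hadd : ∀ y z, P y → P z → P (y + z) := fun y z ⟨N, hN⟩ ⟨M, hM⟩ =>
    ⟨N + M, unipotent_add ω N M y z hN hM⟩
  have hmul : ∀ y z, P y → P z → P (y * z) := fun y z ⟨N, hN⟩ ⟨M, hM⟩ =>
    ⟨N + M, unipotent_mul ω N M y z hN hM⟩
  have hξ : ∀ x, P (d (Contr.η x)) := F.deg_strong_induction fun x ih => by
    have h1 : P (F.q x) := by
      rw [← F.trunc_q x]
      exact F.trunc_induction _ (fun k => hfix _ (F.twist_base k)) hadd (fun y z => hmul _ _)
        ih (fun x _ => hfix _ (F.twist_η x)) _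
    obtain ⟨N, hN⟩ := hadd _ _ (hfix _ (F.twist_base (F.koszul.a (F.jM (F.μ (F.e x)))))) h1
    refine ⟨N + 1, ?_⟩
    rw [Function.iterate_succ_apply]
    have : ω (d (Contr.η x)) - d (Contr.η x) =
        Contr.base (F.koszul.a (F.jM (F.μ (F.e x)))) + F.q x := by
      change F.twist _ - _ = _
      rw [F.twist_ξ, F.χ_e, pcR, pcM]; abel
    rw [this]; exact hN
  refine unipotent_bijective ω fun c => F.pc_free.gen P (fun k => hfix _ (F.twist_base k)) ?_
    hadd hmul c
  rintro (x | x)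
  · exact hξ x
  · exact hfix _ (F.twist_η x)

/-- The generators of the resolution over `S`. -/
def y : F.J → F.PC := Sum.elim (fun i => Contr.base (F.koszul.u i)) Contr.η

theorem y_deg (x : F.J) : pr (F.dgJ x - 1) (F.y x) = F.y x := by
  rcases x with x | x
  · exact Contr.base_hom.hom (F.koszul.free.deg_e x)
  · exact Contr.η_deg x

/-- The resolution is graded free over `S`. -/
theorem χ_free : FreeOn F.χ (fun x => F.dgJ x - 1) F.y := by
  -- Over `M` the algebra `PC` is free on the `u_i`, `ξ_x`, `η_x`. After the twist, the `ξ_x` become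
  -- the images `χ (e x)` of the generators of `S` over `M`, leaving `u_i` and `η_x` as generators
  -- over `S`.
  have hfull := F.koszul.free.trans F.pc_free
  have huniq : ∀ (Z : Type u) [CDGA Z] (h h' : F.PC → Z), IsGrHom h → IsGrHom h' →
      (∀ s, h (F.χ s) = h' (F.χ s)) → (∀ x, h (F.y x) = h' (F.y x)) → h = h' := by
    intro Z _ h h' hh hh' h1 h2
    have key := hfull.hom_ext (hh.comp F.twist_hom) (hh'.comp F.twist_hom) (fun m => by
      rw [F.twist_base]
      have := h1 (F.val m)
      rwa [F.χ_val] at this) (by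
        rintro (x | x | x)
        · simp only [Sum.elim_inl, F.twist_base]; exact h2 (.inl x)
        · simp only [Sum.elim_inl, Sum.elim_inr, F.twist_ξ]; exact h1 _
        · simp only [Sum.elim_inr, F.twist_η]; exact h2 (.inr x))
    funext z
    obtain ⟨z, rfl⟩ := F.twist_bijective.2 z
    exact key z
  refine FreeOn.mk' F.χ_hom.toIsGrHom F.y_deg fun Z _ ψ hψ c hc => ?_
  obtain ⟨t, ht1, ht2⟩ := Function.bijective_iff_has_inverse.1 F.twist_bijective
  have ht := F.twist_hom.inverse ht2 ht1
  -- In untwisted variables `ξ_x` is to take the value `ψ (e x)`. Composition with the inverse twist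
  -- gives the desired map.
  obtain ⟨h0, hh0, h1, h2⟩ := hfull.universal Z (fun m => ψ (F.val m))
    (hψ.comp F.val_hom.toIsGrHom) (Sum.elim (fun i => c (.inl i))
      (Sum.elim (fun x => ψ (F.e x)) fun x => c (.inr x))) (by
        rintro (x | x | x)
        · exact hc (.inl x)
        · exact hψ.hom (F.deg_e x)
        · exact hc (.inr x))
  have e1 : ∀ s, h0 (t (F.χ s)) = ψ s :=
    F.freeOn_M.hom_ext (hh0.comp (ht.comp F.χ_hom.toIsGrHom)) hψ (fun m => by
      rw [F.χ_val, ← h1 m, pcM, ← F.twist_base, ht1, F.twist_base]) fun x => by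
      rw [← F.twist_ξ, ht1]
      exact h2 (.inr (.inl x))
  have e2 : ∀ x, h0 (t (F.y x)) = c x := by
    rintro (x | x)
    · change h0 (t (Contr.base (F.koszul.u x))) = _
      rw [← F.twist_base, ht1]
      exact h2 (.inl x)
    · change h0 (t (Contr.η x)) = _
      rw [← F.twist_η, ht1]
      exact h2 (.inr (.inr x))
  exact ⟨fun z => h0 (t z), ⟨hh0.comp ht, e1, e2⟩, fun h' ⟨hh', h1', h2'⟩ =>
    huniq Z _ _ hh' (hh0.comp ht) (fun s => (h1' s).trans (e1 s).symm)
      fun x => (h2' x).trans (e2 x).symm⟩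

/-! ### The linear part of the differential of the resolution. -/

/-- Linear combinations of the `T x` for the generators `x` of degree `> i`. -/
def linSpan {Z : Type u} [CDGA Z] (r : R → Z) (T : F.J → Z) (i : ℤ) : AddSubgroup Z :=
  AddSubgroup.closure {z | ∃ a x, i < F.dgJ x ∧ z = r a * T x}

section linSpan

variable {Z : Type u} [CDGA Z] {r : R → Z} (hr : IsGrHom r) {T : F.J → Z} {i : ℤ}

include hr

theorem mul_linSpan (a : R) {z : Z} (hz : z ∈ F.linSpan r T i) : r a * z ∈ F.linSpan r T i := by
  induction hz using AddSubgroup.closure_induction with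
  | mem z hz =>
    obtain ⟨b, x, hx, rfl⟩ := hz
    exact AddSubgroup.subset_closure ⟨a * b, x, hx, by rw [hr.map_mul, mul_assoc]⟩
  | zero => rw [mul_zero]; exact zero_mem _
  | add y z _ _ hy hz => rw [mul_add]; exact add_mem hy hz
  | neg y _ hy => rw [mul_neg]; exact neg_mem hy

theorem linSpan_mul (hT : ∀ x, pr (F.dgJ x - 1) (T x) = T x) (a : R) {z : Z}
    (hz : z ∈ F.linSpan r T i) : z * r a ∈ F.linSpan r T i := by
  induction hz using AddSubgroup.closure_induction with
  | mem z hz =>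
    obtain ⟨b, x, hx, rfl⟩ := hz
    rcases Int.even_or_odd (F.dgJ x - 1) with h | h
    · refine AddSubgroup.subset_closure ⟨b * a, x, hx, ?_⟩
      rw [mul_assoc, ← even_comm h (hT x), hr.map_mul, mul_assoc]
    · refine AddSubgroup.subset_closure ⟨b * inv a, x, hx, ?_⟩
      rw [hr.map_mul, hr.map_inv, mul_assoc, mul_assoc, odd_comm h (hT x), CDGA.inv_inv]
  | zero => rw [zero_mul]; exact zero_mem _
  | add y z _ _ hy hz => rw [add_mul]; exact add_mem hy hz
  | neg y _ hy => rw [neg_mul]; exact neg_mem hy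

omit hr in
theorem linSpan_mono {k : ℤ} (h : i ≤ k) : F.linSpan r T k ≤ F.linSpan r T i :=
  AddSubgroup.closure_mono fun _ ⟨a, x, hx, hz⟩ => ⟨a, x, h.trans_lt hx, hz⟩

theorem T_mem_linSpan {x : F.J} (h : i < F.dgJ x) : T x ∈ F.linSpan r T i :=
  AddSubgroup.subset_closure ⟨1, x, h, by rw [hr.map_one, one_mul]⟩

end linSpan

section derivation

variable {Z : Type u} [CDGA Z] {r : R → Z} (hr : IsGrHom r) {κ : F.PC → Z}
  (hκ : IsOddDer (fun y => r (F.pcε y)) κ) (h0 : ∀ x, κ (F.y x) = 0)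
  (hj : ∀ a, κ (F.χ (F.j a)) = 0)
  (hch : ∀ g : F.H, κ (F.χ (F.θS g)) = ∑ i, r (F.μ (F.θS ⟨dt i g.1, Hol.dt_mem i g.2⟩)) *
    κ (F.χ (F.g (.inl i))))

theorem g_deg (x : F.J) : pr (F.dgJ x) (F.g x) = F.g x := by
  rcases x with x | x
  · exact F.θS_deg _
  · exact F.deg_e x

include hr hκ

theorem κ_mul_mem {i : ℤ} {y z : F.PC} (hy : κ y ∈ F.linSpan r (fun x => κ (F.χ (F.g x))) i)
    (hz : κ z ∈ F.linSpan r (fun x => κ (F.χ (F.g x))) i) :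
    κ (y * z) ∈ F.linSpan r (fun x => κ (F.χ (F.g x))) i := by
  rw [hκ.mul]
  exact add_mem (F.linSpan_mul hr (fun x => hκ.hom (F.χ_hom.hom (F.g_deg x))) _ hy)
    (F.mul_linSpan hr _ hz)

include h0 hj hch

/-- On the Koszul algebra `κ` vanishes on `R` and on the `u_i`. On functions the chain rule
expresses it through the coordinates, which have degree `0 > i`. -/
theorem κ_base {i : ℤ} (hi : i < 0) (k : F.koszul.K) :
    κ (Contr.base k) ∈ F.linSpan r (fun x => κ (F.χ (F.g x))) i := by
  refine F.koszul.free.gen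
    (fun k => κ (Contr.base k) ∈ F.linSpan r (fun x => κ (F.χ (F.g x))) i) (fun m => ?_)
    (fun x => ?_) (fun y z hy hz => ?_) (fun y z hy hz => ?_) k
  · have e : ∀ m, Contr.base (F.koszul.a m) = F.χ (F.val m) := fun m => (F.χ_val m).symm
    refine F.M_induction (p := fun m => κ (Contr.base (F.koszul.a m)) ∈
      F.linSpan r (fun x => κ (F.χ (F.g x))) i) (fun a => ?_) (fun g => ?_) (fun y z hy hz => ?_)
      (fun y z hy hz => ?_) m
    · rw [e, show F.val (F.jM a) = F.j a from rfl, hj]; exact zero_mem _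
    · rw [e, F.val_θM, hch]
      refine sum_mem fun k _ => F.mul_linSpan hr _ ?_
      exact F.T_mem_linSpan (T := fun x => κ (F.χ (F.g x))) hr hi
    · rw [F.koszul.a_hom.map_add, Contr.base_hom.map_add, hκ.add]
      exact add_mem hy hz
    · rw [F.koszul.a_hom.map_mul, Contr.base_hom.map_mul]
      exact F.κ_mul_mem hr hκ hy hz
  · rw [show Contr.base (F.koszul.u x) = F.y (.inl x) from rfl, h0]; exact zero_mem _
  · rw [Contr.base_hom.map_add, hκ.add]
    exact add_mem hy hz
  · rw [Contr.base_hom.map_mul]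
    exact F.κ_mul_mem hr hκ hy hz

theorem κ_ξ (x : F.ι) : κ (d (Contr.η x)) = κ (F.χ (F.g (.inr x))) - κ (F.q x) := by
  have : F.pcR (F.μ (F.e x)) = F.χ (F.j (F.μ (F.e x))) := (F.χ_val _).symm
  rw [show F.g (.inr x) = F.e x from rfl, F.χ_e, this, hκ.add, hκ.add, hj]
  abel

/-- Being fixed by the truncation, `q x` is an expression in the Koszul algebra and in `ξ_x'`,
`η_x'` with `deg x' > deg x`. There `κ` kills `η_x'`, and `κ ξ_x'` is known by induction. -/
theorem κ_q (x : F.ι) : κ (F.q x) ∈ F.linSpan r (fun x => κ (F.χ (F.g x))) (F.deg x) := by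
  induction x using F.deg_strong_induction with
  | h x ih =>
    rw [← F.trunc_q]
    refine F.trunc_induction _ (p := fun z => κ z ∈ F.linSpan r (fun x => κ (F.χ (F.g x))) (F.deg x))
      (F.κ_base hr hκ h0 hj hch (F.deg_neg x)) (fun y z hy hz => by rw [hκ.add]; exact add_mem hy hz)
      (fun y z hy hz => F.κ_mul_mem hr hκ hy hz) (fun x' hx' => ?_) (fun x' _ => ?_) _
    · rw [F.κ_ξ hr hκ h0 hj hch]
      exact sub_mem (F.T_mem_linSpan (T := fun x => κ (F.χ (F.g x))) hr hx')
        (F.linSpan_mono hx'.le (ih x' hx'))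
    · rw [show Contr.η x' = F.y (.inr x') from rfl, h0]; exact zero_mem _

/-- The linear part of the differential of the resolution. -/
theorem κ_dy (x : F.J) : κ (d (F.y x)) - κ (F.χ (F.g x)) ∈
    F.linSpan r (fun x => κ (F.χ (F.g x))) (F.dgJ x) := by
  rcases x with x | x
  -- For a coordinate there is no correction: `d u_i = t_i - α_i`, and `α_i` comes from `R`, where
  -- `κ` vanishes.
  · have h1 : d (F.y (.inl x)) = F.χ (F.g (.inl x)) - F.χ (F.j (F.θ ⟨F.α x, F.α_analytic x⟩)) := by
      change d (Contr.base (F.koszul.u x)) = _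
      rw [← Contr.base_hom.map_d, F.koszul.d_u, ← F.χ_hom.map_sub, ← F.θS_fst]
      change F.pcM (F.tbar x) = _
      rw [← F.χ_val]
      congr 1
      change F.θS (F.dif x) = F.θS _ - _
      rw [← map_sub]; rfl
    rw [h1, hκ.sub, hj, sub_zero, sub_self]
    exact zero_mem _
  · change κ (d (Contr.η x)) - _ ∈ _
    rw [F.κ_ξ hr hκ h0 hj hch, sub_sub_cancel_left]
    exact neg_mem (F.κ_q hr hκ h0 hj hch x)

end derivation

end FreeStalk

/-! ## Lifting properties of free extensions -/

theorem PathAlg.int_zero {A : Type u} [CDGA A] : PathAlg.int (0 : PathAlg A) = 0 := by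
  ext1 <;> simp [PathAlg.int]

theorem PathAlg.int_const {A : Type u} [CDGA A] (a : A) : PathAlg.int (PathAlg.const a) = 0 := by
  ext1 <;> simp [PathAlg.int, PathAlg.const]

theorem PathAlg.lmap_linear_mul {A B : Type u} [CDGA A] [CDGA B] {L : A →ₗ[ℂ] B} (hL : IsGrHom L)
    (x y : PathAlg A) : PathAlg.lmap L (x * y) = PathAlg.lmap L x * PathAlg.lmap L y := by
  have h0 : ∀ x : PathAlg A, lmap (0 : A →ₗ[ℂ] B) x = 0 := fun x => by
    have h1 : ∀ p : Polynomial A, DGPoly.lmap (0 : A →ₗ[ℂ] B) p = 0 := fun p => by ext n; simp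
    ext1 <;> simp [lmap, h1]
  have := lmap_mul (L := L) (L₁ := L) (L₂ := L) (L₃ := 0) (L₄ := 0) hL.map_inv (by simp)
    (fun a b => by rw [LinearMap.zero_apply, zero_mul, add_zero]; exact hL.map_mul a b) x y
  rw [this, h0, h0, mul_zero, add_zero]

theorem PathAlg.lmap_grHom {A B : Type u} [CDGA A] [CDGA B] {L : A →ₗ[ℂ] B} (hL : IsGrHom L) :
    IsGrHom (PathAlg.lmap L) where
  map_add := lmap_add L
  map_mul := PathAlg.lmap_linear_mul hL
  map_scal c := by
    rw [← const_hom.map_scal, lmap_const, ← const_hom.map_scal]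
    exact congrArg const (hL.map_scal c)
  map_pr := lmap_pr L hL.map_pr

/-- The linear map underlying a homomorphism. -/
def IsGrHom.lin {A B : Type u} [CDGA A] [CDGA B] {f : A → B} (h : IsGrHom f) : A →ₗ[ℂ] B where
  toFun := f
  map_add' := h.map_add
  map_smul' := h.map_smul

namespace FreeOn

variable {X Y Z R : Type u} [CDGA X] [CDGA Y] [CDGA Z] [CDGA R] {ι : Type*} {a : X → Y}
  {deg : ι → ℤ} {e : ι → Y} (H : FreeOn a deg e)
include H

/-- Lifting along an augmentation with acyclic kernel. -/
theorem exists_lift (hY : NonPos Y) (hdeg : ∀ x, deg x < 0) (ha : IsDGHom a) {ε : Y → R}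
    (hε : IsDGHom ε) {s : R → Z} {ε' : Z → R} (hac : AcyclicAug s ε') {f0 : X → Z}
    (hf0 : IsDGHom f0) (hεf : ∀ x, ε' (f0 x) = ε (a x)) :
    ∃ f : Y → Z, IsDGHom f ∧ (∀ x, f (a x) = f0 x) ∧ ∀ y, ε' (f y) = ε y := by
  obtain ⟨f, hf, h1, h2⟩ := H.exists_dgHom hY hdeg ha hf0 (fun x z => ε' z = ε (e x))
    fun x f hf hfa hgood hfd => by
      have hd := d_hom (H.deg_e x)
      exact hac.fill (hf.hom hd)
        (by rw [← hfd _ (deg x + 1) (by omega) hd, d_d, hf.map_zero]) (hε.toIsGrHom.hom (H.deg_e x))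
        (by
          rw [← hε.map_d]
          exact (H.eq_of_gt hY (deg x) (h := fun y => ε' (f y)) (h' := ε) (hac.ε_hom.toIsGrHom.comp hf)
            hε.toIsGrHom (fun s => by rw [hfa, hεf]) hgood (by omega) hd).symm)
  exact ⟨f, hf, h1, H.hom_ext (hac.ε_hom.comp hf).toIsGrHom hε.toIsGrHom
    (fun s => by rw [h1, hεf]) h2⟩

/-- Uniqueness up to homotopy of lifts along an augmentation with acyclic kernel. -/
theorem exists_homotopy (hY : NonPos Y) (hdeg : ∀ x, deg x < 0) (ha : IsDGHom a) {ε : Y → R}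
    (hε : IsDGHom ε) {s : R → Z} {ε' : Z → R} (hac : AcyclicAug s ε') {u v : Y → Z}
    (hu : IsDGHom u) (hv : IsDGHom v) (huv : ∀ x, u (a x) = v (a x)) (hεu : ∀ y, ε' (u y) = ε y)
    (hεv : ∀ y, ε' (v y) = ε y) :
    ∃ h : Y → PathAlg Z, IsDGHom h ∧ (∀ x, h (a x) = PathAlg.const (u (a x))) ∧
      (∀ y, PathAlg.ev 0 (h y) = u y) ∧ ∀ y, PathAlg.ev 1 (h y) = v y := by
  have hua := hu.comp ha
  let L : Z →ₗ[ℂ] R := hac.ε_hom.toIsGrHom.lin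
  have hL : IsGrHom L := hac.ε_hom.toIsGrHom
  obtain ⟨h, hh, h1, h2⟩ := H.exists_dgHom hY hdeg ha (PathAlg.const_hom.comp hua)
    -- The third condition, constancy of the homotopy after augmentation, is what places the error
    -- at the end point in the acyclic kernel.
    (fun x z => PathAlg.ev 0 z = u (e x) ∧ PathAlg.ev 1 z = v (e x) ∧
      PathAlg.lmap L z = PathAlg.const (ε (e x))) fun x f hf hfa hgood hfd => by
    have hd := d_hom (H.deg_e x)
    have hlt : deg x < deg x + 1 := by omega
    set X := f (d (e x)) with hX
    have dX : d X = 0 := by rw [← hfd _ _ hlt hd, d_d, hf.map_zero]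
    have e0 : PathAlg.ev 0 X = u (d (e x)) :=
      H.eq_of_gt hY (deg x) (h := fun y => PathAlg.ev 0 (f y)) (h' := u)
        ((PathAlg.ev_hom 0).toIsGrHom.comp hf) hu.toIsGrHom
        (fun s => by rw [hfa, PathAlg.ev_const]) (fun x' hx' => (hgood x' hx').1) hlt hd
    have e1 : PathAlg.ev 1 X = v (d (e x)) :=
      H.eq_of_gt hY (deg x) (h := fun y => PathAlg.ev 1 (f y)) (h' := v)
        ((PathAlg.ev_hom 1).toIsGrHom.comp hf) hv.toIsGrHom
        (fun s => by rw [hfa, PathAlg.ev_const, huv]) (fun x' hx' => (hgood x' hx').2.1) hlt hd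
    have eL : PathAlg.lmap L X = PathAlg.const (ε (d (e x))) :=
      H.eq_of_gt hY (deg x) (h := fun y => PathAlg.lmap L (f y))
        (h' := fun y => PathAlg.const (ε y)) ((PathAlg.lmap_grHom hL).comp hf)
        (PathAlg.const_hom.comp hε).toIsGrHom
        (fun s => by
          rw [hfa, PathAlg.lmap_const]
          exact congrArg PathAlg.const (hεu (a s)))
        (fun x' hx' => (hgood x' hx').2.2) hlt hd
    have hXd : pr (deg x + 1) X = X := hf.hom hd
    have hint : pr (deg x) (PathAlg.int X) = PathAlg.int X := by
      simpa using PathAlg.int_hom hXd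
    have dint : d (PathAlg.int X) = X - PathAlg.const (u (d (e x))) := by
      have := PathAlg.d_int X
      rwa [dX, PathAlg.int_zero, add_zero, e0] at this
    -- By `d_int` this is a primitive of `X` with the prescribed value at `0`; only its value at `1`
    -- may be wrong.
    let Y0 := PathAlg.const (u (e x)) + PathAlg.int X
    have hY0 : pr (deg x) Y0 = Y0 := by
      rw [map_add, hint, ← PathAlg.const_hom.map_pr, ← hu.map_pr, H.deg_e]
    have dY0 : d Y0 = X := by
      rw [map_add, dint, ← PathAlg.const_hom.map_d, ← hu.map_d]; abel
    have LY0 : PathAlg.lmap L Y0 = PathAlg.const (ε (e x)) := by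
      rw [PathAlg.lmap_add, PathAlg.lmap_const, PathAlg.lmap_int, eL, PathAlg.int_const, add_zero]
      exact congrArg PathAlg.const (hεu (e x))
    -- The error at `1` is a cocycle of augmentation zero, hence some `d k`. Subtracting the
    -- boundary of the path `τ k` repairs it and changes neither the value at `0` nor the
    -- differential.
    obtain ⟨k, hk1, hk2, hk3⟩ := hac.exists_hom (i := deg x - 1) (z := PathAlg.ev 1 Y0 - v (e x))
      (by
        rw [sub_add_cancel, map_sub, ← (PathAlg.ev_hom 1).map_pr, hY0, ← hv.map_pr, H.deg_e])
      (by rw [map_sub, ← (PathAlg.ev_hom 1).map_d, dY0, e1, ← hv.map_d, sub_self])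
      (by
        rw [hac.ε_hom.map_sub, hεv]
        have := PathAlg.ev_lmap 1 L Y0
        rw [LY0, PathAlg.ev_const] at this
        exact sub_eq_zero.2 this.symm)
    have hl : pr (deg x) (d (PathAlg.line k)) = d (PathAlg.line k) := by
      have : pr (deg x - 1) (PathAlg.line k) = PathAlg.line k := by rw [← PathAlg.line_pr, hk1]
      simpa using d_hom this
    refine ⟨Y0 - d (PathAlg.line k), ?_, ?_, ?_, ?_, ?_⟩
    · rw [map_sub, hY0, hl]
    · rw [map_sub, dY0, d_d, sub_zero]
    · rw [(PathAlg.ev_hom 0).map_sub, (PathAlg.ev_hom 0).map_d, PathAlg.ev_line, zero_smul, map_zero,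
        sub_zero, (PathAlg.ev_hom 0).map_add, PathAlg.ev_const, PathAlg.ev_zero_int, add_zero]
    · rw [(PathAlg.ev_hom 1).map_sub, (PathAlg.ev_hom 1).map_d, PathAlg.ev_line, one_smul, hk2,
        sub_sub_cancel]
    · rw [PathAlg.lmap_sub, LY0, PathAlg.lmap_d L hac.ε_hom.map_d, PathAlg.lmap_line,
        show L k = 0 from hk3, PathAlg.line_zero, map_zero, sub_zero]
  refine ⟨h, hh, h1, H.hom_ext ((PathAlg.ev_hom 0).comp hh).toIsGrHom hu.toIsGrHom
    (fun s => by rw [h1, PathAlg.ev_const]) fun x => (h2 x).1,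
    H.hom_ext ((PathAlg.ev_hom 1).comp hh).toIsGrHom hv.toIsGrHom
    (fun s => by rw [h1, PathAlg.ev_const, huv]) fun x => (h2 x).2.1⟩

end FreeOn

/-! ## Algebras of forms -/

/-- The zero cocycle. -/
def Cocycle0.zero (A : Type u) [CDGA A] : Cocycle0 A := ⟨0, map_zero _, map_zero _⟩

/-- For the zero cocycle `SplitExt` is the algebra of even dual numbers; homomorphisms into it
encode derivations of degree zero and components of weight at most one. -/
theorem Cocycle0.zero_val (A : Type u) [CDGA A] : (Cocycle0.zero A).1 = 0 := rfl

namespace FreeStalk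

variable {R S : Type u} [CDGA R] [CDGA S] (F : FreeStalk R S)

theorem dgJ_nonpos (x : F.J) : F.dgJ x ≤ 0 := by
  rcases x with x | x
  · exact le_rfl
  · exact (F.deg_neg x).le

/-- Odd derivations over the augmentation that satisfy the chain rule are determined by their
values on the generators. -/
theorem der_ext {Z : Type u} [CDGA Z] {f K K' : S → Z} (hf : IsGrHom f) (hK : IsOddDer f K)
    (hK' : IsOddDer f K')
    (hj : ∀ a, K (F.j a) = K' (F.j a))
    (hc : ∀ g : F.H, K (F.θS g) = ∑ i, f (F.θS ⟨dt i g.1, Hol.dt_mem i g.2⟩) * K (F.g (.inl i)))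
    (hc' : ∀ g : F.H, K' (F.θS g) = ∑ i, f (F.θS ⟨dt i g.1, Hol.dt_mem i g.2⟩) * K' (F.g (.inl i)))
    (hg : ∀ x, K (F.g x) = K' (F.g x)) (s : S) : K s = K' s :=
  F.gen (p := fun s => K s = K' s) hj (fun g => by
    rw [hc, hc']
    exact Finset.sum_congr rfl fun i _ => by rw [hg]) (fun x => hg (.inr x))
    (fun y z hy hz => by rw [hK.add, hK'.add, hy, hz])
    (fun y z hy hz => by rw [hK.mul, hK'.mul, hy, hz]) s

end FreeStalk

/-- The structure of the algebra `R ⊗_S Ω` of forms: a homomorphism `r : R → C` and an odd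
derivation `T : S → C` such that `C` is free over `R` on the images of the generators of `S`. -/
structure FormAlg {R S : Type u} [CDGA R] [CDGA S] (F : FreeStalk R S) {C : Type u} [CDGA C]
    (r : R → C) (T : S → C) : Prop where
  r_hom : IsDGHom r
  T_der : IsOddDer (fun s => r (F.μ s)) T
  T_j : ∀ a, T (F.j a) = 0
  T_d : ∀ s, T (d s) = -d (T s)
  chain : ∀ g : F.H, T (F.θS g) =
    ∑ i, r (F.μ (F.θS ⟨dt i g.1, Hol.dt_mem i g.2⟩)) * T (F.g (.inl i))
  free : FreeOn r (fun x => F.dgJ x - 1) (fun x => T (F.g x))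

namespace FormAlg

variable {R S : Type u} [CDGA R] [CDGA S] {F : FreeStalk R S} {C : Type u} [CDGA C]
  {r : R → C} {T : S → C} (H : FormAlg F r T)
include H

theorem nonPos : NonPos C := H.free.nonPos F.nonpos fun x => by
  have := F.dgJ_nonpos x; omega

/-- Forms are weighted by the number of differentials in them. Multiplying every differential by a
variable of square zero kills weights two and higher and separates weights zero and one. It is
prescribed on the generators and extends to all `T s` by `der_ext`. -/
theorem exists_weight : ∃ w : C → SplitExt (Cocycle0.zero C), IsDGHom w ∧ (∀ a, w (r a) = ⟨r a, 0⟩) ∧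
    ∀ s, w (T s) = ⟨0, T s⟩ := by
  have hdT : ∀ x, pr (F.dgJ x - 1) (T (F.g x)) = T (F.g x) := H.free.deg_e
  have hin : IsDGHom (fun a => (⟨r a, 0⟩ : SplitExt (Cocycle0.zero C))) :=
    IsDGHom.comp SplitExt.inl_hom H.r_hom
  obtain ⟨w, hw, h1, h2⟩ := H.free.universal (SplitExt (Cocycle0.zero C)) _ hin.toIsGrHom
    (fun x => ⟨0, T (F.g x)⟩) (fun x => by
      ext
      · simp
      · simpa using hdT x)
  have hμ : IsGrHom (fun s => (⟨r (F.μ s), 0⟩ : SplitExt (Cocycle0.zero C))) :=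
    (hin.comp F.μ_hom).toIsGrHom
  have hT : ∀ s, w (T s) = ⟨0, T s⟩ := by
    have k1 : IsOddDer (fun s => (⟨r (F.μ s), 0⟩ : SplitExt (Cocycle0.zero C))) (fun s => w (T s)) := by
      have := H.T_der.postcomp hw
      simpa only [h1] using this
    refine F.der_ext hμ k1 (K' := fun s => ⟨0, T s⟩) ⟨fun x y => ?_, fun x y => ?_, fun c => ?_, fun i x => ?_⟩
      (fun a => ?_) (fun g => ?_) (fun g => ?_) h2
    · ext <;> simp [H.T_der.add]
    · ext
      · simp
      · simp [H.T_der.mul, Cocycle0.zero_val]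
    · ext <;> simp [H.T_der.scal]
    · ext <;> simp [H.T_der.pr]
    · simp only [H.T_j, hw.map_zero]; rfl
    · rw [H.chain, hw.map_sum]
      exact Finset.sum_congr rfl fun i _ => by rw [hw.map_mul, h1]
    · let p : C →+ SplitExt (Cocycle0.zero C) := ⟨⟨fun c => ⟨0, c⟩, rfl⟩, fun x y => by ext <;> simp⟩
      change p _ = ∑ i, _ * p _
      rw [H.chain, map_sum]
      refine Finset.sum_congr rfl fun i _ => ?_
      change (⟨0, _⟩ : SplitExt (Cocycle0.zero C)) = _ * ⟨0, _⟩
      ext <;> simp [Cocycle0.zero_val]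
  refine ⟨w, H.free.dg_of_gens hw H.r_hom (by rwa [funext h1]) fun x => ?_, h1, hT⟩
  have : d (T (F.g x)) = -T (d (F.g x)) := by rw [H.T_d, neg_neg]
  rw [this, hw.map_neg, hT, hT]
  ext <;> simp [H.T_d]

end FormAlg

namespace FormAlg

variable {R S : Type u} [CDGA R] [CDGA S] {F : FreeStalk R S} {C : Type u} [CDGA C]
  {r : R → C} {T : S → C} (H : FormAlg F r T)

/-- The homomorphism that encodes the components of weight zero and one. -/
def wt : C → SplitExt (Cocycle0.zero C) := H.exists_weight.choose

theorem wt_hom : IsDGHom H.wt := H.exists_weight.choose_spec.1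

theorem wt_r (a : R) : H.wt (r a) = ⟨r a, 0⟩ := H.exists_weight.choose_spec.2.1 a

theorem wt_T (s : S) : H.wt (T s) = ⟨0, T s⟩ := H.exists_weight.choose_spec.2.2 s

/-- The component of weight zero. -/
def p0 : C →ₗ[ℂ] C where
  toFun c := (H.wt c).1
  map_add' x y := by rw [H.wt_hom.map_add]; rfl
  map_smul' a x := by rw [H.wt_hom.map_smul]; rfl

/-- The component of weight one. -/
def p1 : C →ₗ[ℂ] C where
  toFun c := (H.wt c).2
  map_add' x y := by rw [H.wt_hom.map_add]; rfl
  map_smul' a x := by rw [H.wt_hom.map_smul]; rfl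

theorem p0_r (a : R) : H.p0 (r a) = r a := congrArg SplitExt.fst (H.wt_r a)
theorem p1_r (a : R) : H.p1 (r a) = 0 := congrArg SplitExt.snd (H.wt_r a)
theorem p0_T (s : S) : H.p0 (T s) = 0 := congrArg SplitExt.fst (H.wt_T s)
theorem p1_T (s : S) : H.p1 (T s) = T s := congrArg SplitExt.snd (H.wt_T s)

theorem p0_hom : IsDGHom H.p0 := SplitExt.fst_hom.comp H.wt_hom

theorem p1_pr (i : ℤ) (c : C) : H.p1 (pr i c) = pr i (H.p1 c) :=
  congrArg SplitExt.snd (H.wt_hom.map_pr i c)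

theorem p1_d (c : C) : H.p1 (d c) = d (H.p1 c) := congrArg SplitExt.snd (H.wt_hom.map_d c)

theorem p1_mul (a b : C) : H.p1 (a * b) = H.p1 a * H.p0 b + H.p0 a * H.p1 b := by
  have := congrArg SplitExt.snd (H.wt_hom.map_mul a b)
  rwa [SplitExt.mul_snd, Cocycle0.zero_val, zero_mul, zero_mul, add_zero] at this

theorem p0_mem (c : C) : ∃ a, H.p0 c = r a := by
  refine H.free.gen (fun c => ∃ a, H.p0 c = r a) (fun a => ⟨a, H.p0_r a⟩)
    (fun x => ⟨0, by rw [H.p0_T, H.r_hom.map_zero]⟩) ?_ ?_ c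
  · rintro y z ⟨a, ha⟩ ⟨b, hb⟩
    exact ⟨a + b, by rw [map_add, ha, hb, H.r_hom.map_add]⟩
  · rintro y z ⟨a, ha⟩ ⟨b, hb⟩
    exact ⟨a * b, by rw [H.p0_hom.map_mul, ha, hb, H.r_hom.map_mul]⟩

theorem p0_p0 (c : C) : H.p0 (H.p0 c) = H.p0 c := by
  obtain ⟨a, ha⟩ := H.p0_mem c
  rw [ha, H.p0_r]

theorem p1_p0 (c : C) : H.p1 (H.p0 c) = 0 := by
  obtain ⟨a, ha⟩ := H.p0_mem c
  rw [ha, H.p1_r]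

theorem p0_p1_and (c : C) : H.p0 (H.p1 c) = 0 ∧ H.p1 (H.p1 c) = H.p1 c := by
  refine H.free.gen (fun c => H.p0 (H.p1 c) = 0 ∧ H.p1 (H.p1 c) = H.p1 c)
    (fun a => by rw [H.p1_r]; simp) (fun x => by rw [H.p1_T, H.p0_T, H.p1_T]; simp) ?_ ?_ c
  · rintro y z ⟨h1, h2⟩ ⟨h3, h4⟩
    simp only [map_add, h1, h2, h3, h4, add_zero, and_self]
  · rintro y z ⟨h1, h2⟩ ⟨h3, h4⟩
    simp only [H.p1_mul, map_add, H.p0_hom.map_mul, h1, h2, h3, h4, H.p0_p0, H.p1_p0]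
    simp

theorem p0_p1 (c : C) : H.p0 (H.p1 c) = 0 := (H.p0_p1_and c).1

theorem p1_p1 (c : C) : H.p1 (H.p1 c) = H.p1 c := (H.p0_p1_and c).2

theorem p1_linSpan {i : ℤ} {c : C} (hc : c ∈ F.linSpan r (fun x => T (F.g x)) i) : H.p1 c = c := by
  induction hc using AddSubgroup.closure_induction with
  | mem z hz =>
    obtain ⟨a, x, -, rfl⟩ := hz
    rw [H.p1_mul, H.p1_r, H.p0_r, H.p1_T, zero_mul, zero_add]
  | zero => exact map_zero _
  | add y z _ _ hy hz => rw [map_add, hy, hz]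
  | neg y _ hy => rw [map_neg, hy]

/-- An endomorphism that is the identity on `R` and unipotent on the linear part is unipotent. -/
theorem bijective_of_unipotent {ω : C → C} (hω : IsGrHom ω) (hr : ∀ a, ω (r a) = r a)
    (hT : ∀ x, H.p1 (ω (T (F.g x))) - T (F.g x) ∈ F.linSpan r (fun x => T (F.g x)) (F.dgJ x)) :
    Function.Bijective ω := by
  let ω' := hω.toRingHom
  let P : C → Prop := fun c => ∃ N, (fun c => ω' c - c)^[N] c = 0
  have hP : ∀ a, P (r a) := fun a => ⟨1, sub_eq_zero.2 (hr a)⟩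
  have hadd : ∀ y z, P y → P z → P (y + z) := fun y z ⟨N, hN⟩ ⟨M, hM⟩ =>
    ⟨N + M, unipotent_add ω' N M y z hN hM⟩
  have hmul : ∀ y z, P y → P z → P (y * z) := fun y z ⟨N, hN⟩ ⟨M, hM⟩ =>
    ⟨N + M, unipotent_mul ω' N M y z hN hM⟩
  have hzero : P 0 := ⟨0, rfl⟩
  have hneg : ∀ y, P y → P (-y) := fun y hy => by
    have := hmul _ _ (hP (-1)) hy
    rwa [H.r_hom.toIsGrHom.map_neg, H.r_hom.toIsGrHom.map_one, neg_one_mul] at this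
  -- Induction on `-dgJ x`: generators of larger degree are already known to be locally nilpotent
  -- for `ω - 1`.
  have key : ∀ n : ℕ, ∀ x, F.dgJ x = -(n : ℤ) → P (T (F.g x)) := fun n => by
    induction n using Nat.strong_induction_on with
    | _ n ih =>
      have ih' : ∀ x, -(n : ℤ) < F.dgJ x → P (T (F.g x)) := fun x hx => by
        have := F.dgJ_nonpos x
        exact ih (-F.dgJ x).toNat (by omega) x (by omega)
      have hlin : ∀ i, -(n : ℤ) ≤ i → ∀ c ∈ F.linSpan r (fun x => T (F.g x)) i, P c := by
        intro i hi c hc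
        induction hc using AddSubgroup.closure_induction with
        | mem z hz =>
          obtain ⟨a, x, hx, rfl⟩ := hz
          exact hmul _ _ (hP a) (ih' x (by omega))
        | zero => exact hzero
        | add y z _ _ hy hz => exact hadd _ _ hy hz
        | neg y _ hy => exact hneg _ hy
      -- For `k ≥ -n - 1` an element splits into a linear form `ℓ` and a part `u` that is nilpotent
      -- together with its weight-one component. The clause for `k = 0` handles products with a
      -- factor from `R`. The span includes generators with `dgJ = -n` when `k = -n - 1`, so `ℓ`
      -- itself is not yet known to be nilpotent.
      let p : ℤ → C → Prop := fun k c => -(n : ℤ) - 1 ≤ k → (k = 0 → ∃ a, c = r a) ∧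
        ∃ u ℓ, c = u + ℓ ∧ P u ∧ P (H.p1 u) ∧ ℓ ∈ F.linSpan r (fun x => T (F.g x)) k
      have split : ∀ k c, pr k c = c → p k c := fun k c hc => by
        have p_zero : ∀ k, p k 0 := fun k _ => ⟨fun _ => ⟨0, H.r_hom.map_zero.symm⟩, 0, 0,
          (add_zero _).symm, hzero, by rw [map_zero]; exact hzero, zero_mem _⟩
        rw [← hc]
        refine H.free.graded_induction (p := p) ?_ ?_ ?_ ?_ k c
        · intro k y z hy hz hk
          obtain ⟨a1, u, ℓ, rfl, h1, h2, h3⟩ := hy hk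
          obtain ⟨a2, u', ℓ', rfl, h1', h2', h3'⟩ := hz hk
          refine ⟨fun h => ?_, u + u', ℓ + ℓ', by abel, hadd _ _ h1 h1', ?_, add_mem h3 h3'⟩
          · obtain ⟨a, ha⟩ := a1 h
            obtain ⟨b, hb⟩ := a2 h
            exact ⟨a + b, by rw [ha, hb, H.r_hom.map_add]⟩
          · rw [map_add]; exact hadd _ _ h2 h2'
        · intro i k y z hyd hzd hy hz
          rcases lt_or_ge 0 i with hi | hi
          · rw [H.nonPos.eq_zero hi hyd, zero_mul]; exact p_zero _
          rcases lt_or_ge 0 k with hk | hk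
          · rw [H.nonPos.eq_zero hk hzd, mul_zero]; exact p_zero _
          intro hik
          obtain ⟨a1, u, ℓ, e1, h1, h2, h3⟩ := hy (by omega)
          obtain ⟨a2, u', ℓ', e2, h1', h2', h3'⟩ := hz (by omega)
          refine ⟨fun h => ?_, ?_⟩
          · obtain ⟨a, ha⟩ := a1 (by omega)
            obtain ⟨b, hb⟩ := a2 (by omega)
            exact ⟨a * b, by rw [ha, hb, H.r_hom.map_mul]⟩
          · rcases eq_or_ne i 0 with rfl | hi0
            · obtain ⟨a, ha⟩ := a1 rfl
              refine ⟨r a * u', r a * ℓ', by rw [ha, e2, mul_add], hmul _ _ (hP a) h1', ?_, ?_⟩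
              · rw [H.p1_mul, H.p1_r, H.p0_r, zero_mul, zero_add]; exact hmul _ _ (hP a) h2'
              · rw [zero_add]; exact F.mul_linSpan H.r_hom.toIsGrHom a h3'
            rcases eq_or_ne k 0 with rfl | hk0
            · obtain ⟨a, ha⟩ := a2 rfl
              refine ⟨u * r a, ℓ * r a, by rw [ha, e1, add_mul], hmul _ _ h1 (hP a), ?_, ?_⟩
              · rw [H.p1_mul, H.p1_r, H.p0_r, mul_zero, add_zero]; exact hmul _ _ h2 (hP a)
              · rw [add_zero]; exact F.linSpan_mul H.r_hom.toIsGrHom H.free.deg_e a h3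
            -- Both factors now have negative degree. In total degree at least `-n - 1` each has
            -- degree at least `-n`, hence involves only generators covered by the induction
            -- hypothesis. So no terms of weight two or more need control.
            have hPp0 : ∀ c, P (H.p0 c) := fun c => by
              obtain ⟨a, ha⟩ := H.p0_mem c
              rw [ha]; exact hP a
            have q1 : P y := by rw [e1]; exact hadd _ _ h1 (hlin i (by omega) _ h3)
            have q2 : P z := by rw [e2]; exact hadd _ _ h1' (hlin k (by omega) _ h3')
            have q3 : P (H.p1 y) := by
              rw [e1, map_add, H.p1_linSpan h3]; exact hadd _ _ h2 (hlin i (by omega) _ h3)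
            have q4 : P (H.p1 z) := by
              rw [e2, map_add, H.p1_linSpan h3']; exact hadd _ _ h2' (hlin k (by omega) _ h3')
            refine ⟨y * z, 0, (add_zero _).symm, hmul _ _ q1 q2, ?_, zero_mem _⟩
            rw [H.p1_mul]
            exact hadd _ _ (hmul _ _ q3 (hPp0 z)) (hmul _ _ (hPp0 y) q4)
        · intro i a _ _
          exact ⟨fun _ => ⟨a, rfl⟩, r a, 0, (add_zero _).symm, hP a, by rw [H.p1_r]; exact hzero,
            zero_mem _⟩
        · intro x hx
          have := F.dgJ_nonpos x
          exact ⟨fun h => by omega, 0, T (F.g x), (zero_add _).symm, hzero,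
            by rw [map_zero]; exact hzero,
            F.T_mem_linSpan (T := fun x => T (F.g x)) H.r_hom.toIsGrHom (by omega)⟩
      intro x hx
      obtain ⟨-, u, ℓ, e1, h1, h2, h3⟩ := split (F.dgJ x - 1) (ω (T (F.g x)) - H.p1 (ω (T (F.g x))))
        (by
          have := hω.hom (H.free.deg_e x)
          rw [map_sub, this, ← H.p1_pr, this]) (by omega)
      have h4 : P (ω (T (F.g x)) - H.p1 (ω (T (F.g x)))) := by
        -- Applying `p1` kills the left side and fixes `ℓ`, so `ℓ = -p1 u` and only nilpotent terms
        -- remain.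
        have h5 : ω (T (F.g x)) - H.p1 (ω (T (F.g x))) = u + -H.p1 u := by
          have := congrArg H.p1 e1
          rw [map_sub, H.p1_p1, sub_self, map_add, H.p1_linSpan h3] at this
          rw [e1, eq_neg_of_add_eq_zero_right this.symm]
        rw [h5]
        exact hadd _ _ h1 (hneg _ h2)
      have h6 := hadd _ _ h4 (hlin _ hx.ge _ (hT x))
      rw [sub_add_sub_cancel] at h6
      obtain ⟨N, hN⟩ := h6
      exact ⟨N + 1, by rw [Function.iterate_succ_apply]; exact hN⟩
  refine unipotent_bijective ω' fun c => H.free.gen P hP (fun x => ?_) hadd hmul c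
  have := F.dgJ_nonpos x
  exact key (-F.dgJ x).toNat x (by omega)

/-! ### Deforming the comparison map along a path of connections. -/

section comparison

variable {Θ : F.PC → C} {κ' κS : F.PC → C}

/-- The comparison `K[ξ, η] → C` is homotopic to one that is linearly the identity on generators. -/
theorem exists_deformation (hΘ : IsDGHom Θ) (hΘχ : ∀ s, Θ (F.χ s) = r (F.μ s))
    (hκ' : IsOddDer (fun y => r (F.pcε y)) κ') (hκS : IsOddDer (fun y => r (F.pcε y)) κS)
    (hκ'χ : ∀ s, κ' (F.χ s) = T s) (hκSχ : ∀ s, κS (F.χ s) = T s)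
    (h0 : ∀ y, H.p0 (Θ y) = r (F.pcε y)) (h1 : ∀ y, H.p1 (Θ y) = d (κ' y) + κ' (d y))
    (hp' : ∀ y, H.p0 (κ' y) = 0 ∧ H.p1 (κ' y) = κ' y)
    (hpS : ∀ y, H.p0 (κS y) = 0 ∧ H.p1 (κS y) = κS y) :
    ∃ h : F.PC → PathAlg C, IsDGHom h ∧ (∀ s, h (F.χ s) = PathAlg.const (r (F.μ s))) ∧
      (∀ y, PathAlg.ev 0 (h y) = Θ y) ∧
      ∀ y, H.p1 (PathAlg.ev 1 (h y)) = d (κS y) + κS (d y) := by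
  have hrμ : IsDGHom (fun s => PathAlg.const (r (F.μ s))) :=
    PathAlg.const_hom.comp (H.r_hom.comp F.μ_hom)
  have hrε : IsDGHom (fun y => r (F.pcε y)) := H.r_hom.comp F.pcε_hom
  have hPC : NonPos F.PC := F.χ_free.nonPos F.nonpos_S fun x => by
    have := F.dgJ_nonpos x; omega
  -- The affine path from `κ'` at `τ = 0` to `κS` at `τ = 1`. It is again an odd derivation over the
  -- augmentation, and its bracket `m` with the differential is the weight-one part that the
  -- homotopy has to have.
  let κτ : F.PC → PathAlg C := fun y => PathAlg.const (κ' y) - PathAlg.line (κ' y - κS y)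
  have hκτ : IsOddDer (fun y => PathAlg.const (r (F.pcε y))) κτ := by
    refine ⟨fun x y => ?_, fun x y => ?_, fun c => ?_, fun i x => ?_⟩
    · simp only [κτ, hκ'.add, hκS.add, PathAlg.const_hom.map_add]
      rw [add_sub_add_comm, PathAlg.line_add]; abel
    · simp only [κτ, hκ'.mul, hκS.mul, PathAlg.const_hom.map_add, PathAlg.const_hom.map_mul,
        add_sub_add_comm, ← sub_mul, ← mul_sub, PathAlg.line_add]
      rw [← PathAlg.line_mul_const (r (F.pcε y)), ← PathAlg.const_mul_line]
      rw [sub_mul, mul_sub]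
    · simp only [κτ, hκ'.scal, hκS.scal, sub_self, PathAlg.line_zero, PathAlg.const_hom.map_zero]
    · simp only [κτ, hκ'.pr, hκS.pr, ← map_sub, PathAlg.line_pr, PathAlg.const_hom.map_pr]
  let m : F.PC → PathAlg C := fun y => d (κτ y) + κτ (d y)
  have m_mul : ∀ x y, m (x * y) = m x * PathAlg.const (r (F.pcε y)) +
      PathAlg.const (r (F.pcε x)) * m y := hκτ.bracket (PathAlg.const_hom.comp hrε)
  have m_add : ∀ x y, m (x + y) = m x + m y := fun x y => by
    simp only [m, map_add, hκτ.add]; abel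
  have m_χ : ∀ s, m (F.χ s) = 0 := fun s => by
    simp only [m, κτ, ← F.χ_hom.map_d, hκ'χ, hκSχ, sub_self, PathAlg.line_zero, sub_zero, H.T_d]
    rw [← PathAlg.const_hom.map_d, PathAlg.const_hom.toIsGrHom.map_neg, add_neg_cancel]
  have m_d : ∀ y, d (m y) = m (d y) := fun y => by
    simp only [m, map_add, d_d, hκτ.zero, zero_add, add_zero]
  have m_ev0 : ∀ y, PathAlg.ev 0 (m y) = d (κ' y) + κ' (d y) := fun y => by
    simp only [m, κτ, (PathAlg.ev_hom 0).map_add, (PathAlg.ev_hom 0).map_d,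
      (PathAlg.ev_hom 0).toIsGrHom.map_sub, PathAlg.ev_const, PathAlg.ev_line, zero_smul, sub_zero]
  have m_ev1 : ∀ y, PathAlg.ev 1 (m y) = d (κS y) + κS (d y) := fun y => by
    simp only [m, κτ, (PathAlg.ev_hom 1).map_add, (PathAlg.ev_hom 1).map_d,
      (PathAlg.ev_hom 1).toIsGrHom.map_sub, PathAlg.ev_const, PathAlg.ev_line, one_smul,
      sub_sub_cancel]
  have κτ_p : ∀ y, PathAlg.lmap H.p0 (κτ y) = 0 ∧ PathAlg.lmap H.p1 (κτ y) = κτ y := fun y => by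
    simp only [κτ, PathAlg.lmap_sub, PathAlg.lmap_const, PathAlg.lmap_line, map_sub, (hp' y).1,
      (hpS y).1, (hp' y).2, (hpS y).2, sub_self, PathAlg.line_zero, PathAlg.const_hom.map_zero,
      and_self]
  have m_p0 : ∀ y, PathAlg.lmap H.p0 (m y) = 0 := fun y => by
    simp only [m, PathAlg.lmap_add, PathAlg.lmap_d _ H.p0_hom.map_d, (κτ_p _).1, map_zero, add_zero]
  have m_p1 : ∀ y, PathAlg.lmap H.p1 (m y) = m y := fun y => by
    simp only [m, PathAlg.lmap_add, PathAlg.lmap_d _ H.p1_d, (κτ_p _).2]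
  have P1_mul : ∀ x y : PathAlg C, PathAlg.lmap H.p1 (x * y) =
      PathAlg.lmap H.p1 x * PathAlg.lmap H.p0 y + PathAlg.lmap H.p0 x * PathAlg.lmap H.p1 y :=
    PathAlg.lmap_mul (fun a => by
      refine addHom_ext (f := fun a => H.p1 (inv a)) (g := fun a => inv (H.p1 a))
        (fun a b => by simp) (fun a b => by simp) (fun i a => ?_) a
      simp only [inv_pr, map_smul, H.p1_pr]) H.p0_hom.map_inv H.p1_mul
  have lcomp : ∀ (L L' L'' : C →ₗ[ℂ] C), (∀ c, L (L' c) = L'' c) → ∀ x : PathAlg C,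
      PathAlg.lmap L (PathAlg.lmap L' x) = PathAlg.lmap L'' x := fun L L' L'' h x => by
    ext1
    · ext n; simp [PathAlg.lmap, h]
    · ext n; simp [PathAlg.lmap, h]
  have lzero : ∀ x : PathAlg C, PathAlg.lmap (0 : C →ₗ[ℂ] C) x = 0 := fun x => by
    ext1
    · ext n; simp [PathAlg.lmap]
    · ext n; simp [PathAlg.lmap]
  obtain ⟨h, hh, hχ, hgood⟩ := F.χ_free.exists_dgHom hPC (fun x => by
    have := F.dgJ_nonpos x; omega) F.χ_hom hrμ
    (fun x z => PathAlg.ev 0 z = Θ (F.y x) ∧ PathAlg.lmap H.p0 z = PathAlg.const (r (F.pcε (F.y x))) ∧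
      PathAlg.lmap H.p1 z = m (F.y x)) fun x f hf hfχ hgood hfd => by
    have hd := d_hom (F.y_deg x)
    rw [sub_add_cancel] at hd
    have hlt : F.dgJ x - 1 < F.dgJ x := by omega
    set X := f (d (F.y x)) with hX
    have dX : d X = 0 := by rw [← hfd _ _ hlt hd, d_d, hf.map_zero]
    have e0 : PathAlg.ev 0 X = Θ (d (F.y x)) :=
      F.χ_free.eq_of_gt hPC (F.dgJ x - 1) (h := fun y => PathAlg.ev 0 (f y)) (h' := Θ)
        ((PathAlg.ev_hom 0).toIsGrHom.comp hf) hΘ.toIsGrHom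
        (fun s => by rw [hfχ, PathAlg.ev_const, hΘχ]) (fun x' hx' => (hgood x' hx').1) hlt hd
    have e01 : PathAlg.lmap H.p0 X = PathAlg.const (r (F.pcε (d (F.y x)))) ∧
        PathAlg.lmap H.p1 X = m (d (F.y x)) :=
      F.χ_free.induction_gt hPC (F.dgJ x - 1) (p := fun _ y =>
        PathAlg.lmap H.p0 (f y) = PathAlg.const (r (F.pcε y)) ∧ PathAlg.lmap H.p1 (f y) = m y)
        (fun _ y z hy hz => by
          rw [hf.map_add, PathAlg.lmap_add, PathAlg.lmap_add, hy.1, hz.1, hy.2, hz.2, m_add,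
            F.pcε_hom.map_add, H.r_hom.map_add, PathAlg.const_hom.map_add]
          exact ⟨rfl, rfl⟩)
        (fun _ _ y z _ _ hy hz => by
          rw [hf.map_mul, PathAlg.lmap_linear_mul H.p0_hom.toIsGrHom, P1_mul, hy.1, hz.1, hy.2, hz.2,
            m_mul, F.pcε_hom.map_mul, H.r_hom.map_mul, PathAlg.const_hom.map_mul]
          exact ⟨rfl, rfl⟩)
        (fun _ s _ => by
          rw [hfχ, PathAlg.lmap_const, PathAlg.lmap_const, H.p0_r, H.p1_r, F.pcε_χ, m_χ,
            PathAlg.const_hom.map_zero]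
          exact ⟨rfl, rfl⟩)
        (fun x' hx' => (hgood x' hx').2) hlt hd
    have hXd : pr (F.dgJ x) X = X := hf.hom hd
    have hint := PathAlg.int_hom hXd
    have dint : d (PathAlg.int X) = X - PathAlg.const (Θ (d (F.y x))) := by
      have := PathAlg.d_int X
      rwa [dX, PathAlg.int_zero, add_zero, e0] at this
    let Y0 := PathAlg.const (Θ (F.y x)) + PathAlg.int X
    have hY0 : pr (F.dgJ x - 1) Y0 = Y0 := by
      rw [map_add, hint, ← PathAlg.const_hom.map_pr, ← hΘ.map_pr, F.y_deg]
    have dY0 : d Y0 = X := by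
      rw [map_add, dint, ← PathAlg.const_hom.map_d, ← hΘ.map_d]; abel
    have p0Y0 : PathAlg.lmap H.p0 Y0 = PathAlg.const (r (F.pcε (F.y x))) := by
      rw [PathAlg.lmap_add, PathAlg.lmap_const, PathAlg.lmap_int, e01.1, PathAlg.int_const, add_zero,
        h0]
    have hm : pr (F.dgJ x - 1) (m (F.y x)) = m (F.y x) := by
      have a1 := d_hom (hκτ.hom (F.y_deg x))
      have a2 := hκτ.hom hd
      rw [sub_add_cancel] at a1
      rw [map_add, a1, a2]
    -- The weight-one part of `Y0` is exchanged for `m`. Both have differential `m (d (F.y x))` and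
    -- the same value at `τ = 0`, so nothing already achieved is lost.
    refine ⟨Y0 - PathAlg.lmap H.p1 Y0 + m (F.y x), ?_, ?_, ?_, ?_, ?_⟩
    · rw [map_add, map_sub, hY0, hm, ← PathAlg.lmap_pr _ H.p1_pr, hY0]
    · rw [map_add, map_sub, dY0, ← PathAlg.lmap_d _ H.p1_d, dY0, e01.2, m_d]; abel
    · rw [(PathAlg.ev_hom 0).map_add, (PathAlg.ev_hom 0).toIsGrHom.map_sub, PathAlg.ev_lmap, m_ev0,
        (PathAlg.ev_hom 0).map_add, PathAlg.ev_const, PathAlg.ev_zero_int, add_zero, h1]; abel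
    · rw [PathAlg.lmap_add, PathAlg.lmap_sub, p0Y0, lcomp _ _ 0 H.p0_p1, lzero, m_p0, sub_zero,
        add_zero]
    · rw [PathAlg.lmap_add, PathAlg.lmap_sub, lcomp _ _ _ H.p1_p1, m_p1, sub_self, zero_add]
  have p01 : ∀ y, PathAlg.lmap H.p0 (h y) = PathAlg.const (r (F.pcε y)) ∧
      PathAlg.lmap H.p1 (h y) = m y := F.χ_free.gen _
    (fun s => by
      rw [hχ, PathAlg.lmap_const, PathAlg.lmap_const, H.p0_r, H.p1_r, F.pcε_χ, m_χ,
        PathAlg.const_hom.map_zero]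
      exact ⟨rfl, rfl⟩) (fun x => (hgood x).2)
    (fun y z hy hz => by
      rw [hh.map_add, PathAlg.lmap_add, PathAlg.lmap_add, hy.1, hz.1, hy.2, hz.2, m_add,
        F.pcε_hom.map_add, H.r_hom.map_add, PathAlg.const_hom.map_add]
      exact ⟨rfl, rfl⟩)
    (fun y z hy hz => by
      rw [hh.map_mul, PathAlg.lmap_linear_mul H.p0_hom.toIsGrHom, P1_mul, hy.1, hz.1, hy.2, hz.2,
        m_mul, F.pcε_hom.map_mul, H.r_hom.map_mul, PathAlg.const_hom.map_mul]
      exact ⟨rfl, rfl⟩)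
  refine ⟨h, hh, hχ, F.χ_free.hom_ext ((PathAlg.ev_hom 0).comp hh).toIsGrHom hΘ.toIsGrHom
    (fun s => by rw [hχ, PathAlg.ev_const, hΘχ]) fun x => (hgood x).1, fun y => ?_⟩
  rw [← m_ev1, ← (p01 y).2, PathAlg.ev_lmap]

end comparison

end FormAlg

/-! ### Transfer from the explicit resolution to an arbitrary one. -/

theorem isCohomologyIso_of {M N : Type u} [CDGA M] [CDGA N] {f : M → N} (hf : IsDGHom f)
    (h1 : ∀ m, d m = 0 → (∃ b, d b = f m) → ∃ a, d a = m)
    (h2 : ∀ b, d b = 0 → ∃ m, d m = 0 ∧ ∃ c, f m = b + d c) :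
    IsCohomologyIso (fun i (a : M) => pr i a) (fun a => d a) (fun i (b : N) => pr i b)
      (fun b => d b) f where
  injective n m hm hdm := by
    rintro ⟨b, -, hb⟩
    obtain ⟨a, rfl⟩ := h1 m hdm ⟨b, hb⟩
    exact ⟨pr (n - 1) a, pr_self _ _, by rw [d_pr, sub_add_cancel]; exact hm⟩
  surjective n b hb hdb := by
    obtain ⟨m, hm, c, hc⟩ := h2 b hdb
    refine ⟨pr n m, pr_self _ _, by rw [d_pr, hm, map_zero], pr (n - 1) c, pr_self _ _, ?_⟩
    rw [hf.map_pr, hc, map_add, d_pr, sub_add_cancel]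
    exact congrArg (· + _) hb

/-- The comparison map between the two models of the derived tensor product is a
quasi-isomorphism. -/
theorem FormAlg.isCohomologyIso {R S : Type u} [CDGA R] [CDGA S] {F : FreeStalk R S} {C : Type u}
    [CDGA C] {r : R → C} {T : S → C} (H : FormAlg F r T) {B A : Type u} [CDGA B] [CDGA A]
    {φ : S → B} (hφ : IsDGHom φ) {κ : Type*} {degE : κ → ℤ} {e : κ → B} (HB : FreeOn φ degE e)
    (hdeg : ∀ x, degE x < 0) {ν : B → R} (hν : IsDGHom ν) (hνφ : ∀ s, ν (φ s) = F.μ s)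
    (hac : AcyclicAug (fun a => φ (F.j a)) ν) {left : B → A} {right : R → A} (hl : IsDGHom left)
    (hr : IsDGHom right) (hlr : ∀ s, left (φ s) = right (F.μ s))
    (lift : ∀ (Z : Type u) [CDGA Z] (f : B → Z) (g : R → Z), IsDGHom f → IsDGHom g →
      (∀ s, f (φ s) = g (F.μ s)) →
      ∃ h : A → Z, IsDGHom h ∧ (∀ b, h (left b) = f b) ∧ ∀ a, h (right a) = g a)
    (ext : ∀ (Z : Type u) [CDGA Z] (h h' : A → Z), IsDGHom h → IsDGHom h' →
      (∀ b, h (left b) = h' (left b)) → (∀ a, h (right a) = h' (right a)) → ∀ x, h x = h' x)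
    {Φ : A → C} (hΦ : IsDGHom Φ) (hΦr : ∀ a, Φ (right a) = r a) {k : B → C}
    (hk : IsOddDer (fun b => r (ν b)) k) (hkφ : ∀ s, k (φ s) = T s)
    (h0 : ∀ b, H.p0 (Φ (left b)) = r (ν b))
    (h1 : ∀ b, H.p1 (Φ (left b)) = d (k b) + k (d b)) (hk1 : ∀ b, H.p1 (k b) = k b) :
    IsCohomologyIso (fun i (a : A) => pr i a) (fun a => d a) (fun i (c : C) => pr i c)
      (fun c => d c) Φ := by
  have hy : ∀ x, F.dgJ x - 1 < 0 := fun x => by have := F.dgJ_nonpos x; omega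
  have hPC : NonPos F.PC := F.χ_free.nonPos F.nonpos_S fun x => (hy x).le
  have hB : NonPos B := HB.nonPos F.nonpos_S fun x => (hdeg x).le
  -- Both `B` and `PC` are free over `S` with acyclic augmentation kernel, so they map to each other
  -- over `S`. Only the homotopy between `g ∘ f` and the identity of `B` is needed.
  obtain ⟨f, hf, hfφ, hνf⟩ := HB.exists_lift hB hdeg hφ hν F.pc_acyclic F.χ_hom
    fun s => by rw [F.pcε_χ, hνφ]
  obtain ⟨g, hg, hgχ, hνg⟩ := F.χ_free.exists_lift hPC hy F.χ_hom F.pcε_hom hac hφ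
    fun s => by rw [F.pcε_χ, hνφ]
  obtain ⟨hB, hhB, hBφ, hB0, hB1⟩ := HB.exists_homotopy hB hdeg hφ hν hac (hg.comp hf) IsDGHom.id
    (fun s => by rw [hfφ, hgχ]) (fun b => by rw [hνg, hνf]) fun b => rfl
  -- The connection on `PC` that vanishes on the generators `y`; for it `κ_dy` computes the linear
  -- part of the differential.
  obtain ⟨κS, hκS, hκSχ, hκSy⟩ := F.χ_free.exists_oddDer (f := fun y => r (F.pcε y))
    (H.r_hom.comp F.pcε_hom).toIsGrHom (K0 := T) (by simpa only [F.pcε_χ] using H.T_der) 0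
    fun x => map_zero _
  have hk' : IsOddDer (fun y => r (F.pcε y)) (fun y => k (g y)) := by
    have := hk.comp hg.toIsGrHom
    simpa only [hνg] using this
  have hk0 : ∀ b, H.p0 (k b) = 0 := fun b => by rw [← hk1, H.p0_p1]
  have hpS : ∀ y, H.p0 (κS y) = 0 ∧ H.p1 (κS y) = κS y := F.χ_free.gen _
    (fun s => by rw [hκSχ, H.p0_T, H.p1_T]; simp) (fun x => by rw [hκSy]; simp)
    (fun y z hy hz => by rw [hκS.add, map_add, map_add, hy.1, hy.2, hz.1, hz.2, add_zero]; simp)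
    (fun y z hy hz => by
      rw [hκS.mul, map_add, map_add, H.p0_hom.map_mul, H.p0_hom.map_mul, H.p1_mul, H.p1_mul, hy.1,
        hy.2, hz.1, hz.2, H.p0_r, H.p0_r, H.p1_r, H.p1_r]
      simp)
  obtain ⟨h, hh, hhχ, hev0, hp1⟩ := H.exists_deformation (Θ := fun y => Φ (left (g y)))
    (κ' := fun y => k (g y)) (hΦ.comp (hl.comp hg)) (fun s => by rw [hgχ, hlr, hΦr]) hk' hκS
    (fun s => by rw [hgχ, hkφ]) hκSχ (fun y => by rw [h0, hνg]) (fun y => by rw [h1, hg.map_d])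
    (fun y => ⟨hk0 _, hk1 _⟩) hpS
  let Θ' : F.PC → C := fun y => PathAlg.ev 1 (h y)
  have hΘ' : IsDGHom Θ' := (PathAlg.ev_hom 1).comp hh
  have hΘ'χ : ∀ s, Θ' (F.χ s) = r (F.μ s) := fun s => by
    simp only [Θ', hhχ, PathAlg.ev_const]
  -- The endomorphism `T (g x) ↦ Θ' (y x)`. Its linear part is `κS (d (y x))`, unipotent by `κ_dy`.
  obtain ⟨ω, hω, hωr, hωT⟩ := H.free.universal C r H.r_hom.toIsGrHom (fun x => Θ' (F.y x))
    fun x => hΘ'.hom (F.y_deg x)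
  have hωb : Function.Bijective ω := H.bijective_of_unipotent hω hωr fun x => by
    rw [hωT, hp1, hκSy, Pi.zero_apply, map_zero, zero_add]
    have := F.κ_dy H.r_hom.toIsGrHom hκS (fun x => hκSy x) (fun a => by rw [hκSχ, H.T_j])
      (fun g => by
        rw [hκSχ, H.chain]
        exact Finset.sum_congr rfl fun i _ => by rw [hκSχ]) x
    simpa only [hκSχ] using this
  obtain ⟨ω', hω'1, hω'2⟩ := Function.bijective_iff_has_inverse.1 hωb
  have hω' := hω.inverse hω'2 hω'1
  -- As a graded algebra `C` is `PC ⊗_S R`, with `π` the projection. Since `Θ' = ω ∘ π` with `ω`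
  -- bijective, the DG map `Θ'` is such a projection too, now compatible with differentials.
  obtain ⟨π, hπ, hπχ, hπy⟩ := F.χ_free.universal C (fun s => r (F.μ s))
    (H.r_hom.comp F.μ_hom).toIsGrHom (fun x => T (F.g x)) H.free.deg_e
  have hωπ : ∀ y, ω (π y) = Θ' y := F.χ_free.hom_ext (hω.comp hπ) hΘ'.toIsGrHom
    (fun s => by rw [hπχ, hωr, hΘ'χ]) fun x => by rw [hπy, hωT]
  have hπs : ∀ c, ∃ y, π y = c := H.free.gen _ (fun a => ⟨F.χ (F.j a), by rw [hπχ, F.μ_j]⟩)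
    (fun x => ⟨F.y x, hπy x⟩) (fun y z ⟨a, ha⟩ ⟨b, hb⟩ => ⟨a + b, by rw [hπ.map_add, ha, hb]⟩)
    fun y z ⟨a, ha⟩ ⟨b, hb⟩ => ⟨a * b, by rw [hπ.map_mul, ha, hb]⟩
  have hΘ's : ∀ c, ∃ y, Θ' y = c := fun c => by
    obtain ⟨y, hy⟩ := hπs (ω' c)
    exact ⟨y, by rw [← hωπ, hy, hω'2]⟩
  -- The universal property of `PC ⊗_S R` for `C` along `Θ'`. Compatibility of the factored map with
  -- `d` follows from the surjectivity of `Θ'`.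
  have factor : ∀ (Z : Type u) [CDGA Z] (v : F.PC → Z) (ψ : R → Z), IsDGHom v → IsDGHom ψ →
      (∀ s, v (F.χ s) = ψ (F.μ s)) →
      ∃ v' : C → Z, IsDGHom v' ∧ (∀ y, v' (Θ' y) = v y) ∧ ∀ a, v' (r a) = ψ a := by
    intro Z _ v ψ hv hψ hvψ
    obtain ⟨v0, hv0, hv0r, hv0T⟩ := H.free.universal Z ψ hψ.toIsGrHom (fun x => v (F.y x))
      fun x => hv.hom (F.y_deg x)
    have e1 : ∀ y, v0 (π y) = v y := F.χ_free.hom_ext (hv0.comp hπ) hv.toIsGrHom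
      (fun s => by rw [hπχ, hv0r, hvψ]) fun x => by rw [hπy, hv0T]
    have e2 : ∀ y, v0 (ω' (Θ' y)) = v y := fun y => by rw [← hωπ, hω'1, e1]
    refine ⟨fun c => v0 (ω' c), (hv0.comp hω').toDG fun c => ?_, e2, fun a => ?_⟩
    · obtain ⟨y, rfl⟩ := hΘ's c
      rw [← hΘ'.map_d, e2, e2, hv.map_d]
    · dsimp only
      rw [← hωr, hω'1, hv0r]
  obtain ⟨gb, hgb, hgbΘ, hgbr⟩ := factor A (fun y => left (g y)) right (hl.comp hg) hr
    fun s => by rw [hgχ, hlr]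
  obtain ⟨fb, hfb, hfbl, hfbr⟩ := lift C (fun b => Θ' (f b)) r (hΘ'.comp hf) H.r_hom
    fun s => by rw [hfφ, hΘ'χ]
  -- The deformation descends to a homotopy from `Φ ∘ gb` to the identity of `C`. The homotopy on
  -- `B` likewise gives `L` below, from `gb ∘ fb` to the identity of `A`.
  obtain ⟨K, hK, hKΘ, hKr⟩ := factor (PathAlg C) h (fun a => PathAlg.const (r a)) hh
    (PathAlg.const_hom.comp H.r_hom) hhχ
  have hK0 : ∀ c, PathAlg.ev 0 (K c) = Φ (gb c) := fun c => by
    obtain ⟨y, rfl⟩ := hΘ's c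
    rw [hKΘ, hev0, hgbΘ]
  have hK1 : ∀ c, PathAlg.ev 1 (K c) = c := fun c => by
    obtain ⟨y, rfl⟩ := hΘ's c
    rw [hKΘ]
  obtain ⟨pl, hpl, hplc, hple⟩ := PathAlg.map_hom hl
  obtain ⟨L, hL, hLl, hLr⟩ := lift (PathAlg A) (fun b => pl (hB b)) (fun a => PathAlg.const (right a))
    (hpl.comp hhB) (PathAlg.const_hom.comp hr) fun s => by rw [hBφ, hplc, hfφ, hgχ, hlr]
  have hL0 : ∀ a, PathAlg.ev 0 (L a) = gb (fb a) := ext A _ _ ((PathAlg.ev_hom 0).comp hL)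
    (hgb.comp hfb) (fun b => by rw [hLl, hple, hB0, hfbl, hgbΘ])
    fun a => by rw [hLr, PathAlg.ev_const, hfbr, hgbr]
  have hL1 : ∀ a, PathAlg.ev 1 (L a) = a := ext A _ _ ((PathAlg.ev_hom 1).comp hL)
    IsDGHom.id (fun b => by rw [hLl, hple, hB1]) fun a => by rw [hLr, PathAlg.ev_const]
  -- On cohomology `gb` has the left inverse `Φ` and the right inverse `fb`, so it is bijective and
  -- `Φ` is its inverse.
  refine isCohomologyIso_of hΦ (fun m hm ⟨b, hb⟩ => ?_) fun c hc => ?_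
  · have e1 := PathAlg.ev_one_sub hL hm
    rw [hL0, hL1] at e1
    have hm' : d (fb m) = 0 := by rw [← hfb.map_d, hm, hfb.map_zero]
    have e2 := PathAlg.ev_one_sub hK hm'
    rw [hK0, hK1] at e2
    have e4 : gb (fb m) = m - d (PathAlg.ev 1 (PathAlg.int (L m))) := by rw [← e1]; abel
    rw [e4, hΦ.toIsGrHom.map_sub, hΦ.map_d, ← hb, ← map_sub, sub_eq_iff_eq_add, ← map_add] at e2
    refine ⟨PathAlg.ev 1 (PathAlg.int (L m)) + gb (PathAlg.ev 1 (PathAlg.int (K (fb m))) +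
      (b - Φ (PathAlg.ev 1 (PathAlg.int (L m))))), ?_⟩
    rw [map_add, ← hgb.map_d, ← e2, ← e1]
    abel
  · have e1 := PathAlg.ev_one_sub hK hc
    rw [hK0, hK1] at e1
    refine ⟨gb c, by rw [← hgb.map_d, hc, hgb.map_zero], -PathAlg.ev 1 (PathAlg.int (K c)), ?_⟩
    rw [map_neg, ← e1]; abel

/-! ## Partial derivatives -/

section dt

variable {N n : ℕ} {p : (Fin N → ℂ) × (Fin n → ℂ)} {g h : (Fin N → ℂ) × (Fin n → ℂ) → ℂ}

theorem dt_mul (i : Fin n) (hg : DifferentiableAt ℂ g p) (hh : DifferentiableAt ℂ h p) :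
    dt i (fun b => g b * h b) p = dt i g p * h p + g p * dt i h p := by
  simp only [dt, fderiv_fun_mul hg hh, _root_.add_apply, _root_.smul_apply,
    smul_eq_mul]
  ring

theorem dt_add (i : Fin n) (hg : DifferentiableAt ℂ g p) (hh : DifferentiableAt ℂ h p) :
    dt i (fun b => g b + h b) p = dt i g p + dt i h p := by
  simp only [dt, fderiv_fun_add hg hh, _root_.add_apply]

theorem dt_const (i : Fin n) (c : ℂ) : dt i (fun _ => c) p = 0 := by
  simp [dt]

theorem dt_sum (i : Fin n) {ι : Type*} (s : Finset ι) {f : ι → (Fin N → ℂ) × (Fin n → ℂ) → ℂ}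
    (hf : ∀ k ∈ s, DifferentiableAt ℂ (f k) p) :
    dt i (fun b => ∑ k ∈ s, f k b) p = ∑ k ∈ s, dt i (f k) p := by
  simp only [dt, fderiv_fun_sum hf, _root_.sum_apply]

theorem dt_fst (i : Fin n) {g : (Fin N → ℂ) → ℂ} (hg : DifferentiableAt ℂ g p.1) :
    dt i (fun b => g b.1) p = 0 := by
  have := hg.hasFDerivAt.comp p (hasFDerivAt_fst (𝕜 := ℂ) (p := p))
  have h2 : fderiv ℂ (fun b : (Fin N → ℂ) × (Fin n → ℂ) => g b.1) p = _ := this.fderiv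
  simp [dt, h2]

theorem dt_coord (i k : Fin n) :
    dt i (fun b : (Fin N → ℂ) × (Fin n → ℂ) => b.2 k) p = if k = i then 1 else 0 := by
  have := (((ContinuousLinearMap.proj (R := ℂ) (φ := fun _ : Fin n => ℂ) k).comp
      (ContinuousLinearMap.snd ℂ (Fin N → ℂ) (Fin n → ℂ))).hasFDerivAt (x := p)).fderiv
  have h2 : fderiv ℂ (fun b : (Fin N → ℂ) × (Fin n → ℂ) => b.2 k) p = _ := this
  simp [dt, h2, Pi.single_apply]

/-- A change of charts transforms `z` by functions of `z` alone and only relabels the coordinates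
`t`, so `∂/∂t_k` meets no derivative of `ζ`. -/
theorem dt_comp {N' n' : ℕ} (k : Fin n') {ζ : (Fin N' → ℂ) → Fin N → ℂ} (σ : Fin n → Fin n')
    {p : (Fin N' → ℂ) × (Fin n' → ℂ)} (hζ : DifferentiableAt ℂ ζ p.1)
    (hg : DifferentiableAt ℂ g (ζ p.1, fun i => p.2 (σ i))) :
    dt k (fun b => g (ζ b.1, fun i => b.2 (σ i))) p =
      ∑ i, if σ i = k then dt i g (ζ p.1, fun i => p.2 (σ i)) else 0 := by
  let L : ((Fin N' → ℂ) × (Fin n' → ℂ)) →L[ℂ] (Fin n → ℂ) :=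
    ContinuousLinearMap.pi fun i => (ContinuousLinearMap.proj (R := ℂ) (φ := fun _ : Fin n' => ℂ)
      (σ i)).comp (ContinuousLinearMap.snd ℂ (Fin N' → ℂ) (Fin n' → ℂ))
  have h1 := hζ.hasFDerivAt.comp p (hasFDerivAt_fst (𝕜 := ℂ) (p := p))
  have h2 : HasFDerivAt (fun b : (Fin N' → ℂ) × (Fin n' → ℂ) => (ζ b.1, fun i => b.2 (σ i))) _ p :=
    h1.prodMk L.hasFDerivAt
  have h3 : fderiv ℂ (fun b : (Fin N' → ℂ) × (Fin n' → ℂ) => g (ζ b.1, fun i => b.2 (σ i))) p = _ :=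
    (hg.hasFDerivAt.comp p h2).fderiv
  have h4 : L (0, Pi.single k 1) = ∑ i, if σ i = k then Pi.single i (1 : ℂ) else 0 := by
    ext l
    rw [Finset.sum_apply, Finset.sum_eq_single l]
    · by_cases h : σ l = k
      · simp [L, h]
      · simp [L, h, Pi.single_apply]
    · intro i _ hi
      by_cases h : σ i = k
      · simp [h, Pi.single_apply, hi.symm]
      · simp [h]
    · simp
  simp only [dt, h3, ContinuousLinearMap.comp_apply, ContinuousLinearMap.prod_apply]
  have h5 : ((fderiv ℂ ζ p.1).comp (ContinuousLinearMap.fst ℂ (Fin N' → ℂ) (Fin n' → ℂ)))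
      (0, Pi.single k 1) = 0 := by simp
  let M : (Fin n → ℂ) →ₗ[ℂ] ℂ := (fderiv ℂ g (ζ p.1, fun i => p.2 (σ i))).toLinearMap.comp
    (LinearMap.inr ℂ (Fin N → ℂ) (Fin n → ℂ))
  have h6 : ∀ v, fderiv ℂ g (ζ p.1, fun i => p.2 (σ i)) (0, v) = M v := fun v => rfl
  rw [← ContinuousLinearMap.comp_apply (fderiv ℂ ζ p.1), h5, h4, h6, map_sum]
  refine Finset.sum_congr rfl fun i _ => ?_
  split_ifs
  · rfl
  · exact map_zero _

end dt

theorem Hol.eventually_differentiableAt {E : Type*} [NormedAddCommGroup E] [NormedSpace ℂ E] {a : E}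
    (g : Hol E a) : ∀ᶠ b in 𝓝 a, DifferentiableAt ℂ g.1 b :=
  (AnalyticAt.eventually_analyticAt g.2).mono fun _ h => h.differentiableAt

/-! ## Derivations on stalks -/

namespace FreeStalk

variable {R S : Type u} [CDGA R] [CDGA S] (F : FreeStalk R S)

/-- The partial derivatives. -/
def dtH (i : Fin F.n) (g : F.H) : F.H := ⟨dt i g.1, Hol.dt_mem i g.2⟩

theorem θS_dtH_add (i : Fin F.n) (g h : F.H) :
    F.θS (F.dtH i (g + h)) = F.θS (F.dtH i g) + F.θS (F.dtH i h) := by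
  rw [← map_add]
  exact F.ker_of_eventually (((Hol.eventually_differentiableAt g).and (Hol.eventually_differentiableAt h)).mono
    fun b hb => dt_add i hb.1 hb.2)

theorem θS_dtH_mul (i : Fin F.n) (g h : F.H) : F.θS (F.dtH i (g * h)) =
    F.θS (F.dtH i g) * F.θS h + F.θS g * F.θS (F.dtH i h) := by
  rw [← map_mul, ← map_mul, ← map_add]
  exact F.ker_of_eventually (((Hol.eventually_differentiableAt g).and (Hol.eventually_differentiableAt h)).mono
    fun b hb => dt_mul i hb.1 hb.2)

theorem θS_dtH_const (i : Fin F.n) (c : ℂ) : F.θS (F.dtH i (algebraMap ℂ _ c)) = 0 := by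
  rw [← map_zero F.θS]
  exact F.ker_of_eventually (Eventually.of_forall fun b => dt_const i c)

theorem θS_dtH_fst (i : Fin F.n) (g : Hol (Fin F.N → ℂ) F.z) : F.θS (F.dtH i (Hol.fst F.n g)) = 0 := by
  rw [← map_zero F.θS]
  refine F.ker_of_eventually ?_
  have h : ∀ᶠ b in 𝓝 (F.z, (0 : Fin F.n → ℂ)), DifferentiableAt ℂ g.1 b.1 :=
    continuousAt_fst.eventually (Hol.eventually_differentiableAt g)
  exact h.mono fun b hb => dt_fst i hb

theorem θS_dtH_coord (i k : Fin F.n) :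
    F.θS (F.dtH i (Hol.coord F.z k)) = if k = i then 1 else 0 := by
  have : F.θS (F.dtH i (Hol.coord F.z k)) = F.θS (if k = i then 1 else 0) := by
    refine F.ker_of_eventually (Eventually.of_forall fun b => ?_)
    refine (dt_coord i k).trans ?_
    split_ifs <;> rfl
  rw [this]
  split_ifs
  · exact map_one _
  · exact map_zero _

/-- The equations `f_k` do not involve `t`, so the partial derivatives `∂/∂t_i` preserve the ideal
they generate. -/
theorem θS_dtH_ker (i : Fin F.n) {g : F.H} (hg : F.θS g = 0) : F.θS (F.dtH i g) = 0 := by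
  obtain ⟨a, ha⟩ := (F.ker g).1 hg
  refine (F.ker _).2 ⟨fun k => F.dtH i (a k), ?_⟩
  have h1 : ∀ᶠ b in 𝓝 (F.z, (0 : Fin F.n → ℂ)), ∀ k, DifferentiableAt ℂ (a k).1 b :=
    eventually_all.2 fun k => Hol.eventually_differentiableAt (a k)
  have h2 : ∀ᶠ b in 𝓝 (F.z, (0 : Fin F.n → ℂ)), ∀ k, DifferentiableAt ℂ (F.f k) b.1 :=
    eventually_all.2 fun k => continuousAt_fst.eventually
      ((F.f_analytic k).eventually_analyticAt.mono fun _ h => h.differentiableAt)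
  filter_upwards [eventually_eventually_nhds.2 ha, h1, h2] with b hb hb1 hb2
  have e1 : dt i g.1 b = dt i (fun b => ∑ k, (a k).1 b * F.f k b.1) b := by
    simp only [dt]
    rw [Filter.EventuallyEq.fderiv_eq hb]
  have hf2 : ∀ k, DifferentiableAt ℂ (fun b : (Fin F.N → ℂ) × (Fin F.n → ℂ) => F.f k b.1) b :=
    fun k => (hb2 k).comp b differentiableAt_fst
  change dt i g.1 b = _
  rw [e1, dt_sum i _ (f := fun k b => (a k).1 b * F.f k b.1) fun k _ => (hb1 k).mul (hf2 k)]
  refine Finset.sum_congr rfl fun k _ => ?_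
  rw [dt_mul i (hb1 k) (hf2 k), dt_fst i (hb2 k), mul_zero, add_zero]
  rfl

/-- Odd derivations over the augmentation with prescribed values on the generators. -/
theorem exists_der {Z : Type u} [CDGA Z] {ψ : R → Z} (hψ : IsGrHom ψ) (c : F.J → Z)
    (hc : ∀ x, pr (F.dgJ x - 1) (c x) = c x) :
    ∃ T : S → Z, IsOddDer (fun s => ψ (F.μ s)) T ∧ (∀ a, T (F.j a) = 0) ∧ (∀ x, T (F.g x) = c x) ∧
      ∀ g, T (F.θS g) = ∑ i, ψ (F.μ (F.θS (F.dtH i g))) * c (.inl i) := by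
  have hψμ : IsGrHom (fun s => ψ (F.μ s)) := hψ.comp F.μ_hom.toIsGrHom
  have hdeg : ∀ g, pr 0 (ψ (F.μ (F.θS g))) = ψ (F.μ (F.θS g)) := fun g => hψμ.hom (F.θS_deg g)
  have hcomm : ∀ g (z : Z), z * ψ (F.μ (F.θS g)) = ψ (F.μ (F.θS g)) * z := fun g z =>
    even_comm (by decide : Even (0 : ℤ)) (hdeg g) z
  -- The chain rule dictates the derivation on functions.
  let K : F.H → Z := fun g => ∑ i, ψ (F.μ (F.θS (F.dtH i g))) * c (.inl i)
  have K_mul : ∀ g h, K (g * h) = K g * ψ (F.μ (F.θS h)) + ψ (F.μ (F.θS g)) * K h := fun g h => by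
    simp only [K]
    rw [hcomm, Finset.mul_sum, Finset.mul_sum, ← Finset.sum_add_distrib]
    refine Finset.sum_congr rfl fun i _ => ?_
    rw [F.θS_dtH_mul, F.μ_hom.map_add, hψ.map_add, F.μ_hom.map_mul, hψ.map_mul, F.μ_hom.map_mul,
      hψ.map_mul, add_mul, hcomm h, mul_assoc, mul_assoc]
  -- Paired with the values of functions, the derivation becomes an algebra homomorphism into the
  -- odd dual numbers, to which the universal property of `S` applies.
  let χ : F.H →ₐ[ℂ] DN (derData Z) :=
    { toFun := fun g => ⟨ψ (F.μ (F.θS g)), K g⟩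
      map_one' := by
        have h1 := F.θS_dtH_const (c := 1)
        rw [map_one] at h1
        ext
        · simp only [map_one, F.μ_hom.toIsGrHom.map_one, hψ.map_one]; rfl
        · simp only [K, h1, F.μ_hom.map_zero, hψ.map_zero, zero_mul, Finset.sum_const_zero]; rfl
      map_zero' := by
        have h1 := F.θS_dtH_const (c := 0)
        rw [map_zero] at h1
        ext
        · simp only [map_zero, F.μ_hom.map_zero, hψ.map_zero]; rfl
        · simp only [K, h1, F.μ_hom.map_zero, hψ.map_zero, zero_mul, Finset.sum_const_zero]; rfl
      map_add' := fun g h => by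
        ext
        · simp only [map_add, F.μ_hom.map_add, hψ.map_add]; rfl
        · simp only [K, F.θS_dtH_add, F.μ_hom.map_add, hψ.map_add, add_mul, Finset.sum_add_distrib]
          rfl
      map_mul' := fun g h => by
        ext
        · simp only [map_mul, F.μ_hom.map_mul, hψ.map_mul]; rfl
        · have h1 : inv (ψ (F.μ (F.θS g))) = ψ (F.μ (F.θS g)) := by
            rw [inv_hom (hdeg g), sgn_zero, one_smul]
          rw [DN.mul_snd, h1]
          exact K_mul g h
      commutes' := fun a => by
        ext
        · rw [DN.algebraMap_fst]
          simp only [AlgHom.commutes, hψμ.map_scal]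
        · rw [DN.algebraMap_snd]
          simp only [K, F.θS_dtH_const, F.μ_hom.map_zero, hψ.map_zero, zero_mul,
            Finset.sum_const_zero] }
  obtain ⟨h, ⟨hh, h1, h2, h3⟩, -⟩ := F.universal (DN (derData Z)) (fun a => ⟨ψ a, 0⟩)
    ((DN.inl_hom _).comp hψ) χ (fun g => by
      ext
      · exact hdeg g
      · change pr (0 - 1) (K g) = K g
        simp only [K, map_sum]
        refine Finset.sum_congr rfl fun i _ => ?_
        have := mul_hom (hdeg (F.dtH i g)) (hc (.inl i))
        rwa [show 0 + (F.dgJ (.inl i) - 1) = 0 - 1 from rfl] at this)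
    (fun g => by
      ext
      · change ψ (F.μ (F.θS _)) = ψ (F.θ g)
        rw [F.θS_fst, F.μ_j]
      · change K _ = 0
        refine Finset.sum_eq_zero fun i _ => ?_
        rw [F.θS_dtH_fst, F.μ_hom.map_zero, hψ.map_zero, zero_mul])
    (fun g hg => by
      ext
      · change ψ (F.μ (F.θS g)) = _
        rw [hg, hψμ.map_zero]; rfl
      · change K _ = 0
        refine Finset.sum_eq_zero fun i _ => ?_
        rw [F.θS_dtH_ker i hg, F.μ_hom.map_zero, hψ.map_zero, zero_mul])
    (fun x => ⟨ψ (F.μ (F.e x)), c (.inr x)⟩) (fun x => by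
      ext
      · exact hψμ.hom (F.deg_e x)
      · exact hc (.inr x))
  have e1 : ∀ s, (h s).1 = ψ (F.μ s) := F.hom_ext ((DN.fst_hom _).comp hh) hψμ
    (fun a => by rw [h1, F.μ_j]) (fun g => by rw [h2]; rfl) fun x => by rw [h3]
  have hder := IsOddDer.of_hom hh
  rw [funext e1] at hder
  refine ⟨fun s => (h s).2, hder, fun a => by simp only [h1], ?_, fun g => by simp only [h2]; rfl⟩
  rintro (x | x)
  · simp only [g, Sum.elim_inl, h2]
    change K _ = _
    simp only [K]
    rw [Finset.sum_eq_single x]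
    · rw [F.θS_dtH_coord, if_pos rfl, F.μ_hom.toIsGrHom.map_one, hψ.map_one, one_mul]
    · intro i _ hi
      rw [F.θS_dtH_coord, if_neg hi.symm, F.μ_hom.map_zero, hψ.map_zero, zero_mul]
    · simp
  · simp only [g, Sum.elim_inr, h3]

end FreeStalk

/-- The odd derivation into the cofree algebra. -/
theorem IsOddDer.cof {X Z : Type u} [CDGA X] [CDGA Z] {f K : X → Z} (h : IsOddDer f K)
    (hf : IsGrHom f) :
    IsOddDer (Cof.lift f) (fun x => (⟨ZeroD.of (K x), ZeroD.of (-K (d x))⟩ : Cof Z)) where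
  add x y := by
    ext
    · exact h.add x y
    · change -K (d (x + y)) = -K (d x) + -K (d y)
      rw [map_add, h.add, neg_add]
  mul x y := by
    ext
    · exact h.mul x y
    · change -K (d (x * y)) = (-K (d x) * f y + inv (A := Z) (K x) * f (d y)) +
        (f (d (inv x)) * K y + inv (A := Z) (f (inv x)) * (-K (d y)))
      rw [d_mul, h.add, h.mul, h.mul, h.map_inv hf, CDGA.inv_inv, hf.map_inv x, CDGA.inv_inv, d_inv,
        hf.map_neg]
      noncomm_ring
  scal c := by
    ext
    · exact h.scal c
    · change -K (d (algebraMap ℂ X c)) = 0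
      rw [d_algebraMap, h.zero, neg_zero]
  pr i x := by
    ext
    · exact h.pr i x
    · change -K (d (DGRing.pr i x)) = DGRing.pr (i - 1 - -1) (-K (d x))
      rw [d_pr, h.pr, map_neg]
      congr 2; ring_nf

/-- The second component `-K (d x)` is chosen for the sake of this relation, which is the condition
`diff` of `OmegaRel`. -/
theorem IsOddDer.cof_d {X Z : Type u} [CDGA X] [CDGA Z] {f K : X → Z} (h : IsOddDer f K) (x : X) :
    (⟨ZeroD.of (K (d x)), ZeroD.of (-K (d (d x)))⟩ : Cof Z) =
      -d (⟨ZeroD.of (K x), ZeroD.of (-K (d x))⟩ : Cof Z) := by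
  ext
  · change K (d x) = -(0 + 1 * (-K (d x)))
    rw [one_mul, zero_add, neg_neg]
  · change -K (d (d x)) = -(0 - 0)
    rw [d_d, h.zero, sub_zero]

section stalks

variable {W : SimplicialSpace.{u}} {R S B : DGSheaf W} {j : R.Hom S}

/-! ## Algebras of forms on stalks -/

theorem OmegaRel.der {F : FreeAnalytic j} {P : W.Pt} {Z : Type u} [CDGA Z] {f T : S.stalk P → Z}
    (q : OmegaRel F P Z f T) : IsOddDer f T where
  add := q.add
  mul := by
    have h1 : ∀ c, T (algebraMap ℂ _ c) = 0 := fun c => by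
      rw [← (j.hom P).map_scal, q.base]
    have h2 : ∀ (c : ℂ) s, T (c • s) = c • T s := fun c s => by
      have := q.leibniz 0 (algebraMap ℂ _ c) s
      rw [pr_algebraMap, sgn_zero, one_smul, h1, zero_mul, zero_add, q.hom.map_scal,
        ← Algebra.smul_def, ← Algebra.smul_def] at this
      exact this
    exact leibniz_inv q.hom.map_add q.hom.toIsGrHom.map_smul q.add q.leibniz
  scal c := by rw [← (j.hom P).map_scal, q.base]
  pr i x := by
    have := q.proj (i - 1) x
    rwa [sub_add_cancel] at this

/-- The chain rule for functions restricted from a face follows from the one in a single chart at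
the point: by `compat` the restriction is a substitution, and `dt_comp` differentiates it. -/
theorem OmegaRel.of_der {F : FreeAnalytic j} {P : W.Pt} {Z : Type u} [CDGA Z] {f T : S.stalk P → Z}
    (hS : NonPos (S.stalk P)) (hf : IsDGHom f) (h : IsOddDer f T) (base : ∀ r, T (j.app P r) = 0)
    (diff : ∀ s, T (d s) = -d (T s)) (c' : F.Chart P.face) (hc' : P.pt ∈ F.U c')
    (chain : ∀ g, T (F.θS c' P.pt g) = ∑ i, f (F.θS c' P.pt ⟨dt i g.1, Hol.dt_mem i g.2⟩) *
      T (F.gens.val P (F.coord c' i))) : OmegaRel F P Z f T where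
  hom := hf
  add := h.add
  base := base
  leibniz i s s' := by
    rw [h.mul, inv_pr, hf.toIsGrHom.map_smul, smul_mul_assoc]
  diff := diff
  proj i s := by rw [h.pr, add_sub_cancel_right]
  chain := by
    obtain ⟨α, w⟩ := P
    rintro ⟨γ, v⟩ ⟨hγ, hv⟩ c hc g
    simp only at hγ hv hc g c' hc' chain
    subst hv
    obtain ⟨ζ, hζ, hζz, hres⟩ := F.compat hγ c c' w hc hc'
    let σ : Fin (F.n c) → Fin (F.n c') := fun i => (F.coord c').symm (F.gens.incl hγ (F.coord c i))
    let m : (Fin (F.N c') → ℂ) × (Fin (F.n c') → ℂ) → (Fin (F.N c) → ℂ) × (Fin (F.n c) → ℂ) :=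
      fun b => (ζ b.1, fun i => b.2 (σ i))
    have hm : AnalyticAt ℂ m (F.z c' w, 0) :=
      (AnalyticAt.fun_comp (g := ζ) (f := Prod.fst) (x := (F.z c' w, (0 : Fin (F.n c') → ℂ))) hζ
        analyticAt_fst).prod (AnalyticAt.pi fun i => Hol.coord_mem _ _)
    have hm0 : m (F.z c' w, 0) = (F.z c (W.p hγ w), 0) := by
      simp only [m, hζz]; rfl
    have hmem : ∀ g : Hol ((Fin (F.N c) → ℂ) × (Fin (F.n c) → ℂ)) (F.z c (W.p hγ w), 0),
        (fun b => g.1 (m b)) ∈ Hol _ (F.z c' w, (0 : Fin (F.n c') → ℂ)) := fun g => by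
      have hg : AnalyticAt ℂ g.1 (m (F.z c' w, 0)) := by rw [hm0]; exact g.2
      exact AnalyticAt.fun_comp (g := g.1) hg hm
    have hval : ∀ i, F.gens.val ⟨α, w⟩ (F.gens.incl hγ (F.coord c i)) =
        F.gens.val ⟨α, w⟩ (F.coord c' (σ i)) := fun i => by
      rw [(F.coord c').apply_symm_apply]
    have ker : ∀ g g' : Hol ((Fin (F.N c') → ℂ) × (Fin (F.n c') → ℂ)) (F.z c' w, 0),
        (∀ᶠ b in 𝓝 (F.z c' w, (0 : Fin (F.n c') → ℂ)), g.1 b = g'.1 b) →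
        F.θS c' w g = F.θS c' w g' := fun g g' hgg => by
      rw [← sub_eq_zero, ← map_sub, (F.modelS c').ker w hc']
      refine ⟨fun _ _ => 0, fun _ => analyticAt_const, hgg.mono fun b hb => ?_⟩
      change g.1 b - g'.1 b = _
      simp [hb]
    rw [hres g (hmem g), chain]
    simp only [hval]
    -- The derivative along the `k`-th coordinate of the large simplex collects the coordinates `i`
    -- of the face with label `σ i = k`.
    have e1 : ∀ k, F.θS c' w ⟨dt k fun b => g.1 (m b), Hol.dt_mem k (hmem g)⟩ =
        ∑ i, if σ i = k then S.res (W.le_face hγ w)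
          (F.θS c (W.p hγ w) ⟨dt i g.1, Hol.dt_mem i g.2⟩) else 0 := by
      intro k
      have e2 : ∀ i, S.res (W.le_face hγ w) (F.θS c (W.p hγ w) ⟨dt i g.1, Hol.dt_mem i g.2⟩) =
          F.θS c' w ⟨fun b => dt i g.1 (m b), hmem ⟨dt i g.1, Hol.dt_mem i g.2⟩⟩ := fun i =>
        hres ⟨dt i g.1, Hol.dt_mem i g.2⟩ (hmem ⟨dt i g.1, Hol.dt_mem i g.2⟩)
      have e3 : ∀ i, (if σ i = k then S.res (W.le_face hγ w)
          (F.θS c (W.p hγ w) ⟨dt i g.1, Hol.dt_mem i g.2⟩) else 0) = F.θS c' w (if σ i = k then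
            ⟨fun b => dt i g.1 (m b), hmem ⟨dt i g.1, Hol.dt_mem i g.2⟩⟩ else 0) := fun i => by
        split_ifs
        · exact e2 i
        · exact (map_zero _).symm
      rw [Finset.sum_congr rfl fun i _ => e3 i, ← map_sum]
      refine ker _ _ ?_
      have hd1 : ∀ᶠ b in 𝓝 (F.z c' w, (0 : Fin (F.n c') → ℂ)), DifferentiableAt ℂ ζ b.1 :=
        continuousAt_fst.eventually (hζ.eventually_analyticAt.mono fun _ h => h.differentiableAt)
      have hd2 : ∀ᶠ b in 𝓝 (F.z c' w, (0 : Fin (F.n c') → ℂ)), DifferentiableAt ℂ g.1 (m b) := by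
        refine hm.continuousAt.eventually ?_
        rw [hm0]
        exact Hol.eventually_differentiableAt g
      filter_upwards [hd1, hd2] with b hb1 hb2
      refine (dt_comp k σ hb1 hb2).trans ?_
      let evb : Hol ((Fin (F.N c') → ℂ) × (Fin (F.n c') → ℂ)) (F.z c' w, 0) →+ ℂ :=
        ⟨⟨fun g => g.1 b, rfl⟩, fun _ _ => rfl⟩
      change _ = evb _
      rw [map_sum]
      refine Finset.sum_congr rfl fun i _ => ?_
      split_ifs
      · rfl
      · exact (map_zero evb).symm
    have e4 : ∀ k, f (F.θS c' w ⟨dt k fun b => g.1 (m b), Hol.dt_mem k (hmem g)⟩) *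
        T (F.gens.val ⟨α, w⟩ (F.coord c' k)) = ∑ i, if σ i = k then f (S.res (W.le_face hγ w)
          (F.θS c (W.p hγ w) ⟨dt i g.1, Hol.dt_mem i g.2⟩)) *
          T (F.gens.val ⟨α, w⟩ (F.coord c' (σ i))) else 0 := fun k => by
      rw [e1, hf.toIsGrHom.map_sum, Finset.sum_mul]
      refine Finset.sum_congr rfl fun i _ => ?_
      split_ifs with h
      · rw [h]
      · rw [hf.map_zero, zero_mul]
    rw [Finset.sum_congr rfl fun k _ => e4 k, Finset.sum_comm]
    refine Finset.sum_congr rfl fun i _ => ?_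
    rw [Finset.sum_ite_eq]
    simp

variable (F : FreeAnalytic j) (φ : S.Hom B) (P : W.Pt)

theorem tensorRel_self {C' : DGSheaf W} (ψ : S.Hom C') :
    TensorRel φ ψ P ((tensor φ ψ).stalk P) ((tensorLeft φ ψ).app P) ((tensorRight φ ψ).app P) :=
  (tensorPres φ ψ).self P

theorem inB_inOmega (s : S.stalk P) :
    inB F φ P (φ.app P s) = inOmega F φ P ((omegaIncl F).app P s) :=
  (tensorRel_self φ P (omegaIncl F)).eq s

/-- The universal derivation with values in `B ⊗ Ω`. -/
abbrev formD (s : S.stalk P) : (BOmega F φ).stalk P := inOmega F φ P (omegaD F P s)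

theorem inB_hom : IsDGHom (inB F φ P) := (tensorLeft φ (omegaIncl F)).hom P

theorem inOmega_hom : IsDGHom (inOmega F φ P) := (tensorRight φ (omegaIncl F)).hom P

theorem formD_rel : OmegaRel F P ((BOmega F φ).stalk P) (fun s => inB F φ P (φ.app P s))
    (formD F φ P) := by
  have q := OmegaRel.self F P
  have h := inOmega_hom F φ P
  simp only [inB_inOmega]
  exact
  { hom := h.comp q.hom
    add := fun s s' => by rw [← h.map_add]; exact congrArg _ (q.add s s')
    base := fun r => by rw [← h.map_zero]; exact congrArg _ (q.base r)
    leibniz := fun i s s' => by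
      simp only [formD, ← h.map_mul, ← h.toIsGrHom.map_smul, ← h.map_add]
      exact congrArg _ (q.leibniz i s s')
    diff := fun s => by
      simp only [formD, ← h.map_d, ← h.toIsGrHom.map_neg]
      exact congrArg _ (q.diff s)
    proj := fun i s => by
      simp only [formD, ← h.map_pr]
      exact congrArg _ (q.proj i s)
    chain := fun hQ c hc g => by
      simp only [formD, ← h.map_mul, ← h.toIsGrHom.map_sum]
      exact congrArg _ (q.chain hQ c hc g) }

theorem formD_der : IsOddDer (fun s => inB F φ P (φ.app P s)) (formD F φ P) := (formD_rel F φ P).der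

variable {F φ P}

theorem exists_formHom {Z : Type u} [DGRing Z] {f : B.stalk P → Z} (hf : IsDGHom f)
    {T : S.stalk P → Z} (q : OmegaRel F P Z (fun s => f (φ.app P s)) T) :
    ∃ h : (BOmega F φ).stalk P → Z, IsDGHom h ∧ (∀ b, h (inB F φ P b) = f b) ∧
      (∀ a, h (inOmega F φ P a) = Pres.lift (Q := fun Z _ => OmegaRel F P Z) q a) ∧
      ∀ s, h (formD F φ P s) = T s := by
  have t : TensorRel φ (omegaIncl F) P Z f (Pres.lift (Q := fun Z _ => OmegaRel F P Z) q) :=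
    ⟨hf, Pres.lift_hom q, fun _ => rfl⟩
  exact ⟨Pres.lift (Q := fun Z _ => TensorRel φ (omegaIncl F) P Z) t, Pres.lift_hom t,
    fun _ => rfl, fun _ => rfl, fun _ => rfl⟩

theorem omega_ext {Z : Type u} [DGRing Z] {h h' : (Omega F).stalk P → Z} (hh : IsDGHom h)
    (hh' : IsDGHom h') (h1 : ∀ s, h ((omegaIncl F).app P s) = h' ((omegaIncl F).app P s))
    (h2 : ∀ s, h (omegaD F P s) = h' (omegaD F P s)) (x) : h x = h' x :=
  (omegaPres F).hom_ext hh hh' h1 h2 x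

theorem formHom_ext {Z : Type u} [DGRing Z] {h h' : (BOmega F φ).stalk P → Z} (hh : IsDGHom h)
    (hh' : IsDGHom h') (h1 : ∀ b, h (inB F φ P b) = h' (inB F φ P b))
    (h2 : ∀ s, h (formD F φ P s) = h' (formD F φ P s)) (x) : h x = h' x :=
  (tensorPres φ (omegaIncl F)).hom_ext hh hh' h1
    (omega_ext (hh.comp (inOmega_hom F φ P)) (hh'.comp (inOmega_hom F φ P))
      (fun s => by
        have e := inB_inOmega F φ P s
        exact (congrArg h e).symm.trans ((h1 _).trans (congrArg h' e))) h2) x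

/-! ## Stalks of free analytic algebras -/

namespace FreeAnalytic

variable {α : W.faces} {w : W.K α}

/-- In a chart `S⁰` is the quotient of the germs of functions by the kernel of `θS`, so a
homomorphism that kills this kernel descends, independently of chosen representatives. -/
theorem exists_deg0_hom (c : F.Chart α) (hc : w ∈ F.U c) {Z : Type u} [CDGA Z]
    (χ : Hol ((Fin (F.N c) → ℂ) × (Fin (F.n c) → ℂ)) (F.z c w, 0) →ₐ[ℂ] Z)
    (hχ : ∀ g, F.θS c w g = 0 → χ g = 0) :
    ∃ ψ : deg0 (S.stalk ⟨α, w⟩) →ₐ[ℂ] Z, ∀ s g, s.1 = F.θS c w g → ψ s = χ g := by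
  have hex : ∀ s : deg0 (S.stalk ⟨α, w⟩), ∃ g, F.θS c w g = s.1 := fun s => by
    have : s.1 ∈ (F.θS c w).range := by rw [(F.modelS c).range w hc]; exact s.2
    exact this
  choose G hG using hex
  have key : ∀ s g, s.1 = F.θS c w g → χ (G s) = χ g := fun s g h => by
    rw [← sub_eq_zero, ← map_sub]
    exact hχ _ (by rw [map_sub, hG, h, sub_self])
  exact ⟨{ toFun := fun s => χ (G s)
           map_one' := by rw [key 1 1 (map_one _).symm, map_one]
           map_zero' := by rw [key 0 0 (map_zero _).symm, map_zero]
           map_add' := fun s t => by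
             rw [key (s + t) (G s + G t) (by rw [map_add, hG, hG]; rfl), map_add]
           map_mul' := fun s t => by
             rw [key (s * t) (G s * G t) (by rw [map_mul, hG, hG]; rfl), map_mul]
           commutes' := fun a => by
             rw [key (algebraMap ℂ _ a) (algebraMap ℂ _ a) (by rw [AlgHom.commutes]; rfl),
               AlgHom.commutes] }, key⟩

variable (F) in
/-- The stalk of a free analytic algebra at a point. -/
def toStalk (μ : S.Hom R) (hμ : ∀ P r, μ.app P (j.app P r) = r) (hR : ∀ P, NonPos (R.stalk P))
    (c : F.Chart α) (hc : w ∈ F.U c) : FreeStalk (R.stalk ⟨α, w⟩) (S.stalk ⟨α, w⟩) where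
  j := j.app _
  μ := μ.app _
  j_hom := j.hom _
  μ_hom := μ.hom _
  μ_j := hμ _
  nonpos := hR _
  N := F.N c
  n := F.n c
  k := F.k c
  z := F.z c w
  f := F.f c
  f_analytic := (F.modelR c).analytic w hc
  f_zero := (F.modelR c).zero w hc
  θ := F.θ c w
  θS := F.θS c w
  θ_surj r hr := by
    have : r ∈ deg0 (R.stalk ⟨α, w⟩) := hr
    rw [← (F.modelR c).range w hc] at this
    exact this
  θS_deg g := by
    have : F.θS c w g ∈ (F.θS c w).range := ⟨g, rfl⟩
    rw [(F.modelS c).range w hc] at this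
    exact this
  θS_fst g := F.θS_fst c w hc g
  ker g := by
    rw [(F.modelS c).ker w hc]
    exact ⟨fun ⟨a, ha, h⟩ => ⟨fun i => ⟨a i, ha i⟩, h⟩, fun ⟨a, h⟩ => ⟨fun i => (a i).1,
      fun i => (a i).2, h⟩⟩
  ι := Σ i : {i : ℤ // i < 0}, F.gens.Idx α i.1
  deg x := x.1.1
  e x := F.gens.val ⟨α, w⟩ x.2
  deg_neg x := x.1.2
  deg_e x := (S.res_hom _).hom (F.gens.deg _ _)
  universal Z _ ψ hψ χ hχ hχψ hker c' hc' := by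
    obtain ⟨ψ0, hψ0⟩ := exists_deg0_hom c hc χ hker
    have hG : ∀ s : deg0 (S.stalk ⟨α, w⟩), ∃ g, s.1 = F.θS c w g := fun s => by
      have : s.1 ∈ (F.θS c w).range := by rw [(F.modelS c).range w hc]; exact s.2
      obtain ⟨g, hg⟩ := this
      exact ⟨g, hg.symm⟩
    have hθdeg : ∀ g, F.θS c w g ∈ deg0 (S.stalk ⟨α, w⟩) := fun g => by
      rw [← (F.modelS c).range w hc]; exact ⟨g, rfl⟩
    let C : ∀ i, F.gens.Idx α i → Z := fun i x => if h : i < 0 then c' ⟨⟨i, h⟩, x⟩ else 0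
    have hC : ∀ i x, pr i (C i x) = C i x := fun i x => by
      by_cases h : i < 0
      · simp only [C, dif_pos h]; exact hc' ⟨⟨i, h⟩, x⟩
      · simp only [C, dif_neg h, map_zero]
    obtain ⟨h, ⟨h1, h2, h3, h4⟩, hu⟩ := F.universal ⟨α, w⟩ Z ψ hψ ψ0
      (fun s => by
        obtain ⟨g, hg⟩ := hG s
        rw [hψ0 s g hg, hχ])
      (fun r hr h => by
        have : r ∈ deg0 (R.stalk ⟨α, w⟩) := hr
        rw [← (F.modelR c).range w hc] at this
        obtain ⟨g, rfl⟩ := this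
        rw [hψ0 _ (Hol.fst _ g) (F.θS_fst c w hc g).symm, hχψ]
        rfl) C hC
    refine ⟨h, ⟨h1, h2, fun g => (h3 ⟨_, hθdeg g⟩).trans (hψ0 _ g rfl), fun x => ?_⟩, ?_⟩
    · rw [h4 _ _ x.1.2]
      exact dif_pos x.1.2
    · rintro h' ⟨h1', h2', h3', h4'⟩
      refine hu h' ⟨h1', h2', fun s => ?_, fun i x hi => ?_⟩
      · obtain ⟨g, hg⟩ := hG s
        rw [hg, h3', hψ0 s g hg]
      · rw [h4' ⟨⟨i, hi⟩, x⟩]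
        change c' _ = C i x
        simp only [C, dif_pos hi]

variable {μ : S.Hom R} {hμ : ∀ P r, μ.app P (j.app P r) = r} {hR : ∀ P, NonPos (R.stalk P)}
  {c : F.Chart α} {hc : w ∈ F.U c}

theorem toStalk_g_inl (i : Fin (F.n c)) :
    (F.toStalk μ hμ hR c hc).g (.inl i) = F.gens.val ⟨α, w⟩ (F.coord c i) := F.θS_coord c w hc i

/-- The point is freeness over `R`. Prescribed values on the generators extend to a derivation of
`S` by `exists_der`. To use the DG presentation of the forms, both the homomorphism and the
derivation are lifted to `Cof Z` and the result is projected back. For uniqueness, `der_ext`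
determines the values on all differentials. -/
theorem formAlg : FormAlg (F.toStalk μ hμ hR c hc) (inB F μ ⟨α, w⟩) (formD F μ ⟨α, w⟩) := by
  let G := F.toStalk μ hμ hR c hc
  have q := formD_rel F μ ⟨α, w⟩
  have chain : ∀ g : G.H, formD F μ ⟨α, w⟩ (G.θS g) =
      ∑ i, inB F μ ⟨α, w⟩ (G.μ (G.θS ⟨dt i g.1, Hol.dt_mem i g.2⟩)) *
        formD F μ ⟨α, w⟩ (G.g (.inl i)) := fun g => by
    have h : (⟨α, w⟩ : W.Pt) ≤ ⟨α, w⟩ := le_rfl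
    have := q.chain h c hc g
    rw [S.res_refl] at this
    refine this.trans (Finset.sum_congr rfl fun i _ => ?_)
    rw [toStalk_g_inl, S.res_refl]
    rfl
  have hdeg : ∀ x, pr (G.dgJ x - 1) (formD F μ ⟨α, w⟩ (G.g x)) = formD F μ ⟨α, w⟩ (G.g x) :=
    fun x => q.der.hom (G.g_deg x)
  refine ⟨inB_hom F μ _, q.der, q.base, q.diff, chain, FreeOn.mk' (inB_hom F μ _).toIsGrHom hdeg ?_⟩
  intro Z _ ψ hψ v hv
  have hψμ : IsGrHom (fun s => ψ (μ.app ⟨α, w⟩ s)) := hψ.comp (μ.hom _).toIsGrHom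
  obtain ⟨T, hT, hTj, hTg, hTc⟩ := G.exists_der hψ v hv
  have hlift := Cof.lift_hom hψ
  have hliftμ : IsDGHom (fun s => Cof.lift ψ (μ.app ⟨α, w⟩ s)) := hlift.comp (μ.hom _)
  have hT' := hT.cof hψμ
  have elift : Cof.lift (fun s => ψ (μ.app ⟨α, w⟩ s)) = fun s => Cof.lift ψ (μ.app ⟨α, w⟩ s) := by
    funext s
    simp only [Cof.lift, (μ.hom _).map_d]
  rw [show (fun s => ψ (G.μ s)) = fun s => ψ (μ.app ⟨α, w⟩ s) from rfl, elift] at hT'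
  have hd0 : ∀ g, d (G.θS g) = 0 := G.d_θS
  -- Functions are cocycles, so in the chain rule the second components of the lifted elements
  -- vanish.
  have rel : OmegaRel F ⟨α, w⟩ (Cof Z) (fun s => Cof.lift ψ (μ.app ⟨α, w⟩ s))
      (fun s => ⟨ZeroD.of (T s), ZeroD.of (-T (d s))⟩) := by
    refine OmegaRel.of_der G.nonpos_S hliftμ hT' (fun r => ?_) (fun s => hT.cof_d s) c hc
      fun g => ?_
    · ext
      · exact hTj r
      · change -T (d (G.j r)) = 0
        rw [← G.j_hom.map_d, hTj, neg_zero]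
    · have e : ∀ i, Cof.lift ψ (μ.app ⟨α, w⟩ (F.θS c w ⟨dt i g.1, Hol.dt_mem i g.2⟩)) *
          (⟨ZeroD.of (T (F.gens.val ⟨α, w⟩ (F.coord c i))),
            ZeroD.of (-T (d (F.gens.val ⟨α, w⟩ (F.coord c i))))⟩ : Cof Z) =
          ⟨ZeroD.of (ψ (G.μ (G.θS (G.dtH i g))) * v (.inl i)), 0⟩ := fun i => by
        have h1 : d (F.gens.val ⟨α, w⟩ (F.coord c i)) = 0 := by
          rw [← F.θS_coord c w hc i]; exact hd0 _
        have h2 : T (F.gens.val ⟨α, w⟩ (F.coord c i)) = v (.inl i) := by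
          rw [← hTg, toStalk_g_inl]
        rw [h1, h2, hT.zero, neg_zero]
        ext
        · rfl
        · change ψ (d (G.μ (G.θS (G.dtH i g)))) * v (.inl i) + inv (A := Z) _ * 0 = 0
          rw [← G.μ_hom.map_d, hd0, G.μ_hom.map_zero, hψ.map_zero, zero_mul, mul_zero, add_zero]
      rw [Finset.sum_congr rfl fun i _ => e i]
      ext
      · rw [DN.sum_fst]
        exact hTc g
      · rw [DN.sum_snd, Finset.sum_const_zero]
        exact (congrArg (fun s => -T s) (hd0 g)).trans (by rw [hT.zero, neg_zero]; rfl)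
  obtain ⟨h, hh, h1, -, h2⟩ := exists_formHom (φ := μ) hlift rel
  refine ⟨fun y => Cof.proj (h y), ⟨Cof.proj_hom.comp hh.toIsGrHom, fun a => by simp only [h1]; rfl,
    fun x => ?_⟩, ?_⟩
  · simp only [h2]
    exact hTg x
  · rintro h' ⟨hh', h1', h2'⟩
    have hT2 : ∀ s, h' (formD F μ ⟨α, w⟩ s) = T s := by
      have hd' := q.der.postcomp hh'
      simp only [h1'] at hd'
      refine G.der_ext hψμ hd' hT (fun a => ?_) (fun g => ?_) (fun g => ?_) (fun x => ?_)
      · rw [show formD F μ ⟨α, w⟩ (G.j a) = 0 from q.base a, hh'.map_zero, hTj]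
      · rw [chain, hh'.map_sum]
        exact Finset.sum_congr rfl fun i _ => by rw [hh'.map_mul, h1']; rfl
      · rw [hTc]
        exact Finset.sum_congr rfl fun i _ => by rw [hTg]; rfl
      · rw [h2', hTg]
    funext y
    have e := formHom_ext (Cof.lift_hom hh') hh (fun a => by
      rw [h1]
      ext
      · exact h1' a
      · refine Eq.trans ?_ (h1' (d a))
        change h' (d (inB F μ ⟨α, w⟩ a)) = _
        rw [← (inB_hom F μ _).map_d]) (fun s => by
      rw [h2]
      ext
      · exact hT2 s
      · change h' (d (formD F μ ⟨α, w⟩ s)) = -T (d s)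
        rw [← hT2, q.diff, hh'.map_neg, neg_neg]) y
    exact congrArg Cof.proj e

end FreeAnalytic

end stalks

/-- Homogeneous elements commute with all elements up to a change of the latter. -/
theorem CDGA.exists_mul_comm {A : Type u} [CDGA A] {i : ℤ} {a : A} (ha : pr i a = a) (b : A) :
    a * b = b * a ∨ a * b = inv b * a := by
  rcases Int.even_or_odd i with h | h
  · exact .inl (even_comm h ha b).symm
  · refine .inr ?_
    rw [odd_comm h ha (inv b), CDGA.inv_inv]

/-! ### Sections of sheaves of DG algebras and morphisms out of presented sheaves. -/

section sections

variable {W : SimplicialSpace.{u}} (A : DGSheaf W) {α : W.faces} {w : W.K α}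

namespace DGSheaf

theorem sec_zero : (A.sheaf α).IsSec (fun _ => 0) w := by
  have := A.sec_scal (α := α) (w := w) 0
  simpa only [map_zero] using this

theorem sec_smul (c : ℂ) {s : ∀ y, A.stalk ⟨α, y⟩} (hs : (A.sheaf α).IsSec s w) :
    (A.sheaf α).IsSec (fun y => c • s y) w := by
  simp only [Algebra.smul_def]
  exact A.sec_mul (A.sec_scal c) hs

theorem sec_neg {s : ∀ y, A.stalk ⟨α, y⟩} (hs : (A.sheaf α).IsSec s w) :
    (A.sheaf α).IsSec (fun y => -s y) w := by
  simpa only [neg_one_smul] using A.sec_smul (-1) hs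

theorem sec_sum {ι : Type*} (t : Finset ι) {s : ι → ∀ y, A.stalk ⟨α, y⟩}
    (hs : ∀ i, (A.sheaf α).IsSec (s i) w) : (A.sheaf α).IsSec (fun y => ∑ i ∈ t, s i y) w := by
  classical
  induction t using Finset.induction_on with
  | empty => simpa using A.sec_zero
  | insert i t h ih =>
    simp only [Finset.sum_insert h]
    exact A.sec_add (hs i) ih

/-- The degrees of the components of a section are locally bounded. -/
theorem sec_eq_sum_pr {s : ∀ y, A.stalk ⟨α, y⟩} (hs : (A.sheaf α).IsSec s w) :
    ∀ᶠ y in 𝓝 w, s y = ∑ i ∈ supp (s w), pr i (s y) :=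
  (A.sheaf α).eq_near hs (A.sec_sum _ fun i => A.sec_pr i hs) (sum_pr (s w)).symm

theorem sec_inv {s : ∀ y, A.stalk ⟨α, y⟩} (hs : (A.sheaf α).IsSec s w) :
    (A.sheaf α).IsSec (fun y => inv (s y)) w := by
  refine (A.sheaf α).congr (s := fun y => ∑ i ∈ supp (s w), sgn i • pr i (s y))
    (A.sec_sum _ fun i => A.sec_smul _ (A.sec_pr i hs)) ((A.sec_eq_sum_pr hs).mono fun y hy => ?_)
  conv_rhs => rw [hy]
  rw [map_sum]
  exact Finset.sum_congr rfl fun i _ => (inv_pr _ _).symm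

/-- A property that is known for one section through each germ holds for all sections. -/
theorem sec_of_exists {A' : DGSheaf W} {K : ∀ y, A.stalk ⟨α, y⟩ → A'.stalk ⟨α, y⟩}
    (h : ∀ a, ∃ s, (A.sheaf α).IsSec s w ∧ s w = a ∧ (A'.sheaf α).IsSec (fun y => K y (s y)) w)
    {s : ∀ y, A.stalk ⟨α, y⟩} (hs : (A.sheaf α).IsSec s w) :
    (A'.sheaf α).IsSec (fun y => K y (s y)) w := by
  obtain ⟨t, ht, hts, hKt⟩ := h (s w)
  exact (A'.sheaf α).congr hKt (((A.sheaf α).eq_near ht hs hts).mono fun y hy => by simp only [hy])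

theorem Hom.ext_app {A A' : DGSheaf W} {f g : A.Hom A'} (h : ∀ P a, f.app P a = g.app P a) :
    f = g := by
  obtain ⟨f, _, _, _⟩ := f
  obtain ⟨g, _, _, _⟩ := g
  obtain rfl : f = g := funext fun P => funext (h P)
  rfl

end DGSheaf

/-- Morphisms out of a presented sheaf. -/
def SheafPres.desc (D : SheafPres W) (f : ∀ P, D.C.stalk P → A.stalk P)
    (g : ∀ P, D.C'.stalk P → A.stalk P) (q : ∀ P, D.Q P (A.stalk P) (f P) (g P))
    (fres : ∀ {P Q : W.Pt} (h : P ≤ Q) a, f Q (D.C.res h a) = A.res h (f P a))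
    (gres : ∀ {P Q : W.Pt} (h : P ≤ Q) a, g Q (D.C'.res h a) = A.res h (g P a))
    (fsec : ∀ {α w s}, (D.C.sheaf α).IsSec s w → (A.sheaf α).IsSec (fun y => f ⟨α, y⟩ (s y)) w)
    (gsec : ∀ {α w s}, (D.C'.sheaf α).IsSec s w → (A.sheaf α).IsSec (fun y => g ⟨α, y⟩ (s y)) w) :
    D.toSheaf.Hom A where
  app P := Pres.lift (q P)
  hom P := Pres.lift_hom (q P)
  res h := D.hom_ext ((Pres.lift_hom (q _)).comp (D.res_hom h))
    ((A.res_hom h).comp (Pres.lift_hom (q _))) (fres h) (gres h)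
  sec {α w s} hs := by
    have H : ∀ y : W.K α, IsDGHom (Pres.lift (q ⟨α, y⟩)) := fun y => Pres.lift_hom _
    have hs' : D.Sec α w s := hs
    clear hs
    induction hs' with
    | left c h => exact fsec h
    | right c h => exact gsec h
    | scal c => simp only [(H _).map_scal]; exact A.sec_scal c
    | add s t h1 h2 hs ht => simp only [(H _).map_add]; exact A.sec_add hs ht
    | mul s t h1 h2 hs ht => simp only [(H _).map_mul]; exact A.sec_mul hs ht
    | diff s h1 hs => simp only [(H _).map_d]; exact A.sec_d hs
    | proj i s h1 hs => simp only [(H _).map_pr]; exact A.sec_pr i hs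
    | congr s t e h1 hs => exact (A.sheaf α).congr hs (e.mono fun y hy => by simp only [hy])

end sections

/-! ### Stalks of the free resolution. -/

section free

variable {W : SimplicialSpace.{u}} {R S B : DGSheaf W} {φ : S.Hom B} {E : Gens B}

/-- The stalks of a free algebra are free. -/
theorem Gens.IsFree.freeOn (hE : E.IsFree φ) (P : W.Pt) :
    FreeOn (φ.app P) (fun x : Σ i, E.Idx P.face i => x.1) (fun x => E.val P x.2) :=
  .mk' (φ.hom P).toIsGrHom (fun x => (B.res_hom _).toIsGrHom.hom (E.deg _ _))
    fun Z _ ψ hψ c hc => by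
      obtain ⟨h, ⟨h1, h2, h3⟩, hu⟩ := hE.universal P Z ψ hψ (fun i x => c ⟨i, x⟩)
        fun i x => hc ⟨i, x⟩
      exact ⟨h, ⟨h1, h2, fun x => h3 _ _⟩, fun h' ⟨h1', h2', h3'⟩ =>
        hu h' ⟨h1', h2', fun i x => h3' ⟨i, x⟩⟩⟩

theorem Gens.IsFree.deg_neg (hE : E.IsFree φ) {P : W.Pt} (x : Σ i, E.Idx P.face i) : x.1 < 0 := by
  by_contra h
  exact (hE.neg _ _ (not_lt.1 h)).false x.2.2

theorem FreeAnalytic.nonPos {j : R.Hom S} (F : FreeAnalytic j) {μ : S.Hom R}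
    (hμ : ∀ P r, μ.app P (j.app P r) = r) (hR : ∀ P, NonPos (R.stalk P)) (P : W.Pt) :
    NonPos (S.stalk P) := by
  obtain ⟨c, hc⟩ := F.cover P.pt
  exact (F.toStalk μ hμ hR c hc).nonpos_S

/-- A section of a quasi-isomorphism makes it an augmentation with acyclic kernel. -/
theorem acyclicAug_of_isCohomologyIso {A R : Type u} [CDGA A] [CDGA R] {s : R → A} {ε : A → R}
    (hs : IsDGHom s) (hε : IsDGHom ε) (h : ∀ r, ε (s r) = r)
    (hq : IsCohomologyIso (fun i (a : A) => pr i a) (fun a => d a) (fun i (b : R) => pr i b)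
      (fun b => d b) ε) : AcyclicAug s ε where
  s_hom := hs
  ε_hom := hε
  ε_s := h
  acyclic i z hz hd hεz := by
    obtain ⟨w, -, hw⟩ := hq.injective i z hz hd ⟨0, map_zero _, by rw [map_zero, hεz]⟩
    exact ⟨w, hw⟩

end free

/-! ### Generation of the algebra of forms by functions and differentials. -/

section forms

variable {W : SimplicialSpace.{u}} {R S B : DGSheaf W} {j : R.Hom S} {F : FreeAnalytic j}
  {φ : S.Hom B} {P : W.Pt}

theorem OmegaRel.map {Z Z' : Type u} [CDGA Z] [CDGA Z'] {f T : S.stalk P → Z}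
    (q : OmegaRel F P Z f T) {h : Z → Z'} (hh : IsDGHom h) :
    OmegaRel F P Z' (fun s => h (f s)) (fun s => h (T s)) where
  hom := hh.comp q.hom
  add s s' := by rw [q.add, hh.map_add]
  base r := by rw [q.base, hh.map_zero]
  leibniz i s s' := by
    rw [q.leibniz, hh.map_add, hh.map_mul, hh.toIsGrHom.map_smul, hh.map_mul]
  diff s := by rw [q.diff, hh.toIsGrHom.map_neg, hh.map_d]
  proj i s := by rw [q.proj, hh.map_pr]
  chain hQ c hc g := by
    rw [q.chain hQ c hc g, hh.toIsGrHom.map_sum]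
    exact Finset.sum_congr rfl fun i _ => hh.map_mul _ _

/-- Provides the endomorphism of `B ⊗ Ω` that kills all differentials, needed for weights in
`linear_part`. -/
theorem OmegaRel.zero {Z : Type u} [CDGA Z] {f : S.stalk P → Z} (hf : IsDGHom f) :
    OmegaRel F P Z f 0 where
  hom := hf
  add s s' := by simp
  base r := rfl
  leibniz i s s' := by simp
  diff s := by simp
  proj i s := by simp
  chain hQ c hc g := by simp

/-- The algebra `B ⊗ Ω` is generated by `B` and the differentials of elements of `S`. -/
theorem form_gen {p : (BOmega F φ).stalk P → Prop} (hB : ∀ b, p (inB F φ P b))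
    (hd : ∀ s, p (formD F φ P s)) (hadd : ∀ x y, p x → p y → p (x + y))
    (hmul : ∀ x y, p x → p y → p (x * y)) (x) : p x := by
  let g : Set ((BOmega F φ).stalk P) := Set.range (inB F φ P) ∪ Set.range (formD F φ P)
  have hg : ∀ y ∈ g, ∀ i, pr i y ∈ g ∨ pr i y = 0 := by
    rintro _ (⟨b, rfl⟩ | ⟨s, rfl⟩) i
    · exact .inl (.inl ⟨pr i b, (inB_hom F φ P).map_pr i b⟩)
    · exact .inl (.inr ⟨pr (i + 1) s, (formD_rel F φ P).proj i s⟩)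
  have hpr := adjoin_graded hg
  let G := Algebra.adjoin ℂ g
  have hsub : g ⊆ G := Algebra.subset_adjoin
  have hinv : ∀ y ∈ G, inv y ∈ G := fun y hy => by
    rw [← sum_pr y, map_sum]
    refine sum_mem fun i _ => ?_
    rw [inv_pr]
    exact G.smul_mem (hpr i y hy) _
  -- Induction over the presentation also passes through `d` and the projections, so the plain
  -- subalgebra must be stable under both. For `d` this uses that `d (ds)` is `-d(ds')` with `s' = d
  -- s`, again a differential of an element of `S`.
  have hdG : ∀ y ∈ G, d y ∈ G := fun y hy => by
    induction hy using Algebra.adjoin_induction with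
    | mem y hy =>
      rcases hy with ⟨b, rfl⟩ | ⟨s, rfl⟩
      · exact hsub (.inl ⟨d b, (inB_hom F φ P).map_d b⟩)
      · have := (formD_rel F φ P).diff s
        rw [← neg_eq_iff_eq_neg] at this
        rw [← this]
        exact neg_mem (hsub (.inr ⟨_, rfl⟩))
    | algebraMap c => rw [d_algebraMap]; exact zero_mem _
    | add x y _ _ hx hy => rw [map_add]; exact add_mem hx hy
    | mul x y hx' hy' hx hy =>
      rw [d_mul]
      exact add_mem (mul_mem hx hy') (mul_mem (hinv _ hx') hy)
  have hO : ∀ a, inOmega F φ P a ∈ G := fun a => by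
    have h := inOmega_hom F φ P
    refine Pres.induction (p := fun a : (omegaPres F).Stalk P => inOmega F φ P a ∈ G)
      (fun s => ?_) (fun s => hsub (.inr ⟨s, rfl⟩)) (fun c => ?_) (fun x y hx hy => ?_)
      (fun x y hx hy => ?_) (fun x hx => ?_) (fun i x hx => ?_) a
    · have := inB_inOmega F φ P s
      exact this ▸ hsub (.inl ⟨_, rfl⟩)
    · exact (h.map_scal c) ▸ G.algebraMap_mem c
    · exact (h.map_add x y) ▸ add_mem hx hy
    · exact (h.map_mul x y) ▸ mul_mem hx hy
    · exact (h.map_d x) ▸ hdG _ hx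
    · exact (h.map_pr i x) ▸ hpr _ _ hx
  have hx : x ∈ G := by
    refine Pres.induction (p := fun x : (tensorPres φ (omegaIncl F)).Stalk P =>
      (show (BOmega F φ).stalk P from x) ∈ G)
      (fun b => hsub (.inl ⟨b, rfl⟩)) hO (fun c => G.algebraMap_mem c) (fun x y => add_mem)
      (fun x y => mul_mem) hdG (fun i x => hpr i x) x
  induction hx using Algebra.adjoin_induction with
  | mem y hy =>
    rcases hy with ⟨b, rfl⟩ | ⟨s, rfl⟩
    · exact hB b
    · exact hd s
  | algebraMap c => exact (inB_hom F φ P).map_scal c ▸ hB _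
  | add x y _ _ hx hy => exact hadd _ _ hx hy
  | mul x y _ _ hx hy => exact hmul _ _ hx hy

/-! ## Connections -/

variable (F φ P) in
/-- The submodule `B ⊗ Ω^1[1]` of `B ⊗ Ω`. -/
def linForms : Submodule ℂ ((BOmega F φ).stalk P) :=
  Submodule.span ℂ {x | ∃ b' s, x = inB F φ P b' * formD F φ P s}

theorem linForms_left (b : B.stalk P) {x} (hx : x ∈ linForms F φ P) :
    inB F φ P b * x ∈ linForms F φ P := by
  induction hx using Submodule.span_induction with
  | mem x hx =>
    obtain ⟨b', s, rfl⟩ := hx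
    exact Submodule.subset_span ⟨b * b', s, by rw [(inB_hom F φ P).map_mul, mul_assoc]⟩
  | zero => rw [mul_zero]; exact zero_mem _
  | add x y _ _ hx hy => rw [mul_add]; exact add_mem hx hy
  | smul c x _ hx => rw [mul_smul_comm]; exact Submodule.smul_mem _ _ hx

/-- A homogeneous differential commutes with an element of `B` up to the parity involution of the
latter, so left combinations are right combinations. -/
theorem linForms_right (b : B.stalk P) {x} (hx : x ∈ linForms F φ P) :
    x * inB F φ P b ∈ linForms F φ P := by
  induction hx using Submodule.span_induction with
  | mem x hx =>
    obtain ⟨b', s, rfl⟩ := hx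
    rw [mul_assoc]
    refine linForms_left b' ?_
    induction s using hom_induction with
    | add s t hs ht => rw [(formD_rel F φ P).add, add_mul]; exact add_mem hs ht
    | hom i s hs =>
      rcases exists_mul_comm ((formD_der F φ P).hom hs) (inB F φ P b) with h | h
      · exact Submodule.subset_span ⟨b, s, h⟩
      · exact Submodule.subset_span ⟨inv b, s, by rw [h, (inB_hom F φ P).toIsGrHom.map_inv]⟩
  | zero => rw [zero_mul]; exact zero_mem _
  | add x y _ _ hx hy => rw [add_mul]; exact add_mem hx hy
  | smul c x _ hx => rw [smul_mul_assoc]; exact Submodule.smul_mem _ _ hx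

theorem linForms_d {x} (hx : x ∈ linForms F φ P) : d x ∈ linForms F φ P := by
  induction hx using Submodule.span_induction with
  | mem x hx =>
    obtain ⟨b', s, rfl⟩ := hx
    have h : d (formD F φ P s) = -formD F φ P (d s) := by
      rw [(formD_rel F φ P).diff, neg_neg]
    rw [d_mul, h, ← (inB_hom F φ P).map_d, ← (inB_hom F φ P).toIsGrHom.map_inv, mul_neg]
    exact add_mem (Submodule.subset_span ⟨_, _, rfl⟩) (neg_mem (Submodule.subset_span ⟨_, _, rfl⟩))
  | zero => rw [map_zero]; exact zero_mem _
  | add x y _ _ hx hy => rw [map_add]; exact add_mem hx hy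
  | smul c x _ hx => rw [map_smul]; exact Submodule.smul_mem _ _ hx

theorem formD_res {P Q : W.Pt} (h : P ≤ Q) (s : S.stalk P) :
    formD F φ Q (S.res h s) = (BOmega F φ).res h (formD F φ P s) := rfl

theorem inB_res {P Q : W.Pt} (h : P ≤ Q) (b : B.stalk P) :
    inB F φ Q (B.res h b) = (BOmega F φ).res h (inB F φ P b) := rfl

theorem formD_sec {α : W.faces} {w : W.K α} {s : ∀ y, S.stalk ⟨α, y⟩}
    (hs : (S.sheaf α).IsSec s w) :
    ((BOmega F φ).sheaf α).IsSec (fun y => formD F φ ⟨α, y⟩ (s y)) w :=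
  (tensorRight φ (omegaIncl F)).sec (s := fun y => omegaD F ⟨α, y⟩ (s y))
    (SheafPres.Sec.right (D := omegaPres F) s hs)

theorem inB_sec {α : W.faces} {w : W.K α} {b : ∀ y, B.stalk ⟨α, y⟩}
    (hs : (B.sheaf α).IsSec b w) :
    ((BOmega F φ).sheaf α).IsSec (fun y => inB F φ ⟨α, y⟩ (b y)) w :=
  (tensorLeft φ (omegaIncl F)).sec hs

theorem Connection.isOddDer (c : Connection F φ) (P : W.Pt) : IsOddDer (inB F φ P) (c.app P) where
  add := c.map_add P
  mul := by
    have h := inB_hom F φ P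
    have h1 : ∀ a, c.app P (algebraMap ℂ _ a) = 0 := fun a => by
      rw [← (φ.hom P).map_scal, c.extends_d]
      exact (formD_der F φ P).scal a
    have h2 : ∀ (a : ℂ) b, c.app P (a • b) = a • c.app P b := fun a b => by
      have := c.leibniz P 0 (algebraMap ℂ _ a) b
      rw [pr_algebraMap, sgn_zero, one_smul, h1, zero_mul, zero_add, h.map_scal,
        ← Algebra.smul_def, ← Algebra.smul_def] at this
      exact this
    exact leibniz_inv h.map_add h.toIsGrHom.map_smul (c.map_add P) (c.leibniz P)
  scal a := by
    rw [← (φ.hom P).map_scal, c.extends_d]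
    exact (formD_der F φ P).scal a
  pr i x := by
    have := c.proj P (i - 1) x
    rwa [sub_add_cancel] at this

theorem Connection.mem_linForms (c : Connection F φ) (b : B.stalk P) :
    c.app P b ∈ linForms F φ P := c.mem_span P b

/-- Free algebras have connections. -/
theorem Gens.IsFree.nonempty_connection {E : Gens B} (hE : E.IsFree φ) (F : FreeAnalytic j) :
    Nonempty (Connection F φ) := by
  -- The connection that vanishes on the generators. Restriction carries generators to generators,
  -- so uniqueness of derivations makes the stalkwise choices compatible.
  have hex := fun P => (hE.freeOn P).exists_oddDer (inB_hom F φ P).toIsGrHom (formD_der F φ P) 0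
    fun x => map_zero _
  choose K hK hKφ hKe using hex
  have hKe' : ∀ P i x, K P (E.val P (i := i) x) = 0 := fun P i x => hKe P ⟨i, x⟩
  refine ⟨⟨K, fun P => (hK P).add, fun P i b b' => ?_, hKφ, fun P b => ?_, fun P i b => ?_,
    fun {P Q} h b => ?_, fun {α w s} hs => ?_⟩⟩
  · rw [(hK P).mul, inv_pr, (inB_hom F φ P).toIsGrHom.map_smul, smul_mul_assoc]
  · change _ ∈ linForms F φ P
    refine (hE.freeOn P).gen (fun b => K P b ∈ linForms F φ P) (fun s => ?_) (fun x => ?_)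
      (fun y z hy hz => ?_) (fun y z hy hz => ?_) b
    · rw [hKφ]
      exact Submodule.subset_span ⟨1, s, by rw [(inB_hom F φ P).toIsGrHom.map_one, one_mul]⟩
    · rw [hKe' P]; exact zero_mem _
    · rw [(hK P).add]; exact add_mem hy hz
    · rw [(hK P).mul]; exact add_mem (linForms_right _ hy) (linForms_left _ hz)
  · rw [(hK P).pr, add_sub_cancel_right]
  · refine (hE.freeOn P).oddDer_ext (f := fun b => inB F φ Q (B.res h b))
      ((hK Q).comp (B.res_hom h).toIsGrHom)
      ((hK P).postcomp ((BOmega F φ).res_hom h).toIsGrHom) (fun s => ?_) (fun x => ?_) b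
    · rw [← φ.res, hKφ, hKφ, formD_res]
    · rw [hKe' P, E.res_val, hKe', ((BOmega F φ).res_hom h).map_zero]
  · refine B.sec_of_exists (A' := BOmega F φ) (K := fun y => K ⟨α, y⟩)
      ((hE.freeOn ⟨α, w⟩).gen _ (fun a => ?_) (fun x => ?_) ?_ ?_) hs
    · obtain ⟨t, ht, rfl⟩ := (S.sheaf α).exists_sec w a
      exact ⟨_, φ.sec ht, rfl, by simp only [hKφ]; exact formD_sec ht⟩
    · exact ⟨_, E.val_sec x.2 w, rfl, by simp only [hKe']; exact (BOmega F φ).sec_zero⟩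
    · rintro y z ⟨s, h1, rfl, h2⟩ ⟨t, h3, rfl, h4⟩
      exact ⟨_, B.sec_add h1 h3, rfl, by simp only [(hK _).add]; exact (BOmega F φ).sec_add h2 h4⟩
    · rintro y z ⟨s, h1, rfl, h2⟩ ⟨t, h3, rfl, h4⟩
      refine ⟨_, B.sec_mul h1 h3, rfl, ?_⟩
      simp only [(hK _).mul]
      exact (BOmega F φ).sec_add ((BOmega F φ).sec_mul h2 (inB_sec h3))
        ((BOmega F φ).sec_mul (inB_sec (B.sec_inv h1)) h4)

end forms

/-! ## Exponentials of locally nilpotent derivations -/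

section exponential

variable {A : Type u} [CDGA A] (D : A →ₗ[ℂ] A)

/-- The terms of the exponential series of `-D`. -/
def expTerm (n : ℕ) (x : A) : A := ((-1) ^ n / (n.factorial : ℂ)) • D^[n] x

variable {D}

theorem iterate_eq_zero_of_le {N M : ℕ} (h : N ≤ M) {x : A} (hx : D^[N] x = 0) : D^[M] x = 0 := by
  obtain ⟨k, rfl⟩ := Nat.exists_eq_add_of_le' h
  rw [Function.iterate_add_apply, hx, iterate_map_zero]

theorem expTerm_eq_zero {N n : ℕ} (h : N ≤ n) {x : A} (hx : D^[N] x = 0) : expTerm D n x = 0 := by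
  rw [expTerm, iterate_eq_zero_of_le h hx, smul_zero]

theorem expTerm_zero (x : A) : expTerm D 0 x = x := by simp [expTerm]

theorem expTerm_succ (n : ℕ) (x : A) : ((n + 1 : ℕ) : ℂ) • expTerm D (n + 1) x = -D (expTerm D n x) := by
  rw [expTerm, expTerm, map_smul, ← Function.iterate_succ_apply' (f := D), smul_smul, ← neg_smul]
  congr 1
  have h1 : ((n + 1 : ℕ) : ℂ) ≠ 0 := Nat.cast_ne_zero.2 n.succ_ne_zero
  have h2 : ((n.factorial : ℕ) : ℂ) ≠ 0 := Nat.cast_ne_zero.2 n.factorial_ne_zero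
  rw [Nat.factorial_succ, Nat.cast_mul]
  field_simp
  ring

/-- The terms are divided powers of `-D`, for which the iterated Leibniz rule has no binomial
coefficients. In the induction the factor `n + 1` is written as `p.1 + p.2` on the antidiagonal and
absorbed by `expTerm_succ`. -/
theorem expTerm_mul (hD : ∀ x y, D (x * y) = D x * y + x * D y) (n : ℕ) (x y : A) :
    expTerm D n (x * y) = ∑ p ∈ Finset.HasAntidiagonal.antidiagonal n, expTerm D p.1 x * expTerm D p.2 y := by
  induction n with
  | zero => simp [expTerm_zero]
  | succ n ih =>
    have h1 : ((n + 1 : ℕ) : ℂ) ≠ 0 := Nat.cast_ne_zero.2 n.succ_ne_zero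
    refine smul_right_injective A h1 ?_
    change ((n + 1 : ℕ) : ℂ) • _ = ((n + 1 : ℕ) : ℂ) • _
    have e : ((n + 1 : ℕ) : ℂ) • ∑ p ∈ Finset.HasAntidiagonal.antidiagonal (n + 1), expTerm D p.1 x * expTerm D p.2 y =
        (∑ p ∈ Finset.HasAntidiagonal.antidiagonal (n + 1), ((p.1 : ℂ) • expTerm D p.1 x) * expTerm D p.2 y) +
        ∑ p ∈ Finset.HasAntidiagonal.antidiagonal (n + 1), expTerm D p.1 x * ((p.2 : ℂ) • expTerm D p.2 y) := by
      rw [Finset.smul_sum, ← Finset.sum_add_distrib]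
      refine Finset.sum_congr rfl fun p hp => ?_
      rw [smul_mul_assoc, mul_smul_comm, ← add_smul, ← Nat.cast_add, Finset.HasAntidiagonal.mem_antidiagonal.1 hp]
    rw [e, Finset.Nat.sum_antidiagonal_succ, Finset.Nat.sum_antidiagonal_succ', expTerm_succ, ih,
      map_sum, ← Finset.sum_neg_distrib]
    simp only [expTerm_succ, Nat.cast_zero, zero_smul, zero_mul, mul_zero, zero_add, hD,
      neg_add, Finset.sum_add_distrib, neg_mul, mul_neg]

/-- In the product formula of order `N + M` every summand has a vanishing factor, and the rational
coefficient can be removed. -/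
theorem exists_iterate_mul (hD : ∀ x y, D (x * y) = D x * y + x * D y) (N M : ℕ) (x y : A)
    (hx : D^[N] x = 0) (hy : D^[M] y = 0) : D^[N + M] (x * y) = 0 := by
  have h : expTerm D (N + M) (x * y) = 0 := by
    rw [expTerm_mul hD]
    refine Finset.sum_eq_zero fun p hp => ?_
    have := Finset.HasAntidiagonal.mem_antidiagonal.1 hp
    rcases le_or_gt N p.1 with h | h
    · rw [expTerm_eq_zero h hx, zero_mul]
    · rw [expTerm_eq_zero (by omega) hy, mul_zero]
  refine (smul_eq_zero.1 h).resolve_left ?_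
  exact div_ne_zero (pow_ne_zero _ (by simp)) (Nat.cast_ne_zero.2 (Nat.factorial_ne_zero _))

variable (D) in
/-- The exponential of `-D`. -/
def expNil (h : ∀ x, ∃ N, D^[N] x = 0) (x : A) : A := ∑ n ∈ Finset.range (h x).choose, expTerm D n x

theorem expNil_eq {h : ∀ x, ∃ N, D^[N] x = 0} {x : A} {N : ℕ} (hN : D^[N] x = 0) :
    expNil D h x = ∑ n ∈ Finset.range N, expTerm D n x := by
  have key : ∀ N M, N ≤ M → D^[N] x = 0 →
      ∑ n ∈ Finset.range N, expTerm D n x = ∑ n ∈ Finset.range M, expTerm D n x := fun N M hNM hN =>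
    Finset.sum_subset (Finset.range_mono hNM) fun n _ hn =>
      expTerm_eq_zero (not_lt.1 fun h => hn (Finset.mem_range.2 h)) hN
  rw [expNil, key _ _ (le_max_left _ N) (h x).choose_spec, ← key _ _ (le_max_right _ _) hN]

theorem expNil_of_eq_zero {h : ∀ x, ∃ N, D^[N] x = 0} {x : A} (hx : D x = 0) :
    expNil D h x = x := by
  rw [expNil_eq (N := 1) hx, Finset.sum_range_one, expTerm_zero]

theorem expNil_hom (h : ∀ x, ∃ N, D^[N] x = 0) (hD : ∀ x y, D (x * y) = D x * y + x * D y)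
    (hs : ∀ c, D (algebraMap ℂ A c) = 0) (hpr : ∀ i x, D (pr i x) = pr i (D x))
    (hd : ∀ x, D (d x) = d (D x)) : IsDGHom (expNil D h) where
  map_add x y := by
    obtain ⟨N, hN⟩ := h x
    obtain ⟨M, hM⟩ := h y
    have hN' := iterate_eq_zero_of_le (le_max_left N M) hN
    have hM' := iterate_eq_zero_of_le (le_max_right N M) hM
    have hNM : D^[max N M] (x + y) = 0 := by rw [iterate_map_add, hN', hM', add_zero]
    rw [expNil_eq hN', expNil_eq hM', expNil_eq hNM, ← Finset.sum_add_distrib]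
    simp only [expTerm, iterate_map_add, smul_add]
  map_mul x y := by
    obtain ⟨N, hN⟩ := h x
    obtain ⟨M, hM⟩ := h y
    have hNM := exists_iterate_mul hD N M x y hN hM
    -- The terms become coefficients of polynomials in an auxiliary variable. The product formula
    -- says that these polynomials multiply, and evaluation at `1` is a ring homomorphism.
    let p : ∀ (N : ℕ) (x : A), Polynomial A := fun N x =>
      ∑ n ∈ Finset.range N, Polynomial.monomial n (expTerm D n x)
    have hp : ∀ (N : ℕ) (x : A), D^[N] x = 0 → ∀ n, (p N x).coeff n = expTerm D n x := by
      intro N x hN n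
      simp only [p, Polynomial.finsetSum_coeff, Polynomial.coeff_monomial]
      rw [Finset.sum_ite_eq']
      split_ifs with hn
      · rfl
      · exact (expTerm_eq_zero (not_lt.1 fun h => hn (Finset.mem_range.2 h)) hN).symm
    have he : ∀ (N : ℕ) (x : A), D^[N] x = 0 → DGPoly.ev 1 (p N x) = expNil D h x := by
      intro N x hN
      rw [expNil_eq hN, map_sum]
      exact Finset.sum_congr rfl fun n _ => by rw [DGPoly.ev_monomial, one_pow, one_smul]
    rw [← he _ _ hNM, ← he _ _ hN, ← he _ _ hM, ← map_mul]
    congr 1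
    ext n
    rw [hp _ _ hNM, Polynomial.coeff_mul, expTerm_mul hD]
    exact Finset.sum_congr rfl fun i _ => by rw [hp _ _ hN, hp _ _ hM]
  map_scal c := expNil_of_eq_zero (hs c)
  map_pr i x := by
    obtain ⟨N, hN⟩ := h x
    have e : ∀ n, D^[n] (pr i x) = pr i (D^[n] x) := fun n =>
      (Function.Commute.iterate_left (f := D) (g := pr i) (hpr i) n) x
    have hN' : D^[N] (pr i x) = 0 := by rw [e, hN, map_zero]
    rw [expNil_eq hN, expNil_eq hN', map_sum]
    simp only [expTerm, e, map_smul]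
  map_d x := by
    obtain ⟨N, hN⟩ := h x
    have e : ∀ n, D^[n] (d x) = d (D^[n] x) := fun n =>
      (Function.Commute.iterate_left (f := D) (g := d) hd n) x
    have hN' : D^[N] (d x) = 0 := by rw [e, hN, map_zero]
    rw [expNil_eq hN, expNil_eq hN', map_sum]
    simp only [expTerm, e, map_smul]

end exponential

section atiyah

variable {W : SimplicialSpace.{u}} {R S B : DGSheaf W} {j : R.Hom S} {F : FreeAnalytic j}
  {φ : S.Hom B} (c : Connection F φ) {P : W.Pt}

/-! ## The Atiyah class -/

namespace Connection

theorem atiyah_mul (x y : B.stalk P) :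
    c.atiyah P (x * y) = c.atiyah P x * inB F φ P y + inB F φ P x * c.atiyah P y := by
  rw [atiyah, (c.isOddDer P).bracket (inB_hom F φ P), atiyah, atiyah, neg_mul, mul_neg, neg_add]

/-- On `S` the connection is the universal derivation, which anticommutes with the differentials
after the shift. Hence the Atiyah class is `S`-linear. -/
theorem atiyah_base (s : S.stalk P) : c.atiyah P (φ.app P s) = 0 := by
  have h : c.app P (φ.app P (d s)) = -d (c.app P (φ.app P s)) := by
    rw [c.extends_d, c.extends_d]
    exact (formD_rel F φ P).diff s
  rw [atiyah, ← (φ.hom P).map_d, h, add_neg_cancel, neg_zero]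

/-- A derivation of degree zero commuting with `d` is the same as a DG homomorphism into the even
dual numbers. -/
theorem atiyah_hom (P : W.Pt) : IsDGHom (fun b : B.stalk P =>
    (⟨inB F φ P b, c.atiyah P b⟩ : SplitExt (Cocycle0.zero ((BOmega F φ).stalk P)))) where
  map_add x y := by
    ext1
    · exact (inB_hom F φ P).map_add x y
    · change -(_ + _) = -(_ + _) + -(_ + _)
      rw [_root_.map_add d x y, (c.isOddDer P).add, (c.isOddDer P).add, _root_.map_add d]
      abel
  map_mul x y := by
    ext1
    · exact (inB_hom F φ P).map_mul x y
    · rw [SplitExt.mul_snd, Cocycle0.zero_val, zero_mul, zero_mul, add_zero]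
      exact c.atiyah_mul x y
  map_scal a := by
    rw [SplitExt.algebraMap_eq]
    ext1
    · exact (inB_hom F φ P).map_scal a
    · dsimp only
      rw [← (φ.hom P).map_scal, c.atiyah_base]
  map_pr i x := by
    ext1
    · exact (inB_hom F φ P).map_pr i x
    · change -(_ + _) = pr i (-(_ + _))
      rw [(c.isOddDer P).pr, d_pr, d_pr, (c.isOddDer P).pr, _root_.map_neg, _root_.map_add, sub_add_cancel,
        add_sub_cancel_right]
  map_d x := by
    ext1
    · exact (inB_hom F φ P).map_d x
    · change -(_ + _) = d (-(_ + _))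
      rw [d_d, (c.isOddDer P).zero, _root_.map_neg, _root_.map_add, d_d, zero_add, add_zero]

theorem atiyah_mem_linForms (b : B.stalk P) : c.atiyah P b ∈ linForms F φ P :=
  neg_mem (add_mem (linForms_d (c.mem_linForms b)) (c.mem_linForms _))

theorem atiyah_res {P Q : W.Pt} (h : P ≤ Q) (b : B.stalk P) :
    c.atiyah Q (B.res h b) = (BOmega F φ).res h (c.atiyah P b) := by
  have H := (BOmega F φ).res_hom h
  rw [atiyah, atiyah, ← (B.res_hom h).map_d, c.res, c.res, H.toIsGrHom.map_neg, H.map_add, H.map_d]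

theorem atiyah_sec {α : W.faces} {w : W.K α} {b : ∀ y, B.stalk ⟨α, y⟩}
    (hs : (B.sheaf α).IsSec b w) :
    ((BOmega F φ).sheaf α).IsSec (fun y => c.atiyah ⟨α, y⟩ (b y)) w :=
  (BOmega F φ).sec_neg ((BOmega F φ).sec_add ((BOmega F φ).sec_d (c.sec hs)) (c.sec (B.sec_d hs)))

/-- The map `b ↦ b + x At(b)` on `B` and the constant inclusion on `Ω` agree on `S` by
`atiyah_base`. The tensor product therefore maps to the dual numbers, and the coefficient of `x` is
the extension. -/
theorem exists_atiyahExtension : ∃ D, IsAtiyahExtension c D ∧ ∀ P, IsDGHom (fun x =>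
    (⟨x, D P x⟩ : SplitExt (Cocycle0.zero ((BOmega F φ).stalk P)))) := by
  have hex : ∀ P, ∃ D : (BOmega F φ).stalk P → (BOmega F φ).stalk P,
      IsDGHom (fun x => (⟨x, D x⟩ : SplitExt (Cocycle0.zero ((BOmega F φ).stalk P)))) ∧
      (∀ a, D (inOmega F φ P a) = 0) ∧ ∀ b, D (inB F φ P b) = c.atiyah P b := fun P => by
    have q : OmegaRel F P _ (fun s => (⟨inB F φ P (φ.app P s), c.atiyah P (φ.app P s)⟩ :
        SplitExt (Cocycle0.zero ((BOmega F φ).stalk P)))) (fun s => ⟨formD F φ P s, 0⟩) := by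
      simp only [c.atiyah_base]
      exact (formD_rel F φ P).map SplitExt.inl_hom
    obtain ⟨h, hh, h1, -, h2⟩ := exists_formHom (c.atiyah_hom P) q
    have h3 : ∀ x, (h x).1 = x := formHom_ext (SplitExt.fst_hom.comp hh) IsDGHom.id
      (fun b => by rw [h1]) (fun s => by rw [h2])
    refine ⟨fun x => (h x).2, ?_, fun a => ?_, fun b => congrArg SplitExt.snd (h1 b)⟩
    · convert hh using 2 with x
      ext1
      · exact (h3 x).symm
      · rfl
    · refine congrArg SplitExt.snd (omega_ext (hh.comp (inOmega_hom F φ P))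
        (SplitExt.inl_hom.comp (inOmega_hom F φ P)) (fun s => ?_) h2 a)
      have := inB_inOmega F φ P s
      refine (congrArg h this.symm).trans ((h1 _).trans ?_)
      rw [c.atiyah_base]
      exact congrArg (fun x => (⟨x, 0⟩ : SplitExt (Cocycle0.zero ((BOmega F φ).stalk P)))) this
  choose D hD h1 h2 using hex
  refine ⟨D, ⟨fun P x y => ?_, fun P x y => ?_, h1, h2⟩, hD⟩
  · exact congrArg SplitExt.snd ((hD P).map_add x y)
  · have := congrArg SplitExt.snd ((hD P).map_mul x y)
    rwa [SplitExt.mul_snd, Cocycle0.zero_val, zero_mul, zero_mul, add_zero] at this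

end Connection

namespace IsAtiyahExtension

variable {c} {D D' : ∀ P, (BOmega F φ).stalk P → (BOmega F φ).stalk P}

theorem unique (h : IsAtiyahExtension c D) (h' : IsAtiyahExtension c D') : D = D' := by
  funext P x
  refine form_gen (p := fun x => D P x = D' P x) (fun b => by rw [h.atiyah, h'.atiyah])
    (fun s => (h.omega P _).trans (h'.omega P _).symm)
    (fun x y hx hy => by rw [h.map_add, h'.map_add, hx, hy])
    (fun x y hx hy => by rw [h.leibniz, h'.leibniz, hx, hy]) x

variable (h : IsAtiyahExtension c D)
include h

/-- Compatibility with scalars, degrees and differentials is not required of an extension; it is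
inherited from the constructed one by uniqueness. -/
theorem hom (P : W.Pt) :
    IsDGHom (fun x => (⟨x, D P x⟩ : SplitExt (Cocycle0.zero ((BOmega F φ).stalk P)))) := by
  obtain ⟨D', h', hh⟩ := c.exists_atiyahExtension
  obtain rfl := h.unique h'
  exact hh P

theorem map_pr (i : ℤ) (x : (BOmega F φ).stalk P) : D P (pr i x) = pr i (D P x) :=
  congrArg SplitExt.snd ((h.hom P).map_pr i x)

theorem map_d (x : (BOmega F φ).stalk P) : D P (d x) = d (D P x) :=
  congrArg SplitExt.snd ((h.hom P).map_d x)

theorem map_smul (a : ℂ) (x : (BOmega F φ).stalk P) : D P (a • x) = a • D P x :=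
  congrArg SplitExt.snd ((h.hom P).toIsGrHom.map_smul a x)

theorem map_scal (a : ℂ) : D P (algebraMap ℂ _ a) = 0 := by
  have := congrArg SplitExt.snd ((h.hom P).map_scal a)
  rwa [SplitExt.algebraMap_eq] at this

theorem map_formD (s : S.stalk P) : D P (formD F φ P s) = 0 := h.omega P _

/-- The extension of the Atiyah class as a linear map. -/
def lin (P : W.Pt) : (BOmega F φ).stalk P →ₗ[ℂ] (BOmega F φ).stalk P where
  toFun := D P
  map_add' := h.map_add P
  map_smul' := h.map_smul

theorem map_res {P Q : W.Pt} (hPQ : P ≤ Q) (x : (BOmega F φ).stalk P) :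
    D Q ((BOmega F φ).res hPQ x) = (BOmega F φ).res hPQ (D P x) := by
  have H := (BOmega F φ).res_hom hPQ
  refine form_gen (p := fun x => D Q ((BOmega F φ).res hPQ x) = (BOmega F φ).res hPQ (D P x))
    (fun b => ?_) (fun s => ?_) (fun x y hx hy => ?_) (fun x y hx hy => ?_) x
  · rw [← inB_res, h.atiyah, h.atiyah, c.atiyah_res]
  · rw [← formD_res, h.map_formD, h.map_formD, H.map_zero]
  · rw [H.map_add, h.map_add, h.map_add, H.map_add, hx, hy]
  · rw [H.map_mul, h.leibniz, h.leibniz, H.map_add, H.map_mul, H.map_mul, hx, hy]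

theorem map_sec {α : W.faces} {w : W.K α} {x : ∀ y, (BOmega F φ).stalk ⟨α, y⟩}
    (hx : ((BOmega F φ).sheaf α).IsSec x w) :
    ((BOmega F φ).sheaf α).IsSec (fun y => D ⟨α, y⟩ (x y)) w := by
  refine (BOmega F φ).sec_of_exists (A' := BOmega F φ) (K := fun y => D ⟨α, y⟩)
    (fun a => form_gen (p := fun a => ∃ s, ((BOmega F φ).sheaf α).IsSec s w ∧ s w = a ∧
      ((BOmega F φ).sheaf α).IsSec (fun y => D ⟨α, y⟩ (s y)) w) (fun b => ?_) (fun s => ?_) ?_ ?_ a) hx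
  · obtain ⟨t, ht, rfl⟩ := (B.sheaf α).exists_sec w b
    exact ⟨_, inB_sec ht, rfl, by simp only [h.atiyah]; exact c.atiyah_sec ht⟩
  · obtain ⟨t, ht, rfl⟩ := (S.sheaf α).exists_sec w s
    exact ⟨_, formD_sec ht, rfl, by simp only [h.map_formD]; exact (BOmega F φ).sec_zero⟩
  · rintro y z ⟨s, h1, rfl, h2⟩ ⟨t, h3, rfl, h4⟩
    exact ⟨_, (BOmega F φ).sec_add h1 h3, rfl, by
      simp only [h.map_add]; exact (BOmega F φ).sec_add h2 h4⟩
  · rintro y z ⟨s, h1, rfl, h2⟩ ⟨t, h3, rfl, h4⟩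
    exact ⟨_, (BOmega F φ).sec_mul h1 h3, rfl, by
      simp only [h.leibniz]
      exact (BOmega F φ).sec_add ((BOmega F φ).sec_mul h2 h3) ((BOmega F φ).sec_mul h1 h4)⟩

end IsAtiyahExtension

/-! ## Local nilpotency -/

variable (F φ P) in
/-- The filtration of `B ⊗ Ω` by the degree of the first factor. -/
def degFilt (i : ℤ) : Submodule ℂ ((BOmega F φ).stalk P) :=
  Submodule.span ℂ {x | ∃ k b a, i ≤ k ∧ pr k b = b ∧ x = inB F φ P b * inOmega F φ P a}

theorem degFilt_eq_zero (hB : NonPos (B.stalk P)) {i : ℤ} (hi : 0 < i) {x}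
    (hx : x ∈ degFilt F φ P i) : x = 0 := by
  induction hx using Submodule.span_induction with
  | mem x hx =>
    obtain ⟨k, b, a, hk, hb, rfl⟩ := hx
    rw [hB.eq_zero (by omega) hb, (inB_hom F φ P).map_zero, zero_mul]
  | zero => rfl
  | add x y _ _ hx hy => rw [hx, hy, add_zero]
  | smul c x _ hx => rw [hx, smul_zero]

theorem degFilt_mul {i : ℤ} {x} (hx : x ∈ degFilt F φ P i) (a : (Omega F).stalk P) :
    x * inOmega F φ P a ∈ degFilt F φ P i := by
  induction hx using Submodule.span_induction with
  | mem x hx =>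
    obtain ⟨k, b, a', hk, hb, rfl⟩ := hx
    exact Submodule.subset_span ⟨k, b, a' * a, hk, hb, by
      rw [(inOmega_hom F φ P).map_mul, mul_assoc]⟩
  | zero => rw [zero_mul]; exact zero_mem _
  | add x y _ _ hx hy => rw [add_mul]; exact add_mem hx hy
  | smul c x _ hx => rw [smul_mul_assoc]; exact Submodule.smul_mem _ _ hx

/-- As `S` lives in degrees at most zero, `ds` has degree at most `-1` in `Ω^1[1]`. In total degree
`i` the coefficient from `B` thus has degree at least `i + 1`. -/
theorem pr_linForms (hS : NonPos (S.stalk P)) (i : ℤ) {x} (hx : x ∈ linForms F φ P) :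
    pr i x ∈ degFilt F φ P (i + 1) := by
  induction hx using Submodule.span_induction with
  | mem x hx =>
    obtain ⟨b, s, rfl⟩ := hx
    rw [← sum_pr b, (inB_hom F φ P).toIsGrHom.map_sum, Finset.sum_mul, map_sum]
    refine sum_mem fun k _ => ?_
    rw [(inB_hom F φ P).map_pr, pr_mul_left, ← (inB_hom F φ P).map_pr,
      show pr (i - k) (formD F φ P s) = formD F φ P (pr (i - k + 1) s) from
        ((formD_rel F φ P).proj _ _).symm]
    rcases lt_or_ge 0 (i - k + 1) with h | h
    · rw [hS _ _ h, (formD_der F φ P).zero, mul_zero]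
      exact zero_mem _
    · exact Submodule.subset_span ⟨k, pr k b, _, by omega, pr_self _ _, rfl⟩
  | zero => rw [map_zero]; exact zero_mem _
  | add x y _ _ hx hy => rw [map_add]; exact add_mem hx hy
  | smul c x _ hx => rw [map_smul]; exact Submodule.smul_mem _ _ hx

namespace IsAtiyahExtension

variable {c} {D : ∀ P, (BOmega F φ).stalk P → (BOmega F φ).stalk P} (h : IsAtiyahExtension c D)
include h

/-- The derivation is `Ω`-linear, and the Atiyah class of an element of degree `k` is a linear form
of the same total degree, so `pr_linForms` applies. -/
theorem degFilt_succ (hS : NonPos (S.stalk P)) {i : ℤ} {x} (hx : x ∈ degFilt F φ P i) :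
    D P x ∈ degFilt F φ P (i + 1) := by
  induction hx using Submodule.span_induction with
  | mem x hx =>
    obtain ⟨k, b, a, hk, hb, rfl⟩ := hx
    rw [h.leibniz, h.omega, mul_zero, add_zero, h.atiyah]
    refine degFilt_mul ?_ a
    have h1 := pr_linForms hS k (c.atiyah_mem_linForms b)
    have h2 : pr k (c.atiyah P b) = c.atiyah P b := by
      rw [← h.atiyah, ← h.map_pr, ← (inB_hom F φ P).map_pr, hb]
    rw [h2] at h1
    refine Submodule.span_mono ?_ h1
    rintro x ⟨k', b', a', hk', hb', rfl⟩
    exact ⟨k', b', a', by omega, hb', rfl⟩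
  | zero => rw [show D P 0 = 0 from map_zero (h.lin P)]; exact zero_mem _
  | add x y _ _ hx hy => rw [h.map_add]; exact add_mem hx hy
  | smul c x _ hx => rw [h.map_smul]; exact Submodule.smul_mem _ _ hx

/-- The order `N` depends only on the degrees that occur in `b`. This uniformity is what makes the
exponential send sections to sections. -/
theorem iterate_inB (hS : NonPos (S.stalk P)) (hB : NonPos (B.stalk P)) {b : B.stalk P}
    {t : Finset ℤ} (hb : b = ∑ i ∈ t, pr i b) {N : ℕ} (hN : ∀ i ∈ t, 0 < i + N) :
    (D P)^[N] (inB F φ P b) = 0 := by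
  have h1 : ∀ (n : ℕ) i x, x ∈ degFilt F φ P i → (D P)^[n] x ∈ degFilt F φ P (i + n) := by
    intro n
    induction n with
    | zero => intro i x hx; simpa using hx
    | succ n ih =>
      intro i x hx
      rw [Function.iterate_succ_apply, Nat.cast_succ, add_comm (n : ℤ), ← add_assoc]
      exact ih _ _ (h.degFilt_succ hS hx)
  rw [hb, (inB_hom F φ P).toIsGrHom.map_sum]
  change (h.lin P)^[N] _ = 0
  rw [← Module.End.pow_apply, map_sum]
  simp only [Module.End.pow_apply]
  refine Finset.sum_eq_zero fun i hi => degFilt_eq_zero hB (hN i hi) (h1 N i _ ?_)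
  exact Submodule.subset_span ⟨i, pr i b, 1, le_rfl, pr_self _ _, by
    rw [(inOmega_hom F φ P).toIsGrHom.map_one, mul_one]⟩

theorem locally_nilpotent (hS : NonPos (S.stalk P)) (hB : NonPos (B.stalk P))
    (x : (BOmega F φ).stalk P) : ∃ N : ℕ, (D P)^[N] x = 0 := by
  refine form_gen (p := fun x => ∃ N : ℕ, (h.lin P)^[N] x = 0) (fun b => ?_)
    (fun s => ⟨1, h.map_formD s⟩) ?_ ?_ x
  · refine ⟨∑ i ∈ supp b, i.natAbs + 1, h.iterate_inB hS hB (sum_pr b).symm fun i hi => ?_⟩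
    have := Finset.single_le_sum (f := fun i : ℤ => i.natAbs) (fun _ _ => Nat.zero_le _) hi
    omega
  · rintro x y ⟨N, hN⟩ ⟨M, hM⟩
    refine ⟨max N M, ?_⟩
    rw [iterate_map_add, iterate_eq_zero_of_le (le_max_left _ _) hN,
      iterate_eq_zero_of_le (le_max_right _ _) hM, add_zero]
  · rintro x y ⟨N, hN⟩ ⟨M, hM⟩
    exact ⟨N + M, exists_iterate_mul (h.leibniz P) N M x y hN hM⟩

end IsAtiyahExtension

end atiyah

section character

variable {W : SimplicialSpace.{u}} {R S B : DGSheaf W} {j : R.Hom S} {F : FreeAnalytic j}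
  {φ : S.Hom B} {μ : S.Hom R} {ν : B.Hom R}

/-! ## The Atiyah–Chern character -/

variable (F) in
/-- The homomorphism `ν ⊗ id : B ⊗ Ω → R ⊗ Ω`. -/
def formMap (hν : ∀ P s, ν.app P (φ.app P s) = μ.app P s) : (BOmega F φ).Hom (ROmega F μ) :=
  (tensorPres φ (omegaIncl F)).desc (ROmega F μ) (fun P b => inB F μ P (ν.app P b))
    (fun P a => inOmega F μ P a)
    (fun P => ⟨(inB_hom F μ P).comp (ν.hom P), inOmega_hom F μ P, fun s =>
      (congrArg (inB F μ P) (hν P s)).trans (inB_inOmega F μ P s)⟩)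
    (fun h a => (congrArg (inB F μ _) (ν.res h a)).trans (inB_res h _)) (fun _ _ => rfl)
    (fun hs => inB_sec (ν.sec hs)) (fun hs => (tensorRight μ (omegaIncl F)).sec hs)

variable {hν : ∀ P s, ν.app P (φ.app P s) = μ.app P s} {P : W.Pt}

theorem formMap_inB (b : B.stalk P) :
    (formMap F hν).app P (inB F φ P b) = inB F μ P (ν.app P b) := rfl

variable {c : Connection F φ} {D : ∀ P, (BOmega F φ).stalk P → (BOmega F φ).stalk P}

namespace IsAtiyahExtension

variable (h : IsAtiyahExtension c D) (hS : ∀ P, NonPos (S.stalk P)) (hB : ∀ P, NonPos (B.stalk P))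

/-- The exponential of `-D`. -/
def exp (P : W.Pt) : (BOmega F φ).stalk P → (BOmega F φ).stalk P :=
  expNil (h.lin P) (h.locally_nilpotent (hS P) (hB P))

theorem exp_hom (P : W.Pt) : IsDGHom (h.exp hS hB P) :=
  expNil_hom _ (h.leibniz P) h.map_scal h.map_pr h.map_d

theorem exp_eq {x : (BOmega F φ).stalk P} {N : ℕ} (hN : (D P)^[N] x = 0) :
    h.exp hS hB P x = ∑ n ∈ Finset.range N, expTerm (h.lin P) n x := expNil_eq hN

theorem exp_inB {b : B.stalk P} {N : ℕ} (hN : (D P)^[N] (inB F φ P b) = 0) :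
    h.exp hS hB P (inB F φ P b) = expSum D N P b := h.exp_eq hS hB hN

theorem exp_base (s : S.stalk P) :
    h.exp hS hB P (inB F φ P (φ.app P s)) = inB F φ P (φ.app P s) :=
  expNil_of_eq_zero (by rw [inB_inOmega]; exact h.omega P _)

theorem exp_res {P Q : W.Pt} (hPQ : P ≤ Q) (x : (BOmega F φ).stalk P) :
    h.exp hS hB Q ((BOmega F φ).res hPQ x) = (BOmega F φ).res hPQ (h.exp hS hB P x) := by
  have H := (BOmega F φ).res_hom hPQ
  obtain ⟨N, hN⟩ := h.locally_nilpotent (hS P) (hB P) x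
  have e : ∀ n, (D Q)^[n] ((BOmega F φ).res hPQ x) = (BOmega F φ).res hPQ ((D P)^[n] x) := fun n => by
    induction n with
    | zero => rfl
    | succ n ih => rw [Function.iterate_succ_apply', ih, h.map_res, Function.iterate_succ_apply']
  rw [h.exp_eq hS hB hN, h.exp_eq hS hB (N := N) (by rw [e, hN, H.map_zero]), H.toIsGrHom.map_sum]
  refine Finset.sum_congr rfl fun n _ => ?_
  rw [expTerm, expTerm, H.toIsGrHom.map_smul]
  exact congrArg _ (e n)

theorem exp_inB_sec {α : W.faces} {w : W.K α} {b : ∀ y, B.stalk ⟨α, y⟩}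
    (hs : (B.sheaf α).IsSec b w) :
    ((BOmega F φ).sheaf α).IsSec (fun y => h.exp hS hB ⟨α, y⟩ (inB F φ ⟨α, y⟩ (b y))) w := by
  have hit : ∀ n, ((BOmega F φ).sheaf α).IsSec
      (fun y => (D ⟨α, y⟩)^[n] (inB F φ ⟨α, y⟩ (b y))) w := fun n => by
    induction n with
    | zero => exact inB_sec hs
    | succ n ih => simp only [Function.iterate_succ_apply']; exact h.map_sec ih
  -- Near `w` only the degrees present at `w` occur in the section, so one truncation order serves
  -- on a whole neighbourhood.
  let N : ℕ := ∑ i ∈ supp (b w), i.natAbs + 1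
  refine ((BOmega F φ).sheaf α).congr (s := fun y => expSum D N ⟨α, y⟩ (b y))
    ((BOmega F φ).sec_sum _ fun n => (BOmega F φ).sec_smul _ (hit n))
    ((B.sec_eq_sum_pr hs).mono fun y hy => (h.exp_inB hS hB ?_).symm)
  refine h.iterate_inB (hS _) (hB _) hy fun i hi => ?_
  have := Finset.single_le_sum (f := fun i : ℤ => i.natAbs) (fun _ _ => Nat.zero_le _) hi
  simp only [N]
  omega

/-- On `B` the map is `(ν ⊗ id) ∘ exp(-D)`, on `R` the inclusion. They agree on `S`, where the
exponential is the identity because the Atiyah class vanishes. -/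
theorem exists_phi (h : IsAtiyahExtension c D) (hS : ∀ P, NonPos (S.stalk P))
    (hB : ∀ P, NonPos (B.stalk P)) (hν : ∀ P s, ν.app P (φ.app P s) = μ.app P s) :
    ∃ Φ : (BR φ μ).Hom (ROmega F μ), IsPhi ν hν D Φ := by
  let G := formMap F hν
  refine ⟨(tensorPres φ μ).desc (ROmega F μ) (fun P b => G.app P (h.exp hS hB P (inB F φ P b)))
    (fun P r => inB F μ P r)
    (fun P => ⟨(G.hom P).comp ((h.exp_hom hS hB P).comp (inB_hom F φ P)), inB_hom F μ P, fun s => ?_⟩)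
    (fun hPQ b => ?_) (fun _ _ => rfl) (fun hs => G.sec (h.exp_inB_sec hS hB hs))
    (fun hs => inB_sec hs), ⟨fun P r => rfl, fun P b N hN => ?_⟩⟩
  · rw [h.exp_base, formMap_inB, hν]
  · refine (congrArg (fun x => G.app _ (h.exp hS hB _ x)) (inB_res hPQ b)).trans ?_
    exact (congrArg (G.app _) (h.exp_res hS hB hPQ _)).trans (G.res hPQ _)
  · exact congrArg (G.app P) (h.exp_inB hS hB hN)

end IsAtiyahExtension

theorem IsPhi.unique (hN : ∀ P x, ∃ N : ℕ, (D P)^[N] x = 0) {Φ Φ' : (BR φ μ).Hom (ROmega F μ)}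
    (h : IsPhi ν hν D Φ) (h' : IsPhi ν hν D Φ') : Φ = Φ' :=
  DGSheaf.Hom.ext_app fun P => (tensorPres φ μ).hom_ext (Φ.hom P) (Φ'.hom P)
    (fun b => by
      obtain ⟨N, hN⟩ := hN P (inB F φ P b)
      exact (h.character P b N hN).trans (h'.character P b N hN).symm)
    (fun r => (h.linear P r).trans (h'.linear P r).symm)

/-! ## The character is a quasi-isomorphism -/

/-- The linear part of the image of the Atiyah–Chern character under a homomorphism. -/
theorem IsAtiyahExtension.linear_part (h : IsAtiyahExtension c D)
    {Z : Type u} [CDGA Z] {p0 : (BOmega F φ).stalk P → Z} (h0 : IsDGHom p0)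
    {p1 : (BOmega F φ).stalk P →ₗ[ℂ] Z}
    (h1 : ∀ x y, p1 (x * y) = p1 x * p0 y + p0 x * p1 y) (hd : ∀ s, p0 (formD F φ P s) = 0)
    (x : (BOmega F φ).stalk P) : p0 (D P x) = 0 ∧ p1 (D P (D P x)) = 0 := by
  -- The endomorphism `π` of `B ⊗ Ω` fixes `B` and kills all differentials. Since Atiyah classes are
  -- linear forms, `π ∘ D = 0`.
  obtain ⟨π, hπ, hπb, -, hπd⟩ := exists_formHom (inB_hom F φ P)
    (OmegaRel.zero (F := F) ((inB_hom F φ P).comp (φ.hom P)))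
  have lin0 : ∀ y ∈ linForms F φ P, π y = 0 := fun y hy => by
    induction hy using Submodule.span_induction with
    | mem y hy =>
      obtain ⟨b, s, rfl⟩ := hy
      rw [hπ.map_mul, hπd, Pi.zero_apply, mul_zero]
    | zero => exact hπ.map_zero
    | add x y _ _ hx hy => rw [hπ.map_add, hx, hy, add_zero]
    | smul c x _ hx => rw [hπ.toIsGrHom.map_smul, hx, smul_zero]
  have hπD : ∀ x, π (D P x) = 0 := form_gen
    (fun b => by rw [h.atiyah]; exact lin0 _ (c.atiyah_mem_linForms b))
    (fun s => by rw [h.map_formD, hπ.map_zero])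
    (fun x y hx hy => by rw [h.map_add, hπ.map_add, hx, hy, add_zero])
    (fun x y hx hy => by
      rw [h.leibniz, hπ.map_add, hπ.map_mul, hπ.map_mul, hx, hy, zero_mul, mul_zero, add_zero])
  have hp0 : ∀ x, p0 (π x) = p0 x := formHom_ext (h0.comp hπ) h0 (fun b => by rw [hπb])
    (fun s => by rw [hπd, hd]; exact h0.map_zero)
  have hp0D : ∀ x, p0 (D P x) = 0 := fun x => by rw [← hp0, hπD, h0.map_zero]
  -- The weight-one part of `D` depends only on the weight-zero part of its argument. Together with
  -- `π ∘ D = 0` this gives the vanishing of `p1 ∘ D ∘ D`.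
  have hp1 : ∀ x, p1 (D P (π x)) = p1 (D P x) := form_gen (fun b => by rw [hπb])
    (fun s => by rw [hπd, h.map_formD, Pi.zero_apply]; exact congrArg p1 (map_zero (h.lin P)))
    (fun x y hx hy => by rw [hπ.map_add, h.map_add, h.map_add, _root_.map_add, _root_.map_add, hx, hy])
    (fun x y hx hy => by
      rw [hπ.map_mul, h.leibniz, h.leibniz, _root_.map_add, _root_.map_add, h1, h1, h1, h1, hp0D, hp0D, hp0D,
        hp0D, hp0, hp0, hx, hy]
      simp only [zero_mul, mul_zero])
  refine ⟨hp0D x, ?_⟩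
  rw [← hp1, hπD]
  exact (congrArg p1 (map_zero (h.lin P))).trans (map_zero p1)

/-- At each point a chart makes `S` a `FreeStalk`, and `FormAlg.isCohomologyIso` applies. Its input
is the part of the character of weight at most one: the term `n = 0` contributes `ν b`, the term `n
= 1` contributes the bracket of `d` with the connection, and by `linear_part` later terms contribute
nothing. -/
theorem IsPhi.isQuasiIso (h : IsAtiyahExtension c D) (hμ : ∀ P r, μ.app P (j.app P r) = r)
    (hR : ∀ P, NonPos (R.stalk P)) {E : Gens B} (hE : E.IsFree φ) (hqis : ν.IsQuasiIso)
    (hN : ∀ P x, ∃ N : ℕ, (D P)^[N] x = 0) {Φ : (BR φ μ).Hom (ROmega F μ)}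
    (hΦ : IsPhi ν hν D Φ) : Φ.IsQuasiIso := by
  rintro ⟨α, w⟩
  obtain ⟨ch, hc⟩ := F.cover w
  let G := F.toStalk μ hμ hR ch hc
  have H : FormAlg G (inB F μ ⟨α, w⟩) (formD F μ ⟨α, w⟩) := FreeAnalytic.formAlg
  let P : W.Pt := ⟨α, w⟩
  let M := (formMap F hν).app P
  have hM : IsDGHom M := (formMap F hν).hom P
  have hkl : ∀ x ∈ linForms F φ P, H.p0 (M x) = 0 ∧ H.p1 (M x) = M x := fun x hx => by
    induction hx using Submodule.span_induction with
    | mem x hx =>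
      obtain ⟨b, s, rfl⟩ := hx
      rw [hM.map_mul, H.p0_hom.map_mul, H.p1_mul, show M (inB F φ P b) = inB F μ P (ν.app P b) from rfl,
        show M (formD F φ P s) = formD F μ P s from rfl, H.p0_T, H.p1_r, H.p1_T, H.p0_r, mul_zero,
        zero_mul, zero_add]
      exact ⟨rfl, rfl⟩
    | zero => rw [hM.map_zero, map_zero, map_zero]; exact ⟨rfl, rfl⟩
    | add x y _ _ hx hy =>
      rw [hM.map_add, map_add, map_add, hx.1, hx.2, hy.1, hy.2, add_zero]; exact ⟨rfl, rfl⟩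
    | smul c x _ hx =>
      rw [hM.toIsGrHom.map_smul, map_smul, map_smul, hx.1, hx.2, smul_zero]; exact ⟨rfl, rfl⟩
  let p1 : (BOmega F φ).stalk P →ₗ[ℂ] (ROmega F μ).stalk P := H.p1.comp hM.toIsGrHom.lin
  have lp := h.linear_part (p0 := fun x => H.p0 (M x)) (H.p0_hom.comp hM) (p1 := p1)
    (fun x y => (congrArg H.p1 (hM.map_mul x y)).trans (H.p1_mul _ _)) fun s => H.p0_T s
  have hit : ∀ n x, H.p0 (M ((D P)^[n + 1] x)) = 0 ∧ H.p1 (M ((D P)^[n + 2] x)) = 0 := fun n x => by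
    refine ⟨?_, ?_⟩
    · rw [Function.iterate_succ_apply']; exact (lp _).1
    · rw [Function.iterate_succ_apply', Function.iterate_succ_apply']; exact (lp _).2
  -- The exponential series is cut at `N + 2`, so that the terms `n = 0` and `n = 1` can always be
  -- split off.
  have hval : ∀ b, ∃ N, Φ.app P ((tensorLeft φ μ).app P b) =
      ∑ n ∈ Finset.range (N + 2), ((-1) ^ n / (n.factorial : ℂ)) • M ((D P)^[n] (inB F φ P b)) :=
    fun b => by
      obtain ⟨N, hN⟩ := hN P (inB F φ P b)
      refine ⟨N, (hΦ.character P b (N + 2)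
        (iterate_eq_zero_of_le (D := h.lin P) (Nat.le_add_right N 2) hN)).trans ?_⟩
      refine (hM.toIsGrHom.map_sum _ _).trans (Finset.sum_congr rfl fun n _ => ?_)
      exact hM.toIsGrHom.map_smul _ _
  refine H.isCohomologyIso (φ.hom P) (hE.freeOn P) hE.deg_neg (ν.hom P) (hν P)
    (acyclicAug_of_isCohomologyIso ((φ.hom P).comp (j.hom P)) (ν.hom P)
      (fun r => (hν P _).trans (hμ P r)) (hqis P)) ((tensorLeft φ μ).hom P)
    ((tensorRight φ μ).hom P) (tensorRel_self φ P μ).eq (fun Z _ f g hf hg hfg => ?_)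
    (fun Z _ f g hf hg h1 h2 => (tensorPres φ μ).hom_ext hf hg h1 h2) (Φ.hom P) (hΦ.linear P)
    (k := fun b => M (c.app P b)) ((c.isOddDer P).postcomp hM.toIsGrHom) (fun s => ?_) (fun b => ?_)
    (fun b => ?_) fun b => (hkl _ (c.mem_linForms b)).2
  · have t : TensorRel φ μ P Z f g := ⟨hf, hg, hfg⟩
    exact ⟨Pres.lift (Q := fun Z _ => TensorRel φ μ P Z) t, Pres.lift_hom t, fun _ => rfl,
      fun _ => rfl⟩
  · rw [c.extends_d]; rfl
  · obtain ⟨N, e⟩ := hval b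
    rw [e, map_sum, Finset.sum_range_succ', Finset.sum_eq_zero fun n _ => by
      rw [map_smul, (hit n _).1, smul_zero]]
    simp only [pow_zero, Nat.factorial_zero, Nat.cast_one, div_one, one_smul, zero_add,
      Function.iterate_zero, id]
    exact H.p0_r _
  · obtain ⟨N, e⟩ := hval b
    rw [e, map_sum, Finset.sum_range_succ', Finset.sum_range_succ', Finset.sum_eq_zero fun n _ => by
      rw [map_smul, (hit n _).2, smul_zero]]
    have e1 : M (c.atiyah P b) = -(d (M (c.app P b)) + M (c.app P (d b))) := by
      rw [← hM.map_d, ← hM.map_add, ← hM.toIsGrHom.map_neg]; rfl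
    have e2 : H.p1 (M (inB F φ P b)) = 0 := H.p1_r _
    have e3 : H.p1 (d (M (c.app P b)) + M (c.app P (d b))) = d (M (c.app P b)) + M (c.app P (d b)) := by
      have := (hkl _ (c.atiyah_mem_linForms b)).2
      rwa [e1, map_neg, neg_inj] at this
    simp only [zero_add, pow_one, pow_zero, Nat.factorial_zero, Nat.factorial_one, Nat.cast_one,
      div_one, one_smul, Function.iterate_zero, Function.iterate_one, id, h.atiyah, map_smul, e2,
      smul_zero, add_zero, neg_smul, e1, map_neg, neg_neg, e3]

end character

end

theorem theorem2p1 (W : SimplicialSystem.{u}) (R S B : DGSheaf W.toSimplicialSpace)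
    (ι : ∀ P, W.O P →ₐ[ℂ] R.stalk P) (hR : IsStructureAlgebra W R ι)
    (j : R.Hom S) (μ : S.Hom R) (hμ : ∀ P r, μ.app P (j.app P r) = r)
    (F : FreeAnalytic j)
    (φ : S.Hom B) (E : Gens B) (hE : E.IsFree φ)
    (ν : B.Hom R) (hν : ∀ P s, ν.app P (φ.app P s) = μ.app P s) (hqis : ν.IsQuasiIso) :
    Nonempty (Connection F φ) ∧
    ∀ c : Connection F φ,
      (∃! D : ∀ P, (BOmega F φ).stalk P → (BOmega F φ).stalk P, IsAtiyahExtension c D) ∧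
      ∀ D : ∀ P, (BOmega F φ).stalk P → (BOmega F φ).stalk P, IsAtiyahExtension c D →
        (∀ P x, ∃ N : ℕ, (D P)^[N] x = 0) ∧
        (∃! Φ : (BR φ μ).Hom (ROmega F μ), IsPhi ν hν D Φ) ∧
        ∀ (Φ : (BR φ μ).Hom (ROmega F μ)) (h : IsPhi ν hν D Φ),
          Φ.IsQuasiIso ∧ IsIso h.derived := by
  have hS := F.nonPos hμ hR.nonpos
  have hB : ∀ P, NonPos (B.stalk P) := fun P =>
    (hE.freeOn P).nonPos (hS P) fun x => (hE.deg_neg x).le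
  refine ⟨hE.nonempty_connection F, fun c => ⟨?_, fun D hD => ?_⟩⟩
  · obtain ⟨D, hD, -⟩ := c.exists_atiyahExtension
    exact ⟨D, hD, fun D' hD' => hD'.unique hD⟩
  · have hN : ∀ P x, ∃ N : ℕ, (D P)^[N] x = 0 := fun P => hD.locally_nilpotent (hS P) (hB P)
    refine ⟨hN, ?_, fun Φ h => ?_⟩
    · obtain ⟨Φ, hΦ⟩ := hD.exists_phi hS hB hν
      exact ⟨Φ, hΦ, fun Φ' hΦ' => hΦ'.unique hN hΦ⟩
    · have hq := h.isQuasiIso hD hμ hR.nonpos hE hqis hN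
      exact ⟨hq, MorphismProperty.Q_inverts (DGMod.qis R) _ hq⟩
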